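/- **Simple Cycle with Edge Set Constraints.** Given a finite simple undirected graph $G=(V,E)$ with $n\ge 1$ vertices and $m\ge n$ edges, and $k\ge 1$ subsets $S_1,\dots,S_k\subseteq E$ (not necessarily disjoint), find a simple cycle of $G$ that contains exactly one edge from each set $S_i$, or report that there is none. Such a cycle is called a *solution*. Let $V(S_1)$ be the set of vertices of the edges in $S_1$. **Model.** A randomized Word-RAM with words of $w$ bits executes a fixed program, which does not depend on $w$ or on the input. It performs arithmetic, logical, comparison and (direct or indirect) addressing operations on words, and draws uniformly random words, at unit cost. The input ($n$, $m$, $k$, the list of edges, and the $0/1$ table telling which edge belongs to which set) is in a read-only random-access memory. Space is the number of words of working memory, an initial segment of which is used. **Theorem.** There are constants $C$ and $c$ such that for every real $W\ge 1$ the following holds. 1. There is a randomized (Monte Carlo) algorithm that, for every instance and every word size $w\ge c\,(k+\log_2 n)$, always halts within time $$C\cdot 2^k\,m\,n^2\,\log_2\tfrac{2m}{n}\cdot\max(1,|V(S_1)|)\cdot W$$ and uses space at most $C\,(2^k n+m)$. Its output is always either "no cycle" or a solution. With probability at least $1-1/n^W$, its output is a solution with the smallest number of edges if a solution exists, and "no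 cycle" otherwise. 2. There is another such algorithm, with the same guarantees on its output, that for every instance and every word size $w\ge c\,\log_2(nk)$ always halts within time $$C\cdot k\cdot 2^k\,m\,n^2\,\log_2\tfrac{2m}{n}\cdot\max(1,|V(S_1)|)\cdot W$$ and uses only the polynomial space $C\,(kn+m)$. In particular, words of $\Theta(\log n)$ bits suffice in part 1 when $k=O(\log n)$ (the range in which a table of $2^k n$ words can be addressed with such words), and in part 2 when $k=n^{O(1)}$. -/

import Mathlib

namespace WordRAM

/-! ### A randomized Word-RAM

The memory is an array of `w`-bit words, addressed by natural numbers and initially zero.  The input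
is stored in a separate read-only random-access memory.  A program is a fixed finite term, which
does not depend on the word length or on the input.  Every elementary instruction and every test
costs one time unit. -/

/-- The binary operations on words (modulo `2 ^ w`); `lt` and `eq` return `1` or `0`. -/
inductive Op
  | add | sub | mul | div | mod | and | or | xor | shl | shr | lt | eq

/-- The value of a binary operation. -/
def Op.eval {w : ℕ} : Op → BitVec w → BitVec w → BitVec w
  | .add, x, y => x + y
  | .sub, x, y => x - y
  | .mul, x, y => x * y
  | .div, x, y => x / y
  | .mod, x, y => x % y
  | .and, x, y => x &&& y
  | .or, x, y => x ||| y
  | .xor, x, y => x ^^^ y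
  | .shl, x, y => x <<< y.toNat
  | .shr, x, y => x >>> y.toNat
  | .lt, x, y => if x.toNat < y.toNat then BitVec.ofNat w 1 else BitVec.ofNat w 0
  | .eq, x, y => if x = y then BitVec.ofNat w 1 else BitVec.ofNat w 0

/-- Programs.  Below, `M` is the memory and `I` is the read-only input memory. -/
inductive Prog
  /-- do nothing -/
  | skip
  /-- `M[d] := v` (modulo `2 ^ w`) -/
  | const (d v : ℕ)
  /-- `M[d] := M[a] o M[b]` -/
  | op (o : Op) (d a b : ℕ)
  /-- `M[d] := M[M[a]]` -/
  | load (d a : ℕ)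
  /-- `M[M[a]] := M[b]` -/
  | store (a b : ℕ)
  /-- `M[d] := I[M[a]]` -/
  | input (d a : ℕ)
  /-- `M[d] :=` a fresh uniformly random word -/
  | rand (d : ℕ)
  /-- first `p`, then `q` -/
  | seq (p q : Prog)
  /-- if `M[a] ≠ 0` then `p` else `q` -/
  | ite (a : ℕ) (p q : Prog)
  /-- while `M[a] ≠ 0` do `p` -/
  | while (a : ℕ) (p : Prog)

/-- A configuration: the pieces of the program that are still to be executed, the memory, and the
number of random words drawn so far. -/
structure Config (w : ℕ) where
  code : List Prog
  mem : ℕ → BitVec w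
  drawn : ℕ

/-- One time step, with input memory `I` and with `tape j` as the `j`-th random word.  A
configuration without remaining code has halted. -/
def step {w : ℕ} (I tape : ℕ → BitVec w) (σ : Config w) : Config w :=
  match σ.code with
  | [] => σ
  | .skip :: K => ⟨K, σ.mem, σ.drawn⟩
  | .const d v :: K => ⟨K, Function.update σ.mem d (BitVec.ofNat w v), σ.drawn⟩
  | .op o d a b :: K => ⟨K, Function.update σ.mem d (o.eval (σ.mem a) (σ.mem b)), σ.drawn⟩
  | .load d a :: K => ⟨K, Function.update σ.mem d (σ.mem (σ.mem a).toNat), σ.drawn⟩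
  | .store a b :: K => ⟨K, Function.update σ.mem (σ.mem a).toNat (σ.mem b), σ.drawn⟩
  | .input d a :: K => ⟨K, Function.update σ.mem d (I (σ.mem a).toNat), σ.drawn⟩
  | .rand d :: K => ⟨K, Function.update σ.mem d (tape σ.drawn), σ.drawn + 1⟩
  | .seq p q :: K => ⟨p :: q :: K, σ.mem, σ.drawn⟩
  | .ite a p q :: K => ⟨(if σ.mem a ≠ 0 then p else q) :: K, σ.mem, σ.drawn⟩
  | .while a p :: K => ⟨if σ.mem a ≠ 0 then p :: .while a p :: K else K, σ.mem, σ.drawn⟩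

/-- The addresses of the memory words that are read or written in the next step. -/
def touched {w : ℕ} (σ : Config w) : List ℕ :=
  match σ.code with
  | [] => []
  | .skip :: _ => []
  | .const d _ :: _ => [d]
  | .op _ d a b :: _ => [d, a, b]
  | .load d a :: _ => [d, a, (σ.mem a).toNat]
  | .store a b :: _ => [a, b, (σ.mem a).toNat]
  | .input d a :: _ => [d, a]
  | .rand d :: _ => [d]
  | .seq _ _ :: _ => []
  | .ite a _ _ :: _ => [a]
  | .while a _ :: _ => [a]

/-- The configuration of the program `P` after `t` steps. -/
def run {w : ℕ} (P : Prog) (I tape : ℕ → BitVec w) (t : ℕ) : Config w :=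
  (step I tape)^[t] ⟨[P], fun _ => 0, 0⟩

/-- A finite sequence of random words, continued arbitrarily (by zeros).  A run of `T` steps draws
at most `T` random words, so the continuation is never read in such a run. -/
def extend {w T : ℕ} (ω : Fin T → BitVec w) : ℕ → BitVec w :=
  fun j => if h : j < T then ω ⟨j, h⟩ else 0

/-- The probability of the event `E` for `T` independent uniformly random `w`-bit words. -/
noncomputable def prob {w T : ℕ} (E : (Fin T → BitVec w) → Prop) : ℝ :=
  (Nat.card {ω // E ω} : ℝ) / Nat.card (Fin T → BitVec w)

end WordRAM

namespace EdgeSetCycle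

/-! ### Simple Cycle with Edge Set Constraints -/

/-- The cycle `c` is simple and contains exactly one edge from each set `S i`. -/
def IsSolution {V : Type*} {k : ℕ} {G : SimpleGraph V} (S : Fin k → Set (Sym2 V)) {v : V}
    (c : G.Walk v v) : Prop :=
  c.IsCycle ∧ ∀ i, ∃! e, e ∈ c.edges ∧ e ∈ S i

/-- `c` is a solution with the smallest number of edges. -/
def IsShortestSolution {V : Type*} {k : ℕ} {G : SimpleGraph V} (S : Fin k → Set (Sym2 V)) {v : V}
    (c : G.Walk v v) : Prop :=
  IsSolution S c ∧ ∀ (u : V) (c' : G.Walk u u), IsSolution S c' → c.length ≤ c'.length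

/-- The set of vertices of the edges in `S`. -/
def vertexSet {V : Type*} (S : Set (Sym2 V)) : Set V := {v | ∃ e ∈ S, v ∈ e}

/-- `e` lists the edges of `G`, each of them once, in some order and with some orientation. -/
def IsEdgeList {n m : ℕ} (G : SimpleGraph (Fin n)) (e : Fin m → Fin n × Fin n) : Prop :=
  Function.Injective (fun j => s((e j).1, (e j).2)) ∧
    Set.range (fun j => s((e j).1, (e j).2)) = G.edgeSet

open Classical in
/-- The input memory holds `n`, `m`, `k`, then the endpoints of the `m` edges, and then the
`k × m` table of zeros and ones that tells which edges belong to which sets.  (The contents of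
further cells are arbitrary.) -/
structure IsInput {w n m k : ℕ} (e : Fin m → Fin n × Fin n) (S : Fin k → Set (Sym2 (Fin n)))
    (I : ℕ → BitVec w) : Prop where
  n_eq : I 0 = BitVec.ofNat w n
  m_eq : I 1 = BitVec.ofNat w m
  k_eq : I 2 = BitVec.ofNat w k
  fst_eq : ∀ j : Fin m, I (3 + 2 * j) = BitVec.ofNat w (e j).1
  snd_eq : ∀ j : Fin m, I (4 + 2 * j) = BitVec.ofNat w (e j).2
  set_eq : ∀ (i : Fin k) (j : Fin m),
    I (3 + 2 * m + i * m + j) = BitVec.ofNat w (if s((e j).1, (e j).2) ∈ S i then 1 else 0)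

/-- The memory contents `M` represent the answer "no cycle": `M[0] = 0`. -/
def OutputsNone {w : ℕ} (M : ℕ → BitVec w) : Prop := (M 0).toNat = 0

/-- The memory contents `M` represent the cycle `c`: the length of `c` is in `M[0]`, and `M[1]` is
the address at which the list of the successive vertices of `c` begins. -/
def OutputsCycle {w n : ℕ} {G : SimpleGraph (Fin n)} (M : ℕ → BitVec w) {v : Fin n}
    (c : G.Walk v v) : Prop :=
  (M 0).toNat = c.length ∧ ∀ j < c.length, (M ((M 1).toNat + j)).toNat = c.getVert j

/-- The output is "no cycle" or some solution. -/
def IsSound {w n k : ℕ} (G : SimpleGraph (Fin n)) (S : Fin k → Set (Sym2 (Fin n)))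
    (M : ℕ → BitVec w) : Prop :=
  OutputsNone M ∨ ∃ (v : Fin n) (c : G.Walk v v), IsSolution S c ∧ OutputsCycle M c

/-- The output is a shortest solution if there is a solution, and "no cycle" otherwise. -/
def IsOptimal {w n k : ℕ} (G : SimpleGraph (Fin n)) (S : Fin k → Set (Sym2 (Fin n)))
    (M : ℕ → BitVec w) : Prop :=
  (∃ (v : Fin n) (c : G.Walk v v), IsShortestSolution S c ∧ OutputsCycle M c) ∨
    ((¬ ∃ (v : Fin n) (c : G.Walk v v), IsSolution S c) ∧ OutputsNone M)

/-- On the input `I`, whatever the random words are, the program `P` halts within `time` steps, uses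
only the first `space` words of the memory, and outputs "no cycle" or a solution; and with
probability at least `1 - δ` its output is a shortest solution if there is a solution. -/
def MonteCarloFinds {w n k : ℕ} (P : WordRAM.Prog) (I : ℕ → BitVec w) (G : SimpleGraph (Fin n))
    (S : Fin k → Set (Sym2 (Fin n))) (time space δ : ℝ) : Prop :=
  ∃ T s : ℕ, (T : ℝ) ≤ time ∧ (s : ℝ) ≤ space ∧
    (∀ ω : Fin T → BitVec w,
      (WordRAM.run P I (WordRAM.extend ω) T).code = [] ∧
      (∀ t < T, ∀ a ∈ WordRAM.touched (WordRAM.run P I (WordRAM.extend ω) t), a < s) ∧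
      IsSound G S (WordRAM.run P I (WordRAM.extend ω) T).mem) ∧
    1 - δ ≤ WordRAM.prob fun ω : Fin T → BitVec w =>
      IsOptimal G S (WordRAM.run P I (WordRAM.extend ω) T).mem

end EdgeSetCycle

/-! The method is algebraic. Each edge gets a random element of a field of characteristic two with
`2 ^ q` elements, `2 * n ≤ 2 ^ q < 4 * n`. For a start `s` and a length `r + 1`, a dynamic program
sums the products of the elements along all closed walks of that length through `s` which begin with
an edge of the first set, oriented from its smaller endpoint `s` to its larger one, and which
contain exactly one edge from each set.

Cancellation. In a walk with a repeated vertex, find the first closed part which is not its own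
reversal and reverse it. This involution (`flip`, `flip_spec`) preserves the multiset of edges, so
its 2-cycles cancel. In a walk with repeated vertices that it fixes, the closed parts met on the way
are palindromes, which use every edge an even number of times. Deleting them gives a shorter simple
walk with the same parities (`exists_simple_of_flip_eq`); a count of one from a set stays one. Hence
at lengths not exceeding the shortest closed one only simple closed walks survive
(`sum_walks_eq_sum_simple`, `decVal_eq`). Below the minimum the value is zero. At the minimum it is
the value of a sum of distinct monomials: since a solution has exactly one edge in the first set,
the prescribed orientation of that edge keeps the two directions of a cycle from cancelling
(`Cyc.eq_of_perm`). The polynomial has degree at most `n`, so by Schwartz–Zippel a trial misses it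
with probability at most one half (`card_decVal_eq_zero_le`). With `⌈W⌉ * n` independent trials the
failure probability is at most `2 ^ (-⌈W⌉ * n) ≤ n ^ (-W)`.

The sets. In part 1 the state of the dynamic program is the set of labels still to be used. In part
2 the state is a number at most `k` and there are `2 ^ k` rounds. In round `y` a label has weight 1
if its bit in `y` is set and `k + 1` otherwise, and total weight `k` is required. Summed over `y`
modulo two, this keeps exactly the walks with one edge from each set (`sum_rounds`, `sum_trace`).

Construction. The cycle is rebuilt dart by dart with the field elements of one successful trial. A
nonzero value of a partial path equals a field element times the sum of the values of its
extensions, so some extension is nonzero again (`exists_stepVal_ne_zero`, `cyc_of_good`). A final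
deterministic check makes the output sound for all random words.

The field. A feedback polynomial is found by exhaustive search for a shift register of full period,
and multiplication uses tables of exponentials and logarithms, in constant time. Full period alone
implies that the residue ring is a field (`exists_fieldPow`), and a minimal polynomial of a
generator of the multiplicative group shows that the search succeeds (`exists_passes`).

The machine. The program is written in a small structured language with numbers, arrays and exact
step counts. `Exec.runs` transfers executions to the Word-RAM, and the calculus `WP` proves
functional correctness and time bounds together. `algP_spec` describes the result of the whole
program, and `algP_finds` combines it with the combinatorial and probabilistic parts. -/

namespace WordRAM

/-! ### A structured language over registers and arrays -/

/-- The binary operations of the structured language. -/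
inductive BOp
  | add | sub | mul | div | and | xor | lt | eq

/-- The machine operation that implements an operation. -/
def BOp.toOp : BOp → Op
  | .add => .add
  | .sub => .sub
  | .mul => .mul
  | .div => .div
  | .and => .and
  | .xor => .xor
  | .lt => .lt
  | .eq => .eq

/-- The value of an operation on natural numbers. -/
def BOp.val : BOp → ℕ → ℕ → ℕ
  | .add, x, y => x + y
  | .sub, x, y => x - y
  | .mul, x, y => x * y
  | .div, x, y => x / y
  | .and, x, y => x &&& y
  | .xor, x, y => x ^^^ y
  | .lt, x, y => if x < y then 1 else 0
  | .eq, x, y => if x = y then 1 else 0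

/-- The operation does not overflow in words of `w` bits. -/
def BOp.ok (w : ℕ) : BOp → ℕ → ℕ → Prop
  | .add, x, y => x + y < 2 ^ w
  | .sub, x, y => y ≤ x
  | .mul, x, y => x * y < 2 ^ w
  | .div, _, _ => True
  | .and, _, _ => True
  | .xor, _, _ => True
  | .lt, _, _ => True
  | .eq, _, _ => True

/-- Truth values need a word of positive length to hold `1`; the other operations agree with those
on natural numbers as soon as they do not wrap around. -/
theorem BOp.eval_toNat {w : ℕ} (hw : 0 < w) (o : BOp) (x y : BitVec w)
    (h : o.ok w x.toNat y.toNat) :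
    (o.toOp.eval x y).toNat = o.val x.toNat y.toNat := by
  have h1 : 1 % 2 ^ w = 1 := Nat.mod_eq_of_lt (Nat.one_lt_two_pow hw.ne')
  cases o
  · simpa [BOp.toOp, Op.eval, BOp.val] using Nat.mod_eq_of_lt h
  · exact BitVec.toNat_sub_of_le (BitVec.le_def.2 h)
  · simpa [BOp.toOp, Op.eval, BOp.val] using Nat.mod_eq_of_lt h
  · simp [BOp.toOp, Op.eval, BOp.val]
  · simp [BOp.toOp, Op.eval, BOp.val]
  · simp [BOp.toOp, Op.eval, BOp.val]
  · simp only [BOp.toOp, Op.eval, BOp.val]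
    split <;> simp [h1]
  · simp only [BOp.toOp, Op.eval, BOp.val, BitVec.toNat_inj]
    split <;> simp [h1]

/-- Expressions: numerals, registers, array cells, input cells and operations. -/
inductive Ex
  | num (v : ℕ)
  | reg (i : ℕ)
  | arr (A : ℕ) (e : Ex)
  | inp (e : Ex)
  | bin (o : BOp) (x y : Ex)

/-- States of the structured language: registers, arrays, the output list, and the number of
random words drawn. -/
structure St where
  r : ℕ → ℕ
  a : ℕ → ℕ → ℕ
  o : ℕ → ℕ
  d : ℕ

/-- The number of registers for variables. -/
abbrev nv : ℕ := 60
/-- The number of cells before the arrays. -/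
abbrev nr : ℕ := 76
/-- The number of arrays. -/
abbrev na : ℕ := 13

/-- The parameters of an execution: the input memory, the random words, the length of the arrays,
the length of the output. -/
structure Env where
  w : ℕ
  I : ℕ → BitVec w
  tape : ℕ → BitVec w
  L : ℕ
  Lo : ℕ
  w_pos : 0 < w
  fits : nr + na * L + Lo ≤ 2 ^ w

/-- The number of memory words used. -/
def Env.space (E : Env) : ℕ := nr + na * E.L + E.Lo

/-- The content of an input cell. -/
def Env.inp (E : Env) (i : ℕ) : ℕ := (E.I i).toNat

/-- The value of an expression. -/
def Ex.val (E : Env) (σ : St) : Ex → ℕ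
  | .num v => v
  | .reg i => σ.r i
  | .arr A e => σ.a A (e.val E σ)
  | .inp e => E.inp (e.val E σ)
  | .bin o x y => o.val (x.val E σ) (y.val E σ)

/-- The evaluation neither overflows nor violates array bounds. -/
def Ex.ok (E : Env) (σ : St) : Ex → Prop
  | .num v => v < 2 ^ E.w
  | .reg _ => True
  | .arr _ e => e.ok E σ ∧ e.val E σ < E.L
  | .inp e => e.ok E σ
  | .bin o x y => x.ok E σ ∧ y.ok E σ ∧ o.ok E.w (x.val E σ) (y.val E σ)

/-- The registers, the arrays and the temporary cells used by an expression exist. -/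
def Ex.wf (t : ℕ) : Ex → Bool
  | .num _ => decide (t < nr)
  | .reg i => decide (i < nv) && decide (t < nr)
  | .arr A e => decide (A < na) && decide (t + 1 < nr) && e.wf t
  | .inp e => decide (t < nr) && e.wf t
  | .bin _ x y => decide (t < nr) && x.wf t && y.wf (t + 1)

/-- The address of cell `i` of array `A` if `t` holds `i`. -/
def addrCode (A t : ℕ) : Prog :=
  .seq (.const (t + 1) na) (.seq (.op .mul t t (t + 1))
    (.seq (.const (t + 1) (nr + A)) (.op .add t t (t + 1))))

/-- Code that evaluates an expression into cell `t`, using further temporary cells above `t`. -/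
def Ex.code : Ex → ℕ → Prog
  | .num v, t => .const t v
  | .reg i, t => .op .or t i i
  | .arr A e, t => .seq (.seq (e.code t) (addrCode A t)) (.load t t)
  | .inp e, t => .seq (e.code t) (.input t t)
  | .bin o x y, t => .seq (.seq (x.code t) (y.code (t + 1))) (.op o.toOp t t (t + 1))

/-- The running time of `Ex.code`. -/
def Ex.cost : Ex → ℕ
  | .num _ => 1
  | .reg _ => 1
  | .arr _ e => e.cost + 10
  | .inp e => e.cost + 2
  | .bin _ x y => x.cost + y.cost + 3

/-- From memory `M` and `d` drawn words, the code `c` leads to `M'` and `d'` in `t` steps, without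
leaving the first `s` memory cells. -/
def Runs {w : ℕ} (I tape : ℕ → BitVec w) (s : ℕ) (c : List Prog) (M : ℕ → BitVec w) (d : ℕ)
    (M' : ℕ → BitVec w) (d' t : ℕ) : Prop :=
  ∀ K, (step I tape)^[t] ⟨c ++ K, M, d⟩ = ⟨K, M', d'⟩ ∧
    ∀ j < t, ∀ a ∈ touched ((step I tape)^[j] ⟨c ++ K, M, d⟩), a < s

/-! ### Composition of machine runs. -/

section Runs

variable {w : ℕ} {I tape : ℕ → BitVec w} {s : ℕ}

theorem Runs.nil (M : ℕ → BitVec w) (d : ℕ) : Runs I tape s [] M d M d 0 :=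
  fun _ => ⟨rfl, fun _ h => absurd h (Nat.not_lt_zero _)⟩

/-- `Runs` holds for every continuation, so the first run may be taken with the second piece of code
as part of its continuation. -/
theorem Runs.append {c₁ c₂ : List Prog} {M M₁ M₂ : ℕ → BitVec w} {d d₁ d₂ t₁ t₂ : ℕ}
    (h₁ : Runs I tape s c₁ M d M₁ d₁ t₁) (h₂ : Runs I tape s c₂ M₁ d₁ M₂ d₂ t₂) :
    Runs I tape s (c₁ ++ c₂) M d M₂ d₂ (t₁ + t₂) := by
  intro K
  have e₁ := h₁ (c₂ ++ K)
  have e₂ := h₂ K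
  rw [List.append_assoc]
  refine ⟨?_, fun j hj a ha => ?_⟩
  · rw [Nat.add_comm, Function.iterate_add_apply, e₁.1, e₂.1]
  · by_cases hjt : j < t₁
    · exact e₁.2 j hjt a ha
    · obtain ⟨i, rfl⟩ := Nat.exists_eq_add_of_le (not_lt.1 hjt)
      rw [Nat.add_comm, Function.iterate_add_apply, e₁.1] at ha
      exact e₂.2 i (by omega) a ha

/-- A step that replaces the code `c` by `c'`. -/
theorem Runs.head {c c' : List Prog} {M M₁ M₂ : ℕ → BitVec w} {d d₁ d₂ t : ℕ}
    (hs : ∀ K, step I tape ⟨c ++ K, M, d⟩ = ⟨c' ++ K, M₁, d₁⟩)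
    (ht : ∀ K, ∀ a ∈ touched (⟨c ++ K, M, d⟩ : Config w), a < s)
    (h : Runs I tape s c' M₁ d₁ M₂ d₂ t) : Runs I tape s c M d M₂ d₂ (t + 1) := by
  intro K
  refine ⟨by rw [Function.iterate_succ_apply, hs, (h K).1], fun j hj a ha => ?_⟩
  cases j with
  | zero => exact ht K a ha
  | succ j =>
    rw [Function.iterate_succ_apply, hs] at ha
    exact (h K).2 j (by omega) a ha

theorem Runs.one {p : Prog} {M M₁ : ℕ → BitVec w} {d d₁ : ℕ}
    (hs : ∀ K, step I tape ⟨p :: K, M, d⟩ = ⟨K, M₁, d₁⟩)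
    (ht : ∀ K, ∀ a ∈ touched (⟨p :: K, M, d⟩ : Config w), a < s) :
    Runs I tape s [p] M d M₁ d₁ 1 :=
  Runs.head (c' := []) hs ht (Runs.nil _ _)

theorem Runs.seq {p q : Prog} {M M₁ M₂ : ℕ → BitVec w} {d d₁ d₂ t₁ t₂ : ℕ}
    (h₁ : Runs I tape s [p] M d M₁ d₁ t₁) (h₂ : Runs I tape s [q] M₁ d₁ M₂ d₂ t₂) :
    Runs I tape s [.seq p q] M d M₂ d₂ (t₁ + t₂ + 1) :=
  Runs.head (c' := [p, q]) (fun _ => rfl) (by simp [touched]) (h₁.append h₂)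

/-- Needed for loops: after an iteration of a compiled loop the remaining code is the evaluation of
the test followed by the `while`, that is, the compiled loop after its first `seq` step. -/
theorem Runs.of_seq {p q : Prog} {M M' : ℕ → BitVec w} {d d' t : ℕ}
    (h : Runs I tape s [.seq p q] M d M' d' (t + 1)) : Runs I tape s [p, q] M d M' d' t := by
  intro K
  refine ⟨by simpa [Function.iterate_succ_apply, step] using (h K).1, fun j hj a ha => ?_⟩
  refine (h K).2 (j + 1) (by omega) a ?_
  simpa [Function.iterate_succ_apply, step] using ha

theorem Runs.const {M : ℕ → BitVec w} {d a v : ℕ} (ha : a < s) :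
    Runs I tape s [.const a v] M d (Function.update M a (BitVec.ofNat w v)) d 1 :=
  Runs.one (fun _ => rfl) (by simp [touched, ha])

theorem Runs.op {M : ℕ → BitVec w} {d a b c : ℕ} {o : Op} (ha : a < s) (hb : b < s) (hc : c < s) :
    Runs I tape s [.op o a b c] M d (Function.update M a (o.eval (M b) (M c))) d 1 :=
  Runs.one (fun _ => rfl) (by simp [touched, ha, hb, hc])

theorem Runs.input {M : ℕ → BitVec w} {d a b : ℕ} (ha : a < s) (hb : b < s) :
    Runs I tape s [.input a b] M d (Function.update M a (I (M b).toNat)) d 1 :=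
  Runs.one (fun _ => rfl) (by simp [touched, ha, hb])

theorem Runs.load {M : ℕ → BitVec w} {d a b : ℕ} (ha : a < s) (hb : b < s)
    (hm : (M b).toNat < s) :
    Runs I tape s [.load a b] M d (Function.update M a (M (M b).toNat)) d 1 :=
  Runs.one (fun _ => rfl) (by simp [touched, ha, hb, hm])

theorem Runs.store {M : ℕ → BitVec w} {d a b : ℕ} (ha : a < s) (hb : b < s)
    (hm : (M a).toNat < s) :
    Runs I tape s [.store a b] M d (Function.update M (M a).toNat (M b)) d 1 :=
  Runs.one (fun _ => rfl) (by simp [touched, ha, hb, hm])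

theorem Runs.rand {M : ℕ → BitVec w} {d a : ℕ} (ha : a < s) :
    Runs I tape s [.rand a] M d (Function.update M a (tape d)) (d + 1) 1 :=
  Runs.one (fun _ => rfl) (by simp [touched, ha])

end Runs

/-- The machine memory `M` represents the state `σ`. -/
structure Repr (E : Env) (σ : St) (M : ℕ → BitVec E.w) : Prop where
  reg : ∀ i < nv, (M i).toNat = σ.r i
  arr : ∀ A < na, ∀ i < E.L, (M (nr + na * i + A)).toNat = σ.a A i
  out : ∀ j < E.Lo, (M (nr + na * E.L + j)).toNat = σ.o j

theorem Repr.congr {E : Env} {σ : St} {M M' : ℕ → BitVec E.w} (h : Repr E σ M)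
    (h1 : ∀ i < nv, M' i = M i) (h2 : ∀ i, nr ≤ i → M' i = M i) : Repr E σ M' where
  reg i hi := by rw [h1 i hi, h.reg i hi]
  arr A hA i hi := by rw [h2 _ (by omega), h.arr A hA i hi]
  out j hj := by rw [h2 _ (by omega), h.out j hj]

/-- The arrays are interleaved: the cells `i` of all arrays form a block of `na` words. Addresses
can thus be computed without knowing the length of the arrays. -/
theorem addr_lt {E : Env} {A i : ℕ} (hA : A < na) (hi : i < E.L) :
    nr + na * i + A < nr + na * E.L := by
  simp only [nr, na] at *; omega

theorem Env.lt_space {E : Env} {i : ℕ} (hi : i < nr) : i < E.space := by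
  simp only [Env.space]; omega

theorem Runs.addrCode {E : Env} {A i t d : ℕ} (M : ℕ → BitVec E.w) (hA : A < na) (hi : i < E.L)
    (ht : t + 1 < nr) (hM : (M t).toNat = i) :
    ∃ M', Runs E.I E.tape E.space [addrCode A t] M d M' d 7 ∧
      (M' t).toNat = nr + na * i + A ∧ (∀ j, j < t → M' j = M j) ∧ ∀ j, nr ≤ j → M' j = M j := by
  have hf := E.fits
  have ha := addr_lt hA hi
  have h1 : t < E.space := Env.lt_space (by omega)
  have h2 : t + 1 < E.space := Env.lt_space ht
  refine ⟨_, (Runs.const h2).seq ((Runs.op h1 h1 h2).seq ((Runs.const h2).seq (Runs.op h1 h1 h2))), ?_, fun j hj => ?_, fun j hj => ?_⟩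
  · have e1 : na % 2 ^ E.w = na := Nat.mod_eq_of_lt (by simp only [nr, na] at *; omega)
    have e2 : (nr + A) % 2 ^ E.w = nr + A := Nat.mod_eq_of_lt (by simp only [nr, na] at *; omega)
    have e3 : i * na % 2 ^ E.w = i * na := Nat.mod_eq_of_lt (by simp only [nr, na] at *; omega)
    have e4 : (i * na + (nr + A)) % 2 ^ E.w = i * na + (nr + A) :=
      Nat.mod_eq_of_lt (by simp only [nr, na] at *; omega)
    simp only [Op.eval, Function.update_self, ne_eq, one_ne_zero,
      not_false_eq_true, Function.update_of_ne, BitVec.toNat_add, BitVec.toNat_mul,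
      BitVec.toNat_ofNat, hM, Nat.left_eq_add, e1, e2, e3, e4]
    ring
  · have : j ≠ t := by omega
    have : j ≠ t + 1 := by omega
    simp [*]
  · have : j ≠ t := by omega
    have : j ≠ t + 1 := by omega
    simp [*]

/-- The temporary cells act as a stack growing upwards from `t`. The clause on cells below `t` keeps
a left operand intact while the right one is evaluated; the clause on cells from `nr` on protects
arrays and output. -/
theorem Ex.runs_code {E : Env} {σ : St} (e : Ex) : ∀ {M : ℕ → BitVec E.w} {t : ℕ} (d : ℕ),
    Repr E σ M → nv ≤ t → e.wf t = true → e.ok E σ →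
    ∃ M', Runs E.I E.tape E.space [e.code t] M d M' d e.cost ∧ (M' t).toNat = e.val E σ ∧
      (∀ j, j < t → M' j = M j) ∧ ∀ j, nr ≤ j → M' j = M j := by
  induction e with
  | num v =>
    intro M t d hR ht hwf hok
    simp only [Ex.wf, decide_eq_true_eq] at hwf
    refine ⟨_, Runs.const (Env.lt_space hwf), ?_, fun j hj => ?_, fun j hj => ?_⟩
    · simpa [Ex.val] using Nat.mod_eq_of_lt hok
    · simp [hj.ne]
    · simp [show j ≠ t by omega]
  | reg i =>
    intro M t d hR ht hwf hok
    simp only [Ex.wf, Bool.and_eq_true, decide_eq_true_eq] at hwf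
    refine ⟨_, Runs.op (Env.lt_space hwf.2) (Env.lt_space (by omega)) (Env.lt_space (by omega)),
      ?_, fun j hj => ?_, fun j hj => ?_⟩
    · simp [Op.eval, Ex.val, hR.reg i hwf.1]
    · simp [hj.ne]
    · simp [show j ≠ t by omega]
  | arr A e ih =>
    intro M t d hR ht hwf hok
    simp only [Ex.wf, Bool.and_eq_true, decide_eq_true_eq] at hwf
    obtain ⟨M₁, r₁, v₁, l₁, g₁⟩ := ih d hR ht hwf.2 hok.1
    obtain ⟨M₂, r₂, v₂, l₂, g₂⟩ := Runs.addrCode (d := d) M₁ hwf.1.1 hok.2 hwf.1.2 v₁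
    have ha := addr_lt hwf.1.1 hok.2
    have hs : nr + na * E.L ≤ E.space := Nat.le_add_right _ _
    have ht' : t < E.space := Env.lt_space (by omega)
    refine ⟨_, (r₁.seq r₂).seq (Runs.load ht' ht' (by rw [v₂]; omega)), ?_,
      fun j hj => ?_, fun j hj => ?_⟩
    · rw [Function.update_self, v₂, g₂ _ (by omega), g₁ _ (by omega), hR.arr A hwf.1.1 _ hok.2]
      rfl
    · rw [Function.update_of_ne hj.ne, l₂ j hj, l₁ j hj]
    · rw [Function.update_of_ne (by omega), g₂ j hj, g₁ j hj]
  | inp e ih =>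
    intro M t d hR ht hwf hok
    simp only [Ex.wf, Bool.and_eq_true, decide_eq_true_eq] at hwf
    obtain ⟨M₁, r₁, v₁, l₁, g₁⟩ := ih d hR ht hwf.2 hok
    have ht' : t < E.space := Env.lt_space (by omega)
    refine ⟨_, r₁.seq (Runs.input ht' ht'), ?_, fun j hj => ?_, fun j hj => ?_⟩
    · rw [Function.update_self, v₁]
      rfl
    · rw [Function.update_of_ne hj.ne, l₁ j hj]
    · rw [Function.update_of_ne (by omega), g₁ j hj]
  | bin o x y ihx ihy =>
    intro M t d hR ht hwf hok
    simp only [Ex.wf, Bool.and_eq_true, decide_eq_true_eq] at hwf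
    obtain ⟨M₁, r₁, v₁, l₁, g₁⟩ := ihx d hR ht hwf.1.2 hok.1
    have hR₁ := hR.congr (fun i hi => l₁ i (by omega)) g₁
    obtain ⟨M₂, r₂, v₂, l₂, g₂⟩ := ihy d hR₁ (by omega) hwf.2 hok.2.1
    have ht' : t < E.space := Env.lt_space (by omega)
    have ht'' : t + 1 < E.space := by
      have : nr ≤ E.space := by simp only [Env.space]; omega
      have hy : ∀ (y : Ex) (t : ℕ), y.wf t = true → t < nr := by
        intro y
        induction y <;> intro t h <;> simp_all [Ex.wf]
      exact (hy _ _ hwf.2).trans_le this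
    refine ⟨_, (r₁.seq r₂).seq (Runs.op ht' ht' ht''), ?_, fun j hj => ?_, fun j hj => ?_⟩
    · have v₁' : (M₂ t).toNat = x.val E σ := by rw [l₂ t (by omega), v₁]
      rw [Function.update_self, BOp.eval_toNat E.w_pos _ _ _ (by rw [v₁', v₂]; exact hok.2.2),
        v₁', v₂]
      rfl
    · rw [Function.update_of_ne hj.ne, l₂ j (by omega), l₁ j hj]
    · rw [Function.update_of_ne (by omega), g₂ j hj, g₁ j hj]

/-! ### Statements and the correctness of their compilation. -/

/-- Statements. -/
inductive Stm
  | skip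
  | set (i : ℕ) (e : Ex)
  | put (A : ℕ) (x e : Ex)
  | out (x e : Ex)
  | rnd (i : ℕ)
  | seq (p q : Stm)
  | ite (e : Ex) (p q : Stm)
  | wh (e : Ex) (p : Stm)

/-- The machine code of a statement. -/
def Stm.code : Stm → Prog
  | .skip => .skip
  | .set i e => .seq (e.code nv) (.op .or i nv nv)
  | .put A x e => .seq (.seq (.seq (x.code nv) (addrCode A nv)) (e.code (nv + 1)))
      (.store nv (nv + 1))
  | .out x e => .seq (.seq (x.code nv) (e.code (nv + 1))) (.store nv (nv + 1))
  | .rnd i => .rand i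
  | .seq p q => .seq p.code q.code
  | .ite e p q => .seq (e.code nv) (.ite nv p.code q.code)
  | .wh e p => .seq (e.code nv) (.while nv (.seq p.code (e.code nv)))

/-- All registers, arrays and temporary cells used by a statement exist. -/
def Stm.wf : Stm → Bool
  | .skip => true
  | .set i e => decide (i < nv) && e.wf nv
  | .put A x e => decide (A < na) && x.wf nv && e.wf (nv + 1)
  | .out x e => x.wf nv && e.wf (nv + 1)
  | .rnd i => decide (i < nv)
  | .seq p q => p.wf && q.wf
  | .ite e p q => e.wf nv && p.wf && q.wf
  | .wh e p => e.wf nv && p.wf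

/-- The state with register `i` set to `v`. -/
def St.setr (σ : St) (i v : ℕ) : St := { σ with r := Function.update σ.r i v }

/-- The state with cell `x` of array `A` set to `v`. -/
def St.seta (σ : St) (A x v : ℕ) : St :=
  { σ with a := Function.update σ.a A (Function.update (σ.a A) x v) }

/-- The state with output cell `j` set to `v`. -/
def St.seto (σ : St) (j v : ℕ) : St := { σ with o := Function.update σ.o j v }

/-- Execution of statements, with the running time of the machine code. -/
inductive Exec (E : Env) : Stm → St → St → ℕ → Prop
  | skip {σ} : Exec E .skip σ σ 1
  | set {i e σ} (h : e.ok E σ) : Exec E (.set i e) σ (σ.setr i (e.val E σ)) (e.cost + 2)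
  | put {A x e σ} (hx : x.ok E σ) (hl : x.val E σ < E.L) (he : e.ok E σ) :
      Exec E (.put A x e) σ (σ.seta A (x.val E σ) (e.val E σ))
        (x.cost + 7 + 1 + e.cost + 1 + 1 + 1)
  | out {x e σ j} (hx : x.ok E σ) (hl : x.val E σ = nr + na * E.L + j) (hj : j < E.Lo)
      (he : e.ok E σ) :
      Exec E (.out x e) σ (σ.seto j (e.val E σ)) (x.cost + e.cost + 1 + 1 + 1)
  | rnd {i σ} : Exec E (.rnd i) σ ⟨(σ.setr i (E.tape σ.d).toNat).r, σ.a, σ.o, σ.d + 1⟩ 1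
  | seq {p q σ₁ σ₂ σ₃ t₁ t₂} (h₁ : Exec E p σ₁ σ₂ t₁) (h₂ : Exec E q σ₂ σ₃ t₂) :
      Exec E (.seq p q) σ₁ σ₃ (t₁ + t₂ + 1)
  | ite_true {e p q σ σ' t} (he : e.ok E σ) (hv : e.val E σ ≠ 0) (h : Exec E p σ σ' t) :
      Exec E (.ite e p q) σ σ' (e.cost + (t + 1) + 1)
  | ite_false {e p q σ σ' t} (he : e.ok E σ) (hv : e.val E σ = 0) (h : Exec E q σ σ' t) :
      Exec E (.ite e p q) σ σ' (e.cost + (t + 1) + 1)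
  | wh_false {e p σ} (he : e.ok E σ) (hv : e.val E σ = 0) :
      Exec E (.wh e p) σ σ (e.cost + 2)
  | wh_true {e p σ₁ σ₂ σ₃ t₁ t₂} (he : e.ok E σ₁) (hv : e.val E σ₁ ≠ 0) (h₁ : Exec E p σ₁ σ₂ t₁)
      (h₂ : Exec E (.wh e p) σ₂ σ₃ t₂) :
      Exec E (.wh e p) σ₁ σ₃ (e.cost + t₁ + t₂ + 2)

theorem Repr.setr {E : Env} {σ : St} {M : ℕ → BitVec E.w} (h : Repr E σ M) {i v : ℕ}
    {V : BitVec E.w} (hi : i < nv) (hV : V.toNat = v) :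
    Repr E (σ.setr i v) (Function.update M i V) where
  reg j hj := by
    by_cases hji : j = i
    · subst hji; simp [St.setr, hV]
    · simp [St.setr, hji, h.reg j hj]
  arr A hA j hj := by
    rw [Function.update_of_ne (by simp only [nr, nv] at *; omega), h.arr A hA j hj]; rfl
  out j hj := by
    rw [Function.update_of_ne (by simp only [nr, nv] at *; omega), h.out j hj]; rfl

theorem Repr.seta {E : Env} {σ : St} {M : ℕ → BitVec E.w} (h : Repr E σ M) {A i v : ℕ}
    {V : BitVec E.w} (hA : A < na) (hi : i < E.L) (hV : V.toNat = v) :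
    Repr E (σ.seta A i v) (Function.update M (nr + na * i + A) V) where
  reg j hj := by
    rw [Function.update_of_ne (by simp only [nr, nv] at *; omega), h.reg j hj]; rfl
  arr B hB j hj := by
    by_cases hBA : B = A
    · subst hBA
      by_cases hji : j = i
      · subst hji; simp [St.seta, hV]
      · rw [Function.update_of_ne (by simp only [nr, na] at *; omega), h.arr B hB j hj]
        simp [St.seta, hji]
    · rw [Function.update_of_ne (by simp only [nr, na] at *; omega), h.arr B hB j hj]
      simp [St.seta, hBA]
  out j hj := by
    rw [Function.update_of_ne (by simp only [nr, na] at *; omega), h.out j hj]; rfl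

theorem Repr.seto {E : Env} {σ : St} {M : ℕ → BitVec E.w} (h : Repr E σ M) {i v : ℕ}
    {V : BitVec E.w} (hV : V.toNat = v) :
    Repr E (σ.seto i v) (Function.update M (nr + na * E.L + i) V) where
  reg j hj := by
    rw [Function.update_of_ne (by simp only [nr, nv] at *; omega), h.reg j hj]; rfl
  arr B hB j hj := by
    rw [Function.update_of_ne (by simp only [nr, na] at *; omega), h.arr B hB j hj]; rfl
  out j hj := by
    by_cases hji : j = i
    · subst hji; simp [St.seto, hV]
    · rw [Function.update_of_ne (by omega), h.out j hj]; simp [St.seto, hji]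

/-- Induction on the execution. The times in `Exec` are exact step counts of the generated code, so
simulation and time bound are one statement. -/
theorem Exec.runs {E : Env} {p : Stm} {σ σ' : St} {t : ℕ} (h : Exec E p σ σ' t) :
    p.wf = true → ∀ M, Repr E σ M →
      ∃ M', Runs E.I E.tape E.space [p.code] M σ.d M' σ'.d t ∧ Repr E σ' M' := by
  have hnv : nv < E.space := Env.lt_space (by decide)
  have hnv1 : nv + 1 < E.space := Env.lt_space (by decide)
  have hspace : nr + na * E.L + E.Lo = E.space := rfl
  induction h with
  | skip =>
    intro _ M hM
    exact ⟨M, Runs.one (fun _ => rfl) (by simp [touched, Stm.code]), hM⟩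
  | @set i e σ he =>
    intro hwf M hM
    simp only [Stm.wf, Bool.and_eq_true, decide_eq_true_eq] at hwf
    obtain ⟨M₁, r₁, v₁, l₁, g₁⟩ := e.runs_code σ.d hM le_rfl hwf.2 he
    refine ⟨_, r₁.seq (Runs.op (Env.lt_space (by simp only [nv, nr] at *; omega)) hnv hnv),
      (hM.congr l₁ g₁).setr hwf.1 ?_⟩
    simpa [Op.eval] using v₁
  | @put A x e σ hx hl he =>
    intro hwf M hM
    simp only [Stm.wf, Bool.and_eq_true, decide_eq_true_eq] at hwf
    obtain ⟨M₁, r₁, v₁, l₁, g₁⟩ := x.runs_code σ.d hM le_rfl hwf.1.2 hx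
    obtain ⟨M₂, r₂, v₂, l₂, g₂⟩ := Runs.addrCode (d := σ.d) M₁ hwf.1.1 hl (by decide) v₁
    have hR₂ : Repr E σ M₂ := (hM.congr l₁ g₁).congr l₂ g₂
    obtain ⟨M₃, r₃, v₃, l₃, g₃⟩ := e.runs_code σ.d hR₂ (Nat.le_succ _) hwf.2 he
    have ha := addr_lt hwf.1.1 hl
    have hR₃ : Repr E σ M₃ := hR₂.congr (fun j hj => l₃ j (by omega)) g₃
    have v₂' := v₂
    rw [← l₃ nv (Nat.lt_succ_self _)] at v₂'
    have r := ((r₁.seq r₂).seq r₃).seq (Runs.store hnv hnv1 (by rw [v₂']; omega))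
    rw [v₂'] at r
    exact ⟨_, r, hR₃.seta hwf.1.1 hl v₃⟩
  | @out x e σ j hx hl hj he =>
    intro hwf M hM
    simp only [Stm.wf, Bool.and_eq_true] at hwf
    obtain ⟨M₁, r₁, v₁, l₁, g₁⟩ := x.runs_code σ.d hM le_rfl hwf.1 hx
    have hR₁ : Repr E σ M₁ := hM.congr l₁ g₁
    obtain ⟨M₃, r₃, v₃, l₃, g₃⟩ := e.runs_code σ.d hR₁ (Nat.le_succ _) hwf.2 he
    have hR₃ : Repr E σ M₃ := hR₁.congr (fun j hj => l₃ j (by omega)) g₃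
    have v₁' := v₁.trans hl
    rw [← l₃ nv (Nat.lt_succ_self _)] at v₁'
    have r := (r₁.seq r₃).seq (Runs.store hnv hnv1 (by rw [v₁']; omega))
    rw [v₁'] at r
    exact ⟨_, r, hR₃.seto v₃⟩
  | @rnd i σ =>
    intro hwf M hM
    simp only [Stm.wf, decide_eq_true_eq] at hwf
    have h := hM.setr hwf (rfl : (E.tape σ.d).toNat = _)
    exact ⟨_, Runs.rand (Env.lt_space (by simp only [nv, nr] at *; omega)), ⟨h.1, h.2, h.3⟩⟩
  | seq h₁ h₂ ih₁ ih₂ =>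
    intro hwf M hM
    simp only [Stm.wf, Bool.and_eq_true] at hwf
    obtain ⟨M₁, r₁, hM₁⟩ := ih₁ hwf.1 M hM
    obtain ⟨M₂, r₂, hM₂⟩ := ih₂ hwf.2 M₁ hM₁
    exact ⟨M₂, r₁.seq r₂, hM₂⟩
  | @ite_true e p q σ σ' t he hv h ih =>
    intro hwf M hM
    simp only [Stm.wf, Bool.and_eq_true] at hwf
    obtain ⟨M₁, r₁, v₁, l₁, g₁⟩ := e.runs_code σ.d hM le_rfl hwf.1.1 he
    obtain ⟨M₂, r₂, hM₂⟩ := ih hwf.1.2 M₁ (hM.congr l₁ g₁)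
    have hne : M₁ nv ≠ 0 := fun h0 => hv (by rw [← v₁, h0]; rfl)
    exact ⟨M₂, r₁.seq (Runs.head (c' := [p.code]) (fun _ => by simp only [step, List.cons_append, List.nil_append, if_pos hne])
      (by simp [touched, hnv]) r₂), hM₂⟩
  | @ite_false e p q σ σ' t he hv h ih =>
    intro hwf M hM
    simp only [Stm.wf, Bool.and_eq_true] at hwf
    obtain ⟨M₁, r₁, v₁, l₁, g₁⟩ := e.runs_code σ.d hM le_rfl hwf.1.1 he
    obtain ⟨M₂, r₂, hM₂⟩ := ih hwf.2 M₁ (hM.congr l₁ g₁)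
    have hne : M₁ nv = 0 := BitVec.eq_of_toNat_eq (by rw [v₁, hv]; rfl)
    exact ⟨M₂, r₁.seq (Runs.head (c' := [q.code]) (fun _ => by simp [step, hne])
      (by simp [touched, hnv]) r₂), hM₂⟩
  | @wh_false e p σ he hv =>
    intro hwf M hM
    simp only [Stm.wf, Bool.and_eq_true] at hwf
    obtain ⟨M₁, r₁, v₁, l₁, g₁⟩ := e.runs_code σ.d hM le_rfl hwf.1 he
    have hne : M₁ nv = 0 := BitVec.eq_of_toNat_eq (by rw [v₁, hv]; rfl)
    exact ⟨M₁, r₁.seq (Runs.head (c' := []) (t := 0) (fun _ => by simp [step, hne])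
      (by simp [touched, hnv]) (Runs.nil _ _)), hM.congr l₁ g₁⟩
  | @wh_true e p σ₁ σ₂ σ₃ t₁ t₂ he hv h₁ h₂ ih₁ ih₂ =>
    intro hwf M hM
    have hwf' := hwf
    simp only [Stm.wf, Bool.and_eq_true] at hwf'
    obtain ⟨M₁, r₁, v₁, l₁, g₁⟩ := e.runs_code σ₁.d hM le_rfl hwf'.1 he
    obtain ⟨M₂, r₂, hM₂⟩ := ih₁ hwf'.2 M₁ (hM.congr l₁ g₁)
    obtain ⟨M₃, r₃, hM₃⟩ := ih₂ hwf M₂ hM₂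
    have hne : M₁ nv ≠ 0 := fun h0 => hv (by rw [← v₁, h0]; rfl)
    -- The step split off is the initial `seq` step of the compiled loop, which is not repeated
    -- after an iteration.
    obtain ⟨t, rfl⟩ : ∃ t, t₂ = t + 1 := by
      cases h₂ <;> exact ⟨_, rfl⟩
    have r := Runs.head (I := E.I) (tape := E.tape) (s := E.space) (M := M₁) (M₁ := M₁)
      (d := σ₁.d) (d₁ := σ₁.d) (c := [Prog.while nv (.seq p.code (e.code nv))])
      (c' := [.seq p.code (e.code nv), .while nv (.seq p.code (e.code nv))])
      (fun K => by simp only [step, List.cons_append, List.nil_append, if_pos hne])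
      (by simp [touched, hnv]) (Runs.head (c := [.seq p.code (e.code nv), _])
        (c' := [p.code, e.code nv, .while nv (.seq p.code (e.code nv))]) (fun _ => rfl)
        (by simp [touched]) (r₂.append r₃.of_seq))
    have r' := r₁.seq r
    rw [show e.cost + (t₁ + t + 1 + 1) + 1 = e.cost + t₁ + (t + 1) + 2 by omega] at r'
    exact ⟨M₃, r', hM₃⟩

/-! ### Frames -/

/-- The registers that a statement may change. -/
def Stm.wr : Stm → List ℕ
  | .skip => []
  | .set i _ => [i]
  | .put _ _ _ => []
  | .out _ _ => []
  | .rnd i => [i]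
  | .seq p q => p.wr ++ q.wr
  | .ite _ p q => p.wr ++ q.wr
  | .wh _ p => p.wr

/-- The arrays that a statement may change. -/
def Stm.wa : Stm → List ℕ
  | .skip => []
  | .set _ _ => []
  | .put A _ _ => [A]
  | .out _ _ => []
  | .rnd _ => []
  | .seq p q => p.wa ++ q.wa
  | .ite _ p q => p.wa ++ q.wa
  | .wh _ p => p.wa

/-- The statement may draw random words. -/
def Stm.draws : Stm → Bool
  | .rnd _ => true
  | .seq p q => p.draws || q.draws
  | .ite _ p q => p.draws || q.draws
  | .wh _ p => p.draws
  | _ => false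

/-- The states agree outside the registers and arrays that `p` may change. -/
structure Frame (p : Stm) (σ σ' : St) : Prop where
  r : ∀ i ∉ p.wr, σ'.r i = σ.r i
  a : ∀ A ∉ p.wa, σ'.a A = σ.a A
  d : p.draws = false → σ'.d = σ.d

theorem Frame.refl (p : Stm) (σ : St) : Frame p σ σ := ⟨fun _ _ => rfl, fun _ _ => rfl, fun _ => rfl⟩

/-- A purely syntactic footprint. For the concrete statements below, "this register or array is
unchanged" is therefore settled by `decide`. -/
theorem Exec.frame {E : Env} {p : Stm} {σ σ' : St} {t : ℕ} (h : Exec E p σ σ' t) :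
    Frame p σ σ' := by
  induction h with
  | skip => exact Frame.refl _ _
  | set h =>
    refine ⟨fun j hj => ?_, fun _ _ => rfl, fun _ => rfl⟩
    simp only [Stm.wr, List.mem_singleton] at hj
    simp [St.setr, hj]
  | put hx hl he =>
    refine ⟨fun _ _ => rfl, fun j hj => ?_, fun _ => rfl⟩
    simp only [Stm.wa, List.mem_singleton] at hj
    simp [St.seta, hj]
  | out hx hl hj he => exact ⟨fun _ _ => rfl, fun _ _ => rfl, fun _ => rfl⟩
  | rnd =>
    refine ⟨fun j hj => ?_, fun _ _ => rfl, fun h => by simp [Stm.draws] at h⟩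
    simp only [Stm.wr, List.mem_singleton] at hj
    simp [St.setr, hj]
  | seq h₁ h₂ ih₁ ih₂ =>
    refine ⟨fun j hj => ?_, fun j hj => ?_, fun hd => ?_⟩
    · simp only [Stm.wr, List.mem_append, not_or] at hj
      rw [ih₂.r j hj.2, ih₁.r j hj.1]
    · simp only [Stm.wa, List.mem_append, not_or] at hj
      rw [ih₂.a j hj.2, ih₁.a j hj.1]
    · simp only [Stm.draws, Bool.or_eq_false_iff] at hd
      rw [ih₂.d hd.2, ih₁.d hd.1]
  | ite_true he hv h ih =>
    refine ⟨fun j hj => ?_, fun j hj => ?_, fun hd => ?_⟩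
    · simp only [Stm.wr, List.mem_append, not_or] at hj
      exact ih.r j hj.1
    · simp only [Stm.wa, List.mem_append, not_or] at hj
      exact ih.a j hj.1
    · simp only [Stm.draws, Bool.or_eq_false_iff] at hd
      exact ih.d hd.1
  | ite_false he hv h ih =>
    refine ⟨fun j hj => ?_, fun j hj => ?_, fun hd => ?_⟩
    · simp only [Stm.wr, List.mem_append, not_or] at hj
      exact ih.r j hj.2
    · simp only [Stm.wa, List.mem_append, not_or] at hj
      exact ih.a j hj.2
    · simp only [Stm.draws, Bool.or_eq_false_iff] at hd
      exact ih.d hd.2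
  | wh_false he hv => exact Frame.refl _ _
  | wh_true he hv h₁ h₂ ih₁ ih₂ =>
    exact ⟨fun j hj => by rw [ih₂.r j hj, ih₁.r j hj], fun j hj => by rw [ih₂.a j hj, ih₁.a j hj],
      fun hd => by rw [ih₂.d hd, ih₁.d hd]⟩

/-! ### Total correctness with running times -/

/-- From the state `σ`, the statement `p` halts within `t` steps in a state that satisfies `Q`. -/
def WP (E : Env) (p : Stm) (t : ℕ) (Q : St → Prop) (σ : St) : Prop :=
  ∃ σ' t', Exec E p σ σ' t' ∧ t' ≤ t ∧ Q σ'

section WP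

variable {E : Env} {p q : Stm} {t t₁ t₂ : ℕ} {Q R : St → Prop} {σ : St}

/-- Consequence rule, with frame. -/
theorem WP.mono (h : WP E p t₁ R σ) (ht : t₁ ≤ t) (hQ : ∀ σ', Frame p σ σ' → R σ' → Q σ') :
    WP E p t Q σ := by
  obtain ⟨σ', t', he, hle, hR⟩ := h
  exact ⟨σ', t', he, hle.trans ht, hQ _ he.frame hR⟩

theorem WP.seq (h₁ : WP E p t₁ R σ) (h₂ : ∀ σ', Frame p σ σ' → R σ' → WP E q t₂ Q σ')
    (ht : t₁ + t₂ + 1 ≤ t) : WP E (.seq p q) t Q σ := by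
  obtain ⟨σ', t', he, hle, hR⟩ := h₁
  obtain ⟨σ'', t'', he', hle', hQ⟩ := h₂ _ he.frame hR
  exact ⟨σ'', _, he.seq he', by omega, hQ⟩

theorem WP.ite {e : Ex} (he : e.ok E σ) (h₁ : e.val E σ ≠ 0 → WP E p t₁ Q σ)
    (h₂ : e.val E σ = 0 → WP E q t₁ Q σ) (ht : e.cost + t₁ + 2 ≤ t) : WP E (.ite e p q) t Q σ := by
  by_cases hv : e.val E σ = 0
  · obtain ⟨σ', t', hx, hle, hQ⟩ := h₂ hv
    exact ⟨σ', _, Exec.ite_false he hv hx, by omega, hQ⟩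
  · obtain ⟨σ', t', hx, hle, hQ⟩ := h₁ hv
    exact ⟨σ', _, Exec.ite_true he hv hx, by omega, hQ⟩

/-- Loops that are executed exactly `B` times. -/
theorem WP.while {e : Ex} (B : ℕ) (Inv : ℕ → St → Prop) (h₀ : Inv 0 σ)
    (hstep : ∀ j < B, ∀ τ, Frame (.wh e p) σ τ → Inv j τ →
      e.ok E τ ∧ e.val E τ ≠ 0 ∧ WP E p t₁ (Inv (j + 1)) τ)
    (hend : ∀ τ, Frame (.wh e p) σ τ → Inv B τ → e.ok E τ ∧ e.val E τ = 0 ∧ Q τ)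
    (ht : B * (e.cost + t₁ + 2) + e.cost + 2 ≤ t) : WP E (.wh e p) t Q σ := by
  suffices H : ∀ i ≤ B, ∀ τ, Frame (.wh e p) σ τ → Inv (B - i) τ →
      WP E (.wh e p) (i * (e.cost + t₁ + 2) + e.cost + 2) Q τ from
    (H B le_rfl σ (Frame.refl _ _) (by simpa using h₀)).mono ht fun _ _ h => h
  intro i
  induction i with
  | zero =>
    intro _ τ hf hI
    obtain ⟨h1, h2, h3⟩ := hend τ hf (by simpa using hI)
    exact ⟨τ, _, Exec.wh_false h1 h2, by omega, h3⟩
  | succ i ih =>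
    intro hi τ hf hI
    obtain ⟨h1, h2, σ', t', h3, h4, h5⟩ := hstep _ (by omega) τ hf hI
    have hf' := h3.frame
    obtain ⟨σ'', t'', h6, h7, h8⟩ := ih (by omega) σ'
      ⟨fun j hj => by rw [hf'.r j hj, hf.r j hj], fun j hj => by rw [hf'.a j hj, hf.a j hj],
        fun hd => by rw [hf'.d hd, hf.d hd]⟩
      (by rwa [show B - (i + 1) + 1 = B - i by omega] at h5)
    refine ⟨σ'', _, Exec.wh_true h1 h2 h3 h6, ?_, h8⟩
    rw [Nat.add_mul]
    omega

/-- The loop in which register `i` runs through all numbers below the content of register `b`. -/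
def Stm.for (i b : ℕ) (p : Stm) : Stm :=
  .seq (.set i (.num 0)) (.wh (.bin .lt (.reg i) (.reg b))
    (.seq p (.set i (.bin .add (.reg i) (.num 1)))))

/-- The increment belongs to the loop and not to `p`, hence the invariant after the body is required
for the state with the counter already advanced. The constant 20 covers the test, the increment and
the jumps. -/
theorem WP.for {i b : ℕ} (B : ℕ) (Inv : ℕ → St → Prop) (hi : i ∉ p.wr) (hb : b ∉ p.wr)
    (hib : i ≠ b) (hB : σ.r b = B) (hBw : B < 2 ^ E.w)
    (h₀ : Inv 0 (σ.setr i 0))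
    (hstep : ∀ j < B, ∀ τ, Frame (Stm.for i b p) σ τ → τ.r i = j → Inv j τ →
      WP E p t₁ (fun τ' => Inv (j + 1) (τ'.setr i (j + 1))) τ)
    (hend : ∀ τ, Frame (Stm.for i b p) σ τ → Inv B τ → Q τ)
    (ht : (B + 1) * (t₁ + 20) ≤ t) : WP E (Stm.for i b p) t Q σ := by
  have hfr : ∀ τ, Frame (.wh (.bin .lt (.reg i) (.reg b))
      (.seq p (.set i (.bin .add (.reg i) (.num 1))))) (σ.setr i 0) τ →
      Frame (Stm.for i b p) σ τ := fun τ hf => by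
    refine ⟨fun j hj => ?_, hf.a, hf.d⟩
    simp only [Stm.for, Stm.wr, List.mem_append, List.mem_singleton, not_or] at hj
    rw [hf.r j (by simp [Stm.wr, hj])]
    simp [St.setr, hj.1]
  have h1 : 1 < 2 ^ E.w := Nat.one_lt_two_pow E.w_pos.ne'
  refine WP.seq (t₁ := 3) (R := fun τ => τ = σ.setr i 0)
    ⟨_, _, Exec.set (by simp [Ex.ok]), le_rfl, rfl⟩ ?_ (t₂ := (B + 1) * (t₁ + 20) - 4)
    (by have : 20 ≤ (B + 1) * (t₁ + 20) := by nlinarith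
        omega)
  rintro _ - rfl
  refine WP.while B (fun j τ => τ.r i = j ∧ Inv j τ) ⟨by simp [St.setr], h₀⟩ (t₁ := t₁ + 8)
    (fun j hj τ hf hI => ?_) (fun τ hf hI => ?_) ?_
  · have hb' : τ.r b = B := by
      rw [(hfr τ hf).r b (by simp [Stm.for, Stm.wr, hb, hib.symm]), hB]
    refine ⟨by simp [Ex.ok, BOp.ok], by simp [Ex.val, BOp.val, hb', hI.1, hj], ?_⟩
    refine WP.seq (hstep j hj τ (hfr τ hf) hI.1 hI.2) (t₂ := 7) (fun τ' hf' hI' => ?_) (by omega)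
    have hi' : τ'.r i = j := by rw [hf'.r i hi, hI.1]
    refine ⟨_, _, Exec.set ?_, by simp [Ex.cost], ?_⟩
    · simp only [Ex.ok, BOp.ok, Ex.val, hi', true_and]
      omega
    · simp only [Ex.val, BOp.val, hi']
      exact ⟨by simp [St.setr], hI'⟩
  · have hb' : τ.r b = B := by
      rw [(hfr τ hf).r b (by simp [Stm.for, Stm.wr, hb, hib.symm]), hB]
    exact ⟨by simp [Ex.ok, BOp.ok], by simp [Ex.val, BOp.val, hb', hI.1], hend τ (hfr τ hf) hI.2⟩
  · simp only [Ex.cost]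
    have : (B + 1) * (t₁ + 20) = B * (t₁ + 20) + t₁ + 20 := by ring
    have : B * (1 + 1 + 3 + (t₁ + 8) + 2) ≤ B * (t₁ + 20) := Nat.mul_le_mul_left _ (by omega)
    omega

/-! ### Loop-free statements -/

/-- Weakest preconditions of loop-free statements. -/
def Stm.pre (E : Env) : Stm → (St → Prop) → St → Prop
  | .skip, Q, σ => Q σ
  | .set i e, Q, σ => e.ok E σ ∧ Q (σ.setr i (e.val E σ))
  | .put A x e, Q, σ => x.ok E σ ∧ x.val E σ < E.L ∧ e.ok E σ ∧ Q (σ.seta A (x.val E σ) (e.val E σ))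
  | .seq p q, Q, σ => p.pre E (q.pre E Q) σ
  | .ite e p q, Q, σ => e.ok E σ ∧ if e.val E σ ≠ 0 then p.pre E Q σ else q.pre E Q σ
  | _, _, _ => False

/-- A bound for the running time of a loop-free statement. -/
def Stm.cost : Stm → ℕ
  | .skip => 1
  | .set _ e => e.cost + 2
  | .put _ x e => x.cost + e.cost + 11
  | .seq p q => p.cost + q.cost + 1
  | .ite e p q => e.cost + max p.cost q.cost + 2
  | _ => 0

theorem WP.pre : ∀ {p : Stm} {Q : St → Prop} {σ : St}, p.pre E Q σ → WP E p p.cost Q σ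
  | .skip, _, _, h => ⟨_, _, .skip, le_rfl, h⟩
  | .set _ _, _, _, h => ⟨_, _, .set h.1, le_rfl, h.2⟩
  | .put _ _ _, _, _, h =>
    ⟨_, _, .put h.1 h.2.1 h.2.2.1, by simp only [Stm.cost]; omega, h.2.2.2⟩
  | .seq _ _, _, _, h => WP.seq (WP.pre h) (fun _ _ h => WP.pre h) le_rfl
  | .ite _ _ _, _, _, h => by
    refine WP.ite h.1 (t₁ := max _ _) (fun hv => ?_) (fun hv => ?_) le_rfl
    · exact (WP.pre (by simpa [hv] using h.2)).mono (le_max_left _ _) fun _ _ h => h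
    · exact (WP.pre (by simpa [hv] using h.2)).mono (le_max_right _ _) fun _ _ h => h

theorem WP.straight (ht : p.cost ≤ t) (h : p.pre E Q σ) : WP E p t Q σ :=
  (WP.pre h).mono ht fun _ _ h => h

theorem WP.le (h : WP E p t₁ Q σ) (ht : t₁ ≤ t) : WP E p t Q σ := h.mono ht fun _ _ h => h

theorem WP.skip (h : Q σ) : WP E .skip 1 Q σ := ⟨_, _, .skip, le_rfl, h⟩

theorem WP.set {i v : ℕ} {e : Ex} (hok : e.ok E σ) (hv : e.val E σ = v) (h : Q (σ.setr i v)) :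
    WP E (.set i e) (e.cost + 2) Q σ :=
  ⟨_, _, .set hok, le_rfl, hv ▸ h⟩

theorem WP.put {A v y : ℕ} {x e : Ex} (hx : x.ok E σ) (hxv : x.val E σ = y) (hl : y < E.L)
    (hok : e.ok E σ) (hv : e.val E σ = v) (h : Q (σ.seta A y v)) :
    WP E (.put A x e) (x.cost + e.cost + 11) Q σ := by
  subst hxv hv
  exact ⟨_, _, .put hx hl hok, by omega, h⟩

theorem WP.out {j v : ℕ} {x e : Ex} (hx : x.ok E σ) (hxv : x.val E σ = nr + na * E.L + j)
    (hl : j < E.Lo) (hok : e.ok E σ) (hv : e.val E σ = v) (h : Q (σ.seto j v)) :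
    WP E (.out x e) (x.cost + e.cost + 3) Q σ := by
  subst hv
  exact ⟨_, _, .out hx hxv hl hok, by omega, h⟩

theorem WP.then (h₁ : WP E p t₁ R σ) (h₂ : ∀ σ', Frame p σ σ' → R σ' → WP E q t₂ Q σ') :
    WP E (.seq p q) (t₁ + t₂ + 1) Q σ := h₁.seq h₂ le_rfl

/-- This and the next rules have the exact cost in the conclusion, so that a time bound is assembled
by unification while the program is traversed and is compared with the claimed one only at the end,
by `WP.le`. -/
theorem WP.set_then {i v : ℕ} {e : Ex} (hok : e.ok E σ) (hv : e.val E σ = v)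
    (h : WP E q t₂ Q (σ.setr i v)) : WP E (.seq (.set i e) q) (e.cost + 2 + t₂ + 1) Q σ := by
  obtain ⟨σ', t', he, hle, hQ⟩ := h
  subst hv
  exact ⟨σ', _, (Exec.set hok).seq he, by omega, hQ⟩

theorem WP.put_then {A v y : ℕ} {x e : Ex} (hx : x.ok E σ) (hxv : x.val E σ = y) (hl : y < E.L)
    (hok : e.ok E σ) (hv : e.val E σ = v) (h : WP E q t₂ Q (σ.seta A y v)) :
    WP E (.seq (.put A x e) q) (x.cost + e.cost + 11 + t₂ + 1) Q σ := by
  obtain ⟨σ', t', he, hle, hQ⟩ := h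
  subst hxv hv
  exact ⟨σ', _, (Exec.put hx hl hok).seq he, by omega, hQ⟩

/-- The sum of the costs of the branches is used instead of the maximum, so that each branch
determines its own summand. -/
theorem WP.cond {e : Ex} (he : e.ok E σ) (h₁ : e.val E σ ≠ 0 → WP E p t₁ Q σ)
    (h₂ : e.val E σ = 0 → WP E q t₂ Q σ) : WP E (.ite e p q) (e.cost + (t₁ + t₂) + 2) Q σ :=
  WP.ite he (fun h => (h₁ h).le (Nat.le_add_right _ _)) (fun h => (h₂ h).le (Nat.le_add_left _ _))
    le_rfl

theorem WP.and_frame (h : WP E p t Q σ) : WP E p t (fun τ => Frame p σ τ ∧ Q τ) σ :=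
  h.mono le_rfl fun _ h₁ h₂ => ⟨h₁, h₂⟩

end WP

section State

variable (σ : St) (i j v A C x y : ℕ)

@[simp] theorem St.setr_r : (σ.setr i v).r j = if j = i then v else σ.r j := by
  simp [St.setr, Function.update_apply]

@[simp] theorem St.setr_a : (σ.setr i v).a = σ.a := rfl

@[simp] theorem St.setr_d : (σ.setr i v).d = σ.d := rfl

@[simp] theorem St.setr_o : (σ.setr i v).o = σ.o := rfl

@[simp] theorem St.seta_r : (σ.seta A x v).r = σ.r := rfl

@[simp] theorem St.seta_d : (σ.seta A x v).d = σ.d := rfl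

@[simp] theorem St.seta_a_of_ne (h : C ≠ A) : (σ.seta A x v).a C = σ.a C := by
  simp [St.seta, h]

@[simp] theorem St.seta_a : (σ.seta A x v).a A y = if y = x then v else σ.a A y := by
  simp [St.seta, Function.update_apply]

@[simp] theorem St.seto_o : (σ.seto x v).o y = if y = x then v else σ.o y := by
  simp [St.seto, Function.update_apply]

end State

end WordRAM

open WordRAM

/-- The statement `p`, repeated `R` times. -/
def WordRAM.Stm.rep : ℕ → Stm → Stm
  | 0, _ => .skip
  | R + 1, p => .seq (rep R p) p

namespace EdgeSetCycle

/-! ### The program -/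

local infixl:65 "+ₑ" => Ex.bin BOp.add
local infixl:65 "-ₑ" => Ex.bin BOp.sub
local infixl:70 "*ₑ" => Ex.bin BOp.mul
local infixl:70 "/ₑ" => Ex.bin BOp.div
local infixl:60 "&ₑ" => Ex.bin BOp.and
local infixl:60 "^ₑ" => Ex.bin BOp.xor
local infixl:50 "<ₑ" => Ex.bin BOp.lt
local infixl:50 "=ₑ" => Ex.bin BOp.eq
local infixr:30 ";ₛ" => Stm.seq
local prefix:max "♯" => Ex.num
local prefix:max "®" => Ex.reg

/-- The tail of the dart in register `d`. -/
def srcE (d : ℕ) : Ex := .inp (♯3 +ₑ ®d)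

/-- The head of the dart in register `d`. -/
def dstE (d : ℕ) : Ex := .inp (♯3 +ₑ (®d ^ₑ ♯1))

/-- Whether the edge of the dart in register `d` belongs to the set in register `i`. -/
def tabE (i d : ℕ) : Ex := .inp (♯3 +ₑ ®9 +ₑ ®i *ₑ ®3 +ₑ ®d /ₑ ♯2)

/-- Sets register 21 to the truth value of "an edge of weight `l` may be used in state `j`", and
register 22 to the next state. -/
def tstP (j l : ℕ) : Stm :=
  .ite ®5 (.set 21 ((®j &ₑ ®l) =ₑ ®l) ;ₛ .set 22 (®j ^ₑ ®l))
    (.set 21 ((®j <ₑ ®l) =ₑ ♯0) ;ₛ .ite ®21 (.set 22 (®j -ₑ ®l)) .skip)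

/-- Sets register 28 to the product of the field elements in registers `a` and `b`. -/
def mulP (a b : ℕ) : Stm :=
  .ite ®a (.ite ®b (.set 28 (.arr 11 (.arr 12 ®a +ₑ .arr 12 ®b))) (.set 28 ♯0)) (.set 28 ♯0)

/-- Sets the first cells of array `A` to zero, as many as register `b` says. -/
def clearP (A b : ℕ) : Stm := .for 27 b (.put A ®27 ♯0)

/-- Copies the first cells of array `A` to array `B`. -/
def copyP (A B b : ℕ) : Stm := .for 27 b (.put B ®27 (.arr A ®27))

/-- The contribution of the dart in register 25 to the next layer of the dynamic program. -/
def relaxP : Stm :=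
  .ite (.arr 9 (dstE 25)) .skip
    ((.set 23 (.arr 2 (®25 /ₑ ♯2)) ;ₛ .set 29 (.arr 0 (®25 /ₑ ♯2)) ;ₛ
      .set 17 (srcE 25 *ₑ ®6) ;ₛ .set 18 (dstE 25 *ₑ ®6)) ;ₛ
      .for 27 6 (tstP 27 23 ;ₛ .ite ®21
        (.set 26 (.arr 4 (®18 +ₑ ®22)) ;ₛ mulP 29 26 ;ₛ
          .put 5 (®17 +ₑ ®27) (.arr 5 (®17 +ₑ ®27) ^ₑ ®28)) .skip))

/-- One layer of the dynamic program. -/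
def layerP : Stm := clearP 5 11 ;ₛ .for 25 9 relaxP ;ₛ copyP 5 4 11

/-- Adds the values of the candidate darts for the current layer to the results. -/
def hookP : Stm :=
  .ite ®20
    (.for 25 9 (.ite (.arr 8 ®25)
      (.set 23 (.arr 2 (®25 /ₑ ♯2)) ;ₛ tstP 19 23 ;ₛ .ite ®21
        ((.set 29 (.arr 0 (®25 /ₑ ♯2)) ;ₛ .set 26 (.arr 4 (dstE 25 *ₑ ®6 +ₑ ®22))) ;ₛ mulP 29 26 ;ₛ
          .put 6 ®24 (.arr 6 ®24 ^ₑ ®28) ;ₛ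
          .ite (®24 +ₑ ♯1 =ₑ ®13) (.put 7 ®25 (.arr 7 ®25 ^ₑ ®28)) .skip) .skip) .skip))
    .skip

/-- The dynamic program. -/
def dpP : Stm :=
  clearP 4 11 ;ₛ .put 4 (®12 *ₑ ®6) ♯1 ;ₛ .for 24 13 (hookP ;ₛ layerP)

/-- The edge weights. -/
def lamP : Stm :=
  .for 25 9 (.set 23 ♯0 ;ₛ
    .for 24 4 (.ite (tabE 24 25) (.set 23 (®23 +ₑ .arr 3 ®24)) .skip) ;ₛ
    .put 2 (®25 /ₑ ♯2) ®23)

/-- The state after the current path. -/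
def prefP : Stm :=
  .set 19 ®7 ;ₛ .set 20 ♯1 ;ₛ
  .for 24 14 (.set 23 (.arr 2 (.arr 10 ®24 /ₑ ♯2)) ;ₛ tstP 19 23 ;ₛ
    .ite ®21 (.set 19 ®22) (.set 20 ♯0))

/-- Initial label weights. -/
def initYP : Stm :=
  .set 18 ♯1 ;ₛ .for 24 4 (.ite ®5 (.put 3 ®24 ®18 ;ₛ .set 18 (®18 +ₑ ®18))
    (.put 3 ®24 (®4 +ₑ ♯1)))

/-- The next label weights; register 15 tells whether there are any. -/
def nextYP : Stm :=
  .ite ®5 (.set 15 ♯0)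
    (.set 16 ♯1 ;ₛ
      .for 24 4 (.ite ®16 (.ite (.arr 3 ®24 =ₑ ♯1) (.put 3 ®24 (®4 +ₑ ♯1))
        (.put 3 ®24 ♯1 ;ₛ .set 16 ♯0)) .skip) ;ₛ
      .set 15 (♯1 -ₑ ®16))

/-- The values of all candidate darts: in array 6 by lengths, and in array 7 by darts. -/
def sumP : Stm :=
  clearP 6 2 ;ₛ clearP 7 9 ;ₛ initYP ;ₛ .set 15 ♯1 ;ₛ
  .wh ®15 (lamP ;ₛ prefP ;ₛ dpP ;ₛ nextYP)

/-- The candidates for the first dart from the vertex in register `v`; register 33 tells whether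
there are any. -/
def firstP (v : ℕ) : Stm :=
  .set 33 ♯0 ;ₛ .set 27 ♯0 ;ₛ
  .for 25 9 (.put 8 ®25 ((srcE 25 =ₑ ®v) *ₑ (®v <ₑ dstE 25) *ₑ tabE 27 25) ;ₛ
    .ite (.arr 8 ®25) (.set 33 ♯1) .skip)

/-- Updates the smallest length with a nonzero value; register 36 tells whether it has changed. -/
def minP : Stm :=
  .set 36 ♯0 ;ₛ
  .for 24 2 (.ite (.arr 6 ®24) (.ite (®24 <ₑ ®34)
    (.set 34 ®24 ;ₛ .set 35 ®12 ;ₛ .set 36 ♯1) .skip) .skip)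

/-- Draws the field elements for the edges. -/
def drawP : Stm := .for 25 3 (.rnd 23 ;ₛ .put 0 ®25 (®23 &ₑ ®10))

/-- One starting vertex in one trial. -/
def vertexP : Stm :=
  firstP 12 ;ₛ .ite ®33 (sumP ;ₛ minP ;ₛ .ite ®36 (copyP 0 1 3) .skip) .skip

/-- One trial of the search for the smallest length. -/
def trialP : Stm := drawP ;ₛ .for 12 2 vertexP

/-- All trials, `R` times as many as there are vertices. -/
def trialsP (R : ℕ) : Stm :=
  .set 34 ®2 ;ₛ .set 13 ®2 ;ₛ .set 14 ♯0 ;ₛ .rep R (.for 30 2 trialP)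

/-- The candidates for the next dart. -/
def nextCandP : Stm :=
  .ite ®14 (.for 25 9 (.put 8 ®25 ((srcE 25 =ₑ ®40) *ₑ (.arr 9 (dstE 25) =ₑ ♯0)))) (firstP 40)

/-- Picks a dart with a nonzero value. -/
def pickP : Stm := .set 41 ♯0 ;ₛ .for 25 9 (.ite (.arr 7 ®25) (.set 41 ®25) .skip)

/-- The search for a solution of the smallest length. -/
def searchP : Stm :=
  copyP 1 0 3 ;ₛ .set 12 ®35 ;ₛ .set 40 ®35 ;ₛ .set 38 (®34 +ₑ ♯1) ;ₛ
  .for 14 38 (nextCandP ;ₛ .set 13 (®38 -ₑ ®14) ;ₛ sumP ;ₛ pickP ;ₛ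
    .put 10 ®14 ®41 ;ₛ .set 40 (dstE 41) ;ₛ .put 9 ®40 ♯1)

/-- Checks that the darts found form a cycle without repeated vertices. -/
def chainP : Stm :=
  .set 41 (.arr 10 (®38 -ₑ ♯1)) ;ₛ .set 43 (dstE 41) ;ₛ
  .for 24 38 (.set 41 (.arr 10 ®24) ;ₛ .ite (srcE 41 =ₑ ®43) .skip (.set 42 ♯0) ;ₛ
    .set 43 (dstE 41) ;ₛ .ite (.arr 9 ®43) (.set 42 ♯0) .skip ;ₛ .put 9 ®43 ♯1)

/-- Checks that the darts found contain one edge from each set. -/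
def countP : Stm :=
  .for 25 4 (.set 44 ♯0 ;ₛ
    .for 24 38 (.set 41 (.arr 10 ®24) ;ₛ .set 44 (®44 +ₑ tabE 25 41)) ;ₛ
    .ite (®44 =ₑ ♯1) .skip (.set 42 ♯0))

/-- Verification of the darts found; the result is in register 42. -/
def verifyP : Stm := .set 42 ♯1 ;ₛ clearP 9 2 ;ₛ chainP ;ₛ countP

/-- Writes the vertices of the cycle. -/
def outputP : Stm :=
  .set 0 ®38 ;ₛ .set 1 (♯76 +ₑ ♯13 *ₑ (®11 +ₑ ♯8 *ₑ ®2 +ₑ ®9)) ;ₛ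
  .for 24 38 (.set 41 (.arr 10 ®24) ;ₛ .out (®1 +ₑ ®24) (srcE 41))

/-- Reads the parameters, and computes the size of the field (in register 8) and the number of
states (in register 6). -/
def initP (b : Bool) : Stm :=
  .set 5 ♯b.toNat ;ₛ .set 2 (.inp ♯0) ;ₛ .set 3 (.inp ♯1) ;ₛ .set 4 (.inp ♯2) ;ₛ
  .set 9 (®3 +ₑ ®3) ;ₛ .set 45 (®2 +ₑ ®2) ;ₛ .set 8 ♯1 ;ₛ
  .for 24 45 (.ite (®8 <ₑ ®45) (.set 8 (®8 +ₑ ®8)) .skip) ;ₛ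
  .set 10 (®8 -ₑ ♯1) ;ₛ .set 6 ♯1 ;ₛ
  .ite ®5 (.for 24 4 (.set 6 (®6 +ₑ ®6))) (.set 6 (®4 +ₑ ♯1)) ;ₛ
  .set 7 (®6 -ₑ ♯1) ;ₛ .set 11 (®2 *ₑ ®6)

/-- Searches a primitive polynomial and fills the tables of exponentials and logarithms. -/
def fieldP : Stm :=
  .set 48 ♯0 ;ₛ
  .for 46 8 (.ite ®48 .skip
    (.set 47 ♯1 ;ₛ .set 49 ♯1 ;ₛ
      .for 24 10 (.put 11 ®24 ®47 ;ₛ .put 11 (®24 +ₑ ®10) ®47 ;ₛ .put 12 ®47 ®24 ;ₛ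
        .set 47 (®47 +ₑ ®47) ;ₛ
        .ite (®47 <ₑ ®8) .skip (.set 47 (®47 ^ₑ ®8 ^ₑ ®46)) ;ₛ
        .ite (®47 =ₑ ♯1) (.ite (®24 +ₑ ♯1 <ₑ ®10) (.set 49 ♯0) .skip) .skip) ;ₛ
      .ite (®47 =ₑ ♯1) (.set 48 ®49) .skip))

/-- The algorithm. -/
def algP (b : Bool) (R : ℕ) : Stm :=
  initP b ;ₛ fieldP ;ₛ trialsP R ;ₛ
  .ite (®34 <ₑ ®2) (searchP ;ₛ verifyP ;ₛ .ite ®42 outputP .skip) .skip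

/-- Everything except the number `R` of textual repetitions is checked by evaluation. -/
theorem algP_wf (b : Bool) (R : ℕ) : (algP b R).wf = true := by
  have h : (Stm.rep R (.for 30 2 trialP)).wf = true := by
    induction R with
    | zero => rfl
    | succ R ih =>
      simp only [Stm.rep, Stm.wf, ih, Bool.true_and]
      rfl
  simp only [algP, trialsP, Stm.wf, h, Bool.and_true]
  rfl

end EdgeSetCycle

/-! ### Specifications of the elementary steps and of one layer of the dynamic program. -/

namespace EdgeSetCycle

local prefix:max "♯" => Ex.num
local prefix:max "®" => Ex.reg

/-- An edge of weight `l` may be used in state `j`. -/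
def tst (b : Bool) (j l : ℕ) : Prop := if b then j &&& l = l else l ≤ j

instance (b : Bool) (j l : ℕ) : Decidable (tst b j l) := by unfold tst; infer_instance

/-- The state after an edge of weight `l` in state `j`. -/
def nxt (b : Bool) (j l : ℕ) : ℕ := if b then j ^^^ l else j - l

/-- The numerical data of an instance: darts `2 * e` and `2 * e + 1` are the two orientations of the
edge `e`; `src d` is the tail of the dart `d`. -/
structure Inst where
  n : ℕ
  m : ℕ
  k : ℕ
  q : ℕ
  b : Bool
  src : ℕ → ℕ
  tab : ℕ → ℕ → ℕ

namespace Inst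

/-- The head of a dart. -/
def dst (P : Inst) (d : ℕ) : ℕ := P.src (d ^^^ 1)

/-- The number of states of the dynamic program. -/
def J (P : Inst) : ℕ := if P.b then 2 ^ P.k else P.k + 1

/-- The number of rounds of the dynamic program. -/
def Y (P : Inst) : ℕ := if P.b then 1 else 2 ^ P.k

/-- The size of the field. -/
def N (P : Inst) : ℕ := 2 ^ P.q

/-- The execution environment provides the instance and enough space. -/
structure OK (P : Inst) (E : Env) : Prop where
  n3 : 3 ≤ P.n
  nm : P.n ≤ P.m
  k0 : 0 < P.k
  inp0 : E.inp 0 = P.n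
  inp1 : E.inp 1 = P.m
  inp2 : E.inp 2 = P.k
  inp_src : ∀ d < 2 * P.m, E.inp (3 + d) = P.src d
  inp_tab : ∀ i < P.k, ∀ e < P.m, E.inp (3 + 2 * P.m + i * P.m + e) = P.tab i e
  src_lt : ∀ d < 2 * P.m, P.src d < P.n
  tab_le : ∀ i < P.k, ∀ e < P.m, P.tab i e ≤ 1
  L_eq : E.L = P.n * P.J + 8 * P.n + 2 * P.m
  Lo_eq : E.Lo = P.n
  inp_lt : 3 + 2 * P.m + P.k * P.m < 2 ^ E.w
  k_lt : (P.k + 1) * (P.k + 1) < 2 ^ E.w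
  N_ge : 2 * P.n ≤ P.N
  N_lt : P.N < 4 * P.n

theorem J_pos (P : Inst) : 0 < P.J := by
  unfold J; split <;> positivity

theorem xor_one_lt {d m : ℕ} (h : d < 2 * m) : d ^^^ 1 < 2 * m := by
  rcases Nat.even_or_odd d with hd | hd
  · rw [Nat.xor_one_of_even hd]
    obtain ⟨c, rfl⟩ := hd
    omega
  · rw [Nat.xor_one_of_odd hd]
    omega

variable {P : Inst} {E : Env}

theorem OK.dst_lt (h : P.OK E) {d : ℕ} (hd : d < 2 * P.m) : P.dst d < P.n :=
  h.src_lt _ (xor_one_lt hd)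

theorem OK.L_lt (h : P.OK E) : 76 + 13 * E.L + P.n ≤ 2 ^ E.w := by
  have := E.fits
  rwa [h.Lo_eq] at this

end Inst

/-- The map `φ` represents the elements of a field by numbers below `N`, addition being bitwise. -/
structure FieldRep {K : Type} [Field K] (N : ℕ) (φ : ℕ → K) : Prop where
  zero : φ 0 = 0
  one : φ 1 = 1
  xor : ∀ a < N, ∀ b < N, φ (a ^^^ b) = φ a + φ b
  inj : ∀ a < N, φ a = 0 → a = 0

/-- The registers with fixed contents, and the tables of exponentials and logarithms. -/
structure Base {K : Type} [Field K] (P : Inst) (φ : ℕ → K) (σ : St) : Prop where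
  r2 : σ.r 2 = P.n
  r3 : σ.r 3 = P.m
  r4 : σ.r 4 = P.k
  r5 : σ.r 5 = P.b.toNat
  r6 : σ.r 6 = P.J
  r7 : σ.r 7 = P.J - 1
  r8 : σ.r 8 = P.N
  r9 : σ.r 9 = 2 * P.m
  r10 : σ.r 10 = P.N - 1
  r11 : σ.r 11 = P.n * P.J
  mul : ∀ a < P.N, a ≠ 0 → ∀ b < P.N, b ≠ 0 → σ.a 12 a + σ.a 12 b < 8 * P.n ∧
    σ.a 11 (σ.a 12 a + σ.a 12 b) < P.N ∧
    φ (σ.a 11 (σ.a 12 a + σ.a 12 b)) = φ a * φ b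

variable {K : Type} [Field K] {P : Inst} {E : Env} {φ : ℕ → K} {σ σ' : St}

theorem Base.frame {p : Stm} (h : Base P φ σ) (hf : Frame p σ σ')
    (hr : ∀ i ∈ [2, 3, 4, 5, 6, 7, 8, 9, 10, 11], i ∉ p.wr := by decide)
    (ha : 11 ∉ p.wa ∧ 12 ∉ p.wa := by decide) : Base P φ σ' := by
  have hr' := fun i hi => hf.r i (hr i hi)
  constructor
  iterate 10 rw [hr' _ (by decide)]; first | exact h.r2 | exact h.r3 | exact h.r4 | exact h.r5 | exact h.r6 | exact h.r7 | exact h.r8 | exact h.r9 | exact h.r10 | exact h.r11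
  rw [hf.a _ ha.1, hf.a _ ha.2]
  exact h.mul

/-- The next state is specified only if the test succeeds: in the counting version the subtraction
would otherwise underflow and is not performed. -/
theorem tstP_spec {j l : ℕ} (hj : j ≠ 21) (hl : l ≠ 21) (hb : σ.r 5 = P.b.toNat) :
    WP E (tstP j l) 40 (fun σ' => (σ'.r 21 ≠ 0 ↔ tst P.b (σ.r j) (σ.r l)) ∧
      (tst P.b (σ.r j) (σ.r l) → σ'.r 22 = nxt P.b (σ.r j) (σ.r l))) σ := by
  have h1 : 0 < 2 ^ E.w := by positivity
  refine WP.straight (Nat.le_of_ble_eq_true rfl) ?_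
  cases h : P.b
  · rcases lt_or_ge (σ.r j) (σ.r l) with h2 | h2
    · simp [tstP, Stm.pre, Ex.ok, Ex.val, BOp.ok, BOp.val, St.setr, hb, h, tst, nxt, h1, h2]
    · simp [tstP, Stm.pre, Ex.ok, Ex.val, BOp.ok, BOp.val, St.setr, hb, h, hj, hl, tst, nxt, h1, h2,
        not_lt.2 h2]
  · simp [tstP, Stm.pre, Ex.ok, Ex.val, BOp.ok, BOp.val, St.setr, hb, h, hj, hl, tst, nxt]
    split_ifs <;> simp_all

/-- Zero has no logarithm and is treated separately. The sum of two logarithms is looked up without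
reduction, because the table of exponentials covers two periods. -/
theorem mulP_spec {a b : ℕ} (hP : P.OK E) (hB : Base P φ σ) (hφ : FieldRep P.N φ)
    (ha : σ.r a < P.N) (hb : σ.r b < P.N) :
    WP E (mulP a b) 50 (fun σ' => σ'.r 28 < P.N ∧ φ (σ'.r 28) = φ (σ.r a) * φ (σ.r b)) σ := by
  have h1 : 0 < 2 ^ E.w := by positivity
  have h2 : 0 < P.N := by omega
  have hL := hP.L_eq
  have hL' := hP.L_lt
  have hN := hP.N_lt
  refine WP.straight (Nat.le_of_ble_eq_true rfl) ?_
  by_cases h3 : σ.r a = 0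
  · simp [mulP, Stm.pre, Ex.ok, Ex.val, St.setr, h3, hφ.zero, h2]
  by_cases h4 : σ.r b = 0
  · simp [mulP, Stm.pre, Ex.ok, Ex.val, St.setr, h3, h4, hφ.zero, h2]
  have := hB.mul _ ha h3 _ hb h4
  simp [mulP, Stm.pre, Ex.ok, Ex.val, BOp.ok, BOp.val, St.setr, h3, h4, this.2]
  omega

theorem clearP_spec {A b B : ℕ} (hb : σ.r b = B) (hb' : b ≠ 27) (hB : B ≤ E.L)
    (hw : E.L < 2 ^ E.w) :
    WP E (clearP A b) ((B + 1) * 40) (fun σ' => ∀ i, σ'.a A i = if i < B then 0 else σ.a A i) σ := by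
  refine WP.for B (fun j τ => ∀ i, τ.a A i = if i < j then 0 else σ.a A i) (by simp [Stm.wr])
    (by simp [Stm.wr]) hb'.symm hb (by omega) (by simp [St.setr]) (fun j hj τ hf hr hI => ?_)
    (fun _ _ h => h) (t₁ := 20) le_rfl
  refine WP.straight (Nat.le_of_ble_eq_true rfl) ?_
  simp only [Stm.pre, Ex.ok, Ex.val, St.setr, St.seta, hr]
  refine ⟨trivial, by omega, by positivity, fun i => ?_⟩
  simp only [Function.update_self, Function.update_apply, hI]
  split_ifs <;> first | rfl | omega

theorem copyP_spec {A C b B : ℕ} (hAC : A ≠ C) (hb : σ.r b = B) (hb' : b ≠ 27) (hB : B ≤ E.L)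
    (hw : E.L < 2 ^ E.w) :
    WP E (copyP A C b) ((B + 1) * 60)
      (fun σ' => ∀ i, σ'.a C i = if i < B then σ.a A i else σ.a C i) σ := by
  refine WP.for B (fun j τ => ∀ i, τ.a C i = if i < j then σ.a A i else σ.a C i)
    (by simp [Stm.wr]) (by simp [Stm.wr]) hb'.symm hb (by omega) (by simp [St.setr])
    (fun j hj τ hf hr hI => ?_) (fun _ _ h => h) (t₁ := 40) le_rfl
  refine WP.straight (Nat.le_of_ble_eq_true rfl) ?_
  have hA : τ.a A = σ.a A := hf.a A (by simpa [Stm.for, Stm.wa] using hAC)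
  simp only [Stm.pre, Ex.ok, Ex.val, St.setr, St.seta, hr]
  refine ⟨trivial, by omega, ⟨trivial, by omega⟩, fun i => ?_⟩
  simp only [Function.update_self, Function.update_apply, hI, hA]
  split_ifs <;> first | rfl | omega | (subst_vars; rfl)


variable (φ) in
/-- Array `A` represents the table `γ` of field elements. -/
def RepA (P : Inst) (σ : St) (A : ℕ) (γ : ℕ → ℕ → K) : Prop :=
  ∀ v < P.n, ∀ j < P.J, σ.a A (v * P.J + j) < P.N ∧ φ (σ.a A (v * P.J + j)) = γ v j

/-- The contribution of the dart `d` to the next layer of the dynamic program. -/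
def relaxTerm (P : Inst) (lam vis : ℕ → ℕ) (X : ℕ → K) (γ : ℕ → ℕ → K) (d v j : ℕ) : K :=
  if P.src d = v ∧ vis (P.dst d) = 0 ∧ tst P.b j (lam (d / 2)) then
    X (d / 2) * γ (P.dst d) (nxt P.b j (lam (d / 2))) else 0

theorem Inst.idx_lt {v j : ℕ} (hv : v < P.n) (hj : j < P.J) : v * P.J + j < P.n * P.J := by
  have : (v + 1) * P.J ≤ P.n * P.J := Nat.mul_le_mul_right _ hv
  nlinarith

theorem Inst.idx_inj {v j v' j' : ℕ} (hj : j < P.J) (hj' : j' < P.J)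
    (h : v * P.J + j = v' * P.J + j') : v = v' ∧ j = j' := by
  have h1 := congrArg (· / P.J) h
  have h2 := congrArg (· % P.J) h
  simp only [Nat.mul_comm _ P.J, Nat.mul_add_div P.J_pos, Nat.mul_add_mod, Nat.mod_eq_of_lt hj,
    Nat.mod_eq_of_lt hj', Nat.div_eq_of_lt hj, Nat.div_eq_of_lt hj', add_zero] at h1 h2
  exact ⟨h1, h2⟩

theorem nxt_lt {j l : ℕ} (hj : j < P.J) (h : tst P.b j l) : nxt P.b j l < P.J := by
  unfold tst at h
  unfold nxt Inst.J at *
  split_ifs at * with hb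
  · exact Nat.xor_lt_two_pow hj (h ▸ Nat.and_le_left.trans_lt hj)
  · omega

/-- The inequalities from which `omega` excludes overflows and violations of array bounds. -/
theorem Inst.OK.facts (hP : P.OK E) : 1 < 2 ^ E.w ∧ 0 < P.J ∧ P.n ≤ P.n * P.J ∧
    P.n * P.J + 8 * P.n + 2 * P.m = E.L ∧ 76 + 13 * E.L + P.n ≤ 2 ^ E.w ∧
    3 + 2 * P.m + P.k * P.m < 2 ^ E.w ∧ 3 ≤ P.n ∧ P.n ≤ P.m ∧ 0 < P.k ∧ P.N < 4 * P.n ∧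
    2 * P.n ≤ P.N :=
  ⟨Nat.one_lt_two_pow E.w_pos.ne', P.J_pos, Nat.le_mul_of_pos_right _ P.J_pos, hP.L_eq.symm,
    hP.L_lt, hP.inp_lt, hP.n3, hP.nm, hP.k0, hP.N_lt, hP.N_ge⟩

theorem srcE_ok {i d : ℕ} (hP : P.OK E) (hr : σ.r i = d) (hd : d < 2 * P.m) :
    (srcE i).ok E σ ∧ (srcE i).val E σ = P.src d := by
  obtain ⟨h1, h2, h3, h4, h5, h6, h7, h8, h9, h10, h11⟩ := hP.facts
  simp only [srcE, Ex.ok, Ex.val, BOp.ok, BOp.val, hr, hP.inp_src _ hd, true_and, and_true]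
  omega

theorem dstE_ok {i d : ℕ} (hP : P.OK E) (hr : σ.r i = d) (hd : d < 2 * P.m) :
    (dstE i).ok E σ ∧ (dstE i).val E σ = P.dst d := by
  obtain ⟨h1, h2, h3, h4, h5, h6, h7, h8, h9, h10, h11⟩ := hP.facts
  have hd' := Inst.xor_one_lt hd
  simp only [dstE, Ex.ok, Ex.val, BOp.ok, BOp.val, hr, hP.inp_src _ hd', true_and, and_true,
    Inst.dst]
  omega

theorem tabE_ok {i j a d : ℕ} (hP : P.OK E) (h3 : σ.r 3 = P.m) (h9 : σ.r 9 = 2 * P.m)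
    (hi : σ.r i = a) (hj : σ.r j = d) (ha : a < P.k) (hd : d < 2 * P.m) :
    (tabE i j).ok E σ ∧ (tabE i j).val E σ = P.tab a (d / 2) := by
  obtain ⟨h1, h2, h3, h4, h5, h6, h7, h8, h9, h10, h11⟩ := hP.facts
  have h : a * P.m + P.m ≤ P.k * P.m := by nlinarith
  have hd' : d / 2 < P.m := by omega
  simp only [tabE, Ex.ok, Ex.val, BOp.ok, BOp.val, *, true_and, and_true,
    hP.inp_tab a ha _ hd']
  omega

/-- Walks are extended at their beginning: the entry of the tail in the new layer (array 5) receives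
the entry of the head in the old layer (array 4), at the state reached after the dart. -/
theorem relaxP_spec {γ δ : ℕ → ℕ → K} {d : ℕ} (hP : P.OK E) (hB : Base P φ σ)
    (hφ : FieldRep P.N φ) (hd : d < 2 * P.m) (hr : σ.r 25 = d) (hx : ∀ e < P.m, σ.a 0 e < P.N)
    (hγ : RepA φ P σ 4 γ) (hδ : RepA φ P σ 5 δ) :
    WP E relaxP ((P.J + 1) * 400) (fun σ' => RepA φ P σ' 5 fun v j => δ v j +
      relaxTerm P (σ.a 2) (σ.a 9) (fun e => φ (σ.a 0 e)) γ d v j) σ := by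
  obtain ⟨h1, hJ, hnJ, hL, hL', hil, hn3, hnm, hk0, hN, hN'⟩ := hP.facts
  have hsl := hP.src_lt _ hd
  have htl := hP.dst_lt hd
  have hsJ : P.src d * P.J + P.J ≤ P.n * P.J := by nlinarith
  have htJ : P.dst d * P.J + P.J ≤ P.n * P.J := by nlinarith
  have h0 : 0 < 2 ^ E.w := by omega
  have hd2 : d / 2 < P.m := by omega
  apply WP.le
  · apply WP.cond
    · simp only [Ex.ok, dstE_ok hP hr hd, true_and]
      omega
    · intro hv
      simp only [Ex.val, dstE_ok hP hr hd] at hv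
      exact WP.skip (by simpa [relaxTerm, hv] using hδ)
    intro hv
    simp only [Ex.val, dstE_ok hP hr hd] at hv
    apply WP.then (WP.pre (Q := fun τ => τ.r 23 = σ.a 2 (d / 2) ∧ τ.r 29 = σ.a 0 (d / 2) ∧
      τ.r 17 = P.src d * P.J ∧ τ.r 18 = P.dst d * P.J) ?_)
    · rintro τ hf ⟨h23, h29, h17, h18⟩
      have hBτ := hB.frame hf
      have haτ : τ.a = σ.a := by
        funext A
        exact hf.a A (by simp [Stm.wa])
      apply WP.for P.J (fun i τ' => RepA φ P τ' 5 fun v j => δ v j + if j < i then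
        relaxTerm P (σ.a 2) (σ.a 9) (fun e => φ (σ.a 0 e)) γ d v j else 0) (by decide) (by decide)
        (by decide) hBτ.r6 (by omega) ?_ ?_ ?_ le_rfl
      · exact 330
      · simpa [RepA, haτ] using hδ
      · intro i hi τ' hf' hri hI
        have hB' := hBτ.frame hf'
        have hr23 : τ'.r 23 = _ := (hf'.r 23 (by decide)).trans h23
        have hr29 : τ'.r 29 = _ := (hf'.r 29 (by decide)).trans h29
        have hr17 : τ'.r 17 = _ := (hf'.r 17 (by decide)).trans h17
        have hr18 : τ'.r 18 = _ := (hf'.r 18 (by decide)).trans h18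
        have ha4 : τ'.a 4 = σ.a 4 := (hf'.a 4 (by decide)).trans (by rw [haτ])
        -- Iteration `i` changes only the entry of the tail of the dart at state `i`.
        have key : ∀ v j, (if j < i + 1 then
            relaxTerm P (σ.a 2) (σ.a 9) (fun e => φ (σ.a 0 e)) γ d v j else 0) =
          (if j < i then relaxTerm P (σ.a 2) (σ.a 9) (fun e => φ (σ.a 0 e)) γ d v j else 0) +
          if P.src d = v ∧ j = i ∧ tst P.b i (σ.a 2 (d / 2)) then
            φ (σ.a 0 (d / 2)) * γ (P.dst d) (nxt P.b i (σ.a 2 (d / 2))) else 0 := by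
          intro v j
          by_cases hji : j = i
          · subst hji
            simp [relaxTerm, hv]
          · have : j < i + 1 ↔ j < i := by omega
            simp [this, hji]
        apply WP.le
        · apply WP.then (tstP_spec (by decide) (by decide) hB'.r5)
          intro τ₁ hf₁ h₁
          rw [hri, hr23] at h₁
          apply WP.cond (by simp [Ex.ok])
          · intro hv₁
            have htst := h₁.1.1 hv₁
            have hnx := nxt_lt hi htst
            have hr18' : τ₁.r 18 = P.dst d * P.J := (hf₁.r 18 (by decide)).trans hr18
            have ha4' : τ₁.a 4 = σ.a 4 := (hf₁.a 4 (by decide)).trans ha4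
            have hr22 := h₁.2 htst
            have hg := hγ _ htl _ hnx
            have hii := Inst.idx_lt hsl hi
            apply WP.then (WP.pre (Q := fun τ => τ.r 26 =
              σ.a 4 (P.dst d * P.J + nxt P.b i (σ.a 2 (d / 2)))) ?_)
            · intro τ₂ hf₂ h₂
              have hr29' : τ₂.r 29 = _ :=
                (hf₂.r 29 (by decide)).trans ((hf₁.r 29 (by decide)).trans hr29)
              apply WP.then (mulP_spec hP ((hB'.frame hf₁).frame hf₂) hφ
                (by rw [hr29']; exact hx _ hd2) (by rw [h₂]; exact hg.1))
              rintro τ₃ hf₃ ⟨h₃, h₃'⟩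
              rw [hr29', h₂, hg.2] at h₃'
              have hr17' : τ₃.r 17 = _ := (hf₃.r 17 (by decide)).trans
                ((hf₂.r 17 (by decide)).trans ((hf₁.r 17 (by decide)).trans hr17))
              have hr27' : τ₃.r 27 = _ := (hf₃.r 27 (by decide)).trans
                ((hf₂.r 27 (by decide)).trans ((hf₁.r 27 (by decide)).trans hri))
              have ha5 : τ₃.a 5 = τ'.a 5 := (hf₃.a 5 (by decide)).trans
                ((hf₂.a 5 (by decide)).trans (hf₁.a 5 (by decide)))
              apply WP.put (y := P.src d * P.J + i) (v := τ'.a 5 (P.src d * P.J + i) ^^^ τ₃.r 28)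
              · simp [Ex.ok, BOp.ok, Ex.val, hr17', hr27']; omega
              · simp [BOp.val, Ex.val, hr17', hr27']
              · omega
              · simp [Ex.ok, BOp.ok, BOp.val, Ex.val, hr17', hr27']; omega
              · simp [BOp.val, Ex.val, hr17', hr27', ha5]
              · intro v hvn j hj
                have h5 := hI v hvn j hj
                simp only [St.setr_a, St.seta_a, key, ha5]
                by_cases he : v * P.J + j = P.src d * P.J + i
                · obtain ⟨rfl, rfl⟩ := Inst.idx_inj hj hi he
                  simp only [htst, and_true, if_true, lt_irrefl, if_false, add_zero, zero_add]
                    at h5 ⊢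
                  rw [hφ.xor _ h5.1 _ h₃, h5.2, h₃']
                  exact ⟨Nat.xor_lt_two_pow h5.1 h₃, rfl⟩
                · have hne : ¬ (P.src d = v ∧ j = i ∧ tst P.b i (σ.a 2 (d / 2))) := by
                    rintro ⟨rfl, rfl, _⟩
                    exact he rfl
                  rw [if_neg he, if_neg hne, add_zero]
                  exact h5
            · simp [Stm.pre, Ex.ok, BOp.ok, BOp.val, Ex.val, hr18', hr22, ha4']
              have := Inst.idx_lt htl hnx
              omega
          · intro hv₁
            have htst : ¬ tst P.b i (σ.a 2 (d / 2)) := fun h => h₁.1.2 h hv₁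
            refine WP.skip fun v hvn j hj => ?_
            have h5 := hI v hvn j hj
            have ha5 : τ₁.a 5 = τ'.a 5 := hf₁.a 5 (by decide)
            simpa only [St.setr_a, key, htst, and_false, if_false, add_zero, ha5] using h5
        · simp [Stm.cost, Ex.cost]
      · intro τ' hf' hI v hvn j hj
        simpa [hj] using hI v hvn j hj
    · have e1 := fun τ h => srcE_ok (σ := τ) (i := 25) hP h hd
      have e2 := fun τ h => dstE_ok (σ := τ) (i := 25) hP h hd
      simp [Stm.pre, Ex.ok, BOp.ok, BOp.val, Ex.val, hr, e1, e2, hB.r6]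
      omega
  · simp [Stm.cost, Ex.cost, srcE, dstE]
    omega

omit [Field K] in
theorem RepA.congr {γ δ : ℕ → ℕ → K} {A C : ℕ} (h : RepA φ P σ A γ)
    (hA : ∀ i < P.n * P.J, σ'.a C i = σ.a A i) (hγ : ∀ v < P.n, ∀ j < P.J, γ v j = δ v j) :
    RepA φ P σ' C δ := fun v hv j hj => by
  rw [hA _ (Inst.idx_lt hv hj), ← hγ v hv j hj]
  exact h v hv j hj

theorem Inst.N_pos (P : Inst) : 0 < P.N := Nat.two_pow_pos _

theorem layerP_spec {γ : ℕ → ℕ → K} (hP : P.OK E) (hB : Base P φ σ) (hφ : FieldRep P.N φ)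
    (hx : ∀ e < P.m, σ.a 0 e < P.N) (hγ : RepA φ P σ 4 γ) :
    WP E layerP (3000 * (P.m * P.J)) (fun σ' => RepA φ P σ' 4 fun v j =>
      ∑ d ∈ Finset.range (2 * P.m),
        relaxTerm P (σ.a 2) (σ.a 9) (fun e => φ (σ.a 0 e)) γ d v j) σ := by
  obtain ⟨h1, hJ, hnJ, hL, hL', hil, hn3, hnm, hk0, hN, hN'⟩ := hP.facts
  apply WP.le
  · apply WP.then (clearP_spec hB.r11 (by decide) (by omega) (by omega))
    intro τ hf h
    have hBτ := hB.frame hf (by decide) (by decide)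
    apply WP.then (WP.for (2 * P.m) (fun i τ' => RepA φ P τ' 5 fun v j =>
      ∑ d ∈ Finset.range i, relaxTerm P (σ.a 2) (σ.a 9) (fun e => φ (σ.a 0 e)) γ d v j)
      (by decide) (by decide) (by decide) hBτ.r9 (by omega) ?_ ?_ (fun _ _ h => h) le_rfl)
    · intro τ' hf' hI
      have hB' := hBτ.frame hf'
      refine (copyP_spec (by decide) hB'.r11 (by decide) (by omega) (by omega)).mono le_rfl
        fun τ₂ _ h₂ => hI.congr (fun i hi => ?_) fun _ _ _ _ => rfl
      rw [h₂, if_pos hi]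
    · exact (P.J + 1) * 400
    · intro v hv j hj
      have := Inst.idx_lt hv hj
      simp [h, this, hφ.zero, P.N_pos]
    · intro i hi τ' hf' hri hI
      have hB' := hBτ.frame hf'
      have ha : ∀ A ∈ [0, 2, 4, 9], τ'.a A = σ.a A := fun A hA =>
        (hf'.a A (by revert A; decide)).trans (hf.a A (by revert A; decide))
      refine (relaxP_spec hP hB' hφ hi hri (by rw [ha 0 (by decide)]; exact hx)
        (hγ.congr (fun i hi => by rw [ha 4 (by decide)]) fun _ _ _ _ => rfl) hI).mono le_rfl
        fun τ₂ _ h₂ => h₂.congr (fun _ _ => rfl) fun v hv j hj => ?_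
      rw [Finset.sum_range_succ, ha 0 (by decide), ha 2 (by decide), ha 9 (by decide)]
  · have : P.n * P.J ≤ P.m * P.J := Nat.mul_le_mul_right _ hnm
    have : P.m ≤ P.m * P.J := Nat.le_mul_of_pos_right _ hJ
    have : P.J ≤ P.m * P.J := Nat.le_mul_of_pos_left _ (by omega)
    ring_nf at *
    nlinarith

variable (φ) in
/-- The first `B` cells of array `A` represent the list `γ` of field elements. -/
def RepV (P : Inst) (σ : St) (A B : ℕ) (γ : ℕ → K) : Prop :=
  ∀ i < B, σ.a A i < P.N ∧ φ (σ.a A i) = γ i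

omit [Field K] in
theorem RepV.congr {γ δ : ℕ → K} {A B : ℕ} (h : RepV φ P σ A B γ)
    (hA : σ'.a A = σ.a A) (hγ : ∀ v < B, γ v = δ v) : RepV φ P σ' A B δ := fun v hv => by
  rw [hA, ← hγ v hv]
  exact h v hv

/-- The value of the candidate dart `d` in state `j`. -/
def hookTerm (P : Inst) (lam cand : ℕ → ℕ) (X : ℕ → K) (γ : ℕ → ℕ → K) (j d : ℕ) : K :=
  if cand d ≠ 0 ∧ tst P.b j (lam (d / 2)) then
    X (d / 2) * γ (P.dst d) (nxt P.b j (lam (d / 2))) else 0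

/-- Registers 19 and 20 hold the state after the current path. -/
def PrefOK (P : Inst) (σ : St) : Option ℕ → Prop
  | none => σ.r 20 = 0
  | some j => σ.r 20 ≠ 0 ∧ σ.r 19 = j ∧ j < P.J

/-- The value of the candidate dart `d` after the current path. -/
def hookVal (P : Inst) (lam cand : ℕ → ℕ) (X : ℕ → K) (γ : ℕ → ℕ → K) (jp : Option ℕ) (d : ℕ) : K :=
  match jp with
  | none => 0
  | some j => hookTerm P lam cand X γ j d

theorem hookP_spec {γ : ℕ → ℕ → K} {α β : ℕ → K} {jp : Option ℕ} {r lim : ℕ} (hP : P.OK E)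
    (hB : Base P φ σ) (hφ : FieldRep P.N φ) (hx : ∀ e < P.m, σ.a 0 e < P.N)
    (hγ : RepA φ P σ 4 γ) (hα : RepV φ P σ 6 P.n α) (hβ : RepV φ P σ 7 (2 * P.m) β)
    (hjp : PrefOK P σ jp) (hr : σ.r 24 = r) (hrn : r < P.n) (hlim : σ.r 13 = lim) :
    WP E hookP (2000 * P.m) (fun σ' =>
      RepV φ P σ' 6 P.n (fun i => α i + if i = r then ∑ d ∈ Finset.range (2 * P.m),
        hookVal P (σ.a 2) (σ.a 8) (fun e => φ (σ.a 0 e)) γ jp d else 0) ∧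
      RepV φ P σ' 7 (2 * P.m) (fun d => β d + if r + 1 = lim then
        hookVal P (σ.a 2) (σ.a 8) (fun e => φ (σ.a 0 e)) γ jp d else 0)) σ := by
  obtain ⟨h1, hJ, hnJ, hL, hL', hil, hn3, hnm, hk0, hN, hN'⟩ := hP.facts
  cases jp with
  | none =>
    have h20 : σ.r 20 = 0 := hjp
    refine WP.ite (t₁ := 1) (by simp [Ex.ok]) (fun hv => (hv (by simpa [Ex.val] using h20)).elim)
      (fun _ => WP.skip ?_) (by simp [Ex.cost]; omega)
    simpa [hookVal] using ⟨hα, hβ⟩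
  | some jp =>
  obtain ⟨h20, h19, hjJ⟩ := hjp
  simp only [hookVal]
  apply WP.le
  · apply WP.ite (t₁ := (2 * P.m + 1) * 420) (by simp [Ex.ok]) ?_
      (fun hv => (h20 (by simpa [Ex.val] using hv)).elim) le_rfl
    intro _
    refine WP.for (2 * P.m) (fun i τ' =>
      RepV φ P τ' 6 P.n (fun i' => α i' + if i' = r then ∑ d ∈ Finset.range i,
        hookTerm P (σ.a 2) (σ.a 8) (fun e => φ (σ.a 0 e)) γ jp d else 0) ∧
      RepV φ P τ' 7 (2 * P.m) (fun d => β d + if d < i ∧ r + 1 = lim then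
        hookTerm P (σ.a 2) (σ.a 8) (fun e => φ (σ.a 0 e)) γ jp d else 0))
      (by decide) (by decide) (by decide) hB.r9 (by omega) ?_ ?_ ?_ (t₁ := 400) le_rfl
    · simpa using ⟨hα, hβ⟩
    · intro d hd τ hf hrd hI
      have hBτ := hB.frame hf
      have ha : ∀ A ∈ [0, 2, 4, 8], τ.a A = σ.a A := fun A hA => hf.a A (by revert A; decide)
      have hd2 : d / 2 < P.m := by omega
      have htl := hP.dst_lt hd
      have h24 : τ.r 24 = r := (hf.r 24 (by decide)).trans hr
      have h13 : τ.r 13 = lim := (hf.r 13 (by decide)).trans hlim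
      have key : ∀ d', (if d' < d + 1 ∧ r + 1 = lim then
          hookTerm P (σ.a 2) (σ.a 8) (fun e => φ (σ.a 0 e)) γ jp d' else 0) =
        (if d' < d ∧ r + 1 = lim then
          hookTerm P (σ.a 2) (σ.a 8) (fun e => φ (σ.a 0 e)) γ jp d' else 0) +
        if d' = d ∧ r + 1 = lim then
          hookTerm P (σ.a 2) (σ.a 8) (fun e => φ (σ.a 0 e)) γ jp d else 0 := by
        intro d'
        by_cases hdd : d' = d
        · subst hdd; simp
        · have : d' < d + 1 ↔ d' < d := by omega
          simp [this, hdd]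
      -- Common to the two branches in which nothing is written: the dart is no candidate, or its
      -- edge may not be used in the current state.
      have hzero : hookTerm P (σ.a 2) (σ.a 8) (fun e => φ (σ.a 0 e)) γ jp d = 0 → ∀ τ',
          τ'.a 6 = τ.a 6 → τ'.a 7 = τ.a 7 →
          RepV φ P τ' 6 P.n (fun i' => α i' + if i' = r then ∑ d ∈ Finset.range (d + 1),
            hookTerm P (σ.a 2) (σ.a 8) (fun e => φ (σ.a 0 e)) γ jp d else 0) ∧
          RepV φ P τ' 7 (2 * P.m) (fun d' => β d' + if d' < d + 1 ∧ r + 1 = lim then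
            hookTerm P (σ.a 2) (σ.a 8) (fun e => φ (σ.a 0 e)) γ jp d' else 0) := by
        intro h0 τ' h6 h7
        refine ⟨hI.1.congr h6 fun i _ => ?_, hI.2.congr h7 fun i _ => ?_⟩
        · rw [Finset.sum_range_succ, h0, add_zero]
        · rw [key, h0, ite_self, add_zero]
      apply WP.le
      · apply WP.cond
        · simp [Ex.ok, Ex.val, hrd]; omega
        · intro hv
          simp only [Ex.val, hrd, ha 8 (by decide)] at hv
          apply WP.then (WP.pre (Q := fun τ' => τ'.r 23 = σ.a 2 (d / 2)) ?_)
          · intro τ₁ hf₁ h₁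
            have hB₁ := hBτ.frame hf₁
            apply WP.then (tstP_spec (by decide) (by decide) hB₁.r5)
            intro τ₂ hf₂ h₂
            have h19' : τ₁.r 19 = jp :=
              (hf₁.r 19 (by decide)).trans ((hf.r 19 (by decide)).trans h19)
            rw [h₁, h19'] at h₂
            have hB₂ := hB₁.frame hf₂
            have h25 : τ₂.r 25 = d := (hf₂.r 25 (by decide)).trans ((hf₁.r 25 (by decide)).trans hrd)
            have ha₂ : ∀ A, τ₂.a A = τ.a A := fun A =>
              (hf₂.a A (by simp [tstP, Stm.wa])).trans (hf₁.a A (by simp [Stm.wa]))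
            apply WP.cond (by simp [Ex.ok])
            · intro hv₂
              have htst := h₂.1.1 hv₂
              have hnx := nxt_lt hjJ htst
              have hg := hγ _ htl _ hnx
              have hix := Inst.idx_lt htl hnx
              have e2 := fun τ h => dstE_ok (σ := τ) (i := 25) hP h hd
              have hterm : hookTerm P (σ.a 2) (σ.a 8) (fun e => φ (σ.a 0 e)) γ jp d =
                  φ (σ.a 0 (d / 2)) * γ (P.dst d) (nxt P.b jp (σ.a 2 (d / 2))) :=
                if_pos ⟨hv, htst⟩
              apply WP.then (WP.pre (Q := fun τ' => τ'.r 29 = σ.a 0 (d / 2) ∧ τ'.r 26 =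
                σ.a 4 (P.dst d * P.J + nxt P.b jp (σ.a 2 (d / 2)))) ?_)
              · rintro τ₃ hf₃ ⟨h29, h26⟩
                apply WP.then (mulP_spec hP (hB₂.frame hf₃) hφ (by rw [h29]; exact hx _ hd2)
                  (by rw [h26]; exact hg.1))
                rintro τ₄ hf₄ ⟨h28, h28'⟩
                rw [h29, h26, hg.2, ← hterm] at h28'
                have hr₄ : ∀ i ∈ [13, 24, 25], τ₄.r i = τ.r i := fun i hi =>
                  (hf₄.r i (by revert i; decide)).trans ((hf₃.r i (by revert i; decide)).trans
                    ((hf₂.r i (by revert i; decide)).trans (hf₁.r i (by revert i; decide))))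
                have ha₄ : ∀ A, τ₄.a A = τ.a A := fun A =>
                  (hf₄.a A (by simp [mulP, Stm.wa])).trans
                    ((hf₃.a A (by simp [Stm.wa])).trans (ha₂ A))
                have h13' := (hr₄ 13 (by decide)).trans h13
                have h24' := (hr₄ 24 (by decide)).trans h24
                have h25' := (hr₄ 25 (by decide)).trans hrd
                have h6 := hI.1 r hrn
                have h7 := hI.2 d hd
                simp only [if_true, lt_irrefl, false_and, if_false, add_zero] at h6 h7
                have hI' : RepV φ P (τ₄.seta 6 r (τ.a 6 r ^^^ τ₄.r 28)) 6 P.n (fun i' => α i' +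
                    if i' = r then ∑ d ∈ Finset.range (d + 1),
                    hookTerm P (σ.a 2) (σ.a 8) (fun e => φ (σ.a 0 e)) γ jp d else 0) := by
                  intro i hi
                  by_cases hir : i = r
                  · subst hir
                    simp only [St.seta_a, if_true, Finset.sum_range_succ]
                    rw [hφ.xor _ h6.1 _ h28, h6.2, h28', add_assoc]
                    exact ⟨Nat.xor_lt_two_pow h6.1 h28, rfl⟩
                  · have := hI.1 i hi
                    simp only [St.seta_a, if_neg hir, ha₄] at this ⊢
                    exact this
                apply WP.put_then (y := r) (v := τ.a 6 r ^^^ τ₄.r 28)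
                · simp [Ex.ok]
                · simp [Ex.val, h24']
                · omega
                · simp [Ex.ok, Ex.val, h24', BOp.ok]; omega
                · simp [Ex.val, BOp.val, h24', ha₄]
                apply WP.cond
                · simp [Ex.ok, Ex.val, h24', BOp.ok, E.w_pos.ne']; omega
                · intro hl
                  simp [Ex.val, BOp.val, h24', h13'] at hl
                  apply WP.put (y := d) (v := τ.a 7 d ^^^ τ₄.r 28)
                  · simp [Ex.ok]
                  · simp [Ex.val, h25']
                  · omega
                  · simp [Ex.ok, Ex.val, h25', BOp.ok]; omega
                  · simp [Ex.val, BOp.val, h25', ha₄]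
                  refine ⟨hI'.congr (by simp) fun _ _ => rfl, fun d' hd' => ?_⟩
                  have h7' := hI.2 d' hd'
                  simp only [key]
                  by_cases hdd : d' = d
                  · subst hdd
                    rw [if_neg (by simp), zero_add, if_pos ⟨rfl, hl⟩]
                    simp only [St.setr_a, St.seta_a, if_true]
                    rw [hφ.xor _ h7.1 _ h28, h7.2, h28']
                    exact ⟨Nat.xor_lt_two_pow h7.1 h28, rfl⟩
                  · rw [if_neg (fun h => hdd h.1 : ¬ (d' = d ∧ r + 1 = lim)), add_zero]
                    simpa [hdd, ha₄] using h7'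
                · intro hl
                  simp [Ex.val, BOp.val, h24', h13'] at hl
                  refine WP.skip ⟨hI', fun d' hd' => ?_⟩
                  have h7' := hI.2 d' hd'
                  simpa [hl, ha₄] using h7'
              · have e3 := fun τ h => dstE_ok (σ := τ) (i := 25) hP h hd
                simp [Stm.pre, Ex.ok, BOp.ok, BOp.val, Ex.val, h25, e3, hB₂.r6, ha₂, ha 0, ha 4,
                  h₂.2 htst]
                omega
            · intro hv₂
              have htst : ¬ tst P.b jp (σ.a 2 (d / 2)) := fun h => h₂.1.2 h hv₂
              exact WP.skip (hzero (if_neg fun h => htst h.2) _ (ha₂ 6) (ha₂ 7))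
          · simp [Stm.pre, Ex.ok, BOp.ok, BOp.val, Ex.val, hrd, ha 2]
            omega
        · intro hv
          simp only [Ex.val, hrd, ha 8 (by decide)] at hv
          exact WP.skip (hzero (if_neg fun h => h.1 hv) _ rfl rfl)
      · simp [Stm.cost, Ex.cost, dstE]
    · intro τ' hf' hI
      refine ⟨hI.1, hI.2.congr rfl fun d hd => ?_⟩
      simp [hd]
  · simp [Ex.cost]
    omega

end EdgeSetCycle

/-! ### The whole dynamic program, the edge weights, and the state after a given path. -/

namespace EdgeSetCycle

local prefix:max "♯" => Ex.num
local prefix:max "®" => Ex.reg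

variable {K : Type} [Field K] {P : Inst} {E : Env} {φ : ℕ → K} {σ σ' : St}

/-- The values of the dynamic program: `gval r v j` sums over the walks with `r` edges from `v` to
`s` that lead from state `j` to state `0`. -/
def gval (P : Inst) (lam vis : ℕ → ℕ) (X : ℕ → K) (s : ℕ) : ℕ → ℕ → ℕ → K
  | 0 => fun v j => if v = s ∧ j = 0 then 1 else 0
  | r + 1 => fun v j => ∑ d ∈ Finset.range (2 * P.m), relaxTerm P lam vis X (gval P lam vis X s r) d v j

/-- Each layer is evaluated by `hookP` before `layerP` replaces it, so the `lim` iterations see the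
layers `0, …, lim - 1`. Array 7 is changed only in the last of them, which gives the completions
with exactly `lim - 1` edges. -/
theorem dpP_spec {α β : ℕ → K} {jp : Option ℕ} {s lim : ℕ} (hP : P.OK E)
    (hB : Base P φ σ) (hφ : FieldRep P.N φ) (hx : ∀ e < P.m, σ.a 0 e < P.N)
    (hα : RepV φ P σ 6 P.n α) (hβ : RepV φ P σ 7 (2 * P.m) β)
    (hjp : PrefOK P σ jp) (hs : σ.r 12 = s) (hsn : s < P.n) (hlim : σ.r 13 = lim)
    (hlim0 : 0 < lim) (hlimn : lim ≤ P.n) :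
    WP E dpP (12000 * (P.m * P.J * P.n)) (fun σ' =>
      RepV φ P σ' 6 P.n (fun i => α i + if i < lim then ∑ d ∈ Finset.range (2 * P.m),
        hookVal P (σ.a 2) (σ.a 8) (fun e => φ (σ.a 0 e))
          (gval P (σ.a 2) (σ.a 9) (fun e => φ (σ.a 0 e)) s i) jp d else 0) ∧
      RepV φ P σ' 7 (2 * P.m) (fun d => β d +
        hookVal P (σ.a 2) (σ.a 8) (fun e => φ (σ.a 0 e))
          (gval P (σ.a 2) (σ.a 9) (fun e => φ (σ.a 0 e)) s (lim - 1)) jp d)) σ := by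
  obtain ⟨h1, hJ, hnJ, hL, hL', hil, hn3, hnm, hk0, hN, hN'⟩ := hP.facts
  have hsJ := Inst.idx_lt hsn hJ
  apply WP.le
  · apply WP.then (clearP_spec hB.r11 (by decide) (by omega) (by omega))
    intro τ hf h
    have hBτ := hB.frame hf (by decide) (by decide)
    have hsτ : τ.r 12 = s := (hf.r 12 (by decide)).trans hs
    apply WP.put_then (y := s * P.J) (v := 1)
    · simp [Ex.ok, Ex.val, BOp.ok, hsτ, hBτ.r6]; omega
    · simp [Ex.val, BOp.val, hsτ, hBτ.r6]
    · omega
    · simpa [Ex.ok] using E.w_pos.ne'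
    · rfl
    have hB₁ : Base P φ (τ.seta 4 (s * P.J) 1) := by
      refine ⟨hBτ.r2, hBτ.r3, hBτ.r4, hBτ.r5, hBτ.r6, hBτ.r7, hBτ.r8, hBτ.r9, hBτ.r10, hBτ.r11, ?_⟩
      simpa using hBτ.mul
    generalize hτ₁ : τ.seta 4 (s * P.J) 1 = τ₁ at *
    have hr₁ : τ₁.r = τ.r := by rw [← hτ₁]; simp
    have ha₁ : ∀ A, A ≠ 4 → τ₁.a A = σ.a A := fun A hA => by
      rw [← hτ₁, St.seta_a_of_ne _ _ _ _ _ hA]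
      exact hf.a A (by simpa [clearP, Stm.for, Stm.wa] using hA)
    set X : ℕ → K := fun e => φ (σ.a 0 e) with hX
    refine WP.for lim (fun r τ' => RepA φ P τ' 4 (gval P (σ.a 2) (σ.a 9) X s r) ∧
      RepV φ P τ' 6 P.n (fun i => α i + if i < r then ∑ d ∈ Finset.range (2 * P.m),
        hookVal P (σ.a 2) (σ.a 8) X (gval P (σ.a 2) (σ.a 9) X s i) jp d else 0) ∧
      RepV φ P τ' 7 (2 * P.m) (fun d => β d + if r = lim then
        hookVal P (σ.a 2) (σ.a 8) X (gval P (σ.a 2) (σ.a 9) X s (lim - 1)) jp d else 0))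
      (by decide) (by decide) (by decide)
      (by rw [hr₁, hf.r 13 (by decide), hlim]) (by omega) ?_ ?_ ?_
      (t₁ := 2000 * P.m + 3000 * (P.m * P.J) + 1) le_rfl
    · refine ⟨fun v hv j hj => ?_, ?_, ?_⟩
      · have hvj := Inst.idx_lt hv hj
        rw [← hτ₁]
        simp only [St.setr_a, St.seta_a, h, hvj, if_true]
        by_cases hvs : v * P.J + j = s * P.J
        · obtain ⟨rfl, rfl⟩ := Inst.idx_inj (j' := 0) hj hJ (by simpa using hvs)
          simp [gval, hφ.one]
          omega
        · have : ¬ (v = s ∧ j = 0) := by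
            rintro ⟨rfl, rfl⟩
            simp at hvs
          simp [gval, hvs, this, hφ.zero, P.N_pos]
      · exact hα.congr (by simp [ha₁]) (by simp)
      · exact hβ.congr (by simp [ha₁]) (fun d _ => by simp [hlim0.ne])
    · rintro r hr τ' hf' hrr ⟨hI1, hI2, hI3⟩
      have hB' := hB₁.frame hf'
      have ha' : ∀ A ∈ [0, 2, 8, 9], τ'.a A = σ.a A := fun A hA =>
        (hf'.a A (by revert A; decide)).trans (ha₁ A (by revert A; decide))
      have hjp' : PrefOK P τ' jp := by
        have e19 : τ'.r 19 = σ.r 19 :=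
          (hf'.r 19 (by decide)).trans ((congrFun hr₁ 19).trans (hf.r 19 (by decide)))
        have e20 : τ'.r 20 = σ.r 20 :=
          (hf'.r 20 (by decide)).trans ((congrFun hr₁ 20).trans (hf.r 20 (by decide)))
        cases jp <;> simpa [PrefOK, e19, e20] using hjp
      have hlim' : τ'.r 13 = lim := (hf'.r 13 (by decide)).trans
        ((congrFun hr₁ 13).trans ((hf.r 13 (by decide)).trans hlim))
      apply WP.then (hookP_spec hP hB' hφ (by rw [ha' 0 (by decide)]; exact hx) hI1 hI2 hI3 hjp' hrr
        (by omega) hlim')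
      rintro τ₂ hf₂ ⟨h₂, h₂'⟩
      have hB₂ := hB'.frame hf₂
      have ha₂ : ∀ A ∈ [0, 2, 8, 9], τ₂.a A = σ.a A := fun A hA =>
        (hf₂.a A (by revert A; decide)).trans (ha' A hA)
      refine (layerP_spec hP hB₂ hφ (by rw [ha₂ 0 (by decide)]; exact hx)
        (hI1.congr (fun i _ => by rw [hf₂.a 4 (by decide)]) fun _ _ _ _ => rfl)).mono le_rfl
        fun τ₃ hf₃ h₃ => ⟨?_, ?_, ?_⟩
      · rw [ha₂ 0 (by decide), ha₂ 2 (by decide), ha₂ 9 (by decide)] at h₃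
        exact h₃
      · refine h₂.congr (hf₃.a 6 (by decide)) fun i _ => ?_
        rw [ha' 0 (by decide), ha' 2 (by decide), ha' 8 (by decide), add_assoc]
        congr 1
        by_cases hir : i = r
        · subst hir; simp [hX]
        · have : i < r + 1 ↔ i < r := by omega
          simp [hir, this]
      · refine h₂'.congr (hf₃.a 7 (by decide)) fun i _ => ?_
        rw [ha' 0 (by decide), ha' 2 (by decide), ha' 8 (by decide), if_neg hr.ne, add_zero]
        congr 1
        by_cases hir : r + 1 = lim
        · subst hir; simp [hX]
        · simp [hir]
    · rintro τ' hf' ⟨-, h6, h7⟩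
      exact ⟨h6, h7.congr rfl fun d _ => by simp⟩
  · have e1 : P.m * P.J ≤ P.m * P.J * P.n := Nat.le_mul_of_pos_right _ (by omega)
    have e2 : P.m ≤ P.m * P.J := Nat.le_mul_of_pos_right _ hJ
    have e3 : P.n * P.J ≤ P.m * P.J := Nat.mul_le_mul_right _ hnm
    have e4 : (lim + 1) * (2000 * P.m + 3000 * (P.m * P.J) + 1 + 20) ≤
        (P.n + 1) * (5010 * (P.m * P.J)) := Nat.mul_le_mul (by omega) (by omega)
    have e5 : (P.n + 1) * (5010 * (P.m * P.J)) = 5010 * (P.m * P.J * P.n) + 5010 * (P.m * P.J) := by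
      ring
    simp only [Ex.cost]
    have e6 : (P.n * P.J + 1) * 40 ≤ (P.m * P.J + 1) * 40 := Nat.mul_le_mul_right _ (by omega)
    have e7 : 3 ≤ P.m * P.J := by nlinarith
    omega

/-- The weight of an edge. -/
def lamOf (P : Inst) (wt : ℕ → ℕ) (e : ℕ) : ℕ :=
  ∑ i ∈ Finset.range P.k, if P.tab i e ≠ 0 then wt i else 0

theorem lamP_spec {wt : ℕ → ℕ} (hP : P.OK E) (hB : Base P φ σ) (hw : ∀ i < P.k, σ.a 3 i = wt i)
    (hs : ∑ i ∈ Finset.range P.k, wt i < 2 ^ E.w) (hkL : P.k ≤ E.L) :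
    WP E lamP (300 * (P.m * (P.k + 1))) (fun σ' => ∀ e < P.m, σ'.a 2 e = lamOf P wt e) σ := by
  obtain ⟨h1, hJ, hnJ, hL, hL', hil, hn3, hnm, hk0, hN, hN'⟩ := hP.facts
  apply WP.le
  -- Both darts of an edge write the same weight; an edge is finished once its even dart has been
  -- treated.
  · refine WP.for (2 * P.m) (fun d τ => ∀ e, 2 * e < d → τ.a 2 e = lamOf P wt e)
      (by decide) (by decide) (by decide) hB.r9 (by omega) (by simp) ?_
      (fun τ _ h e he => h e (by omega)) (t₁ := (P.k + 1) * 100) le_rfl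
    intro d hd τ hf hrd hI
    have hB' := hB.frame hf
    have h3 : τ.a 3 = σ.a 3 := hf.a 3 (by decide)
    have hd2 : d / 2 < P.m := by omega
    apply WP.le
    · apply WP.set_then (v := 0) (by simp [Ex.ok]) rfl
      apply WP.then (WP.for P.k (fun i τ' => τ'.r 23 = ∑ i' ∈ Finset.range i,
        if P.tab i' (d / 2) ≠ 0 then wt i' else 0) (by decide) (by decide) (by decide)
        (by simpa using hB'.r4) (by nlinarith) (by simp) ?_ (fun _ _ h => h) (t₁ := 50) le_rfl)
      · intro τ₁ hf₁ h₁
        have h25 : τ₁.r 25 = d := (hf₁.r 25 (by decide)).trans (by simpa using hrd)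
        have h2 : τ₁.a 2 = τ.a 2 := hf₁.a 2 (by decide)
        apply WP.put (y := d / 2) (v := lamOf P wt (d / 2))
        · simp [Ex.ok, BOp.ok]; omega
        · simp [Ex.val, h25, BOp.val]
        · omega
        · simp [Ex.ok]
        · exact h₁
        · intro e he
          simp only [St.setr_a, St.seta_a]
          split_ifs with hed
          · rw [hed]
          · rw [h2]
            exact hI e (by omega)
      · intro i hi τ₁ hf₁ hri h₁
        have h25 : τ₁.r 25 = d := (hf₁.r 25 (by decide)).trans (by simpa using hrd)
        have h3' : τ₁.a 3 i = wt i := by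
          rw [hf₁.a 3 (by decide)]
          simp [h3, hw i hi]
        have e3 : τ₁.r 3 = P.m := (hf₁.r 3 (by decide)).trans (by simpa using hB'.r3)
        have e9 : τ₁.r 9 = 2 * P.m := (hf₁.r 9 (by decide)).trans (by simpa using hB'.r9)
        have ht := tabE_ok hP e3 e9 hri h25 hi hd
        have hle : τ₁.r 23 + wt i ≤ ∑ i ∈ Finset.range P.k, wt i := by
          rw [h₁]
          calc _ ≤ ∑ i' ∈ Finset.range i, wt i' + wt i :=
                Nat.add_le_add_right (Finset.sum_le_sum fun j _ => by split_ifs <;> simp) _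
            _ = ∑ i' ∈ Finset.range (i + 1), wt i' := (Finset.sum_range_succ _ _).symm
            _ ≤ _ := Finset.sum_le_sum_of_subset (by simpa using hi)
        apply WP.le
        · apply WP.cond ht.1
          · intro hv
            rw [ht.2] at hv
            apply WP.set (v := τ₁.r 23 + wt i)
            · simp [Ex.ok, Ex.val, BOp.ok, hri, h3']; omega
            · simp [Ex.val, BOp.val, hri, h3']
            · simp [Finset.sum_range_succ, hv, h₁]
          · intro hv
            rw [ht.2] at hv
            exact WP.skip (by simp [Finset.sum_range_succ, hv, h₁])
        · simp [tabE, Ex.cost]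
    · simp [Ex.cost]; omega
  · nlinarith

/-- The state after edges of the given weights. -/
def trace (b : Bool) : List ℕ → ℕ → Option ℕ
  | [], j => some j
  | l :: ls, j => if tst b j l then trace b ls (nxt b j l) else none

theorem trace_append (b : Bool) (ls ls' : List ℕ) (j : ℕ) :
    trace b (ls ++ ls') j = (trace b ls j).bind (trace b ls') := by
  induction ls generalizing j with
  | nil => rfl
  | cons l ls ih =>
    simp only [List.cons_append, trace]
    split_ifs
    · exact ih _
    · rfl

theorem prefP_spec {pl : ℕ} (hP : P.OK E) (hB : Base P φ σ) (hpl : σ.r 14 = pl) (hpn : pl ≤ P.n)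
    (hpe : ∀ i < pl, σ.a 10 i < 2 * P.m) :
    WP E prefP (200 * P.n) (fun σ' => PrefOK P σ'
      (trace P.b ((List.range pl).map fun i => σ.a 2 (σ.a 10 i / 2)) (P.J - 1))) σ := by
  obtain ⟨h1, hJ, hnJ, hL, hL', hil, hn3, hnm, hk0, hN, hN'⟩ := hP.facts
  apply WP.le
  · apply WP.set_then (v := P.J - 1) (by simp [Ex.ok]) (by simp [Ex.val, hB.r7])
    apply WP.set_then (v := 1) (by simpa [Ex.ok] using E.w_pos.ne') rfl
    refine WP.for pl (fun i τ => PrefOK P τ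
      (trace P.b ((List.range i).map fun i => σ.a 2 (σ.a 10 i / 2)) (P.J - 1)))
      (by decide) (by decide) (by decide) (by simpa using hpl) (by omega) ?_ ?_ (fun _ _ h => h)
      (t₁ := 100) le_rfl
    · simp [trace, PrefOK, hJ]
    · intro i hi τ hf hri hI
      have hr : ∀ j ∈ [5, 14], τ.r j = σ.r j := fun j hj =>
        (hf.r j (by revert j; decide)).trans (by revert j; simp)
      have ha : ∀ A, τ.a A = σ.a A := fun A => hf.a A (by simp [Stm.for, tstP, Stm.wa])
      have hp := hpe i hi
      rw [List.range_succ, List.map_append, trace_append]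
      apply WP.le
      · apply WP.set_then (v := σ.a 2 (σ.a 10 i / 2))
        · simp [Ex.ok, Ex.val, BOp.ok, BOp.val, hri, ha]; omega
        · simp [Ex.val, BOp.val, hri, ha]
        have h5 : (τ.setr 23 (σ.a 2 (σ.a 10 i / 2))).r 5 = P.b.toNat := by
          simp [hr 5, hB.r5]
        apply WP.then (tstP_spec (by decide) (by decide) h5)
        intro τ₁ hf₁ h₁
        have h20 : τ₁.r 20 = τ.r 20 := (hf₁.r 20 (by decide)).trans (by simp)
        have e19 : (τ.setr 23 (σ.a 2 (σ.a 10 i / 2))).r 19 = τ.r 19 := by simp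
        have e23 : (τ.setr 23 (σ.a 2 (σ.a 10 i / 2))).r 23 = σ.a 2 (σ.a 10 i / 2) := by simp
        rw [e19, e23] at h₁
        apply WP.cond (by simp [Ex.ok])
        · intro hv
          have htst := h₁.1.1 hv
          apply WP.set (v := nxt P.b (τ.r 19) (σ.a 2 (σ.a 10 i / 2))) (by simp [Ex.ok])
            (by simp [Ex.val, h₁.2 htst])
          revert hI
          cases trace P.b ((List.range i).map fun i => σ.a 2 (σ.a 10 i / 2)) (P.J - 1) with
          | none => simp [PrefOK, h20]
          | some j =>
            rintro ⟨h2, h3, h4⟩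
            subst h3
            simp [trace, htst, PrefOK, h20, h2, nxt_lt h4 htst]
        · intro hv
          have htst : ¬ tst P.b (τ.r 19) (σ.a 2 (σ.a 10 i / 2)) := fun h => h₁.1.2 h hv
          apply WP.set (v := 0) (by simp [Ex.ok]) rfl
          revert hI
          cases trace P.b ((List.range i).map fun i => σ.a 2 (σ.a 10 i / 2)) (P.J - 1) with
          | none => simp [PrefOK]
          | some j =>
            rintro ⟨h2, h3, h4⟩
            subst h3
            simp [trace, htst, PrefOK]
      · simp [Ex.cost]
  · simp [Ex.cost]
    omega

end EdgeSetCycle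

/-! ### The label weights of the rounds and the sum over all rounds. -/

namespace EdgeSetCycle

local prefix:max "♯" => Ex.num
local prefix:max "®" => Ex.reg

variable {K : Type} [Field K] {P : Inst} {E : Env} {φ : ℕ → K} {σ σ' : St}

/-- The label weights of round `y`. -/
def wtY (P : Inst) (y i : ℕ) : ℕ := if P.b then 2 ^ i else if y.testBit i then 1 else P.k + 1

theorem Inst.k_lt_J (P : Inst) : P.k < P.J := by
  unfold J
  split_ifs
  · exact Nat.lt_two_pow_self
  · omega

/-- Keeps the computation of edge weights from overflowing: the sum is `2 ^ k - 1`, which is less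
than the number of states, or at most `k * (k + 1)`. -/
theorem sum_wtY_lt (hP : P.OK E) (y : ℕ) : ∑ i ∈ Finset.range P.k, wtY P y i < 2 ^ E.w := by
  obtain ⟨h1, hJ, hnJ, hL, hL', hil, hn3, hnm, hk0, hN, hN'⟩ := hP.facts
  have hJn : P.J ≤ P.n * P.J := Nat.le_mul_of_pos_left _ (by omega)
  unfold wtY
  split_ifs with hb
  · have : P.J = 2 ^ P.k := by simp [Inst.J, hb]
    have h2 := Nat.geomSum_eq (le_refl 2) P.k
    have : 0 < 2 ^ P.k := by positivity
    rw [h2]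
    omega
  · calc _ ≤ ∑ i ∈ Finset.range P.k, (P.k + 1) := Finset.sum_le_sum fun i _ => by split_ifs <;> omega
      _ = P.k * (P.k + 1) := by simp
      _ ≤ (P.k + 1) * (P.k + 1) := Nat.mul_le_mul_right _ (by omega)
      _ < _ := hP.k_lt

theorem initYP_spec (hP : P.OK E) (hB : Base P φ σ) :
    WP E initYP (200 * (P.k + 1)) (fun σ' => ∀ i < P.k, σ'.a 3 i = wtY P 0 i) σ := by
  obtain ⟨h1, hJ, hnJ, hL, hL', hil, hn3, hnm, hk0, hN, hN'⟩ := hP.facts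
  have hkJ := P.k_lt_J
  have hJn : P.J ≤ P.n * P.J := Nat.le_mul_of_pos_left _ (by omega)
  apply WP.le
  · apply WP.set_then (v := 1) (by simpa [Ex.ok] using E.w_pos.ne') rfl
    refine WP.for P.k (fun i τ => (P.b = true → τ.r 18 = 2 ^ i) ∧ ∀ j < i, τ.a 3 j = wtY P 0 j)
      (by decide) (by decide) (by decide) (by simpa using hB.r4) (by omega) (by simp) ?_
      (fun _ _ h => h.2) (t₁ := 100) le_rfl
    rintro i hi τ hf hri ⟨hI, hI'⟩
    have h5 : τ.r 5 = P.b.toNat := (hf.r 5 (by decide)).trans (by simpa using hB.r5)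
    have h4 : τ.r 4 = P.k := (hf.r 4 (by decide)).trans (by simpa using hB.r4)
    refine WP.straight (Nat.le_of_ble_eq_true rfl) ?_
    cases hb : P.b with
    | true =>
      have h18 := hI hb
      have hJ2 : P.J = 2 ^ P.k := by simp [Inst.J, hb]
      have : 2 ^ i * 2 ≤ 2 ^ P.k := by
        rw [← pow_succ]; exact Nat.pow_le_pow_right (by omega) (by omega)
      simp [Stm.pre, Ex.ok, Ex.val, BOp.ok, BOp.val, h5, hb, hri, h18]
      refine ⟨by omega, by omega, by ring, fun j hj => ?_⟩
      split_ifs with hji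
      · simp [hji, wtY, hb]
      · exact hI' j (by omega)
    | false =>
      simp [Stm.pre, Ex.ok, Ex.val, BOp.ok, BOp.val, h5, hb, hri, h4, E.w_pos.ne']
      refine ⟨by omega, by omega, fun j hj => ?_⟩
      split_ifs with hji
      · simp [wtY, hb]
      · exact hI' j (by omega)
  · simp [Ex.cost]
    omega

/-- Binary increment: bit `i` changes if and only if a carry reaches it, that is, all lower bits of
`y` are set, that is, `2 ^ i` divides `y + 1`. -/
theorem testBit_succ_eq (y i : ℕ) : (y + 1).testBit i =
    (y.testBit i ^^ decide ((y + 1) % 2 ^ i = 0)) := by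
  induction i generalizing y with
  | zero =>
    simp only [Nat.testBit_zero, pow_zero, Nat.mod_one]
    rcases Nat.mod_two_eq_zero_or_one y with h | h <;> simp [Nat.add_mod, h]
  | succ i ih =>
    rw [Nat.testBit_succ, Nat.testBit_succ]
    rcases Nat.even_or_odd' y with ⟨c, rfl | rfl⟩
    · have h1 : (2 * c + 1) / 2 = c := by omega
      have h2 : 2 * c / 2 = c := by omega
      have h3 : (2 * c + 1) % 2 ^ (i + 1) ≠ 0 := by
        intro h
        have := Nat.dvd_of_mod_eq_zero h
        have : 2 ∣ 2 * c + 1 := (dvd_pow_self 2 (Nat.succ_ne_zero i)).trans this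
        omega
      simp [h1, h2, h3]
    · have h1 : (2 * c + 1 + 1) / 2 = c + 1 := by omega
      have h2 : (2 * c + 1) / 2 = c := by omega
      have h3 : (2 * c + 1 + 1) % 2 ^ (i + 1) = 2 * ((c + 1) % 2 ^ i) := by
        rw [pow_succ', show 2 * c + 1 + 1 = 2 * (c + 1) by ring, Nat.mul_mod_mul_left]
      rw [h1, h2, h3, ih]
      simp

theorem Inst.Y_pos (P : Inst) : 0 < P.Y := by
  unfold Y; split_ifs <;> positivity

/-- In the counting version array 3 is a binary counter with digits `k + 1` (for zero) and `1` (for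
one), and register 16 is the carry. A carry out of the last digit means that `y = 2 ^ k - 1` was the
last round. -/
theorem nextYP_spec {y : ℕ} (hP : P.OK E) (hB : Base P φ σ) (hy : y < P.Y)
    (hw : ∀ i < P.k, σ.a 3 i = wtY P y i) :
    WP E nextYP (300 * (P.k + 1)) (fun σ' => (y + 1 < P.Y → σ'.r 15 ≠ 0) ∧
      (y + 1 = P.Y → σ'.r 15 = 0) ∧ (∀ i < P.k, σ'.a 3 i = wtY P (y + 1) i)) σ := by
  obtain ⟨h1, hJ, hnJ, hL, hL', hil, hn3, hnm, hk0, hN, hN'⟩ := hP.facts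
  have hkJ := P.k_lt_J
  have hJn : P.J ≤ P.n * P.J := Nat.le_mul_of_pos_left _ (by omega)
  apply WP.le
  · apply WP.cond (by simp [Ex.ok])
    · intro hv
      have hb : P.b = true := by
        by_contra hb
        simp [Ex.val, hB.r5, hb] at hv
      have hY : P.Y = 1 := by simp [Inst.Y, hb]
      apply WP.set (v := 0) (by simp [Ex.ok]) rfl
      refine ⟨fun h => by omega, fun _ => by simp, fun i hi => ?_⟩
      simpa [wtY, hb] using hw i hi
    · intro hv
      have hb : P.b = false := by
        by_contra hb
        simp [Ex.val, hB.r5, hb] at hv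
      have hY : P.Y = 2 ^ P.k := by simp [Inst.Y, hb]
      apply WP.set_then (v := 1) (by simpa [Ex.ok] using E.w_pos.ne') rfl
      -- The carry into digit `i` is present exactly if `2 ^ i` divides `y + 1`.
      apply WP.then (WP.for P.k (fun i τ => τ.r 16 = (if (y + 1) % 2 ^ i = 0 then 1 else 0) ∧
        ∀ j < P.k, τ.a 3 j = if j < i then wtY P (y + 1) j else wtY P y j)
        (by decide) (by decide) (by decide) (by simpa using hB.r4) (by omega)
        (by simpa [Nat.mod_one] using hw) ?_ (fun _ _ h => h) (t₁ := 150) le_rfl)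
      · rintro τ hf ⟨hI, hI'⟩
        apply WP.set (v := 1 - τ.r 16)
        · simp only [Ex.ok, Ex.val, BOp.ok, hI]
          refine ⟨h1, trivial, ?_⟩
          split_ifs <;> simp
        · simp [Ex.val, BOp.val]
        · simp only [St.setr_r, if_true, St.setr_a]
          refine ⟨fun h => ?_, fun h => ?_, fun i hi => ?_⟩
          · rw [hI, Nat.mod_eq_of_lt (by omega)]
            simp
          · rw [hI, h, hY]
            simp
          · rw [hI' i hi, if_pos hi]
      · rintro i hi τ hf hri ⟨hI, hI'⟩
        have h4 : τ.r 4 = P.k := (hf.r 4 (by decide)).trans (by simpa using hB.r4)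
        have h3i : τ.a 3 i = if y.testBit i then 1 else P.k + 1 := by
          rw [hI' i hi, if_neg (lt_irrefl _)]
          simp [wtY, hb]
        have hdvd : (y + 1) % 2 ^ (i + 1) = 0 ↔ (y + 1) % 2 ^ i = 0 ∧ y.testBit i = true := by
          have h := testBit_succ_eq y i
          rw [Nat.testBit_eq_decide_div_mod_eq] at h
          rw [Nat.mod_pow_succ, Nat.add_eq_zero_iff, Nat.mul_eq_zero]
          have h2 : ¬ 2 ^ i = 0 := by positivity
          rcases Nat.mod_two_eq_zero_or_one ((y + 1) / 2 ^ i) with h3 | h3 <;>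
          by_cases h0 : (y + 1) % 2 ^ i = 0 <;> cases hy : y.testBit i <;>
          simp_all
        have hbit := testBit_succ_eq y i
        refine WP.straight (Nat.le_of_ble_eq_true rfl) ?_
        have key : ∀ v, v = wtY P (y + 1) i → ∀ j < P.k,
            (if j = i then v else τ.a 3 j) = if j ≤ i then wtY P (y + 1) j else wtY P y j := by
          intro v hv j hj
          split_ifs with h h' h'
          · rw [h, hv]
          · omega
          · rw [hI' j hj, if_pos (by omega)]
          · rw [hI' j hj, if_neg (by omega)]
        have key' : τ.a 3 i = wtY P (y + 1) i → ∀ j < P.k,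
            τ.a 3 j = if j ≤ i then wtY P (y + 1) j else wtY P y j := by
          intro hv j hj
          rw [← key _ hv j hj]
          split_ifs with h
          · rw [h]
          · rfl
        by_cases h0 : (y + 1) % 2 ^ i = 0
        · have h16 : τ.r 16 = 1 := by rw [hI, if_pos h0]
          cases hyi : y.testBit i with
          | true =>
            have h3i' : τ.a 3 i = 1 := by simp [h3i, hyi]
            simp only [Stm.pre, Ex.ok, Ex.val, BOp.ok, BOp.val, hri, h4, h16, h3i', true_and,
              and_true, if_true, ne_eq, one_ne_zero, not_false_eq_true, St.setr_r, St.seta_r,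
              St.setr_a, St.seta_a, hdvd, h0, hyi, Order.lt_add_one_iff]
            refine ⟨⟨by omega, by omega⟩, by omega, ⟨by omega, by omega⟩, by simp, key _ ?_⟩
            simp [wtY, hb, hbit, h0, hyi]
          | false =>
            have h3i' : ¬ τ.a 3 i = 1 := by simp [h3i, hyi]; omega
            simp [Stm.pre, Ex.ok, Ex.val, BOp.ok, BOp.val, hri, h16, h3i', E.w_pos.ne', hdvd,
              h0, hyi]
            refine ⟨by omega, key _ ?_⟩
            simp [wtY, hb, hbit, h0, hyi]
        · have h16 : τ.r 16 = 0 := by rw [hI, if_neg h0]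
          simp [Stm.pre, Ex.ok, Ex.val, h16, hdvd, h0]
          refine key' ?_
          rw [h3i]
          simp [wtY, hb, hbit, h0]
  · simp [Ex.cost]
    omega

theorem relaxTerm_congr {lam lam' vis : ℕ → ℕ} {X : ℕ → K} {γ : ℕ → ℕ → K}
    (h : ∀ e < P.m, lam e = lam' e) {d v j : ℕ} (hd : d < 2 * P.m) :
    relaxTerm P lam vis X γ d v j = relaxTerm P lam' vis X γ d v j := by
  rw [relaxTerm, relaxTerm, h _ (by omega)]

theorem gval_congr {lam lam' vis : ℕ → ℕ} {X : ℕ → K} {s : ℕ}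
    (h : ∀ e < P.m, lam e = lam' e) (r : ℕ) : gval P lam vis X s r = gval P lam' vis X s r := by
  induction r with
  | zero => rfl
  | succ r ih =>
    funext v j
    simp only [gval, ih]
    exact Finset.sum_congr rfl fun d hd => relaxTerm_congr h (Finset.mem_range.1 hd)

theorem hookVal_congr {lam lam' cand : ℕ → ℕ} {X : ℕ → K} {γ : ℕ → ℕ → K} {jp : Option ℕ}
    (h : ∀ e < P.m, lam e = lam' e) {d : ℕ} (hd : d < 2 * P.m) :
    hookVal P lam cand X γ jp d = hookVal P lam' cand X γ jp d := by
  cases jp with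
  | none => rfl
  | some j => rw [hookVal, hookVal, hookTerm, hookTerm, h _ (by omega)]

/-- The value of the candidate dart `d`, after the path with the edges `pre`, for completions with
`r` further edges to `s`, in round `y`. -/
def roundVal (P : Inst) (vis cand : ℕ → ℕ) (X : ℕ → K) (pre : List ℕ) (s y r d : ℕ) : K :=
  hookVal P (lamOf P (wtY P y)) cand X (gval P (lamOf P (wtY P y)) vis X s r)
    (trace P.b (pre.map (lamOf P (wtY P y))) (P.J - 1)) d

/-- The value of the candidate dart `d`, after the path with the edges `pre`, for completions with
`r` further edges to `s`. -/
def totalVal (P : Inst) (vis cand : ℕ → ℕ) (X : ℕ → K) (pre : List ℕ) (s r d : ℕ) : K :=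
  ∑ y ∈ Finset.range P.Y, roundVal P vis cand X pre s y r d

/-- The exclusive ors in arrays 6 and 7 accumulate the field sums over the rounds. The array of
weights agrees with `lamOf` only on the edges of the graph, which is all that the values depend on
(`hookVal_congr`, `gval_congr`). -/
theorem sumP_spec {s lim pl : ℕ} (hP : P.OK E)
    (hB : Base P φ σ) (hφ : FieldRep P.N φ) (hx : ∀ e < P.m, σ.a 0 e < P.N)
    (hpl : σ.r 14 = pl) (hpn : pl ≤ P.n) (hpe : ∀ i < pl, σ.a 10 i < 2 * P.m)
    (hs : σ.r 12 = s) (hsn : s < P.n) (hlim : σ.r 13 = lim)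
    (hlim0 : 0 < lim) (hlimn : lim ≤ P.n) :
    WP E sumP (20000 * (P.Y * (P.m * P.J * P.n))) (fun σ' =>
      RepV φ P σ' 6 P.n (fun r => if r < lim then ∑ d ∈ Finset.range (2 * P.m),
        totalVal P (σ.a 9) (σ.a 8) (fun e => φ (σ.a 0 e))
          ((List.range pl).map fun i => σ.a 10 i / 2) s r d else 0) ∧
      RepV φ P σ' 7 (2 * P.m) (totalVal P (σ.a 9) (σ.a 8) (fun e => φ (σ.a 0 e))
          ((List.range pl).map fun i => σ.a 10 i / 2) s (lim - 1))) σ := by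
  obtain ⟨h1, hJ, hnJ, hL, hL', hil, hn3, hnm, hk0, hN, hN'⟩ := hP.facts
  have hkJ := P.k_lt_J
  have hJn : P.J ≤ P.n * P.J := Nat.le_mul_of_pos_left _ (by omega)
  have hY := P.Y_pos
  set X : ℕ → K := fun e => φ (σ.a 0 e) with hX
  set pre := (List.range pl).map fun i => σ.a 10 i / 2 with hpre
  apply WP.le
  · apply WP.then (clearP_spec hB.r2 (by decide) (by omega) (by omega))
    intro τ hf h
    have hB₁ := hB.frame hf (by decide) (by decide)
    apply WP.then (clearP_spec hB₁.r9 (by decide) (by omega) (by omega))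
    intro τ₂ hf₂ h₂
    have hB₂ := hB₁.frame hf₂ (by decide) (by decide)
    apply WP.then (initYP_spec hP hB₂)
    intro τ₃ hf₃ h₃
    have hB₃ := hB₂.frame hf₃
    apply WP.set_then (v := 1) (by simpa [Ex.ok] using E.w_pos.ne') rfl
    have hr : ∀ i ∈ [2, 3, 4, 5, 6, 7, 8, 9, 10, 11, 12, 13, 14], (τ₃.setr 15 1).r i = σ.r i :=
      fun i hi => by
        rw [St.setr_r, if_neg (by revert i; decide)]
        exact (hf₃.r i (by revert i; decide)).trans ((hf₂.r i (by revert i; decide)).trans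
          (hf.r i (by revert i; decide)))
    have ha : ∀ A ∈ [0, 8, 9, 10, 11, 12], (τ₃.setr 15 1).a A = σ.a A := fun A hA =>
        (hf₃.a A (by revert A; decide)).trans ((hf₂.a A (by revert A; decide)).trans
          (hf.a A (by revert A; decide)))
    have hB₄ : Base P φ (τ₃.setr 15 1) := by
      constructor
      iterate 10 rw [hr _ (by decide)]; first | exact hB.r2 | exact hB.r3 | exact hB.r4 | exact hB.r5 | exact hB.r6 | exact hB.r7 | exact hB.r8 | exact hB.r9 | exact hB.r10 | exact hB.r11
      rw [ha 11 (by decide), ha 12 (by decide)]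
      exact hB.mul
    have h6₀ : RepV φ P (τ₃.setr 15 1) 6 P.n fun _ => 0 := fun i hi => by
      rw [St.setr_a, hf₃.a 6 (by decide), hf₂.a 6 (by decide), h, if_pos hi]
      exact ⟨P.N_pos, hφ.zero⟩
    have h7₀ : RepV φ P (τ₃.setr 15 1) 7 (2 * P.m) fun _ => 0 := fun i hi => by
      rw [St.setr_a, hf₃.a 7 (by decide), h₂, if_pos hi]
      exact ⟨P.N_pos, hφ.zero⟩
    have h15₀ : (τ₃.setr 15 1).r 15 ≠ 0 := by simp
    have h3₀ : ∀ i < P.k, (τ₃.setr 15 1).a 3 i = wtY P 0 i := by simpa using h₃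
    generalize τ₃.setr 15 1 = τ₄ at *
    refine WP.while P.Y (fun y τ => (y < P.Y → τ.r 15 ≠ 0) ∧ (y = P.Y → τ.r 15 = 0) ∧
        (∀ i < P.k, τ.a 3 i = wtY P y i) ∧
        RepV φ P τ 6 P.n (fun r => if r < lim then ∑ d ∈ Finset.range (2 * P.m),
          ∑ y' ∈ Finset.range y, roundVal P (σ.a 9) (σ.a 8) X pre s y' r d else 0) ∧
        RepV φ P τ 7 (2 * P.m) (fun d =>
          ∑ y' ∈ Finset.range y, roundVal P (σ.a 9) (σ.a 8) X pre s y' (lim - 1) d))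
      ⟨fun _ => h15₀, fun h => by omega, h3₀, by simpa using h6₀, by simpa using h7₀⟩ ?_ ?_ le_rfl
      (t₁ := 300 * (P.m * (P.k + 1)) + 200 * P.n + 12000 * (P.m * P.J * P.n) +
        300 * (P.k + 1) + 3)
    · rintro y hy τ hfτ ⟨hI1, -, hI3, hI6, hI7⟩
      refine ⟨by simp [Ex.ok], hI1 hy, ?_⟩
      have hBτ := hB₄.frame hfτ
      apply WP.le
      · apply WP.then (lamP_spec hP hBτ hI3 (sum_wtY_lt hP y) (by omega))
        intro τ₁ hf₁ h₁
        have hB₁ := hBτ.frame hf₁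
        have hr₁ : ∀ i ∈ [12, 13, 14], τ₁.r i = σ.r i := fun i hi =>
          (hf₁.r i (by revert i; decide)).trans ((hfτ.r i (by revert i; decide)).trans
            (hr i (by revert i; decide)))
        have ha₁ : ∀ A ∈ [0, 8, 9, 10], τ₁.a A = σ.a A := fun A hA =>
          (hf₁.a A (by revert A; decide)).trans ((hfτ.a A (by revert A; decide)).trans
            (ha A (by revert A; decide)))
        apply WP.then (prefP_spec hP hB₁ ((hr₁ 14 (by decide)).trans hpl) hpn
          (by rw [ha₁ 10 (by decide)]; exact hpe))
        intro τ₂ hf₂ h₂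
        have hB₂ := hB₁.frame hf₂
        have hr₂ : ∀ i ∈ [12, 13, 14], τ₂.r i = σ.r i := fun i hi =>
          (hf₂.r i (by revert i; decide)).trans (hr₁ i hi)
        have ha₂ : ∀ A ∈ [0, 8, 9, 10], τ₂.a A = σ.a A := fun A hA =>
          (hf₂.a A (by revert A; decide)).trans (ha₁ A hA)
        apply WP.then (dpP_spec hP hB₂ hφ (by rw [ha₂ 0 (by decide)]; exact hx)
          (hI6.congr ((hf₂.a 6 (by decide)).trans (hf₁.a 6 (by decide))) fun _ _ => rfl)
          (hI7.congr ((hf₂.a 7 (by decide)).trans (hf₁.a 7 (by decide))) fun _ _ => rfl)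
          h₂ ((hr₂ 12 (by decide)).trans hs) hsn ((hr₂ 13 (by decide)).trans hlim) hlim0 hlimn)
        rintro τ₃ hf₃ ⟨h6, h7⟩
        have hB₃ := hB₂.frame hf₃
        have hw₃ : ∀ i < P.k, τ₃.a 3 i = wtY P y i := fun i hi => by
          rw [hf₃.a 3 (by decide), hf₂.a 3 (by decide), hf₁.a 3 (by decide), hI3 i hi]
        have hlam : ∀ e < P.m, τ₂.a 2 e = lamOf P (wtY P y) e := fun e he => by
          rw [hf₂.a 2 (by decide), h₁ e he]
        have hval : ∀ r, ∀ d < 2 * P.m, hookVal P (τ₂.a 2) (τ₂.a 8) (fun e => φ (τ₂.a 0 e))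
            (gval P (τ₂.a 2) (τ₂.a 9) (fun e => φ (τ₂.a 0 e)) s r)
            (trace P.b ((List.range pl).map fun i => τ₁.a 2 (τ₁.a 10 i / 2)) (P.J - 1)) d =
            roundVal P (σ.a 9) (σ.a 8) X pre s y r d := by
          intro r d hd
          rw [hookVal_congr hlam hd, gval_congr hlam, ha₂ 0 (by decide), ha₂ 8 (by decide),
            ha₂ 9 (by decide), roundVal]
          congr 2
          rw [hpre, List.map_map]
          refine List.map_congr_left fun i hi => ?_
          have := hpe i (List.mem_range.1 hi)
          rw [ha₁ 10 (by decide), h₁ _ (by omega)]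
          rfl
        refine (nextYP_spec hP hB₃ hy hw₃).mono le_rfl fun τ₄ hf₄ ⟨g1, g2, g3⟩ =>
          ⟨g1, g2, g3, ?_, ?_⟩
        · refine h6.congr (hf₄.a 6 (by decide)) fun r _ => ?_
          split_ifs with hr
          · rw [← Finset.sum_add_distrib]
            refine Finset.sum_congr rfl fun d hd => ?_
            rw [hval r d (Finset.mem_range.1 hd), Finset.sum_range_succ]
          · rw [add_zero]
        · refine h7.congr (hf₄.a 7 (by decide)) fun d hd => ?_
          rw [hval _ d hd, Finset.sum_range_succ]
      · omega
    · rintro τ hfτ ⟨-, hI2, -, hI6, hI7⟩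
      exact ⟨by simp [Ex.ok], hI2 rfl, hI6, hI7⟩
  · simp only [Ex.cost]
    have e1 : P.m ≤ P.m * P.J := Nat.le_mul_of_pos_right _ hJ
    have e2 : P.m * P.J ≤ P.m * P.J * P.n := Nat.le_mul_of_pos_right _ (by omega)
    have e3 : P.m * (P.k + 1) ≤ P.m * P.J := Nat.mul_le_mul_left _ hkJ
    have e4 : P.k + 1 ≤ P.m * (P.k + 1) := Nat.le_mul_of_pos_left _ (by omega)
    have e5 : P.m * P.J * P.n ≤ P.Y * (P.m * P.J * P.n) := Nat.le_mul_of_pos_left _ hY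
    have e6 : 3 * (P.m * P.J) ≤ P.m * P.J * P.n := by
      rw [Nat.mul_comm]
      exact Nat.mul_le_mul_left _ hn3
    have e7 : P.Y * (1 + (300 * (P.m * (P.k + 1)) + 200 * P.n + 12000 * (P.m * P.J * P.n) +
        300 * (P.k + 1) + 3) + 2) ≤ P.Y * (12400 * (P.m * P.J * P.n)) :=
      Nat.mul_le_mul_left _ (by omega)
    have e8 : P.Y * (12400 * (P.m * P.J * P.n)) = 12400 * (P.Y * (P.m * P.J * P.n)) := by ring
    omega

end EdgeSetCycle

/-! ### Repetition, and loops whose iterations differ in cost. -/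

namespace WordRAM

variable {E : Env} {p : Stm} {Q : St → Prop} {σ : St}

theorem Frame.trans {σ' τ : St} (h₁ : Frame p σ σ') (h₂ : Frame p σ' τ) : Frame p σ τ :=
  ⟨fun j hj => by rw [h₂.r j hj, h₁.r j hj], fun j hj => by rw [h₂.a j hj, h₁.a j hj],
    fun hd => by rw [h₂.d hd, h₁.d hd]⟩

theorem Stm.not_mem_wr_rep {i : ℕ} (h : i ∉ p.wr) : ∀ R, i ∉ (Stm.rep R p).wr
  | 0 => by simp [Stm.rep, Stm.wr]
  | R + 1 => by simp [Stm.rep, Stm.wr, Stm.not_mem_wr_rep h R, h]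

theorem WP.rep {t : ℕ} (Inv : ℕ → St → Prop) (h₀ : Inv 0 σ) : ∀ R : ℕ,
    (∀ j < R, ∀ τ, Frame p σ τ → Inv j τ → WP E p t (Inv (j + 1)) τ) →
    WP E (.rep R p) (R * (t + 1) + 1) (fun τ => Frame p σ τ ∧ Inv R τ) σ
  | 0, _ => (WP.skip ⟨Frame.refl _ _, h₀⟩).le (by omega)
  | R + 1, hstep => by
    refine (WP.then (WP.rep Inv h₀ R fun j hj => hstep j (by omega)) (t₂ := t)
      fun τ _ h => ?_).le (by nlinarith)
    exact (hstep R (by omega) τ h.1 h.2).mono le_rfl fun τ' hf' h' => ⟨h.1.trans hf', h'⟩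

/-- Individual costs matter in the loop over starting vertices: only those with a candidate dart pay
for the dynamic program. This gives the factor `|V(S_1)|` in the time instead of `n`. -/
theorem WP.while_sum {e : Ex} (B : ℕ) (c : ℕ → ℕ) (Inv : ℕ → St → Prop) (h₀ : Inv 0 σ)
    (hstep : ∀ j < B, ∀ τ, Frame (.wh e p) σ τ → Inv j τ →
      e.ok E τ ∧ e.val E τ ≠ 0 ∧ WP E p (c j) (Inv (j + 1)) τ)
    (hend : ∀ τ, Frame (.wh e p) σ τ → Inv B τ → e.ok E τ ∧ e.val E τ = 0 ∧ Q τ) :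
    WP E (.wh e p) (∑ j ∈ Finset.range B, (e.cost + c j + 2) + e.cost + 2) Q σ := by
  suffices H : ∀ i ≤ B, ∀ τ, Frame (.wh e p) σ τ → Inv (B - i) τ →
      WP E (.wh e p) (∑ j ∈ Finset.Ico (B - i) B, (e.cost + c j + 2) + e.cost + 2) Q τ by
    have := H B le_rfl σ (Frame.refl _ _) (by rwa [Nat.sub_self])
    rwa [Nat.sub_self, ← Finset.range_eq_Ico] at this
  intro i
  induction i with
  | zero =>
    intro _ τ hf hI
    obtain ⟨h1, h2, h3⟩ := hend τ hf (by simpa using hI)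
    exact ⟨τ, _, Exec.wh_false h1 h2, by omega, h3⟩
  | succ i ih =>
    intro hi τ hf hI
    obtain ⟨h1, h2, σ', t', h3, h4, h5⟩ := hstep _ (by omega) τ hf hI
    have hf' := h3.frame
    have hB : B - (i + 1) + 1 = B - i := by omega
    obtain ⟨σ'', t'', h6, h7, h8⟩ := ih (by omega) σ'
      ⟨fun j hj => by rw [hf'.r j hj, hf.r j hj], fun j hj => by rw [hf'.a j hj, hf.a j hj],
        fun hd => by rw [hf'.d hd, hf.d hd]⟩ (by rwa [hB] at h5)
    refine ⟨σ'', _, Exec.wh_true h1 h2 h3 h6, ?_, h8⟩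
    rw [Finset.sum_eq_sum_Ico_succ_bot (by omega), hB]
    omega

/-- Loops whose iterations have different running times. -/
theorem WP.for_sum {i b : ℕ} (B : ℕ) (c : ℕ → ℕ) (Inv : ℕ → St → Prop) (hi : i ∉ p.wr)
    (hb : b ∉ p.wr) (hib : i ≠ b) (hB : σ.r b = B) (hBw : B < 2 ^ E.w)
    (h₀ : Inv 0 (σ.setr i 0))
    (hstep : ∀ j < B, ∀ τ, Frame (Stm.for i b p) σ τ → τ.r i = j → Inv j τ →
      WP E p (c j) (fun τ' => Inv (j + 1) (τ'.setr i (j + 1))) τ)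
    (hend : ∀ τ, Frame (Stm.for i b p) σ τ → Inv B τ → Q τ) :
    WP E (Stm.for i b p) (∑ j ∈ Finset.range B, (c j + 20) + 20) Q σ := by
  have hfr : ∀ τ, Frame (.wh (.bin .lt (.reg i) (.reg b))
      (.seq p (.set i (.bin .add (.reg i) (.num 1))))) (σ.setr i 0) τ →
      Frame (Stm.for i b p) σ τ := fun τ hf => by
    refine ⟨fun j hj => ?_, hf.a, hf.d⟩
    simp only [Stm.for, Stm.wr, List.mem_append, List.mem_singleton, not_or] at hj
    rw [hf.r j (by simp [Stm.wr, hj])]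
    simp [St.setr, hj.1]
  have h1 : 1 < 2 ^ E.w := Nat.one_lt_two_pow E.w_pos.ne'
  have hb' : ∀ τ, Frame (.wh (.bin .lt (.reg i) (.reg b))
      (.seq p (.set i (.bin .add (.reg i) (.num 1))))) (σ.setr i 0) τ → τ.r b = B := fun τ hf => by
    rw [(hfr τ hf).r b (by simp [Stm.for, Stm.wr, hb, hib.symm]), hB]
  apply WP.le
  · apply WP.set_then (v := 0) (by simp [Ex.ok]) rfl
    refine WP.while_sum B (fun j => c j + 8) (fun j τ => τ.r i = j ∧ Inv j τ)
      ⟨by simp [St.setr], h₀⟩ (fun j hj τ hf hI => ?_) (fun τ hf hI => ?_)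
    · refine ⟨by simp [Ex.ok, BOp.ok], by simp [Ex.val, BOp.val, hb' τ hf, hI.1, hj], ?_⟩
      refine WP.seq (hstep j hj τ (hfr τ hf) hI.1 hI.2) (t₂ := 7) (fun τ' hf' hI' => ?_) (by omega)
      have hi' : τ'.r i = j := by rw [hf'.r i hi, hI.1]
      refine ⟨_, _, Exec.set ?_, by simp [Ex.cost], ?_⟩
      · simp only [Ex.ok, BOp.ok, Ex.val, hi', true_and]
        omega
      · simp only [Ex.val, BOp.val, hi']
        exact ⟨by simp [St.setr], hI'⟩
    · exact ⟨by simp [Ex.ok, BOp.ok], by simp [Ex.val, BOp.val, hb' τ hf, hI.1],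
        hend τ (hfr τ hf) hI.2⟩
  · have : ∑ j ∈ Finset.range B, (1 + 1 + 3 + (c j + 8) + 2) ≤ ∑ j ∈ Finset.range B, (c j + 20) :=
      Finset.sum_le_sum fun j _ => by omega
    simp only [Ex.cost]
    omega

end WordRAM

/-! ### Initialization. -/

namespace EdgeSetCycle

local prefix:max "♯" => Ex.num
local prefix:max "®" => Ex.reg

variable {K : Type} [Field K] {P : Inst} {E : Env} {φ : ℕ → K} {σ σ' : St}

/-- The registers with fixed contents. -/
structure RegBase (P : Inst) (σ : St) : Prop where
  r2 : σ.r 2 = P.n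
  r3 : σ.r 3 = P.m
  r4 : σ.r 4 = P.k
  r5 : σ.r 5 = P.b.toNat
  r6 : σ.r 6 = P.J
  r7 : σ.r 7 = P.J - 1
  r8 : σ.r 8 = P.N
  r9 : σ.r 9 = 2 * P.m
  r10 : σ.r 10 = P.N - 1
  r11 : σ.r 11 = P.n * P.J

theorem initP_spec (hP : P.OK E) : WP E (initP P.b) (500 * P.n + 100 * P.k) (RegBase P) σ := by
  obtain ⟨h1, hJ, hnJ, hL, hL', hil, hn3, hnm, hk0, hN, hN'⟩ := hP.facts
  have hkJ := P.k_lt_J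
  have hJn : P.J ≤ P.n * P.J := Nat.le_mul_of_pos_left _ (by omega)
  have hbw : P.b.toNat < 2 ^ E.w := lt_of_le_of_lt (Bool.toNat_le _) h1
  -- The doubling loop makes `2 * n` iterations and becomes idle at `2 ^ q`, the first power of two
  -- that is at least `2 * n`; so the number of iterations suffices.
  have hq : P.q ≤ 2 * P.n := by
    by_contra hq
    have h2 : 2 ^ (2 * P.n + 1) ≤ P.N := Nat.pow_le_pow_right (by omega) (by omega)
    have h3 : 2 * P.n < 2 ^ (2 * P.n) := Nat.lt_two_pow_self
    rw [pow_succ] at h2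
    omega
  apply WP.le
  · apply WP.set_then (v := P.b.toNat) (by simpa [Ex.ok] using hbw) rfl
    apply WP.set_then (v := P.n) (by simp [Ex.ok]) (by simpa [Ex.val] using hP.inp0)
    apply WP.set_then (v := P.m) (by simpa [Ex.ok] using E.w_pos.ne') (by simpa [Ex.val] using hP.inp1)
    apply WP.set_then (v := P.k) (by simp [Ex.ok]; omega) (by simpa [Ex.val] using hP.inp2)
    apply WP.set_then (v := 2 * P.m)
    · simp [Ex.ok, Ex.val, BOp.ok]; omega
    · simp [Ex.val, BOp.val]; omega
    apply WP.set_then (v := 2 * P.n)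
    · simp [Ex.ok, Ex.val, BOp.ok]; omega
    · simp [Ex.val, BOp.val]; omega
    apply WP.set_then (v := 1) (by simpa [Ex.ok] using E.w_pos.ne') rfl
    have g2 : ((((((((σ.setr 5 P.b.toNat).setr 2 P.n).setr 3 P.m).setr 4 P.k).setr 9 (2 * P.m)).setr
      45 (2 * P.n)).setr 8 1)).r 2 = P.n ∧ ((((((((σ.setr 5 P.b.toNat).setr 2 P.n).setr 3 P.m).setr 4 P.k).setr 9 (2 * P.m)).setr
      45 (2 * P.n)).setr 8 1)).r 3 = P.m ∧ ((((((((σ.setr 5 P.b.toNat).setr 2 P.n).setr 3 P.m).setr 4 P.k).setr 9 (2 * P.m)).setr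
      45 (2 * P.n)).setr 8 1)).r 4 = P.k ∧ ((((((((σ.setr 5 P.b.toNat).setr 2 P.n).setr 3 P.m).setr 4 P.k).setr 9 (2 * P.m)).setr
      45 (2 * P.n)).setr 8 1)).r 5 = P.b.toNat ∧ ((((((((σ.setr 5 P.b.toNat).setr 2 P.n).setr 3 P.m).setr 4 P.k).setr 9 (2 * P.m)).setr
      45 (2 * P.n)).setr 8 1)).r 9 = 2 * P.m ∧ ((((((((σ.setr 5 P.b.toNat).setr 2 P.n).setr 3 P.m).setr 4 P.k).setr 9 (2 * P.m)).setr
      45 (2 * P.n)).setr 8 1)).r 45 = 2 * P.n ∧ ((((((((σ.setr 5 P.b.toNat).setr 2 P.n).setr 3 P.m).setr 4 P.k).setr 9 (2 * P.m)).setr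
      45 (2 * P.n)).setr 8 1)).r 8 = 1 := by simp
    generalize ((((((σ.setr 5 P.b.toNat).setr 2 P.n).setr 3 P.m).setr 4 P.k).setr 9 (2 * P.m)).setr
      45 (2 * P.n)).setr 8 1 = σ₁ at g2 ⊢
    obtain ⟨g2, g3, g4, g5, g9, g45, g8⟩ := g2
    apply WP.then (WP.for (2 * P.n) (fun i τ => τ.r 8 = 2 ^ min i P.q) (by decide) (by decide)
      (by decide) g45 (by omega) (by simpa using g8) ?_ (fun _ _ h => h) (t₁ := 30) le_rfl)
    · intro τ hf h8
      rw [min_eq_right hq] at h8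
      replace h8 : τ.r 8 = P.N := h8
      have hr : ∀ i ∈ [2, 3, 4, 5, 9], τ.r i = σ₁.r i := fun i hi => hf.r i (by revert i; decide)
      apply WP.set_then (v := P.N - 1)
      · simp [Ex.ok, Ex.val, BOp.ok, h8, E.w_pos.ne']; omega
      · simp [Ex.val, BOp.val, h8]
      apply WP.set_then (v := 1) (by simpa [Ex.ok] using E.w_pos.ne') rfl
      apply WP.then (R := fun τ' => τ'.r 6 = P.J)
      · apply WP.cond (by simp [Ex.ok])
        · intro hv
          have hb : P.b = true := by
            by_contra hb
            simp [Ex.val, hr 5, g5, hb] at hv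
          have hJ2 : P.J = 2 ^ P.k := by simp [Inst.J, hb]
          rw [hJ2]
          refine WP.for P.k (fun i τ => τ.r 6 = 2 ^ i) (by decide) (by decide) (by decide)
            (by simp [hr 4, g4]) (by omega) (by simp) ?_ (fun _ _ h => h) (t₁ := 10) le_rfl
          intro i hi τ' _ _ h6
          have : 2 ^ i * 2 ≤ 2 ^ P.k := by
            rw [← pow_succ]; exact Nat.pow_le_pow_right (by omega) (by omega)
          refine (WP.set (v := 2 ^ (i + 1)) ?_ ?_ (by simp)).le (Nat.le_of_ble_eq_true rfl)
          · simp [Ex.ok, Ex.val, BOp.ok, h6]; omega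
          · simp [Ex.val, BOp.val, h6]; ring
        · intro hv
          have hb : P.b = false := by
            by_contra hb
            simp [Ex.val, hr 5, g5, hb] at hv
          apply WP.set (v := P.k + 1)
          · simp [Ex.ok, Ex.val, BOp.ok, hr 4, g4, E.w_pos.ne']; omega
          · simp [Ex.val, BOp.val, hr 4, g4]
          · simp [Inst.J, hb]
      · intro τ₂ hf₂ h6
        have e2 : τ₂.r 2 = P.n := (hf₂.r 2 (by decide)).trans (by simp [hr 2, g2])
        have e3 : τ₂.r 3 = P.m := (hf₂.r 3 (by decide)).trans (by simp [hr 3, g3])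
        have e4 : τ₂.r 4 = P.k := (hf₂.r 4 (by decide)).trans (by simp [hr 4, g4])
        have e5 : τ₂.r 5 = P.b.toNat := (hf₂.r 5 (by decide)).trans (by simp [hr 5, g5])
        have e9 : τ₂.r 9 = 2 * P.m := (hf₂.r 9 (by decide)).trans (by simp [hr 9, g9])
        have e8 : τ₂.r 8 = P.N := (hf₂.r 8 (by decide)).trans (by simp [h8])
        have e10 : τ₂.r 10 = P.N - 1 := (hf₂.r 10 (by decide)).trans (by simp)
        apply WP.set_then (v := P.J - 1)
        · simp [Ex.ok, Ex.val, BOp.ok, h6, E.w_pos.ne']; omega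
        · simp [Ex.val, BOp.val, h6]
        apply WP.set (v := P.n * P.J)
        · simp [Ex.ok, Ex.val, BOp.ok, e2, h6]; omega
        · simp [Ex.val, BOp.val, e2, h6]
        constructor <;> simp [*]
    · intro i hi τ hf hri h8
      have h45 : τ.r 45 = 2 * P.n := (hf.r 45 (by decide)).trans g45
      refine WP.straight (Nat.le_of_ble_eq_true rfl) ?_
      by_cases hiq : i < P.q
      · have h2 : 2 ^ (i + 1) ≤ P.N := Nat.pow_le_pow_right (by omega) hiq
        rw [min_eq_left hiq.le] at h8
        rw [pow_succ] at h2
        have h3 : 2 ^ i < 2 * P.n := by omega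
        simp [Stm.pre, Ex.ok, Ex.val, BOp.ok, BOp.val, h8, h45, h3, min_eq_left (show i + 1 ≤ P.q from hiq)]
        exact ⟨by omega, by ring⟩
      · rw [min_eq_right (by omega)] at h8
        have h3 : ¬ P.N < 2 * P.n := by omega
        replace h8 : τ.r 8 = P.N := h8
        simp [Stm.pre, Ex.ok, Ex.val, BOp.ok, BOp.val, h8, h45, h3, min_eq_right (show P.q ≤ i + 1 by omega)]
        rfl
  · simp [Ex.cost]
    omega

end EdgeSetCycle

/-! ### The shift register and the tables of exponentials and logarithms. -/

namespace EdgeSetCycle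

local prefix:max "♯" => Ex.num
local prefix:max "®" => Ex.reg

variable {K : Type} [Field K] {P : Inst} {E : Env} {φ : ℕ → K} {σ σ' : St}

/-- The powers of the variable modulo a polynomial over the field with two elements, written in
binary; `N + f` is the polynomial. -/
def lfsr (N f : ℕ) : ℕ → ℕ
  | 0 => 1
  | i + 1 => if 2 * lfsr N f i < N then 2 * lfsr N f i else 2 * lfsr N f i ^^^ N ^^^ f

/-- The powers of the variable have the period `N - 1`. -/
def Passes (N f : ℕ) : Prop := lfsr N f (N - 1) = 1 ∧ ∀ i, 0 < i → i < N - 1 → lfsr N f i ≠ 1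

/-- In the given range bit `q` is the leading bit, and the operation clears it. -/
theorem xor_two_pow_lt {a q : ℕ} (h₁ : 2 ^ q ≤ a) (h₂ : a < 2 ^ (q + 1)) : a ^^^ 2 ^ q < 2 ^ q := by
  refine Nat.lt_pow_two_of_testBit _ fun i hi => ?_
  rw [Nat.testBit_xor, Nat.testBit_two_pow]
  rcases hi.eq_or_lt with rfl | hi
  · rw [Nat.testBit_eq_decide_div_mod_eq]
    have : a / 2 ^ q = 1 := by
      rw [Nat.div_eq_iff (by positivity)]
      rw [pow_succ] at h₂
      omega
    simp [this]
  · rw [Nat.testBit_lt_two_pow (lt_of_lt_of_le h₂ (Nat.pow_le_pow_right (by omega) hi))]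
    simp [hi.ne]

theorem lfsr_lt {q f : ℕ} (hq : 0 < q) (hf : f < 2 ^ q) (i : ℕ) : lfsr (2 ^ q) f i < 2 ^ q := by
  induction i with
  | zero => exact Nat.one_lt_two_pow hq.ne'
  | succ i ih =>
    unfold lfsr
    split_ifs with h
    · exact h
    · refine Nat.xor_lt_two_pow (xor_two_pow_lt (by omega) ?_) hf
      rw [pow_succ]
      omega

/-- The tables of exponentials and logarithms for the polynomial `N + f`, up to the exponent `j`. -/
structure Tables (N f j : ℕ) (σ : St) : Prop where
  exp : ∀ i < j, σ.a 11 i = lfsr N f i ∧ σ.a 11 (i + (N - 1)) = lfsr N f i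
  log : ∀ i < j, σ.a 12 (lfsr N f i) < j ∧ lfsr N f (σ.a 12 (lfsr N f i)) = lfsr N f i

/-- Feedback polynomials are tried in increasing order, each attempt overwriting the tables.
Register 48 blocks all attempts after the first success, so the tables that remain belong to the
least polynomial of full period. -/
theorem fieldP_spec (hP : P.OK E) (hB : RegBase P σ) {f₀ : ℕ} (hf₀ : f₀ < P.N)
    (hp : Passes P.N f₀) (hmin : ∀ f < f₀, ¬ Passes P.N f) :
    WP E fieldP (400 * ((P.N + 1) * (P.N + 1)))
      (Tables P.N f₀ (P.N - 1)) σ := by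
  obtain ⟨h1, hJ, hnJ, hL, hL', hil, hn3, hnm, hk0, hN, hN'⟩ := hP.facts
  have hq : 0 < P.q := by
    by_contra h
    have : P.N = 1 := by simp [Inst.N, show P.q = 0 by omega]
    omega
  have hlt : ∀ f < P.N, ∀ i, lfsr P.N f i < P.N := fun f hf i => lfsr_lt hq hf i
  apply WP.le
  · apply WP.set_then (v := 0) (by simp [Ex.ok]) rfl
    apply WP.for P.N (fun j τ => (τ.r 48 = 0 ∧ ∀ f < j, ¬ Passes P.N f) ∨
      (τ.r 48 ≠ 0 ∧ ∃ f < P.N, Passes P.N f ∧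
        (∀ f' < f, ¬ Passes P.N f') ∧ Tables P.N f (P.N - 1) τ)) (by decide) (by decide)
      (by decide) (by simp [hB.r8]) (by omega) (by simp) ?_ ?_ (t₁ := P.N * 200 + 100) le_rfl
    · intro f hf τ hfr hr hI
      have e8 : τ.r 8 = P.N := (hfr.r 8 (by decide)).trans (by simp [hB.r8])
      have e10 : τ.r 10 = P.N - 1 := (hfr.r 10 (by decide)).trans (by simp [hB.r10])
      apply WP.le
      · apply WP.cond (by simp [Ex.ok])
        · intro hv
          replace hv : τ.r 48 ≠ 0 := hv
          apply WP.skip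
          rcases hI with hI | ⟨_, f', h2, h3, h5, h4⟩
          · exact absurd hI.1 hv
          · exact Or.inr ⟨by simpa using hv, f', h2, h3, h5, ⟨h4.exp, h4.log⟩⟩
        · intro hv
          replace hv : τ.r 48 = 0 := hv
          replace hI := hI.resolve_right (fun h => h.1 hv)
          apply WP.set_then (v := 1) (by simpa [Ex.ok] using E.w_pos.ne') rfl
          apply WP.set_then (v := 1) (by simpa [Ex.ok] using E.w_pos.ne') rfl
          -- Register 49 becomes zero when the value 1 recurs at a positive exponent below `N - 1`;
          -- recurrence at `N - 1` itself is tested after the loop.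
          apply WP.then (WP.for (P.N - 1) (fun j τ => τ.r 47 = lfsr P.N f j ∧
            (τ.r 49 ≠ 0 ↔ ∀ i, 0 < i → i < P.N - 1 → i ≤ j → lfsr P.N f i ≠ 1) ∧
            Tables P.N f j τ) (by decide) (by decide) (by decide) (by simp [e10]) (by omega)
            ⟨rfl, by simp; omega, by simp, by simp⟩ ?_ (fun _ _ h => h) (t₁ := 120) le_rfl)
          · rintro τ₁ hf₁ ⟨g1, g2, g3⟩
            have e48 : τ₁.r 48 = 0 := (hf₁.r 48 (by decide)).trans (by simp [hv])
            refine WP.straight (t := 20) (Nat.le_of_ble_eq_true rfl) ?_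
            simp only [Stm.pre, Ex.ok, Ex.val, BOp.ok, BOp.val, g1]
            by_cases h2 : lfsr P.N f (P.N - 1) = 1
            · by_cases h3 : τ₁.r 49 = 0
              · simp only [h2, ite_true, ne_eq, one_ne_zero, not_false_eq_true, true_and,
                  and_true, h1, St.setr_r]
                refine Or.inl ⟨by simp [h3], fun f' hf' => ?_⟩
                rcases Nat.lt_succ_iff_lt_or_eq.1 hf' with hf' | rfl
                · exact hI.2 _ hf'
                · intro hpa
                  exact g2.2 (fun i hi hi' _ => hpa.2 i hi hi') h3
              · simp only [h2, ite_true, ne_eq, one_ne_zero, not_false_eq_true, true_and,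
                  and_true, h1, St.setr_r]
                refine Or.inr ⟨by simp [h3], f, hf, ⟨h2, fun i hi hi' => g2.1 h3 i hi hi' (by omega)⟩, hI.2,
                  ⟨g3.exp, g3.log⟩⟩
            · simp only [h2, ite_false, ne_eq, not_true, true_and, h1,
                St.setr_r]
              refine Or.inl ⟨by simp [e48], fun f' hf' => ?_⟩
              rcases Nat.lt_succ_iff_lt_or_eq.1 hf' with hf' | rfl
              · exact hI.2 _ hf'
              · exact fun hpa => h2 hpa.1
          · rintro j hj τ₁ hf₁ hr₁ ⟨g1, g2, g3⟩
            have e8' : τ₁.r 8 = P.N := (hf₁.r 8 (by decide)).trans (by simp [e8])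
            have e10' : τ₁.r 10 = P.N - 1 := (hf₁.r 10 (by decide)).trans (by simp [e10])
            have e46 : τ₁.r 46 = f := (hf₁.r 46 (by decide)).trans (by simp [hr])
            have hl := hlt f hf j
            -- For a polynomial that fails, values may repeat and a later exponent overwrites an
            -- earlier logarithm. Hence the invariant asks only that the stored exponent yields the
            -- same value.
            have hT : Tables P.N f (j + 1) (((τ₁.seta 11 j (lfsr P.N f j)).seta 11 (j + (P.N - 1))
                (lfsr P.N f j)).seta 12 (lfsr P.N f j) j) := by
              constructor
              · intro i hi
                rcases Nat.lt_succ_iff_lt_or_eq.1 hi with hi' | rfl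
                · have := g3.exp i hi'
                  simp [this, show i ≠ j + (P.N - 1) by omega, hi'.ne,
                    show i + (P.N - 1) ≠ j by omega]
                · simp
              · intro i hi
                by_cases h : lfsr P.N f i = lfsr P.N f j
                · simp [h]
                · rcases Nat.lt_succ_iff_lt_or_eq.1 hi with hi' | rfl
                  · have := g3.log i hi'
                    simp [h, this, this.1.trans]
                  · exact absurd rfl h
            apply WP.le
            · apply WP.put_then (v := lfsr P.N f j) (y := j) (by simp [Ex.ok])
                (by simp [Ex.val, hr₁]) (by omega) (by simp [Ex.ok]) (by simp [Ex.val, g1])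
              apply WP.put_then (v := lfsr P.N f j) (y := j + (P.N - 1))
                (by simp [Ex.ok, Ex.val, BOp.ok, hr₁, e10']; omega)
                (by simp [Ex.val, BOp.val, hr₁, e10']) (by omega) (by simp [Ex.ok])
                (by simp [Ex.val, g1])
              apply WP.put_then (t₂ := 60) (v := j) (y := lfsr P.N f j) (by simp [Ex.ok])
                (by simp [Ex.val, g1]) (by omega) (by simp [Ex.ok])
                (by simp [Ex.val, hr₁])
              generalize hτ₂ : (((τ₁.seta 11 j (lfsr P.N f j)).seta 11 (j + (P.N - 1))
                (lfsr P.N f j)).seta 12 (lfsr P.N f j) j) = τ₂ at hT ⊢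
              have hrr : τ₂.r = τ₁.r := by rw [← hτ₂]; simp
              have hl' : lfsr P.N f (j + 1) = if lfsr P.N f j + lfsr P.N f j < P.N then
                lfsr P.N f j + lfsr P.N f j else (lfsr P.N f j + lfsr P.N f j) ^^^ P.N ^^^ f := by
                rw [lfsr, two_mul]
              have hg : ∀ τ₃ : St, τ₃.a = τ₂.a → τ₃.r 47 = lfsr P.N f (j + 1) → (τ₃.r 49 =
                if lfsr P.N f (j + 1) = 1 ∧ j + 1 < P.N - 1 then 0 else τ₁.r 49) →
                ((τ₃.setr 24 (j + 1)).r 47 = lfsr P.N f (j + 1) ∧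
                ((τ₃.setr 24 (j + 1)).r 49 ≠ 0 ↔
                  ∀ i, 0 < i → i < P.N - 1 → i ≤ j + 1 → lfsr P.N f i ≠ 1) ∧
                Tables P.N f (j + 1) (τ₃.setr 24 (j + 1))) := by
                intro τ₃ ha h47 h49
                refine ⟨by simpa using h47, ?_, ⟨by simpa [ha] using hT.exp,
                  by simpa [ha] using hT.log⟩⟩
                simp only [St.setr_r, show (49 : ℕ) ≠ 24 by decide, ite_false, h49]
                split_ifs with hc
                · simp only [ne_eq, not_true, false_iff]
                  exact fun h => h (j + 1) (by omega) hc.2 le_rfl hc.1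
                · rw [g2]
                  refine ⟨fun h i hi hi' hi'' => ?_, fun h i hi hi' hi'' => h i hi hi' (by omega)⟩
                  rcases hi''.eq_or_lt with rfl | hi''
                  · exact fun h => hc ⟨h, hi'⟩
                  · exact h i hi hi' (by omega)
              have c1 : lfsr P.N f j + lfsr P.N f j < 2 ^ E.w := by omega
              have c2 : j + 1 < 2 ^ E.w := by omega
              refine WP.mono (R := fun τ₃ => τ₃.a = τ₂.a ∧ τ₃.r 47 = lfsr P.N f (j + 1) ∧ τ₃.r 49 =
                if lfsr P.N f (j + 1) = 1 ∧ j + 1 < P.N - 1 then 0 else τ₁.r 49)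
                (WP.straight (t := 60) (Nat.le_of_ble_eq_true rfl) ?_) le_rfl
                fun τ₃ _ h => hg τ₃ h.1 h.2.1 h.2.2
              have c3 : 1 < P.N := by omega
              have c4 := hlt f hf (j + 1)
              have c5 : lfsr P.N f (j + 1) < 2 ^ E.w := by omega
              by_cases h2 : lfsr P.N f j + lfsr P.N f j < P.N <;>
                simp only [h2, if_true, if_false] at hl' <;>
                by_cases h3 : lfsr P.N f (j + 1) = 1 <;> by_cases h4 : j + 1 < P.N - 1 <;>
                simp [Stm.pre, Ex.ok, Ex.val, BOp.ok, BOp.val, h2, ← hl', h3, h4, hrr, e8', e46,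
                  hr₁, e10', c1, c2, c3, c5, c4, E.w_pos.ne', g1]
            · simp [Ex.cost]
      · simp [Ex.cost]
        omega
    · rintro τ hf (⟨_, h⟩ | ⟨_, f, hf, hpf, hfmin, h⟩)
      · exact absurd hp (h f₀ hf₀)
      · obtain rfl : f = f₀ := by
          rcases lt_trichotomy f f₀ with h' | h' | h'
          · exact absurd hpf (hmin f h')
          · exact h'
          · exact absurd hp (hfmin f₀ h')
        exact h
  · simp [Ex.cost]
    nlinarith

end EdgeSetCycle

/-! ### The finite field behind the shift register. -/

namespace EdgeSetCycle

open Polynomial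

/-- The polynomial with the binary digits of `a` below the position `q + 1` as coefficients. -/
noncomputable def digitPoly (q a : ℕ) : (ZMod 2)[X] :=
  ∑ i ∈ Finset.range (q + 1), if a.testBit i then X ^ i else 0

theorem coeff_digitPoly (q a i : ℕ) :
    (digitPoly q a).coeff i = if i ≤ q ∧ a.testBit i then 1 else 0 := by
  have h : ∀ j, (if a.testBit j then X ^ j else (0 : (ZMod 2)[X])).coeff i =
      if i = j then (if a.testBit j then 1 else 0) else 0 := fun j => by
    split_ifs <;> simp_all [coeff_X_pow]
  simp only [digitPoly, finsetSum_coeff, h, Finset.sum_ite_eq, Finset.mem_range, Nat.lt_succ_iff]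
  split_ifs <;> simp_all

theorem digitPoly_xor (q a b : ℕ) : digitPoly q (a ^^^ b) = digitPoly q a + digitPoly q b := by
  ext i
  simp only [coeff_digitPoly, coeff_add, Nat.testBit_xor]
  by_cases h : i ≤ q <;> cases a.testBit i <;> cases b.testBit i <;> simp [h]
  rfl

theorem digitPoly_one (q : ℕ) : digitPoly q 1 = 1 := by
  ext i
  simp only [coeff_digitPoly, coeff_one, Nat.testBit_one_eq_true_iff_self_eq_zero]
  split_ifs <;> simp_all

theorem digitPoly_zero (q : ℕ) : digitPoly q 0 = 0 := by
  ext i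
  simp [coeff_digitPoly]

theorem digitPoly_two_mul {q a : ℕ} (ha : a < 2 ^ q) : digitPoly q (2 * a) = X * digitPoly q a := by
  ext i
  rcases i with _ | i
  · simp [coeff_digitPoly]
  · simp only [coeff_digitPoly, coeff_X_mul, Nat.testBit_succ]
    rw [Nat.mul_div_cancel_left _ (by omega)]
    rcases le_or_gt (i + 1) q with h | h
    · simp [h, show i ≤ q by omega]
    · have : a.testBit i = false :=
        Nat.testBit_lt_two_pow (lt_of_lt_of_le ha (Nat.pow_le_pow_right (by omega) (by omega)))
      simp [this]

theorem digitPoly_two_pow (q : ℕ) : digitPoly q (2 ^ q) = X ^ q := by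
  ext i
  simp only [coeff_digitPoly, coeff_X_pow, Nat.testBit_two_pow]
  split_ifs <;> simp_all

theorem degree_digitPoly_lt {q a : ℕ} (ha : a < 2 ^ q) : (digitPoly q a).degree < q := by
  rw [degree_lt_iff_coeff_zero]
  intro i hi
  have : a.testBit i = false :=
    Nat.testBit_lt_two_pow (lt_of_lt_of_le ha (Nat.pow_le_pow_right (by omega) hi))
  simp [coeff_digitPoly, this]

theorem eq_zero_of_digitPoly_eq_zero {q a : ℕ} (ha : a < 2 ^ q) (h : digitPoly q a = 0) : a = 0 := by
  refine Nat.eq_of_testBit_eq fun i => ?_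
  rcases le_or_gt q i with hi | hi
  · rw [Nat.testBit_lt_two_pow (lt_of_lt_of_le ha (Nat.pow_le_pow_right (by omega) hi))]
    simp
  · have := congrArg (coeff · i) h
    simp only [coeff_digitPoly, coeff_zero] at this
    simpa [hi.le] using this

/-- Doubling the number multiplies the polynomial by the variable, and the conditional exclusive or
adds the feedback polynomial, which vanishes at `g`. -/
theorem aeval_digitPoly_lfsr {A : Type*} [CommRing A] [Algebra (ZMod 2) A] {q f : ℕ} (hq : 0 < q)
    (hf : f < 2 ^ q) {g : A} (hg : aeval g (digitPoly q (2 ^ q ^^^ f)) = 0) (i : ℕ) :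
    aeval g (digitPoly q (lfsr (2 ^ q) f i)) = g ^ i := by
  induction i with
  | zero => simp [lfsr, digitPoly_one]
  | succ i ih =>
    unfold lfsr
    split_ifs
    · rw [digitPoly_two_mul (lfsr_lt hq hf i), map_mul, aeval_X, ih, pow_succ']
    · rw [Nat.xor_assoc, digitPoly_xor, digitPoly_two_mul (lfsr_lt hq hf i), map_add, hg, map_mul,
        aeval_X, ih, pow_succ', add_zero]

/-- The state of the shift register runs through the powers of a generator of a finite field. -/
structure FieldPow {K : Type} [Field K] (N f : ℕ) (φ : ℕ → K) (g : K) : Prop where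
  rep : FieldRep N φ
  pow : ∀ i, φ (lfsr N f i) = g ^ i
  period : g ^ (N - 1) = 1
  surj : ∀ a < N, a ≠ 0 → ∃ i < N - 1, lfsr N f i = a

/-- No irreducibility test is needed. Full period makes the powers of the root `g` with exponents
below `2 ^ q - 1` pairwise distinct, and they are nonzero since `g` is a unit. So they exhaust the
nonzero residues, and every nonzero residue is invertible. -/
theorem exists_fieldPow {q f : ℕ} (hq : 0 < q) (hf : f < 2 ^ q) (hp : Passes (2 ^ q) f) :
    ∃ (K : Type) (_ : Field K) (φ : ℕ → K) (g : K), FieldPow (2 ^ q) f φ g := by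
  have h2q : 1 < 2 ^ q := Nat.one_lt_two_pow hq.ne'
  set p := digitPoly q (2 ^ q ^^^ f) with hp'
  have hpf : p = X ^ q + digitPoly q f := by rw [hp', digitPoly_xor, digitPoly_two_pow]
  have hm : p.Monic := hpf ▸ monic_X_pow_add (degree_digitPoly_lt hf)
  have hdeg : p.degree = q := by
    rw [hpf, degree_add_eq_left_of_degree_lt] <;> rw [degree_X_pow]
    exact degree_digitPoly_lt hf
  set g := AdjoinRoot.root p
  have hφ : ∀ i, AdjoinRoot.mk p (digitPoly q (lfsr (2 ^ q) f i)) = g ^ i := fun i => by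
    rw [← AdjoinRoot.aeval_eq]
    exact aeval_digitPoly_lfsr hq hf (by rw [AdjoinRoot.aeval_eq, AdjoinRoot.mk_self]) i
  have hinj : ∀ a < 2 ^ q, AdjoinRoot.mk p (digitPoly q a) = 0 → a = 0 := fun a ha h => by
    refine eq_zero_of_digitPoly_eq_zero ha ?_
    by_contra h0
    exact hm.not_dvd_of_degree_lt h0 (by rw [hdeg]; exact degree_digitPoly_lt ha)
      (AdjoinRoot.mk_eq_zero.1 h)
  have hadd : ∀ x : AdjoinRoot p, x + x = 0 := fun x => by
    rw [← two_smul (ZMod 2), show (2 : ZMod 2) = 0 from rfl, zero_smul]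
  have hinj' : ∀ a < 2 ^ q, ∀ b < 2 ^ q,
      AdjoinRoot.mk p (digitPoly q a) = AdjoinRoot.mk p (digitPoly q b) → a = b := by
    intro a ha b hb h
    refine Nat.xor_eq_zero_iff.1 (hinj _ (Nat.xor_lt_two_pow ha hb) ?_)
    rw [digitPoly_xor, map_add, h, hadd]
  have hper : g ^ (2 ^ q - 1) = 1 := by rw [← hφ, hp.1, digitPoly_one, map_one]
  have hunit : IsUnit g := IsUnit.of_pow_eq_one hper (by omega)
  have hlt := lfsr_lt hq hf
  have hnt : Nontrivial (AdjoinRoot p) := by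
    refine ⟨⟨0, 1, fun h => ?_⟩⟩
    have := hinj 1 h2q (by rw [digitPoly_one, map_one, h])
    omega
  have hne : ∀ i, lfsr (2 ^ q) f i ≠ 0 := fun i h => by
    have h1 := hφ i
    rw [h, digitPoly_zero, map_zero] at h1
    exact (hunit.pow i).ne_zero h1.symm
  have hsurj : ∀ a < 2 ^ q, a ≠ 0 → ∃ i < 2 ^ q - 1, lfsr (2 ^ q) f i = a := by
    -- The register takes `2 ^ q - 1` distinct nonzero values below `2 ^ q`, hence all of them:
    -- equal values at exponents `i < j` would cancel to the value 1 at the exponent `j - i`,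
    -- against the full period.
    have h1 : (Finset.range (2 ^ q - 1)).image (lfsr (2 ^ q) f) = Finset.Ioo 0 (2 ^ q) := by
      refine Finset.eq_of_subset_of_card_le (fun a ha => ?_) ?_
      · obtain ⟨i, _, rfl⟩ := Finset.mem_image.1 ha
        exact Finset.mem_Ioo.2 ⟨Nat.pos_of_ne_zero (hne i), hlt i⟩
      · have hlt' : ∀ i j, i < j → j < 2 ^ q - 1 → lfsr (2 ^ q) f i ≠ lfsr (2 ^ q) f j := by
          intro i j hij hj h
          refine hp.2 (j - i) (by omega) (by omega) (hinj' _ (hlt _) _ h2q ?_)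
          rw [hφ, digitPoly_one, map_one]
          have h2 : g ^ i = g ^ j := by rw [← hφ, h, hφ]
          rw [show j = i + (j - i) by omega, pow_add] at h2
          exact (hunit.pow i).mul_left_cancel (by rw [mul_one, ← h2])
        rw [Finset.card_image_of_injOn, Finset.card_range, Nat.card_Ioo, Nat.sub_zero]
        intro i hi j hj h
        by_contra hij
        rcases Nat.lt_or_gt_of_ne hij with hij | hij
        · exact hlt' i j hij (Finset.mem_range.1 hj) h
        · exact hlt' j i hij (Finset.mem_range.1 hi) h.symm
    intro a ha ha0
    have : a ∈ (Finset.range (2 ^ q - 1)).image (lfsr (2 ^ q) f) := by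
      rw [h1, Finset.mem_Ioo]
      omega
    simpa using this
  have hall : ∀ x : AdjoinRoot p, ∃ a < 2 ^ q, AdjoinRoot.mk p (digitPoly q a) = x := by
    intro x
    induction x using AdjoinRoot.induction_on with
    | ih r =>
      induction r using Polynomial.induction_on' with
      | add r s hr hs =>
        obtain ⟨a, ha, hr⟩ := hr
        obtain ⟨b, hb, hs⟩ := hs
        exact ⟨a ^^^ b, Nat.xor_lt_two_pow ha hb, by rw [digitPoly_xor, map_add, map_add, hr, hs]⟩
      | monomial i c =>
        have hc : c = 0 ∨ c = 1 := by revert c; decide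
        rcases hc with rfl | rfl
        · exact ⟨0, by omega, by simp [digitPoly_zero]⟩
        · refine ⟨_, hlt i, ?_⟩
          rw [hφ, monomial_one_right_eq_X_pow, map_pow, AdjoinRoot.mk_X]
  have hF : IsField (AdjoinRoot p) := by
    refine ⟨⟨0, 1, zero_ne_one⟩, mul_comm, fun {x} hx => ?_⟩
    obtain ⟨a, ha, rfl⟩ := hall x
    obtain ⟨i, hi, rfl⟩ := hsurj a ha (by rintro rfl; simp [digitPoly_zero] at hx)
    exact ⟨g ^ (2 ^ q - 1 - i), by rw [hφ, ← pow_add, Nat.add_sub_cancel' hi.le, hper]⟩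
  letI := hF.toField
  refine ⟨AdjoinRoot p, hF.toField, fun a => AdjoinRoot.mk p (digitPoly q a), g, ⟨?_, hφ, hper, hsurj⟩⟩
  exact ⟨by simp [digitPoly_zero], by simp [digitPoly_one],
      fun a _ b _ => by rw [digitPoly_xor, map_add], hinj⟩

/-- Take the minimal polynomial of a generator of the multiplicative group of the field with `2 ^ q`
elements. The register then represents the powers of an element of order exactly `2 ^ q - 1`. -/
theorem exists_passes {q : ℕ} (hq : 1 < q) : ∃ f < 2 ^ q, Passes (2 ^ q) f := by
  have h2q : 1 < 2 ^ q := Nat.one_lt_two_pow (by omega)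
  have : Fact (Nat.Prime 2) := ⟨Nat.prime_two⟩
  let F := GaloisField 2 q
  have : Finite F := inferInstance
  have : Fintype F := Fintype.ofFinite F
  have hcard : Nat.card F = 2 ^ q := GaloisField.card 2 q (by omega)
  obtain ⟨g, hg⟩ := IsCyclic.exists_generator (α := Fˣ)
  have hord : orderOf g = 2 ^ q - 1 := by
    rw [orderOf_eq_card_of_forall_mem_zpowers hg, Nat.card_units, hcard]
  have hint : IsIntegral (ZMod 2) (g : F) := IsIntegral.of_finite _ _
  -- Every nonzero element is a power of the generator, so the generator has degree `q` over the
  -- prime field.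
  have htop : IntermediateField.adjoin (ZMod 2) {(g : F)} = ⊤ := by
    rw [eq_top_iff]
    intro x _
    by_cases hx : x = 0
    · rw [hx]; exact zero_mem _
    · obtain ⟨i, hi⟩ := Subgroup.mem_zpowers_iff.1 (hg (Units.mk0 x hx))
      have : x = (g : F) ^ i := by rw [← Units.val_zpow_eq_zpow_val, hi]; rfl
      rw [this]
      exact zpow_mem (IntermediateField.mem_adjoin_simple_self _ _) _
  have hdeg : (minpoly (ZMod 2) (g : F)).natDegree = q := by
    rw [← IntermediateField.adjoin.finrank hint, htop, IntermediateField.finrank_top',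
      GaloisField.finrank 2 (by omega)]
  set p := minpoly (ZMod 2) (g : F)
  -- The binary digits are the coefficients of the minimal polynomial below its leading one; bit `q`
  -- is contributed by `2 ^ q`.
  let f := Nat.ofBits fun i : Fin q => decide (p.coeff i = 1)
  have hf : f < 2 ^ q := Nat.ofBits_lt_two_pow _
  have hmon : p.Monic := minpoly.monic hint
  have hpf : digitPoly q (2 ^ q ^^^ f) = p := by
    ext i
    rw [digitPoly_xor, digitPoly_two_pow, coeff_add, coeff_X_pow, coeff_digitPoly]
    rcases lt_trichotomy i q with hi | rfl | hi
    · have : f.testBit i = decide (p.coeff i = 1) := Nat.testBit_ofBits_lt _ _ hi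
      rw [this, if_neg hi.ne]
      generalize p.coeff i = c
      simp only [hi.le, true_and, decide_eq_true_eq, zero_add]
      fin_cases c <;> rfl
    · have : f.testBit i = false := Nat.testBit_lt_two_pow hf
      rw [this]
      have := hmon.coeff_natDegree
      rw [hdeg] at this
      simp [this]
    · rw [if_neg hi.ne', if_neg (by omega), coeff_eq_zero_of_natDegree_lt (by omega), add_zero]
  have hφ := aeval_digitPoly_lfsr (by omega) hf (g := (g : F)) (by rw [hpf]; exact minpoly.aeval _ _)
  have hinj : ∀ a < 2 ^ q, aeval (g : F) (digitPoly q a) = 0 → a = 0 := fun a ha h => by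
    refine eq_zero_of_digitPoly_eq_zero ha ?_
    by_contra h0
    have h1 := minpoly.degree_le_of_ne_zero (ZMod 2) (g : F) h0 h
    rw [degree_eq_natDegree hmon.ne_zero, hdeg] at h1
    exact absurd (degree_digitPoly_lt ha) h1.not_gt
  refine ⟨f, hf, ?_, fun i hi hi' h => ?_⟩
  · refine Nat.xor_eq_zero_iff.1 (hinj _ (Nat.xor_lt_two_pow (lfsr_lt (by omega) hf _) h2q) ?_)
    rw [digitPoly_xor, map_add, hφ, digitPoly_one, map_one, ← hord, ← Units.val_pow_eq_pow_val,
      pow_orderOf_eq_one, Units.val_one]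
    exact CharTwo.add_self_eq_zero 1
  · have h1 := hφ i
    rw [h, digitPoly_one, map_one, ← Units.val_pow_eq_pow_val] at h1
    have h3 := orderOf_le_of_pow_eq_one hi (Units.val_eq_one.1 h1.symm)
    omega

end EdgeSetCycle

/-! ### The random trials and the smallest length with a nonzero value. -/

namespace EdgeSetCycle

local prefix:max "♯" => Ex.num
local prefix:max "®" => Ex.reg

variable {K : Type} [Field K] {P : Inst} {E : Env} {φ : ℕ → K} {σ σ' : St}

/-- The sum of two logarithms is less than `2 * (N - 1)`, and since the power `g ^ (N - 1)` is 1,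
the second copy of the table of exponentials gives the product. -/
theorem Base.of_tables {f : ℕ} {g : K} (hP : P.OK E) (hf : f < P.N) (hB : RegBase P σ)
    (hT : Tables P.N f (P.N - 1) σ) (hg : FieldPow P.N f φ g) : Base P φ σ := by
  obtain ⟨h1, hJ, hnJ, hL, hL', hil, hn3, hnm, hk0, hN, hN'⟩ := hP.facts
  have hlog : ∀ a < P.N, a ≠ 0 → σ.a 12 a < P.N - 1 ∧ φ a = g ^ σ.a 12 a := by
    intro a ha h0
    obtain ⟨i, hi, rfl⟩ := hg.surj a ha h0
    obtain ⟨h2, h3⟩ := hT.log i hi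
    exact ⟨h2, by rw [← hg.pow (σ.a 12 _), h3]⟩
  have hexp : ∀ i, i < P.N - 1 + (P.N - 1) → ∃ j, σ.a 11 i = lfsr P.N f j ∧ g ^ j = g ^ i := by
    intro i hi
    rcases lt_or_ge i (P.N - 1) with h | h
    · exact ⟨i, (hT.exp i h).1, rfl⟩
    · have h2 := (hT.exp (i - (P.N - 1)) (by omega)).2
      rw [Nat.sub_add_cancel h] at h2
      exact ⟨_, h2, by rw [← Nat.sub_add_cancel h, pow_add, hg.period, mul_one, Nat.add_sub_cancel]⟩
  have hq : 0 < P.q := by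
    by_contra h
    have : P.N = 1 := by simp [Inst.N, show P.q = 0 by omega]
    omega
  have hlt : ∀ i, lfsr P.N f i < P.N := lfsr_lt hq hf
  refine ⟨hB.r2, hB.r3, hB.r4, hB.r5, hB.r6, hB.r7, hB.r8, hB.r9, hB.r10, hB.r11, ?_⟩
  intro a ha ha0 b hb hb0
  obtain ⟨h2, h3⟩ := hlog a ha ha0
  obtain ⟨h4, h5⟩ := hlog b hb hb0
  obtain ⟨j, h6, h7⟩ := hexp (σ.a 12 a + σ.a 12 b) (by omega)
  refine ⟨by omega, h6 ▸ hlt j, ?_⟩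
  rw [h6, hg.pow, h7, pow_add, h3, h5]

/-- Of the marks of visited vertices and candidates only whether they vanish matters, which permits
replacing the actual arrays by the mathematical descriptions. -/
theorem totalVal_congr {vis vis' cand cand' : ℕ → ℕ} {X X' : ℕ → K} {pre : List ℕ} {s r d : ℕ}
    (hP : P.OK E) (hvis : ∀ v < P.n, vis v = 0 ↔ vis' v = 0)
    (hcand : ∀ d < 2 * P.m, cand d = 0 ↔ cand' d = 0) (hX : ∀ e < P.m, X e = X' e)
    (hd : d < 2 * P.m) :
    totalVal P vis cand X pre s r d = totalVal P vis' cand' X' pre s r d := by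
  have hg : ∀ lam r, gval P lam vis X s r = gval P lam vis' X' s r := by
    intro lam r
    induction r with
    | zero => rfl
    | succ r ih =>
      funext v j
      simp only [gval, ih]
      refine Finset.sum_congr rfl fun d hd => ?_
      have hd := Finset.mem_range.1 hd
      simp only [relaxTerm, hvis _ (hP.dst_lt hd), hX (d / 2) (by omega)]
  unfold totalVal roundVal
  refine Finset.sum_congr rfl fun y _ => ?_
  rw [hg]
  cases trace P.b (pre.map (lamOf P (wtY P y))) (P.J - 1) with
  | none => rfl
  | some j => simp only [hookVal, hookTerm, ne_eq, hcand d hd, hX (d / 2) (by omega)]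

theorem totalVal_eq_zero {vis cand : ℕ → ℕ} {X : ℕ → K} {pre : List ℕ} {s r d : ℕ}
    (h : cand d = 0) : totalVal P vis cand X pre s r d = 0 := by
  unfold totalVal roundVal
  refine Finset.sum_eq_zero fun y _ => ?_
  cases trace P.b (pre.map (lamOf P (wtY P y))) (P.J - 1) with
  | none => rfl
  | some j => simp [hookVal, hookTerm, h]

/-- The darts from `s` that are candidates for the first dart of a cycle. -/
def firstCand (P : Inst) (s d : ℕ) : ℕ :=
  if P.src d = s ∧ s < P.dst d ∧ P.tab 0 (d / 2) = 1 then 1 else 0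

theorem firstP_spec {v s : ℕ} (hP : P.OK E) (h3 : σ.r 3 = P.m) (h9 : σ.r 9 = 2 * P.m)
    (hs : σ.r v = s) (hv : v ≠ 25 ∧ v ≠ 27 ∧ v ≠ 33) :
    WP E (firstP v) (400 * P.m) (fun σ' => (∀ d < 2 * P.m, σ'.a 8 d = firstCand P s d) ∧
      (σ'.r 33 ≠ 0 ↔ ∃ d < 2 * P.m, firstCand P s d ≠ 0)) σ := by
  obtain ⟨h1, hJ, hnJ, hL, hL', hil, hn3, hnm, hk0, hN, hN'⟩ := hP.facts
  apply WP.le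
  · apply WP.set_then (v := 0) (by simp [Ex.ok]) rfl
    apply WP.set_then (v := 0) (by simp [Ex.ok]) rfl
    refine WP.for (2 * P.m) (fun j τ => (∀ d < j, τ.a 8 d = firstCand P s d) ∧
      (τ.r 33 ≠ 0 ↔ ∃ d < j, firstCand P s d ≠ 0)) (by simp [Stm.wr])
      (by simp [Stm.wr]) (by decide) (by simp [h9]) (by omega) (by simp) ?_ (fun _ _ h => h)
      (t₁ := 120) le_rfl
    rintro d hd τ hf hr ⟨hI, hI'⟩
    have e3 : τ.r 3 = P.m := (hf.r 3 (by simp [Stm.wr, Stm.for])).trans (by simp [h3])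
    have e9 : τ.r 9 = 2 * P.m := (hf.r 9 (by simp [Stm.wr, Stm.for])).trans (by simp [h9])
    have e27 : τ.r 27 = 0 := (hf.r 27 (by simp [Stm.wr, Stm.for])).trans (by simp)
    have ev : τ.r v = s := (hf.r v (by simp [Stm.wr, Stm.for, hv])).trans (by simp [hv, hs])
    have ht := tabE_ok hP e3 e9 e27 hr hk0 hd
    have hsr := srcE_ok hP hr hd
    have hds := dstE_ok hP hr hd
    have htab : P.tab 0 (d / 2) = 0 ∨ P.tab 0 (d / 2) = 1 := by
      have := hP.tab_le 0 hk0 (d / 2) (by omega)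
      omega
    have hc : (if P.src d = s then 1 else 0) * (if s < P.dst d then 1 else 0) * P.tab 0 (d / 2) =
        firstCand P s d := by
      unfold firstCand
      rcases htab with h | h <;> split_ifs <;> simp_all
    have hc1 : firstCand P s d = 0 ∨ firstCand P s d = 1 := by
      unfold firstCand
      split_ifs <;> simp
    apply WP.le
    · apply WP.put_then (v := firstCand P s d) (y := d) (by simp [Ex.ok]) (by simp [Ex.val, hr])
        (by omega)
      · simp only [Ex.ok, BOp.ok, Ex.val, BOp.val, ht, hsr, hds, true_and, and_true, ev]
        rcases htab with h | h <;> split_ifs <;> simp [h, E.w_pos.ne']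
      · simp only [Ex.val, BOp.val, ht, hsr, hds, ev, hc]
      refine WP.straight (t := 20) (Nat.le_of_ble_eq_true rfl) ?_
      have hlast : ∀ d' < d + 1, (if d' = d then firstCand P s d else τ.a 8 d') = firstCand P s d' := by
        intro d' hd'
        split_ifs with h
        · rw [h]
        · exact hI d' (by omega)
      have hex : (∃ d' < d + 1, firstCand P s d' ≠ 0) ↔
          (∃ d' < d, firstCand P s d' ≠ 0) ∨ firstCand P s d ≠ 0 := by
        simp only [Nat.lt_succ_iff_lt_or_eq]
        aesop
      have hdL : d < E.L := by omega
      rcases hc1 with h | h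
      · simp only [Stm.pre, Ex.ok, Ex.val, hr, h, St.seta_r, St.seta_a, if_true, ne_eq, not_true,
          if_false, true_and, St.setr_a, St.setr_r, hdL]
        rw [h] at hlast hex
        exact ⟨hlast, hI'.trans (by rw [hex]; simp)⟩
      · simp only [Stm.pre, Ex.ok, Ex.val, hr, h, St.seta_r, St.seta_a, if_true, ne_eq, one_ne_zero,
          not_false_eq_true, true_and, St.setr_a, St.setr_r, h1, hdL]
        rw [h] at hlast hex
        exact ⟨hlast, by simpa using hex⟩
    · simp [Ex.cost, tabE, srcE, dstE]
  · simp [Ex.cost]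
    omega

/-- The sum that decides whether there is a cycle of length `r + 1` whose smallest vertex is `s`,
or rather whose first dart is a candidate from `s`. -/
def decVal (P : Inst) (X : ℕ → K) (s r : ℕ) : K :=
  ∑ d ∈ Finset.range (2 * P.m), totalVal P (fun _ => 0) (firstCand P s) X [] s r d

theorem decVal_congr {X X' : ℕ → K} {s r : ℕ} (hP : P.OK E) (hX : ∀ e < P.m, X e = X' e) :
    decVal P X s r = decVal P X' s r :=
  Finset.sum_congr rfl fun _ hd =>
    totalVal_congr hP (fun _ _ => Iff.rfl) (fun _ _ => Iff.rfl) hX (Finset.mem_range.1 hd)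

/-- The number assigned to the edge `e` in trial `t`. -/
def draw (P : Inst) (E : Env) (t e : ℕ) : ℕ := (E.tape (t * P.m + e)).toNat &&& (P.N - 1)

theorem draw_lt (t e : ℕ) : draw P E t e < P.N := by
  have : draw P E t e ≤ P.N - 1 := Nat.and_le_right
  have := P.N_pos
  omega

variable (φ) in
/-- Register 34 holds the smallest parameter for which a value has been nonzero, for the trials and
starting vertices in `D`. -/
structure Best (P : Inst) (E : Env) (D : ℕ → ℕ → Prop) (σ : St) : Prop where
  le : σ.r 34 ≤ P.n
  spec : σ.r 34 < P.n → σ.r 35 < P.n ∧ ∃ t, (∀ e < P.m, σ.a 1 e = draw P E t e) ∧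
    decVal P (fun e => φ (draw P E t e)) (σ.r 35) (σ.r 34) ≠ 0
  min : ∀ t s, D t s → ∀ r < P.n, decVal P (fun e => φ (draw P E t e)) s r ≠ 0 → σ.r 34 ≤ r

/-- The number of vertices that have candidates for the first dart. -/
def actCard (P : Inst) : ℕ :=
  ((Finset.range P.n).filter fun s => ∃ d < 2 * P.m, firstCand P s d ≠ 0).card

theorem WP.rnd_then {i t : ℕ} {q : Stm} {Q : St → Prop}
    (h : WP E q t Q ⟨(σ.setr i (E.tape σ.d).toNat).r, σ.a, σ.o, σ.d + 1⟩) :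
    WP E (.seq (.rnd i) q) (t + 2) Q σ := by
  obtain ⟨σ', t', he, hle, hQ⟩ := h
  exact ⟨σ', _, Exec.rnd.seq he, by omega, hQ⟩

theorem drawP_spec {t : ℕ} (hP : P.OK E) (h3 : σ.r 3 = P.m) (h10 : σ.r 10 = P.N - 1)
    (hd : σ.d = t * P.m) :
    WP E drawP (100 * P.m)
      (fun σ' => (∀ e < P.m, σ'.a 0 e = draw P E t e) ∧ σ'.d = (t + 1) * P.m) σ := by
  obtain ⟨h1, hJ, hnJ, hL, hL', hil, hn3, hnm, hk0, hN, hN'⟩ := hP.facts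
  apply WP.le
  · refine WP.for P.m (fun j τ => (∀ e < j, τ.a 0 e = draw P E t e) ∧ τ.d = t * P.m + j)
      (by decide) (by decide) (by decide) h3 (by omega) (by simpa using hd) ?_
      (fun τ _ h => ⟨h.1, by rw [h.2]; ring⟩) (t₁ := 40) le_rfl
    rintro e he τ hf hr ⟨hI, hId⟩
    have e10 : τ.r 10 = P.N - 1 := (hf.r 10 (by decide)).trans h10
    apply WP.le
    · apply WP.rnd_then
      apply WP.put (v := draw P E t e) (y := e) (by simp [Ex.ok]) (by simp [Ex.val, hr])
        (by omega) (by simp [Ex.ok, BOp.ok])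
      · simp [Ex.val, BOp.val, e10, draw, hId]
      · refine ⟨fun e' he' => ?_, by simp [hId, add_assoc]⟩
        simp only [St.setr_a, St.seta_a]
        split_ifs with h
        · rw [h]
        · exact hI e' (by omega)
    · simp [Ex.cost]
  · omega

/-- The search for the smallest parameter with a nonzero value. -/
theorem minP_spec {s : ℕ} {γ : ℕ → K} (hP : P.OK E) (hφ : FieldRep P.N φ) (h2 : σ.r 2 = P.n)
    (h12 : σ.r 12 = s) (h6 : RepV φ P σ 6 P.n γ) :
    WP E minP (100 * P.n)
      (fun σ' => (∀ r < P.n, γ r ≠ 0 → σ'.r 34 ≤ r) ∧ σ'.r 34 ≤ σ.r 34 ∧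
        ((σ'.r 36 = 0 ∧ σ'.r 34 = σ.r 34 ∧ σ'.r 35 = σ.r 35) ∨
        (σ'.r 36 ≠ 0 ∧ σ'.r 34 < P.n ∧ γ (σ'.r 34) ≠ 0 ∧ σ'.r 35 = s))) σ := by
  obtain ⟨h1, hJ, hnJ, hL, hL', hil, hn3, hnm, hk0, hN, hN'⟩ := hP.facts
  apply WP.le
  · apply WP.set_then (v := 0) (by simp [Ex.ok]) rfl
    refine WP.for P.n (fun j τ => (∀ r < j, γ r ≠ 0 → τ.r 34 ≤ r) ∧ τ.r 34 ≤ σ.r 34 ∧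
        ((τ.r 36 = 0 ∧ τ.r 34 = σ.r 34 ∧ τ.r 35 = σ.r 35) ∨
        (τ.r 36 ≠ 0 ∧ τ.r 34 < P.n ∧ γ (τ.r 34) ≠ 0 ∧ τ.r 35 = s)))
      (by decide) (by decide) (by decide) (by simpa using h2) (by omega) (by simp) ?_
      (fun τ _ h => h) (t₁ := 40) le_rfl
    rintro j hj τ hf hr ⟨hI, hI', hI''⟩
    have e12 : τ.r 12 = s := (hf.r 12 (by decide)).trans (by simpa using h12)
    have e6 : τ.a 6 j = σ.a 6 j := congrFun (hf.a 6 (by decide)) j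
    obtain ⟨g1, g2⟩ := h6 j hj
    have g3 : σ.a 6 j = 0 ↔ γ j = 0 := by
      rw [← g2]
      exact ⟨fun h => by rw [h, hφ.zero], hφ.inj _ g1⟩
    have hjL : j < E.L := by omega
    refine WP.straight (Nat.le_of_ble_eq_true rfl) ?_
    by_cases h0 : σ.a 6 j = 0
    · simp only [Stm.pre, Ex.ok, Ex.val, hr, e6, h0, true_and, ne_eq, not_true, if_false, hjL,
        St.setr_r, show (34 : ℕ) ≠ 24 by decide, show (36 : ℕ) ≠ 24 by decide,
        show (35 : ℕ) ≠ 24 by decide]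
      refine ⟨fun r hr h => ?_, hI', hI''⟩
      rcases Nat.lt_succ_iff_lt_or_eq.1 hr with hr | rfl
      · exact hI r hr h
      · exact absurd (g3.1 h0) h
    · by_cases hlt : j < τ.r 34
      · simp only [Stm.pre, Ex.ok, Ex.val, hr, e6, h0, true_and, ne_eq, not_false_eq_true, if_true,
          hjL, BOp.ok, BOp.val, hlt, one_ne_zero, e12, St.setr_r,
          Nat.reduceEqDiff, if_false, false_and, false_or, h1]
        refine ⟨fun r hr h => ?_, by omega, hj, by rw [← g3]; exact ⟨h0, trivial⟩⟩
        rcases Nat.lt_succ_iff_lt_or_eq.1 hr with hr | rfl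
        · have := hI r hr h
          omega
        · exact le_rfl
      · simp only [Stm.pre, Ex.ok, Ex.val, hr, e6, h0, true_and, ne_eq, not_false_eq_true, if_true,
          hjL, BOp.ok, BOp.val, hlt, if_false, not_true, St.setr_r, show (34 : ℕ) ≠ 24 by decide,
          show (36 : ℕ) ≠ 24 by decide, show (35 : ℕ) ≠ 24 by decide]
        refine ⟨fun r hr h => ?_, hI', hI''⟩
        rcases Nat.lt_succ_iff_lt_or_eq.1 hr with hr | rfl
        · exact hI r hr h
        · omega
  · simp [Ex.cost]
    omega

/-- One starting vertex in one trial. -/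
theorem vertexP_spec {t s : ℕ} {D : ℕ → ℕ → Prop} (hP : P.OK E) (hB : Base P φ σ)
    (hφ : FieldRep P.N φ) (hx : ∀ e < P.m, σ.a 0 e = draw P E t e) (h13 : σ.r 13 = P.n)
    (h14 : σ.r 14 = 0) (h9 : ∀ v < P.n, σ.a 9 v = 0) (hs : σ.r 12 = s) (hsn : s < P.n)
    (hI : Best φ P E D σ) :
    WP E vertexP
      (500 * P.m + if ∃ d < 2 * P.m, firstCand P s d ≠ 0 then 21000 * (P.Y * (P.m * P.J * P.n)) else 0)
      (Best φ P E fun t' s' => D t' s' ∨ t' = t ∧ s' = s) σ := by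
  obtain ⟨h1, hJ, hnJ, hL, hL', hil, hn3, hnm, hk0, hN, hN'⟩ := hP.facts
  refine WP.seq (t₁ := 400 * P.m) (firstP_spec hP hB.r3 hB.r9 hs (by decide)) (fun τ hf h => ?_)
    (t₂ := 80 * P.m + if ∃ d < 2 * P.m, firstCand P s d ≠ 0 then
      21000 * (P.Y * (P.m * P.J * P.n)) else 0) (by omega)
  have hrr : ∀ i ∈ [12, 13, 14, 34, 35], τ.r i = σ.r i := fun i hi => hf.r i (by revert i; decide)
  have haa : ∀ A ∈ [0, 1, 9], τ.a A = σ.a A := fun A hA => hf.a A (by revert A; decide)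
  have hB₁ := hB.frame hf
  have hXX : ∀ {τ' : St}, τ'.a 0 = σ.a 0 → ∀ e < P.m, φ (τ'.a 0 e) = φ (draw P E t e) :=
    fun h e he => by rw [h, hx e he]
  by_cases hc : ∃ d < 2 * P.m, firstCand P s d ≠ 0
  · rw [if_pos hc]
    have e33 : τ.r 33 ≠ 0 := h.2.2 hc
    have hmin : P.m * P.n ≤ P.Y * (P.m * P.J * P.n) := by
      calc P.m * P.n ≤ P.m * P.n * (P.Y * P.J) :=
            Nat.le_mul_of_pos_right _ (Nat.mul_pos P.Y_pos hJ)
        _ = _ := by ring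
    have hmn : P.m ≤ P.m * P.n := Nat.le_mul_of_pos_right _ (by omega)
    refine WP.ite (t₁ := 20000 * (P.Y * (P.m * P.J * P.n)) + (100 * P.n +
      (60 * P.m + 70) + 1) + 1) (by simp [Ex.ok]) (fun _ => ?_)
      (fun hv => absurd hv e33) (by simp [Ex.cost]; omega)
    refine WP.then (sumP_spec hP hB₁ hφ
      (fun e he => by rw [haa 0 (by decide), hx e he]; exact draw_lt _ _)
      ((hrr 14 (by decide)).trans h14) (by omega) (by simp) ((hrr 12 (by decide)).trans hs) hsn
      ((hrr 13 (by decide)).trans h13) (by omega) le_rfl) ?_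
    rintro τ₁ hf₁ ⟨h6, -⟩
    have hB₂ := hB₁.frame hf₁
    have hrr₁ : ∀ i ∈ [12, 13, 14, 34, 35], τ₁.r i = σ.r i := fun i hi =>
      (hf₁.r i (by revert i; decide)).trans (hrr i hi)
    have haa₁ : ∀ A ∈ [0, 1, 9], τ₁.a A = σ.a A := fun A hA =>
      (hf₁.a A (by revert A; decide)).trans (haa A hA)
    have h6' : RepV φ P τ₁ 6 P.n (decVal P (fun e => φ (draw P E t e)) s) := by
      refine h6.congr rfl fun r hr => ?_
      rw [if_pos hr]
      refine Finset.sum_congr rfl fun d hd => ?_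
      refine totalVal_congr hP (fun v hv => ?_) (fun d hd => by rw [h.1 d hd])
        (hXX (haa 0 (by decide))) (Finset.mem_range.1 hd)
      rw [haa 9 (by decide), h9 v hv]
    refine WP.then (minP_spec hP hφ hB₂.r2 ((hrr₁ 12 (by decide)).trans hs) h6') ?_
    rintro τ₂ hf₂ ⟨g1, g2, g3⟩
    have haa₂ : ∀ A ∈ [0, 1, 9], τ₂.a A = σ.a A := fun A hA =>
      (hf₂.a A (by revert A; decide)).trans (haa₁ A hA)
    have e34 : τ₁.r 34 = σ.r 34 := hrr₁ 34 (by decide)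
    have e35 : τ₁.r 35 = σ.r 35 := hrr₁ 35 (by decide)
    have hmin' : ∀ t' s', (D t' s' ∨ t' = t ∧ s' = s) → ∀ r < P.n,
        decVal P (fun e => φ (draw P E t' e)) s' r ≠ 0 → τ₂.r 34 ≤ r := by
      rintro t' s' (hD | ⟨rfl, rfl⟩) r hr hne
      · exact g2.trans (e34.le.trans (hI.min t' s' hD r hr hne))
      · exact g1 r hr hne
    apply WP.le
    · apply WP.cond (by simp [Ex.ok])
      · intro hv
        replace g3 := g3.resolve_left fun h => hv h.1
        refine (copyP_spec (by decide) ((hB₂.frame hf₂).r3) (by decide) (by omega)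
          (by omega)).mono le_rfl fun τ₃ hf₃ h₃ => ?_
        have e34' : τ₃.r 34 = τ₂.r 34 := hf₃.r 34 (by decide)
        have e35' : τ₃.r 35 = τ₂.r 35 := hf₃.r 35 (by decide)
        refine ⟨by rw [e34']; exact g3.2.1.le, fun _ => ?_, by rw [e34']; exact hmin'⟩
        rw [e34', e35', g3.2.2.2]
        refine ⟨hsn, t, fun e he => ?_, g3.2.2.1⟩
        rw [h₃ e, if_pos he, haa₂ 0 (by decide), hx e he]
      · intro hv
        replace g3 := g3.resolve_right fun h => h.1 hv
        apply WP.skip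
        refine ⟨by rw [g3.2.1, e34]; exact hI.le, ?_, hmin'⟩
        rw [g3.2.1, g3.2.2, e34, e35, haa₂ 1 (by decide)]
        exact hI.spec
    · simp [Ex.cost]
      omega
  · rw [if_neg hc]
    have e33 : τ.r 33 = 0 := not_not.1 (mt h.2.1 hc)
    refine WP.ite (t₁ := 1) (by simp [Ex.ok]) (fun hv => absurd e33 (show τ.r 33 ≠ 0 from hv)) (fun _ => WP.skip ?_) (by simp [Ex.cost]; omega)
    refine ⟨by rw [hrr 34 (by decide)]; exact hI.le, ?_, ?_⟩
    · rw [hrr 34 (by decide), hrr 35 (by decide), haa 1 (by decide)]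
      exact hI.spec
    · rw [hrr 34 (by decide)]
      rintro t' s' (hD | ⟨rfl, rfl⟩) r hr hne
      · exact hI.min t' s' hD r hr hne
      · refine absurd (Finset.sum_eq_zero fun d hd => totalVal_eq_zero ?_) hne
        by_contra h0
        exact hc ⟨d, Finset.mem_range.1 hd, h0⟩

theorem Best.congr {D D' : ℕ → ℕ → Prop} (h : Best φ P E D σ) (h34 : σ'.r 34 = σ.r 34)
    (h35 : σ'.r 35 = σ.r 35) (h1 : σ'.a 1 = σ.a 1) (hD : ∀ t, ∀ s < P.n, D' t s → D t s)
    (hD' : ∀ t s, D' t s → s < P.n) : Best φ P E D' σ' :=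
  ⟨h34 ▸ h.le, by rw [h34, h35, h1]; exact h.spec,
    by rw [h34]; exact fun t s h' => h.min t s (hD t s (hD' t s h') h')⟩

theorem trialP_spec {t : ℕ} (hP : P.OK E) (hB : Base P φ σ)
    (hφ : FieldRep P.N φ) (h13 : σ.r 13 = P.n)
    (h14 : σ.r 14 = 0) (h9 : ∀ v < P.n, σ.a 9 v = 0) (hd : σ.d = t * P.m)
    (hI : Best φ P E (fun t' s' => t' < t ∧ s' < P.n) σ) :
    WP E trialP (700 * (P.m * P.n) + actCard P * (21000 * (P.Y * (P.m * P.J * P.n))))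
      (fun σ' => σ'.d = (t + 1) * P.m ∧ Best φ P E (fun t' s' => t' < t + 1 ∧ s' < P.n) σ') σ := by
  obtain ⟨h1, hJ, hnJ, hL, hL', hil, hn3, hnm, hk0, hN, hN'⟩ := hP.facts
  apply WP.le
  · apply WP.then (drawP_spec hP hB.r3 hB.r10 hd)
    rintro τ hf ⟨hx, hd'⟩
    have hB₁ := hB.frame hf
    refine (WP.for_sum P.n (fun s => 500 * P.m + if ∃ d < 2 * P.m, firstCand P s d ≠ 0 then
      21000 * (P.Y * (P.m * P.J * P.n)) else 0)
      (fun s τ' => Best φ P E (fun t' s' => (t' < t ∧ s' < P.n) ∨ (t' = t ∧ s' < s)) τ')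
      (by decide) (by decide) (by decide) hB₁.r2 (by omega) ?_ ?_
      (Q := fun σ' => Best φ P E (fun t' s' => t' < t + 1 ∧ s' < P.n) σ') ?_).mono le_rfl ?_
    · exact hI.congr (by simp [hf.r 34 (by decide)]) (by simp [hf.r 35 (by decide)])
        (by simp [hf.a 1 (by decide)]) (by simp) (by simp)
    · intro s hs τ' hf' hr hI'
      have hB₂ := hB₁.frame hf' (by decide) (by decide)
      refine (vertexP_spec (t := t) (s := s) hP hB₂ hφ
        (by rw [hf'.a 0 (by decide)]; exact hx)
        ((hf'.r 13 (by decide)).trans ((hf.r 13 (by decide)).trans h13))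
        ((hf'.r 14 (by decide)).trans ((hf.r 14 (by decide)).trans h14))
        (by rw [hf'.a 9 (by decide), hf.a 9 (by decide)]; exact h9) hr hs hI').mono le_rfl
        fun τ'' _ h'' => ?_
      refine h''.congr (by simp) (by simp) rfl ?_ ?_
      · rintro t' s' _ (h | ⟨rfl, h⟩)
        · exact Or.inl (Or.inl h)
        · rcases Nat.lt_succ_iff_lt_or_eq.1 h with h | rfl
          · exact Or.inl (Or.inr ⟨rfl, h⟩)
          · exact Or.inr ⟨rfl, rfl⟩
      · rintro t' s' (h | ⟨rfl, h⟩)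
        · exact h.2
        · omega
    · intro τ' hf' hI'
      refine hI'.congr rfl rfl rfl ?_ ?_
      · rintro t' s' _ ⟨h, h'⟩
        rcases Nat.lt_succ_iff_lt_or_eq.1 h with h | rfl
        · exact Or.inl ⟨h, h'⟩
        · exact Or.inr ⟨rfl, h'⟩
      · exact fun t' s' h => h.2
    · exact fun τ' hf' h => ⟨(hf'.d (by decide)).trans hd', h⟩
  -- The expensive summand occurs once for each active starting vertex, which is what `actCard`
  -- counts.
  · have hs : ∑ s ∈ Finset.range P.n, (500 * P.m + (if ∃ d < 2 * P.m, firstCand P s d ≠ 0 then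
      21000 * (P.Y * (P.m * P.J * P.n)) else 0) + 20) =
      P.n * (500 * P.m + 20) + actCard P * (21000 * (P.Y * (P.m * P.J * P.n))) := by
      rw [actCard, Finset.card_filter, Finset.sum_mul, ← smul_eq_mul (a := P.n),
        ← Finset.card_range P.n, ← Finset.sum_const, Finset.card_range, ← Finset.sum_add_distrib]
      refine Finset.sum_congr rfl fun s _ => ?_
      split_ifs <;> simp <;> ring
    rw [hs]
    have hmn : P.m ≤ P.m * P.n := Nat.le_mul_of_pos_right _ (by omega)
    have : P.n * (500 * P.m + 20) = 500 * (P.m * P.n) + 20 * P.n := by ring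
    nlinarith

/-- The factor `R` is compiled into the program as a textual repetition, since it depends only on
`W`; the factor `n` in the number of trials comes from a loop. Distinct trials read disjoint blocks
of `m` random words. -/
theorem trialsP_spec (R : ℕ) (hP : P.OK E) (hB : Base P φ σ)
    (hφ : FieldRep P.N φ) (h9 : ∀ v < P.n, σ.a 9 v = 0) (hd : σ.d = 0) :
    WP E (trialsP R) (50 + R * (50 + (P.n + 1) * (720 * (P.m * P.n) +
        actCard P * (21000 * (P.Y * (P.m * P.J * P.n))))))
      (fun σ' => Base P φ σ' ∧ (∀ v, σ'.a 9 v = σ.a 9 v) ∧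
        Best φ P E (fun t' s' => t' < R * P.n ∧ s' < P.n) σ') σ := by
  obtain ⟨h1, hJ, hnJ, hL, hL', hil, hn3, hnm, hk0, hN, hN'⟩ := hP.facts
  apply WP.le
  · apply WP.set_then (v := P.n) (by simp [Ex.ok]) (by simp [Ex.val, hB.r2])
    apply WP.set_then (v := P.n) (by simp [Ex.ok]) (by simp [Ex.val, hB.r2])
    apply WP.set_then (v := 0) (by simp [Ex.ok]) rfl
    refine (WP.rep (t := (P.n + 1) * (700 * (P.m * P.n) + actCard P * (21000 *
      (P.Y * (P.m * P.J * P.n))) + 20)) (fun i τ => τ.d = i * P.n * P.m ∧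
      Best φ P E (fun t' s' => t' < i * P.n ∧ s' < P.n) τ) ?_ R ?_).mono le_rfl ?_
    · exact ⟨by simp [hd], by simp, by simp, by simp⟩
    · rintro i hi τ hf ⟨hd', hI⟩
      have hBτ : Base P φ τ := by
        constructor
        iterate 10 rw [hf.r _ (by decide)]; simp [hB.r2, hB.r3, hB.r4, hB.r5, hB.r6, hB.r7, hB.r8, hB.r9, hB.r10, hB.r11]
        rw [hf.a 11 (by decide), hf.a 12 (by decide)]
        exact hB.mul
      refine WP.for P.n (fun j τ' => τ'.d = (i * P.n + j) * P.m ∧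
        Best φ P E (fun t' s' => t' < i * P.n + j ∧ s' < P.n) τ') (by decide) (by decide)
        (by decide) hBτ.r2 (by omega)
        ⟨by simp [hd'], hI.congr (by simp) (by simp) rfl (by simp) (by simp)⟩
        ?_ (fun τ' _ h => by rwa [Nat.succ_mul]) le_rfl
      rintro j hj τ' hf' hr ⟨hd'', hI'⟩
      refine (trialP_spec (t := i * P.n + j) hP (hBτ.frame hf') hφ
        ((hf'.r 13 (by decide)).trans ((hf.r 13 (by decide)).trans (by simp)))
        ((hf'.r 14 (by decide)).trans ((hf.r 14 (by decide)).trans (by simp)))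
        (by rw [hf'.a 9 (by decide), hf.a 9 (by decide)]; exact h9) hd'' hI').mono le_rfl ?_
      rintro τ'' _ ⟨g1, g2⟩
      exact ⟨by simpa [add_assoc] using g1,
        g2.congr (by simp) (by simp) rfl (by simp [add_assoc]) (by simp)⟩
    · rintro τ - ⟨hf, -, hI⟩
      refine ⟨?_, fun v => by rw [hf.a 9 (by decide)]; rfl, hI⟩
      constructor
      iterate 10 rw [hf.r _ (by decide)]; simp [hB.r2, hB.r3, hB.r4, hB.r5, hB.r6, hB.r7, hB.r8, hB.r9, hB.r10, hB.r11]
      rw [hf.a 11 (by decide), hf.a 12 (by decide)]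
      exact hB.mul
  · simp only [Ex.cost]
    have : 1 ≤ P.m * P.n := Nat.mul_pos (by omega) (by omega)
    have h2 : R * ((P.n + 1) * (700 * (P.m * P.n) + actCard P * (21000 *
      (P.Y * (P.m * P.J * P.n))) + 20) + 1) ≤ R * (50 + (P.n + 1) * (720 * (P.m * P.n) +
        actCard P * (21000 * (P.Y * (P.m * P.J * P.n))))) := by
      refine Nat.mul_le_mul_left _ ?_
      have : (P.n + 1) * (700 * (P.m * P.n) + actCard P * (21000 *
        (P.Y * (P.m * P.J * P.n))) + 20) ≤ (P.n + 1) * (720 * (P.m * P.n) +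
        actCard P * (21000 * (P.Y * (P.m * P.J * P.n)))) := Nat.mul_le_mul_left _ (by omega)
      omega
    omega

end EdgeSetCycle

/-! ### Reconstruction, verification and output of the cycle. -/

namespace EdgeSetCycle

local prefix:max "♯" => Ex.num
local prefix:max "®" => Ex.reg

variable {K : Type} [Field K] {P : Inst} {E : Env} {φ : ℕ → K} {σ σ' : St}

/-- The vertex `v` is one of the heads of the first `j` darts. -/
def visOf (P : Inst) (pe : ℕ → ℕ) (j v : ℕ) : ℕ := if ∃ i < j, P.dst (pe i) = v then 1 else 0

/-- The candidates for the dart after the first `j` darts. -/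
def candOf (P : Inst) (pe : ℕ → ℕ) (s j d : ℕ) : ℕ :=
  if j = 0 then firstCand P s d
  else if P.src d = P.dst (pe (j - 1)) ∧ visOf P pe j (P.dst d) = 0 then 1 else 0

/-- The value of the dart `d` as the next dart after the first `j` darts. -/
def stepVal (P : Inst) (X : ℕ → K) (pe : ℕ → ℕ) (s r j d : ℕ) : K :=
  totalVal P (visOf P pe j) (candOf P pe s j) X ((List.range j).map fun i => pe i / 2) s (r - j) d

theorem visOf_congr {pe pe' : ℕ → ℕ} {j : ℕ} (h : ∀ i < j, pe i = pe' i) :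
    visOf P pe j = visOf P pe' j := by
  funext v
  have : (∃ i < j, P.dst (pe i) = v) ↔ ∃ i < j, P.dst (pe' i) = v := by
    refine exists_congr fun i => and_congr_right fun hi => by rw [h i hi]
  simp only [visOf, this]

theorem candOf_congr {pe pe' : ℕ → ℕ} {s j : ℕ} (h : ∀ i < j, pe i = pe' i) :
    candOf P pe s j = candOf P pe' s j := by
  funext d
  rcases j with _ | j
  · rfl
  · simp only [candOf, visOf_congr h, Nat.add_sub_cancel, h j (Nat.lt_succ_self j)]

theorem stepVal_congr {X : ℕ → K} {pe pe' : ℕ → ℕ} {s r j : ℕ} (h : ∀ i < j, pe i = pe' i) (d : ℕ) :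
    stepVal P X pe s r j d = stepVal P X pe' s r j d := by
  have : (List.range j).map (fun i => pe i / 2) = (List.range j).map fun i => pe' i / 2 :=
    List.map_congr_left fun i hi => by rw [h i (List.mem_range.1 hi)]
  rw [stepVal, stepVal, visOf_congr h, candOf_congr h, this]

/-- The dart `pe j` has a nonzero value if possible. -/
def Good (P : Inst) (X : ℕ → K) (pe : ℕ → ℕ) (s r j : ℕ) : Prop :=
  pe j < 2 * P.m ∧ ((∃ d < 2 * P.m, stepVal P X pe s r j d ≠ 0) → stepVal P X pe s r j (pe j) ≠ 0)

theorem Good.congr {X : ℕ → K} {pe pe' : ℕ → ℕ} {s r j : ℕ} (hg : Good P X pe s r j)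
    (h : ∀ i ≤ j, pe i = pe' i) : Good P X pe' s r j := by
  have h' := fun d => stepVal_congr (P := P) (X := X) (s := s) (r := r)
    (fun i hi => (h i (le_of_lt hi)).symm) d
  simp only [Good, h', ← h j le_rfl]
  exact hg

theorem nextCandP_spec {s j : ℕ} {pe : ℕ → ℕ} (hP : P.OK E) (h3 : σ.r 3 = P.m)
    (h9 : σ.r 9 = 2 * P.m) (h14 : σ.r 14 = j)
    (h40 : σ.r 40 = if j = 0 then s else P.dst (pe (j - 1)))
    (hvis : ∀ v < P.n, σ.a 9 v = 0 ↔ visOf P pe j v = 0) :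
    WP E nextCandP (500 * P.m)
      (fun σ' => ∀ d < 2 * P.m, σ'.a 8 d = candOf P pe s j d) σ := by
  obtain ⟨h1, hJ, hnJ, hL, hL', hil, hn3, hnm, hk0, hN, hN'⟩ := hP.facts
  refine WP.ite (t₁ := 450 * P.m) (by simp [Ex.ok]) (fun hv => ?_) (fun hv => ?_)
    (by simp [Ex.cost]; omega)
  · replace hv : j ≠ 0 := h14 ▸ hv
    rw [if_neg hv] at h40
    apply WP.le
    · refine WP.for (2 * P.m) (fun i τ => ∀ d < i, τ.a 8 d = candOf P pe s j d) (by decide)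
        (by decide) (by decide) h9 (by omega) (by simp) ?_ (fun _ _ h => h) (t₁ := 60) le_rfl
      intro d hd τ hf hr hI
      have e40 : τ.r 40 = _ := (hf.r 40 (by decide)).trans h40
      have e9 : τ.a 9 = σ.a 9 := hf.a 9 (by decide)
      have hsr := srcE_ok hP hr hd
      have hds := dstE_ok hP hr hd
      have hdn := hP.dst_lt hd
      apply WP.le
      · apply WP.put (v := candOf P pe s j d) (y := d) (by simp [Ex.ok]) (by simp [Ex.val, hr])
          (by omega)
        · simp only [Ex.ok, BOp.ok, Ex.val, BOp.val, hsr, hds, true_and, and_true]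
          refine ⟨⟨by omega, by omega⟩, ?_⟩
          split_ifs <;> simp [E.w_pos.ne']
        · simp only [Ex.val, BOp.val, hsr, hds, e40, e9, hvis _ hdn, candOf, if_neg hv]
          split_ifs <;> simp_all
        · intro d' hd'
          simp only [St.setr_a, St.seta_a]
          split_ifs with h
          · rw [h]
          · exact hI d' (by omega)
      · simp [Ex.cost, srcE, dstE]
    · omega
  · replace hv : j = 0 := h14 ▸ hv
    rw [if_pos hv] at h40
    refine (firstP_spec hP h3 h9 h40 (by decide)).mono (by omega) fun τ _ h d hd => ?_
    rw [h.1 d hd, candOf, if_pos hv]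

theorem pickP_spec {γ : ℕ → K} (hP : P.OK E) (hφ : FieldRep P.N φ) (h9 : σ.r 9 = 2 * P.m)
    (h7 : RepV φ P σ 7 (2 * P.m) γ) :
    WP E pickP (100 * P.m)
      (fun σ' => σ'.r 41 < 2 * P.m ∧ ((∃ d < 2 * P.m, γ d ≠ 0) → γ (σ'.r 41) ≠ 0)) σ := by
  obtain ⟨h1, hJ, hnJ, hL, hL', hil, hn3, hnm, hk0, hN, hN'⟩ := hP.facts
  apply WP.le
  · apply WP.set_then (v := 0) (by simp [Ex.ok]) rfl
    refine WP.for (2 * P.m) (fun j τ => τ.r 41 < 2 * P.m ∧ ((∃ d < j, γ d ≠ 0) → γ (τ.r 41) ≠ 0))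
      (by decide) (by decide) (by decide) (by simp [h9]) (by omega) (by simp; omega) ?_
      (fun _ _ h => h) (t₁ := 20) le_rfl
    rintro d hd τ hf hr ⟨hI, hI'⟩
    have e7 : τ.a 7 d = σ.a 7 d := congrFun (hf.a 7 (by decide)) d
    obtain ⟨g1, g2⟩ := h7 d hd
    have g3 : σ.a 7 d = 0 ↔ γ d = 0 := by
      rw [← g2]
      exact ⟨fun h => by rw [h, hφ.zero], hφ.inj _ g1⟩
    have hdL : d < E.L := by omega
    refine WP.straight (t := 20) (Nat.le_of_ble_eq_true rfl) ?_
    by_cases h0 : σ.a 7 d = 0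
    · simp only [Stm.pre, Ex.ok, Ex.val, hr, e7, h0, true_and, ne_eq, not_true, if_false, hdL,
        St.setr_r, show (41 : ℕ) ≠ 25 by decide]
      refine ⟨hI, ?_⟩
      rintro ⟨d', h2, h3⟩
      rcases Nat.lt_succ_iff_lt_or_eq.1 h2 with h2 | rfl
      · exact hI' ⟨d', h2, h3⟩
      · exact absurd (g3.1 h0) h3
    · simp only [Stm.pre, Ex.ok, Ex.val, hr, e7, h0, true_and, ne_eq, not_false_eq_true, if_true,
        hdL, St.setr_r, show (41 : ℕ) ≠ 25 by decide, if_false]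
      exact ⟨hd, fun _ h => h0 (g3.2 h)⟩
  · simp [Ex.cost]
    omega

/-- Array 1 holds the field elements of the trial that gave the smallest length, so no new
randomness enters. With `j` darts fixed, the limit `r + 1 - j` makes array 7 refer to completions
with exactly `r - j` further edges. -/
theorem searchP_spec {s r : ℕ} (hP : P.OK E) (hB : Base P φ σ) (hφ : FieldRep P.N φ)
    (hx : ∀ e < P.m, σ.a 1 e < P.N) (h34 : σ.r 34 = r) (h35 : σ.r 35 = s) (hr : r < P.n)
    (hs : s < P.n) (h9 : ∀ v < P.n, σ.a 9 v = 0) :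
    WP E searchP ((P.n + 1) * (22000 * (P.Y * (P.m * P.J * P.n)))) (fun σ' => σ'.r 38 = r + 1 ∧
      ∀ j < r + 1, Good P (fun e => φ (σ.a 1 e)) (σ'.a 10) s r j) σ := by
  obtain ⟨h1, hJ, hnJ, hL, hL', hil, hn3, hnm, hk0, hN, hN'⟩ := hP.facts
  have hmin : P.m * P.n ≤ P.Y * (P.m * P.J * P.n) := by
    calc P.m * P.n ≤ P.m * P.n * (P.Y * P.J) :=
          Nat.le_mul_of_pos_right _ (Nat.mul_pos P.Y_pos hJ)
      _ = _ := by ring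
  have hmn : P.m * 3 ≤ P.m * P.n := Nat.mul_le_mul_left _ hn3
  apply WP.le
  · apply WP.then (copyP_spec (by decide) hB.r3 (by decide) (by omega) (by omega))
    intro τ hf h
    have hB₁ := hB.frame hf (by decide) (by decide)
    have e35 : τ.r 35 = s := (hf.r 35 (by decide)).trans h35
    have e34 : τ.r 34 = r := (hf.r 34 (by decide)).trans h34
    have e9 : τ.a 9 = σ.a 9 := hf.a 9 (by decide)
    apply WP.set_then (v := s) (by simp [Ex.ok]) (by simp [Ex.val, e35])
    apply WP.set_then (v := s) (by simp [Ex.ok]) (by simp [Ex.val, e35])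
    apply WP.set_then (v := r + 1) (by simp [Ex.ok, Ex.val, BOp.ok, e34, E.w_pos.ne']; omega)
      (by simp [Ex.val, BOp.val, e34])
    have hB₂ : Base P φ (((τ.setr 12 s).setr 40 s).setr 38 (r + 1)) := by
      constructor
      iterate 10 simp [hB₁.r2, hB₁.r3, hB₁.r4, hB₁.r5, hB₁.r6, hB₁.r7, hB₁.r8, hB₁.r9, hB₁.r10, hB₁.r11]
      exact hB₁.mul
    have g12 : (((τ.setr 12 s).setr 40 s).setr 38 (r + 1)).r 12 = s := by simp
    have g40 : (((τ.setr 12 s).setr 40 s).setr 38 (r + 1)).r 40 = s := by simp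
    have g38 : (((τ.setr 12 s).setr 40 s).setr 38 (r + 1)).r 38 = r + 1 := by simp
    have g0 : ∀ e < P.m, (((τ.setr 12 s).setr 40 s).setr 38 (r + 1)).a 0 e = σ.a 1 e := by
      intro e he
      simp [h e, he]
    have g9 : ∀ v < P.n, (((τ.setr 12 s).setr 40 s).setr 38 (r + 1)).a 9 v = 0 := by
      simpa [e9] using h9
    generalize (((τ.setr 12 s).setr 40 s).setr 38 (r + 1)) = τ₀ at hB₂ g12 g40 g38 g0 g9 ⊢
    -- Only heads of darts are marked as visited: the start `s` must remain available as the end of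
    -- the cycle.
    refine WP.for (r + 1) (fun j τ => (∀ v < P.n, τ.a 9 v = 0 ↔ visOf P (τ.a 10) j v = 0) ∧
      (τ.r 40 = if j = 0 then s else P.dst (τ.a 10 (j - 1))) ∧
      ∀ i < j, Good P (fun e => φ (σ.a 1 e)) (τ.a 10) s r i) (by decide) (by decide)
      (by decide) g38 (by omega) ⟨by simpa [visOf] using g9, by simpa using g40, by simp⟩ ?_ ?_
      (t₁ := 20000 * (P.Y * (P.m * P.J * P.n)) + 700 * P.m) le_rfl
    · rintro j hj τ₁ hf₁ hr₁ ⟨I1, I2, I3⟩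
      have hB₃ := hB₂.frame hf₁
      have e12 : τ₁.r 12 = s := (hf₁.r 12 (by decide)).trans g12
      have e38 : τ₁.r 38 = r + 1 := (hf₁.r 38 (by decide)).trans g38
      have e0 : ∀ e < P.m, τ₁.a 0 e = σ.a 1 e := by
        rw [hf₁.a 0 (by decide)]
        exact g0
      apply WP.le
      · apply WP.then (nextCandP_spec (s := s) (pe := τ₁.a 10) hP hB₃.r3 hB₃.r9 hr₁ I2 I1)
        intro τ₂ hf₂ h₂
        have hB₄ := hB₃.frame hf₂
        have e10 : τ₂.a 10 = τ₁.a 10 := hf₂.a 10 (by decide)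
        apply WP.set_then (v := r + 1 - j)
        · simp [Ex.ok, Ex.val, BOp.ok, hf₂.r 38 (by decide), hf₂.r 14 (by decide), e38, hr₁]
          omega
        · simp [Ex.val, BOp.val, hf₂.r 38 (by decide), hf₂.r 14 (by decide), e38, hr₁]
        have hB₅ : Base P φ (τ₂.setr 13 (r + 1 - j)) := by
          constructor
          iterate 10 simp [hB₄.r2, hB₄.r3, hB₄.r4, hB₄.r5, hB₄.r6, hB₄.r7, hB₄.r8, hB₄.r9, hB₄.r10, hB₄.r11]
          exact hB₄.mul
        apply WP.then (sumP_spec (s := s) (lim := r + 1 - j) (pl := j) hP hB₅ hφ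
          (fun e he => by
            rw [St.setr_a, hf₂.a 0 (by decide), e0 e he]
            exact hx e he) (by simp [hf₂.r 14 (by decide), hr₁]) (by omega)
          (fun i hi => by simpa [e10] using (I3 i hi).1) (by simp [hf₂.r 12 (by decide), e12]) hs
          (by simp) (by omega) (by omega))
        rintro τ₃ hf₃ ⟨-, h7⟩
        have hB₆ := hB₅.frame hf₃
        have h7' : RepV φ P τ₃ 7 (2 * P.m) (stepVal P (fun e => φ (σ.a 1 e)) (τ₁.a 10) s r j) := by
          refine h7.congr rfl fun d hd => ?_
          rw [stepVal, St.setr_a, e10, show r + 1 - j - 1 = r - j by omega]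
          refine totalVal_congr hP (fun v hv => ?_) (fun d hd => by rw [h₂ d hd])
            (fun e he => by simp only [hf₂.a 0 (by decide), e0 e he]) hd
          rw [hf₂.a 9 (by decide)]
          exact I1 v hv
        apply WP.then (pickP_spec hP hφ hB₆.r9 h7')
        rintro τ₄ hf₄ ⟨h41, h41'⟩
        have e14 : τ₄.r 14 = j := (hf₄.r 14 (by decide)).trans ((hf₃.r 14 (by decide)).trans
          (by simp [hf₂.r 14 (by decide), hr₁]))
        have e10' : τ₄.a 10 = τ₁.a 10 := (hf₄.a 10 (by decide)).trans ((hf₃.a 10 (by decide)).trans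
          (by simp [e10]))
        have e9' : τ₄.a 9 = τ₁.a 9 := (hf₄.a 9 (by decide)).trans ((hf₃.a 9 (by decide)).trans
          (by simp [hf₂.a 9 (by decide)]))
        apply WP.put_then (y := j) (v := τ₄.r 41) (by simp [Ex.ok]) (by simp [Ex.val, e14])
          (by omega) (by simp [Ex.ok]) (by simp [Ex.val])
        have hds := dstE_ok (i := 41) (σ := τ₄.seta 10 j (τ₄.r 41)) hP (by simp) h41
        have hdn := hP.dst_lt h41
        apply WP.set_then hds.1 hds.2
        apply WP.put (y := P.dst (τ₄.r 41)) (v := 1) (by simp [Ex.ok]) (by simp [Ex.val])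
          (by omega) (by simpa [Ex.ok] using E.w_pos.ne') rfl
        have hold : ∀ i < j, τ₁.a 10 i = if i = j then τ₄.r 41 else τ₁.a 10 i := fun i hi => by
          rw [if_neg hi.ne]
        refine ⟨fun v hv => ?_, ?_, fun i hi => ?_⟩
        · have hvv := I1 v hv
          simp only [visOf] at hvv ⊢
          simp [e9', e10']
          by_cases hv1 : v = P.dst (τ₄.r 41)
          · simp [hv1]
            exact ⟨j, le_rfl, by simp⟩
          · simp only [hv1, if_false]
            rw [hvv]
            simp only [ite_eq_right_iff, one_ne_zero, imp_false, not_exists, not_and]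
            refine ⟨fun h i hi => ?_, fun h i hi => ?_⟩
            · split_ifs with hij
              · exact fun h => hv1 h.symm
              · exact h i (by omega)
            · have := h i hi.le
              rwa [if_neg hi.ne] at this
        · simp
        · have hfin : ((((τ₄.seta 10 j (τ₄.r 41)).setr 40 (P.dst (τ₄.r 41))).seta 9 (P.dst (τ₄.r 41))
              1).setr 14 (j + 1)).a 10 = fun i => if i = j then τ₄.r 41 else τ₁.a 10 i := by
            funext i
            simp [e10']
          rw [hfin]
          rcases Nat.lt_succ_iff_lt_or_eq.1 hi with hi | rfl
          · exact (I3 i hi).congr fun i' hi' => hold i' (by omega)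
          · have h' := fun d => stepVal_congr (P := P) (X := fun e => φ (σ.a 1 e)) (s := s) (r := r)
              hold d
            simp only [Good, ← h', if_true]
            exact ⟨h41, h41'⟩
      · simp [Ex.cost, dstE]
        omega
    · rintro τ₁ hf₁ ⟨-, -, h⟩
      exact ⟨(hf₁.r 38 (by decide)).trans g38, h⟩
  · simp [Ex.cost]
    have h2 : (r + 1 + 1) * (20000 * (P.Y * (P.m * P.J * P.n)) + 700 * P.m + 20) ≤
        (P.n + 1) * (21000 * (P.Y * (P.m * P.J * P.n))) := Nat.mul_le_mul (by omega) (by omega)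
    have h3 : P.Y * (P.m * P.J * P.n) * 1 ≤ P.Y * (P.m * P.J * P.n) * (P.n + 1) :=
      Nat.mul_le_mul_left _ (by omega)
    nlinarith

/-- The darts form a cycle without repeated vertices that contains one edge from each set. -/
structure Valid (P : Inst) (pe : ℕ → ℕ) (l : ℕ) : Prop where
  chain : ∀ i < l, P.src (pe i) = P.dst (pe (if i = 0 then l - 1 else i - 1))
  inj : ∀ i < l, ∀ i' < i, P.dst (pe i') ≠ P.dst (pe i)
  count : ∀ a < P.k, ∑ p ∈ Finset.range l, P.tab a (pe p / 2) = 1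

theorem chainP_spec {l : ℕ} (hP : P.OK E) (h38 : σ.r 38 = l) (hl : 0 < l) (hln : l ≤ P.n)
    (hpe : ∀ i < l, σ.a 10 i < 2 * P.m) (h9 : ∀ v < P.n, σ.a 9 v = 0) (h42 : σ.r 42 ≠ 0) :
    WP E chainP (500 * P.n) (fun σ' => σ'.r 42 ≠ 0 ↔
      (∀ i < l, P.src (σ.a 10 i) = P.dst (σ.a 10 (if i = 0 then l - 1 else i - 1))) ∧
      ∀ i < l, ∀ i' < i, P.dst (σ.a 10 i') ≠ P.dst (σ.a 10 i)) σ := by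
  obtain ⟨h1, hJ, hnJ, hL, hL', hil, hn3, hnm, hk0, hN, hN'⟩ := hP.facts
  apply WP.le
  · apply WP.set_then (v := σ.a 10 (l - 1))
    · simp [Ex.ok, Ex.val, BOp.ok, BOp.val, h38, E.w_pos.ne']; omega
    · simp [Ex.val, BOp.val, h38]
    have hds := dstE_ok (i := 41) (σ := σ.setr 41 (σ.a 10 (l - 1))) hP (by simp)
      (hpe (l - 1) (by omega))
    apply WP.set_then hds.1 hds.2
    -- Register 43 initially holds the head of the last dart, so the first comparison checks that
    -- the walk is closed.
    refine WP.for l (fun j τ => (∀ v < P.n, τ.a 9 v = 0 ↔ visOf P (σ.a 10) j v = 0) ∧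
      (τ.r 43 = P.dst (σ.a 10 (if j = 0 then l - 1 else j - 1))) ∧
      (τ.r 42 ≠ 0 ↔ (∀ i < j, P.src (σ.a 10 i) = P.dst (σ.a 10 (if i = 0 then l - 1 else i - 1))) ∧
        ∀ i < j, ∀ i' < i, P.dst (σ.a 10 i') ≠ P.dst (σ.a 10 i))) (by decide) (by decide)
      (by decide) (by simp [h38]) (by omega) ⟨by simpa [visOf] using h9, by simp, by simp [h42]⟩ ?_
      (fun _ _ h => h.2.2) (t₁ := 200) le_rfl
    rintro j hj τ hf hr ⟨I1, I2, I3⟩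
    have e10 : τ.a 10 = σ.a 10 := (hf.a 10 (by decide)).trans (by simp)
    have hp := hpe j hj
    have hdn := hP.dst_lt hp
    have hvj : visOf P (σ.a 10) j (P.dst (σ.a 10 j)) = 0 ↔
        ∀ i' < j, P.dst (σ.a 10 i') ≠ P.dst (σ.a 10 j) := by
      simp [visOf]
    apply WP.le
    · apply WP.set_then (v := σ.a 10 j) (by simp [Ex.ok, Ex.val, hr]; omega)
        (by simp [Ex.val, hr, e10])
      have hsr := srcE_ok (i := 41) (σ := τ.setr 41 (σ.a 10 j)) hP (by simp) hp
      apply WP.then (R := fun τ' => τ'.r 41 = σ.a 10 j ∧ τ'.a = τ.a ∧ τ'.r 24 = j ∧ (τ'.r 42 ≠ 0 ↔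
        τ.r 42 ≠ 0 ∧ P.src (σ.a 10 j) = P.dst (σ.a 10 (if j = 0 then l - 1 else j - 1))))
      · apply WP.cond (by simp [Ex.ok, BOp.ok, hsr])
        · intro hv
          simp [Ex.val, BOp.val, hsr, I2] at hv
          exact WP.skip ⟨by simp, by simp, by simp [hr], by simp [hv]⟩
        · intro hv
          simp [Ex.val, BOp.val, hsr, I2] at hv
          exact WP.set (v := 0) (by simp [Ex.ok]) rfl
            ⟨by simp, by simp, by simp [hr], by simp [hv]⟩
      rintro τ₁ hf₁ ⟨k1, k2, k3, k4⟩
      have hds := dstE_ok (i := 41) hP k1 hp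
      apply WP.set_then hds.1 hds.2
      apply WP.then (R := fun τ' => τ'.r 43 = P.dst (σ.a 10 j) ∧ τ'.a = τ.a ∧ (τ'.r 42 ≠ 0 ↔
        τ₁.r 42 ≠ 0 ∧ ∀ i' < j, P.dst (σ.a 10 i') ≠ P.dst (σ.a 10 j)))
      · apply WP.cond (by simp [Ex.ok, Ex.val]; omega)
        · intro hv
          simp only [Ex.val, St.setr_r, if_true, St.setr_a, k2, ne_eq, I1 _ hdn, hvj] at hv
          exact WP.set (v := 0) (by simp [Ex.ok]) rfl ⟨by simp, by simp [k2], by simpa using fun _ => by simpa using hv⟩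
        · intro hv
          simp only [Ex.val, St.setr_r, if_true, St.setr_a, k2, ne_eq, I1 _ hdn, hvj] at hv
          exact WP.skip ⟨by simp, by simp [k2], by simpa using fun _ => hv⟩
      rintro τ₂ hf₂ ⟨m1, m2, m3⟩
      apply WP.put (y := P.dst (σ.a 10 j)) (v := 1) (by simp [Ex.ok]) (by simp [Ex.val, m1])
        (by omega) (by simpa [Ex.ok] using E.w_pos.ne') rfl
      refine ⟨fun v hv => ?_, by simp [m1], ?_⟩
      · have hvv := I1 v hv
        simp only [visOf] at hvv ⊢
        simp [m2]
        by_cases hv1 : v = P.dst (σ.a 10 j)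
        · simp [hv1]
          exact ⟨j, le_rfl, rfl⟩
        · simp only [hv1, if_false]
          rw [hvv]
          simp only [ite_eq_right_iff, one_ne_zero, imp_false, not_exists, not_and]
          refine ⟨fun h i hi => ?_, fun h i hi => h i hi.le⟩
          rcases hi.eq_or_lt with rfl | hi
          · exact fun h => hv1 h.symm
          · exact h i hi
      · rw [show ((τ₂.seta 9 (P.dst (σ.a 10 j)) 1).setr 24 (j + 1)).r 42 = τ₂.r 42 by simp, m3, k4, I3]
        simp only [Nat.lt_succ_iff_lt_or_eq, or_imp, forall_and, forall_eq]
        tauto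
    · simp [Ex.cost, srcE, dstE]
  · simp [Ex.cost, dstE]
    omega

theorem countP_spec {l : ℕ} (hP : P.OK E) (h3 : σ.r 3 = P.m) (h4 : σ.r 4 = P.k)
    (h9 : σ.r 9 = 2 * P.m) (h38 : σ.r 38 = l) (hln : l ≤ P.n)
    (hpe : ∀ i < l, σ.a 10 i < 2 * P.m) :
    WP E countP (1000 * (P.J * P.n)) (fun σ' => σ'.r 42 ≠ 0 ↔ σ.r 42 ≠ 0 ∧
      ∀ a < P.k, ∑ p ∈ Finset.range l, P.tab a (σ.a 10 p / 2) = 1) σ := by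
  obtain ⟨h1, hJ, hnJ, hL, hL', hil, hn3, hnm, hk0, hN, hN'⟩ := hP.facts
  have hkJ := P.k_lt_J
  have hJn : P.J ≤ P.J * P.n := Nat.le_mul_of_pos_right _ (by omega)
  apply WP.le
  · refine WP.for P.k (fun j τ => τ.r 42 ≠ 0 ↔ σ.r 42 ≠ 0 ∧
      ∀ a < j, ∑ p ∈ Finset.range l, P.tab a (σ.a 10 p / 2) = 1) (by decide) (by decide)
      (by decide) h4 (by nlinarith) (by simp) ?_
      (fun _ _ h => h) (t₁ := 100 * (P.n + 1) + 50) le_rfl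
    rintro a ha τ hf hr hI
    have e38 : τ.r 38 = l := (hf.r 38 (by decide)).trans h38
    have e3 : τ.r 3 = P.m := (hf.r 3 (by decide)).trans h3
    have e9 : τ.r 9 = 2 * P.m := (hf.r 9 (by decide)).trans h9
    have e10 : τ.a 10 = σ.a 10 := hf.a 10 (by decide)
    apply WP.le
    · apply WP.set_then (v := 0) (by simp [Ex.ok]) rfl
      apply WP.then (WP.for l (fun j τ' => τ'.r 44 = ∑ p ∈ Finset.range j, P.tab a (σ.a 10 p / 2))
        (by decide) (by decide) (by decide) (by simp [e38]) (by omega) (by simp) ?_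
        (fun _ _ h => h) (t₁ := 50) le_rfl)
      · intro τ₁ hf₁ h44
        have e42 : τ₁.r 42 = τ.r 42 := (hf₁.r 42 (by decide)).trans (by simp)
        apply WP.cond (by simpa [Ex.ok, BOp.ok] using E.w_pos.ne')
        · intro hv
          replace hv : τ₁.r 44 = 1 := by
            by_contra h
            simp [Ex.val, BOp.val, h] at hv
          refine WP.skip ?_
          simp only [St.setr_r, show (42 : ℕ) ≠ 25 by decide, if_false, e42, hI, ne_eq,
            Nat.lt_succ_iff_lt_or_eq, or_imp, forall_and, forall_eq, ← h44, hv, and_true]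
        · intro hv
          replace hv : τ₁.r 44 ≠ 1 := fun h => by simp [Ex.val, BOp.val, h] at hv
          refine WP.set (v := 0) (by simp [Ex.ok]) rfl ?_
          simp only [St.setr_r, show (42 : ℕ) ≠ 25 by decide, if_false, if_true, ne_eq, not_true,
            Nat.lt_succ_iff_lt_or_eq, or_imp, forall_and, forall_eq, ← h44, hv, and_false]
      · rintro j hj τ₁ hf₁ hr₁ h44
        have e10' : τ₁.a 10 = σ.a 10 := (hf₁.a 10 (by decide)).trans (by simp [e10])
        have hp := hpe j hj
        have hle : τ₁.r 44 ≤ j := by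
          rw [h44]
          refine (Finset.sum_le_card_nsmul _ _ 1 fun p hp => ?_).trans (by simp)
          have := hpe p (by simp at hp; omega)
          exact hP.tab_le a ha _ (by omega)
        apply WP.le
        · apply WP.set_then (v := σ.a 10 j) (by simp [Ex.ok, Ex.val, hr₁]; omega)
            (by simp [Ex.val, hr₁, e10'])
          have ht := tabE_ok (i := 25) (j := 41) (σ := τ₁.setr 41 (σ.a 10 j)) hP
            (by simpa using (hf₁.r 3 (by decide)).trans (by simp [e3]))
            (by simpa using (hf₁.r 9 (by decide)).trans (by simp [e9]))
            (a := a) (d := σ.a 10 j) (by simpa using (hf₁.r 25 (by decide)).trans (by simp [hr]))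
            (by simp) ha hp
          have htl := hP.tab_le a ha (σ.a 10 j / 2) (by omega)
          apply WP.set (v := τ₁.r 44 + P.tab a (σ.a 10 j / 2))
          · simp only [Ex.ok, BOp.ok, Ex.val, ht, true_and, St.setr_r]
            simp
            omega
          · simp [Ex.val, BOp.val, ht]
          · simp [Finset.sum_range_succ, h44]
        · simp [Ex.cost, tabE]
    · simp [Ex.cost]
      omega
  · nlinarith

theorem verifyP_spec {l : ℕ} (hP : P.OK E) (hB : Base P φ σ) (h38 : σ.r 38 = l) (hl : 0 < l)
    (hln : l ≤ P.n) (hpe : ∀ i < l, σ.a 10 i < 2 * P.m) :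
    WP E verifyP (2000 * (P.J * P.n)) (fun σ' => σ'.r 42 ≠ 0 ↔ Valid P (σ.a 10) l) σ := by
  obtain ⟨h1, hJ, hnJ, hL, hL', hil, hn3, hnm, hk0, hN, hN'⟩ := hP.facts
  apply WP.le
  · apply WP.set_then (v := 1) (by simpa [Ex.ok] using E.w_pos.ne') rfl
    apply WP.then (clearP_spec (B := P.n) (by simp [hB.r2]) (by decide) (by omega) (by omega))
    intro τ hf h9
    have e38 : τ.r 38 = l := (hf.r 38 (by decide)).trans (by simp [h38])
    have e10 : τ.a 10 = σ.a 10 := (hf.a 10 (by decide)).trans (by simp)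
    have e42 : τ.r 42 = 1 := (hf.r 42 (by decide)).trans (by simp)
    apply WP.then (chainP_spec hP e38 hl hln (by rwa [e10]) (fun v hv => by rw [h9, if_pos hv])
      (by simp [e42]))
    intro τ₁ hf₁ h₁
    have hr : ∀ i ∈ [3, 4, 9, 38], τ₁.r i = σ.r i := fun i hi =>
      (hf₁.r i (by revert i; decide)).trans ((hf.r i (by revert i; decide)).trans
        (by revert i; simp))
    have e10' : τ₁.a 10 = σ.a 10 := (hf₁.a 10 (by decide)).trans e10
    refine (countP_spec hP ((hr 3 (by decide)).trans hB.r3) ((hr 4 (by decide)).trans hB.r4)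
      ((hr 9 (by decide)).trans hB.r9) ((hr 38 (by decide)).trans h38) hln
      (by rwa [e10'])).mono le_rfl fun τ₂ _ h₂ => ?_
    rw [h₂, h₁, e10, e10']
    exact ⟨fun h => ⟨h.1.1, h.1.2, h.2⟩, fun h => ⟨⟨h.chain, h.inj⟩, h.count⟩⟩
  · simp [Ex.cost]
    nlinarith

theorem outputP_spec {l : ℕ} (hP : P.OK E) (hB : Base P φ σ) (h38 : σ.r 38 = l) (hln : l ≤ P.n)
    (hpe : ∀ i < l, σ.a 10 i < 2 * P.m) :
    WP E outputP (200 * P.n) (fun σ' => σ'.r 0 = l ∧ σ'.r 1 = 76 + 13 * E.L ∧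
      ∀ i < l, σ'.o i = P.src (σ.a 10 i)) σ := by
  obtain ⟨h1, hJ, hnJ, hL, hL', hil, hn3, hnm, hk0, hN, hN'⟩ := hP.facts
  have hLo := hP.Lo_eq
  apply WP.le
  · apply WP.set_then (v := l) (by simp [Ex.ok]) (by simp [Ex.val, h38])
    apply WP.set_then (v := 76 + 13 * E.L)
    · simp [Ex.ok, Ex.val, BOp.ok, BOp.val, hB.r11, hB.r2, hB.r9, hL]
      omega
    · simp [Ex.val, BOp.val, hB.r11, hB.r2, hB.r9, hL]
    refine WP.for l (fun j τ => ∀ i < j, τ.o i = P.src (σ.a 10 i)) (by decide) (by decide)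
      (by decide) (by simp [h38]) (by omega) (by simp) ?_ ?_ (t₁ := 60) le_rfl
    · intro j hj τ hf hr hI
      have e1 : τ.r 1 = 76 + 13 * E.L := (hf.r 1 (by decide)).trans (by simp)
      have e10 : τ.a 10 = σ.a 10 := (hf.a 10 (by decide)).trans (by simp)
      have hp := hpe j hj
      apply WP.le
      · apply WP.set_then (v := σ.a 10 j) (by simp [Ex.ok, Ex.val, hr]; omega)
          (by simp [Ex.val, hr, e10])
        have hsr := srcE_ok (i := 41) (σ := τ.setr 41 (σ.a 10 j)) hP (by simp) hp
        apply WP.out (j := j) (v := P.src (σ.a 10 j))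
        · simp [Ex.ok, Ex.val, BOp.ok, e1, hr]; omega
        · simp [Ex.val, BOp.val, e1, hr, nr, na]
        · omega
        · exact hsr.1
        · exact hsr.2
        · intro i hi
          simp only [show ∀ τ : St, ∀ i v, (τ.setr i v).o = τ.o from fun _ _ _ => rfl, St.seto_o]
          split_ifs with h
          · rw [h]
          · exact hI i (by omega)
      · simp [Ex.cost, srcE]
    · intro τ hf h
      exact ⟨(hf.r 0 (by decide)).trans (by simp), (hf.r 1 (by decide)).trans (by simp), h⟩
  · simp [Ex.cost]
    omega

variable (φ) in
/-- The results of the algorithm. -/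
inductive Result (P : Inst) (E : Env) (D : ℕ) (σ : St) : Prop
  | none (h0 : σ.r 0 = 0)
      (h : ∀ t < D, ∀ s < P.n, ∀ r < P.n, decVal P (fun e => φ (draw P E t e)) s r = 0)
  | some {s r t : ℕ} (pe : ℕ → ℕ) (hs : s < P.n) (hr : r < P.n)
      (hne : decVal P (fun e => φ (draw P E t e)) s r ≠ 0)
      (hmin : ∀ t' < D, ∀ s' < P.n, ∀ r' < P.n,
        decVal P (fun e => φ (draw P E t' e)) s' r' ≠ 0 → r ≤ r')
      (hpe : ∀ j < r + 1, Good P (fun e => φ (draw P E t e)) pe s r j)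
      (hout : (Valid P pe (r + 1) ∧ σ.r 0 = r + 1 ∧ σ.r 1 = 76 + 13 * E.L ∧
        ∀ i < r + 1, σ.o i = P.src (pe i)) ∨ (¬ Valid P pe (r + 1) ∧ σ.r 0 = 0))

theorem Good.congr_fun {X X' : ℕ → K} {pe : ℕ → ℕ} {s r j : ℕ} (hP : P.OK E)
    (hX : ∀ e < P.m, X e = X' e) (h : Good P X pe s r j) : Good P X' pe s r j := by
  have h' : ∀ d < 2 * P.m, stepVal P X pe s r j d = stepVal P X' pe s r j d := fun d hd =>
    totalVal_congr hP (fun _ _ => Iff.rfl) (fun _ _ => Iff.rfl) hX hd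
  refine ⟨h.1, ?_⟩
  rintro ⟨d, hd, hne⟩
  rw [← h' _ h.1]
  exact h.2 ⟨d, hd, by rwa [h' d hd]⟩

/-- The trials dominate: `R * n` trials, each with `actCard P` sums of cost of order `Y * m * J *
n`. The search for the field costs a multiple of `(N + 1) ^ 2 ≤ 16 * n ^ 2` and the reconstruction
consists of at most `n` sums; these are absorbed by `R + 1` in place of `R`. -/
theorem algP_spec (R : ℕ) (hP : P.OK E) {f : ℕ} {g : K} (hf : f < P.N) (hp : Passes P.N f)
    (hmin : ∀ f' < f, ¬ Passes P.N f') (hg : FieldPow P.N f φ g)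
    (hr : ∀ i, σ.r i = 0) (ha : ∀ A i, σ.a A i = 0) (hd : σ.d = 0) :
    WP E (algP P.b R) ((R + 1) * (300000 * (max 1 (actCard P) * (P.Y * (P.m * P.J * (P.n * P.n))))))
      (Result φ P E (R * P.n)) σ := by
  obtain ⟨h1, hJ, hnJ, hL, hL', hil, hn3, hnm, hk0, hN, hN'⟩ := hP.facts
  have hkJ := P.k_lt_J
  have hY := P.Y_pos
  apply WP.le
  · apply WP.then (initP_spec hP)
    intro τ hτ hB
    apply WP.then (fieldP_spec hP hB hf hp hmin)
    intro τ₁ hτ₁ hT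
    have hB₁ : RegBase P τ₁ := by
      constructor
      iterate 10 rw [hτ₁.r _ (by decide)]; simp [hB.r2, hB.r3, hB.r4, hB.r5, hB.r6, hB.r7, hB.r8, hB.r9, hB.r10, hB.r11]
    have hBase := Base.of_tables hP hf hB₁ hT hg
    have ha₁ : ∀ A ∈ [1, 9], ∀ i, τ₁.a A i = 0 := fun A hA i => by
      rw [hτ₁.a A (by revert A; decide), hτ.a A (by simp [initP, Stm.wa, Stm.for]), ha]
    have hr₁ : τ₁.r 0 = 0 := by
      rw [hτ₁.r 0 (by decide), hτ.r 0 (by simp [initP, Stm.wr, Stm.for]), hr]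
    have hd₁ : τ₁.d = 0 := by
      rw [hτ₁.d (by decide), hτ.d (by simp [initP, Stm.draws, Stm.for]), hd]
    apply WP.then ((trialsP_spec R hP hBase hg.rep (fun v _ => ha₁ 9 (by decide) v) hd₁).and_frame)
    rintro τ₂ - ⟨hτ₂, hB₂, h9, hI⟩
    have hr₂ : τ₂.r 0 = 0 := by
      refine (hτ₂.r 0 ?_).trans hr₁
      have : 0 ∉ (Stm.rep R (.for 30 2 trialP)).wr := Stm.not_mem_wr_rep (by decide) R
      simpa [trialsP, Stm.wr] using this
    apply WP.cond (by simp [Ex.ok, BOp.ok])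
    · intro hv
      have hlt : τ₂.r 34 < P.n := by
        by_contra h
        simp [Ex.val, BOp.val, hB₂.r2, h] at hv
      obtain ⟨hs, t, ht, hne⟩ := hI.spec hlt
      apply WP.then (searchP_spec hP hB₂ hg.rep (fun e he => by rw [ht e he]; exact draw_lt _ _)
        rfl rfl hlt hs (fun v _ => by rw [h9, ha₁ 9 (by decide)]))
      rintro τ₃ hτ₃ ⟨h38, hgood⟩
      have hB₃ := hB₂.frame hτ₃
      have hpe : ∀ i < τ₂.r 34 + 1, τ₃.a 10 i < 2 * P.m := fun i hi => (hgood i hi).1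
      apply WP.then (verifyP_spec hP hB₃ h38 (by omega) (by omega) hpe)
      intro τ₄ hτ₄ h42
      have hB₄ := hB₃.frame hτ₄
      have e38 : τ₄.r 38 = τ₂.r 34 + 1 := (hτ₄.r 38 (by decide)).trans h38
      have e10 : τ₄.a 10 = τ₃.a 10 := hτ₄.a 10 (by decide)
      have e0 : τ₄.r 0 = 0 := by rw [hτ₄.r 0 (by decide), hτ₃.r 0 (by decide), hr₂]
      have hm : ∀ t' < R * P.n, ∀ s' < P.n, ∀ r' < P.n,
          decVal P (fun e => φ (draw P E t' e)) s' r' ≠ 0 → τ₂.r 34 ≤ r' :=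
        fun t' ht' s' hs' r' hr' hne' => hI.min t' s' ⟨ht', hs'⟩ r' hr' hne'
      have hgood' : ∀ j < τ₂.r 34 + 1,
          Good P (fun e => φ (draw P E t e)) (τ₃.a 10) (τ₂.r 35) (τ₂.r 34) j := fun j hj =>
        (hgood j hj).congr_fun hP fun e he => by simp only [ht e he]
      apply WP.cond (by simp [Ex.ok])
      · intro hv
        refine (outputP_spec hP hB₄ e38 (by omega) (by rwa [e10])).mono le_rfl fun τ₅ _ h => ?_
        rw [e10] at h
        exact .some (τ₃.a 10) hs hlt hne hm hgood' (Or.inl ⟨h42.1 hv, h⟩)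
      · intro hv
        exact WP.skip (.some (τ₃.a 10) hs hlt hne hm hgood' (Or.inr ⟨fun h => h42.2 h hv, e0⟩))
    · intro hv
      have hlt : ¬ τ₂.r 34 < P.n := fun h => by simp [Ex.val, BOp.val, hB₂.r2, h] at hv
      refine WP.skip (.none hr₂ fun t ht s hs r hr => ?_)
      by_contra hne
      exact hlt ((hI.min t s ⟨ht, hs⟩ r hr hne).trans_lt hr)
  · simp only [Ex.cost]
    set A := max 1 (actCard P) with hA
    have hA1 : 1 ≤ A := le_max_left _ _
    have hA2 : actCard P ≤ A := le_max_right _ _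
    set Z := P.Y * (P.m * P.J * (P.n * P.n)) with hZ
    have z0 : P.Y * (P.m * P.J * P.n) * (P.n + 1) ≤ 2 * Z := by
      rw [hZ]
      calc _ ≤ P.Y * (P.m * P.J * P.n) * (2 * P.n) := Nat.mul_le_mul_left _ (by omega)
        _ = _ := by ring
    have z1 : P.J * (P.m * (P.n * P.n)) ≤ Z := by
      rw [hZ]
      calc _ = 1 * (P.m * P.J * (P.n * P.n)) := by ring
        _ ≤ _ := Nat.mul_le_mul_right _ hY
    have z2 : P.m * (P.n * P.n) ≤ Z := (Nat.le_mul_of_pos_left _ hJ).trans z1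
    have z3 : P.n * P.n ≤ P.m * (P.n * P.n) := Nat.le_mul_of_pos_left _ (by omega)
    have z4 : P.n ≤ P.n * P.n := Nat.le_mul_of_pos_left _ (by omega)
    have z5 : P.k ≤ P.J * (P.m * (P.n * P.n)) :=
      hkJ.le.trans (Nat.le_mul_of_pos_right _ (Nat.mul_pos (by omega) (Nat.mul_pos (by omega) (by omega))))
    have z6 : P.J * P.n ≤ P.J * (P.m * (P.n * P.n)) := Nat.mul_le_mul_left _ (z4.trans z3)
    have z7 : (P.N + 1) * (P.N + 1) ≤ 16 * Z := by
      calc _ ≤ (4 * P.n) * (4 * P.n) := Nat.mul_le_mul (by omega) (by omega)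
        _ = 16 * (P.n * P.n) := by ring
        _ ≤ _ := by omega
    have z8 : (P.n + 1) * (P.m * P.n) ≤ 2 * Z := by
      calc _ ≤ (2 * P.n) * (P.m * P.n) := Nat.mul_le_mul_right _ (by omega)
        _ = 2 * (P.m * (P.n * P.n)) := by ring
        _ ≤ _ := by omega
    have z9 : (P.n + 1) * (actCard P * (21000 * (P.Y * (P.m * P.J * P.n)))) ≤ 42000 * (A * Z) := by
      calc _ = actCard P * (21000 * (P.Y * (P.m * P.J * P.n) * (P.n + 1))) := by ring
        _ ≤ A * (21000 * (2 * Z)) := Nat.mul_le_mul hA2 (Nat.mul_le_mul_left _ z0)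
        _ = _ := by ring
    have z10 : Z ≤ A * Z := Nat.le_mul_of_pos_left _ hA1
    have z11 : 1 ≤ Z := by omega
    have z12 : R * (50 + (P.n + 1) * (720 * (P.m * P.n) +
        actCard P * (21000 * (P.Y * (P.m * P.J * P.n))))) ≤ R * (50000 * (A * Z)) := by
      refine Nat.mul_le_mul_left _ ?_
      rw [mul_add]
      have : (P.n + 1) * (720 * (P.m * P.n)) = 720 * ((P.n + 1) * (P.m * P.n)) := by ring
      omega
    have z13 : (P.n + 1) * (22000 * (P.Y * (P.m * P.J * P.n))) ≤ 44000 * Z := by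
      calc _ = 22000 * (P.Y * (P.m * P.J * P.n) * (P.n + 1)) := by ring
        _ ≤ 22000 * (2 * Z) := Nat.mul_le_mul_left _ z0
        _ = _ := by ring
    have z14 : R * (50000 * (A * Z)) ≤ R * (300000 * (A * Z)) := Nat.mul_le_mul_left _ (by omega)
    rw [add_mul R, one_mul]
    omega

end EdgeSetCycle

/-! ### Walks as lists of darts, and the cancellation of walks with repeated vertices. -/

namespace EdgeSetCycle

variable {K : Type} [Field K] {P : Inst} {E : Env} {vis : ℕ → ℕ} {s v u : ℕ} {w A B : List ℕ}

/-- The list `w` of darts is a walk from `v` to `s` that avoids the vertices in `vis`, except perhaps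
`v`. -/
def IsWalk (P : Inst) (vis : ℕ → ℕ) (s : ℕ) : ℕ → List ℕ → Prop
  | v, [] => v = s
  | v, d :: w => d < 2 * P.m ∧ P.src d = v ∧ vis (P.dst d) = 0 ∧ IsWalk P vis s (P.dst d) w

theorem xor_one_xor_one (d : ℕ) : (d ^^^ 1) ^^^ 1 = d := by
  rw [Nat.xor_assoc, Nat.xor_self, Nat.xor_zero]

theorem xor_one_div_two (d : ℕ) : (d ^^^ 1) / 2 = d / 2 := by
  rcases Nat.even_or_odd d with hd | hd
  · rw [Nat.xor_one_of_even hd]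
    obtain ⟨c, rfl⟩ := hd
    omega
  · rw [Nat.xor_one_of_odd hd]
    obtain ⟨c, rfl⟩ := hd
    omega

theorem Inst.src_xor_one (P : Inst) (d : ℕ) : P.src (d ^^^ 1) = P.dst d := rfl

theorem Inst.dst_xor_one (P : Inst) (d : ℕ) : P.dst (d ^^^ 1) = P.src d := by
  rw [Inst.dst, xor_one_xor_one]

theorem isWalk_append : IsWalk P vis s v (A ++ B) ↔ ∃ u, IsWalk P vis u v A ∧ IsWalk P vis s u B := by
  induction A generalizing v with
  | nil => simp [IsWalk]
  | cons d A ih =>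
    simp only [List.cons_append, IsWalk, ih]
    constructor
    · rintro ⟨h1, h2, h3, u, h4, h5⟩
      exact ⟨u, ⟨h1, h2, h3, h4⟩, h5⟩
    · rintro ⟨u, ⟨h1, h2, h3, h4⟩, h5⟩
      exact ⟨h1, h2, h3, u, h4, h5⟩

/-- The reversed walk. -/
def rev (w : List ℕ) : List ℕ := (w.map (· ^^^ 1)).reverse

theorem rev_cons (d : ℕ) (w : List ℕ) : rev (d :: w) = rev w ++ [d ^^^ 1] := by simp [rev]

theorem rev_rev (w : List ℕ) : rev (rev w) = w := by
  simp [rev, Function.comp_def]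

/-- The start of a walk is exempt from avoiding `vis`, but in the reversed walk it becomes a head;
hence the extra hypothesis. -/
theorem IsWalk.reverse (h : IsWalk P vis u v A) (hv : vis v = 0) : IsWalk P vis v u (rev A) := by
  induction A generalizing v with
  | nil => exact Eq.symm h
  | cons d A ih =>
    obtain ⟨h1, h2, h3, h4⟩ := h
    rw [rev_cons, isWalk_append]
    exact ⟨P.dst d, ih h4 h3, Inst.xor_one_lt h1, P.src_xor_one d, by rw [P.dst_xor_one, h2, hv],
      by rw [P.dst_xor_one, h2]; rfl⟩

/-- The nonempty walk `A` ends at `v`. -/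
def EndsAt (P : Inst) (v : ℕ) (A : List ℕ) : Prop := ∀ h : A ≠ [], P.dst (A.getLast h) = v

theorem IsWalk.endsAt (h : IsWalk P vis u v A) : EndsAt P u A := by
  intro hA
  rw [← List.dropLast_append_getLast hA, isWalk_append] at h
  obtain ⟨_, _, _, _, _, h⟩ := h
  exact h

theorem IsWalk.eq_of_endsAt (h : IsWalk P vis u v A) (hA : EndsAt P v A) : u = v := by
  by_cases h0 : A = []
  · subst h0
    exact Eq.symm h
  · rw [← hA h0, ← h.endsAt h0]

theorem IsWalk.vis_eq_zero (h : IsWalk P vis u v A) (hA : A ≠ []) : vis u = 0 := by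
  have h' := h.endsAt hA
  rw [← List.dropLast_append_getLast hA, isWalk_append] at h
  obtain ⟨_, _, _, _, h, _⟩ := h
  rwa [h'] at h

theorem IsWalk.lt (h : IsWalk P vis u v A) : ∀ d ∈ A, d < 2 * P.m := by
  induction A generalizing v with
  | nil => simp
  | cons d A ih =>
    intro d' hd'
    rcases List.mem_cons.1 hd' with rfl | hd'
    · exact h.1
    · exact ih h.2.2.2 d' hd'

theorem IsWalk.vis_dst (h : IsWalk P vis u v A) : ∀ d ∈ A, vis (P.dst d) = 0 := by
  induction A generalizing v with
  | nil => simp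
  | cons d A ih =>
    intro d' hd'
    rcases List.mem_cons.1 hd' with rfl | hd'
    · exact h.2.2.1
    · exact ih h.2.2.2 d' hd'

theorem IsWalk.mono {vis' : ℕ → ℕ} (h : IsWalk P vis u v A) (h' : ∀ d ∈ A, vis' (P.dst d) = 0) :
    IsWalk P vis' u v A := by
  induction A generalizing v with
  | nil => exact h
  | cons d A ih =>
    exact ⟨h.1, h.2.1, h' d (by simp), ih h.2.2.2 fun d hd => h' d (by simp [hd])⟩

theorem IsWalk.map_src (h : IsWalk P vis u v A) : A.map P.src ++ [u] = v :: A.map P.dst := by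
  induction A generalizing v with
  | nil => simp [show v = u from h]
  | cons d A ih => simp [ih h.2.2.2, h.2.1]

theorem map_div_rev_perm (A : List ℕ) : ((rev A).map (· / 2)).Perm (A.map (· / 2)) := by
  rw [rev, List.map_reverse, List.map_map]
  simp only [Function.comp_def, xor_one_div_two]
  exact List.reverse_perm _

/-- The heads of the reversed darts are the tails of the original ones, and along a closed walk the
tails are a cyclic shift of the heads. -/
theorem IsWalk.map_dst_rev_perm (h : IsWalk P vis v v A) :
    ((rev A).map P.dst).Perm (A.map P.dst) := by
  rw [rev, List.map_reverse, List.map_map]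
  simp only [Function.comp_def, P.dst_xor_one]
  refine (List.reverse_perm _).trans ?_
  have h1 := h.map_src
  have h2 : (v :: A.map P.src).Perm (v :: A.map P.dst) := by
    rw [← h1]
    exact (List.perm_append_singleton _ _).symm
  exact (List.perm_cons v).1 h2

/-- The involution on walks from `v` that reverses a closed part. -/
def flip (P : Inst) (v : ℕ) (w : List ℕ) : List ℕ :=
  if rev (w.rdropWhile fun d => P.dst d ≠ v) = w.rdropWhile fun d => P.dst d ≠ v then
    match h : w.rtakeWhile fun d => P.dst d ≠ v with
    | [] => w
    | d :: B => (w.rdropWhile fun d => P.dst d ≠ v) ++ d :: flip P (P.dst d) B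
  else rev (w.rdropWhile fun d => P.dst d ≠ v) ++ w.rtakeWhile fun d => P.dst d ≠ v
termination_by w.length
decreasing_by
  have := (List.rtakeWhile_suffix (p := fun d => decide (P.dst d ≠ v)) (l := w)).length_le
  rw [h] at this
  exact this

theorem exists_split (P : Inst) (v : ℕ) (w : List ℕ) :
    ∃ A B, w = A ++ B ∧ EndsAt P v A ∧ ∀ d ∈ B, P.dst d ≠ v := by
  refine ⟨w.rdropWhile fun d => P.dst d ≠ v, w.rtakeWhile fun d => P.dst d ≠ v,
    List.rdropWhile_append_rtakeWhile.symm, fun h => ?_, fun d hd => ?_⟩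
  · simpa using List.rdropWhile_last_not _ _ h
  · simpa using List.mem_rtakeWhile_imp hd

/-- The decomposition into the longest initial part that returns to `v` and a remainder that never
does is unique; the involution can therefore be computed from any such decomposition. -/
theorem split_append (hA : EndsAt P v A) (hB : ∀ d ∈ B, P.dst d ≠ v) :
    (A ++ B).rdropWhile (fun d => P.dst d ≠ v) = A ∧
      (A ++ B).rtakeWhile (fun d => P.dst d ≠ v) = B := by
  have h1 : (A ++ B).rdropWhile (fun d => P.dst d ≠ v) = A := by
    induction B using List.reverseRecOn with
    | nil =>
      rw [List.append_nil, List.rdropWhile_eq_self_iff]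
      intro h
      simpa using hA h
    | append_singleton B d ih =>
      rw [← List.append_assoc, List.rdropWhile_concat_pos]
      · exact ih fun d' hd' => hB d' (by simp [hd'])
      · simpa using hB d (by simp)
  refine ⟨h1, ?_⟩
  have h2 := List.rdropWhile_append_rtakeWhile (p := fun d => decide (P.dst d ≠ v)) (l := A ++ B)
  rw [h1] at h2
  exact List.append_cancel_left h2

theorem flip_of_ne (hA : EndsAt P v A) (hB : ∀ d ∈ B, P.dst d ≠ v) (h : rev A ≠ A) :
    flip P v (A ++ B) = rev A ++ B := by
  rw [flip, (split_append hA hB).1, (split_append hA hB).2, if_neg h]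

theorem flip_nil_of_eq (hA : EndsAt P v A) (h : rev A = A) : flip P v A = A := by
  have h2 := split_append (B := []) hA (by simp)
  rw [List.append_nil] at h2
  rw [flip, h2.1, if_pos h]
  split
  · rfl
  · rename_i h3
    rw [h2.2] at h3
    simp at h3

theorem flip_cons_of_eq {d : ℕ} (hA : EndsAt P v A) (hB : ∀ d' ∈ d :: B, P.dst d' ≠ v)
    (h : rev A = A) : flip P v (A ++ d :: B) = A ++ d :: flip P (P.dst d) B := by
  have h2 := split_append hA hB
  rw [flip, h2.1, if_pos h]
  split
  · rename_i h3
    rw [h2.2] at h3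
    simp at h3
  · rename_i h3
    rw [h2.2] at h3
    simp only [List.cons.injEq] at h3
    rw [h3.1, h3.2]

/-- Let `A` be the longest closed initial part. If `A` is not a palindrome it is reversed; otherwise
`A` and the following dart are kept and the procedure continues behind them. The heads in the
remainder are only permuted, so the result has the same place of division. Since `A` is a palindrome
exactly if its reversal is, a second application takes the same case and restores the walk. -/
theorem flip_spec (w : List ℕ) : ∀ v, IsWalk P vis s v w → IsWalk P vis s v (flip P v w) ∧
    ((flip P v w).map (· / 2)).Perm (w.map (· / 2)) ∧
    ((flip P v w).map P.dst).Perm (w.map P.dst) ∧ flip P v (flip P v w) = w := by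
  induction hl : w.length using Nat.strong_induction_on generalizing w with
  | _ l ih =>
    intro v hw
    obtain ⟨A, B, rfl, hA, hB⟩ := exists_split P v w
    obtain ⟨u, h1, h2⟩ := isWalk_append.1 hw
    obtain rfl := h1.eq_of_endsAt hA
    by_cases h : rev A = A
    · rcases B with _ | ⟨d, B⟩
      · rw [List.append_nil, flip_nil_of_eq hA h]
        exact ⟨by simpa using hw, .rfl, .rfl, flip_nil_of_eq hA h⟩
      · obtain ⟨g1, g2, g3, g4⟩ := ih B.length (by simp at hl; omega) B rfl _ h2.2.2.2
        rw [flip_cons_of_eq hA hB h]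
        refine ⟨isWalk_append.2 ⟨_, h1, h2.1, h2.2.1, h2.2.2.1, g1⟩, ?_, ?_, ?_⟩
        · simpa using (g2.cons _).append_left _
        · simpa using (g3.cons _).append_left _
        · rw [flip_cons_of_eq hA _ h, g4]
          intro d' hd'
          have h3 : P.dst d' ∈ (d :: flip P (P.dst d) B).map P.dst := List.mem_map_of_mem hd'
          rw [List.map_cons, (g3.cons _).mem_iff, ← List.map_cons, List.mem_map] at h3
          obtain ⟨d'', h4, h5⟩ := h3
          rw [← h5]
          exact hB d'' h4
    · have hA0 : A ≠ [] := by
        rintro rfl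
        exact h rfl
      have h3 := h1.reverse (h1.vis_eq_zero hA0)
      rw [flip_of_ne hA hB h]
      refine ⟨isWalk_append.2 ⟨_, h3, h2⟩, ?_, ?_, ?_⟩
      · simpa using (map_div_rev_perm A).append_right _
      · simpa using h1.map_dst_rev_perm.append_right _
      · rw [flip_of_ne h3.endsAt hB (by rwa [rev_rev, ne_comm]), rev_rev]

/-- Peeling off both ends: the first and last darts of a palindrome are the two orientations of one
edge, and a single dart is never its own reversal. So every edge occurs an even number of times. -/
theorem exists_sum_eq_of_rev_eq (h : rev A = A) (f : ℕ → ℕ) :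
    ∃ q, (A.map fun d => f (d / 2)).sum = 2 * q := by
  induction A using List.bidirectionalRec with
  | nil => exact ⟨0, rfl⟩
  | singleton d =>
    simp [rev] at h
  | cons_append d A e ih =>
    have h1 : rev (d :: (A ++ [e])) = (e ^^^ 1) :: (rev A ++ [d ^^^ 1]) := by simp [rev]
    rw [h1, List.cons.injEq] at h
    obtain ⟨h2, h3⟩ := h
    have h4 := List.append_inj' h3 rfl
    obtain ⟨q, hq⟩ := ih h4.1
    refine ⟨q + f (d / 2), ?_⟩
    have : e / 2 = d / 2 := by rw [← h2, xor_one_div_two]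
    simp [hq, this]
    ring

/-- If the involution fixes the walk, then every closed part that it meets is a palindrome. Deleting
these parts leaves a simple walk with the same ends and changes each count of edges by an even
number. -/
theorem exists_simple_of_flip_eq (w : List ℕ) : ∀ v, IsWalk P vis s v w → flip P v w = w →
    ∃ c, IsWalk P vis s v c ∧ (v :: c.map P.dst).Nodup ∧ (∀ d ∈ c, ∃ d' ∈ w, P.dst d' = P.dst d) ∧
      (c = w ∨ c.length < w.length) ∧
      ∀ f : ℕ → ℕ, ∃ q, (w.map fun d => f (d / 2)).sum = (c.map fun d => f (d / 2)).sum + 2 * q := by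
  induction hl : w.length using Nat.strong_induction_on generalizing w with
  | _ l ih =>
    intro v hw hfl
    obtain ⟨A, B, rfl, hA, hB⟩ := exists_split P v w
    obtain ⟨u, h1, h2⟩ := isWalk_append.1 hw
    obtain rfl := h1.eq_of_endsAt hA
    by_cases h : rev A = A
    · have hlen : A = [] ∨ 0 < A.length := by
        rcases A with _ | ⟨a, A⟩ <;> simp
      rcases B with _ | ⟨d, B⟩
      · refine ⟨[], h2, by simp, by simp, ?_, fun f => ?_⟩
        · rcases hlen with rfl | hlen
          · exact Or.inl rfl
          · exact Or.inr (by simp at hl ⊢; omega)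
        · obtain ⟨q, hq⟩ := exists_sum_eq_of_rev_eq h f
          exact ⟨q, by simp [hq]⟩
      · rw [flip_cons_of_eq hA hB h] at hfl
        have hfl' := List.append_cancel_left hfl
        rw [List.cons.injEq] at hfl'
        obtain ⟨c, g1, g2, g3, g4, g5⟩ := ih B.length (by simp at hl; omega) B rfl _ h2.2.2.2 hfl'.2
        have hsub : ∀ d' ∈ d :: c, ∃ d'' ∈ d :: B, P.dst d'' = P.dst d' := by
          intro d' hd'
          rcases List.mem_cons.1 hd' with rfl | hd'
          · exact ⟨_, by simp, rfl⟩
          · obtain ⟨d'', k1, k2⟩ := g3 d' hd'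
            exact ⟨d'', by simp [k1], k2⟩
        refine ⟨d :: c, ⟨h2.1, h2.2.1, h2.2.2.1, g1⟩, ?_, ?_, ?_, fun f => ?_⟩
        · rw [List.nodup_cons]
          refine ⟨fun hm => ?_, g2⟩
          obtain ⟨d', k1, k2⟩ := List.mem_map.1 hm
          obtain ⟨d'', k3, k4⟩ := hsub d' k1
          exact hB d'' k3 (k4.trans k2)
        · intro d' hd'
          obtain ⟨d'', k1, k2⟩ := hsub d' hd'
          exact ⟨d'', List.mem_append_right _ k1, k2⟩
        · simp only [List.length_append, List.length_cons] at hl ⊢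
          rcases hlen with rfl | hlen
          · rcases g4 with rfl | g4
            · exact Or.inl rfl
            · exact Or.inr (by omega)
          · refine Or.inr ?_
            have : c.length ≤ B.length := by
              rcases g4 with rfl | g4
              · exact le_rfl
              · exact g4.le
            omega
        · obtain ⟨q, hq⟩ := exists_sum_eq_of_rev_eq h f
          obtain ⟨q', hq'⟩ := g5 f
          refine ⟨q + q', ?_⟩
          simp [hq, hq']
          ring
    · rw [flip_of_ne hA hB h] at hfl
      exact absurd (List.append_cancel_right hfl) h

/-- The walks of length `r` from `v` to `s` that avoid `vis`. -/
def walks (P : Inst) (vis : ℕ → ℕ) (s : ℕ) : ℕ → ℕ → Finset (List ℕ)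
  | 0, v => if v = s then {[]} else ∅
  | r + 1, v => ((Finset.range (2 * P.m)).filter fun d => P.src d = v ∧ vis (P.dst d) = 0).biUnion
      fun d => (walks P vis s r (P.dst d)).image (List.cons d)

theorem mem_walks {r : ℕ} : w ∈ walks P vis s r v ↔ w.length = r ∧ IsWalk P vis s v w := by
  induction r generalizing v w with
  | zero =>
    rw [walks]
    split_ifs with h
    · rw [Finset.mem_singleton]
      constructor
      · rintro rfl
        exact ⟨rfl, h⟩
      · rintro ⟨h1, -⟩
        exact List.length_eq_zero_iff.1 h1
    · simp only [Finset.notMem_empty, false_iff, not_and]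
      intro h1
      rw [List.length_eq_zero_iff.1 h1]
      exact h
  | succ r ih =>
    simp only [walks, Finset.mem_biUnion, Finset.mem_filter, Finset.mem_range, Finset.mem_image, ih]
    constructor
    · rintro ⟨d, ⟨h1, h2, h3⟩, w, ⟨h4, h5⟩, rfl⟩
      exact ⟨by simp [h4], h1, h2, h3, h5⟩
    · rcases w with _ | ⟨d, w⟩
      · simp
      · rintro ⟨h1, h2, h3, h4, h5⟩
        exact ⟨d, ⟨h2, h3, h4⟩, w, ⟨by simpa using h1, h5⟩, rfl⟩

theorem sum_walks_succ {M : Type*} [AddCommMonoid M] (F : List ℕ → M) (r v : ℕ) :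
    ∑ w ∈ walks P vis s (r + 1) v, F w =
      ∑ d ∈ Finset.range (2 * P.m), if P.src d = v ∧ vis (P.dst d) = 0 then
        ∑ w ∈ walks P vis s r (P.dst d), F (d :: w) else 0 := by
  rw [walks, Finset.sum_biUnion, Finset.sum_filter]
  · refine Finset.sum_congr rfl fun d _ => ?_
    rw [Finset.sum_image]
    intro _ _ _ _ h
    simpa using h
  · intro d _ d' _ h
    simp only [Function.onFun, Finset.disjoint_left, Finset.mem_image]
    rintro _ ⟨w, _, rfl⟩ ⟨w', _, h'⟩
    simp only [List.cons.injEq] at h'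
    exact h h'.1.symm

/-- The product of the field elements of the darts. -/
def weight (X : ℕ → K) (w : List ℕ) : K := (w.map fun d => X (d / 2)).prod

/-- The darts contain exactly one edge from each set. -/
def Exact (P : Inst) (w : List ℕ) : Prop := ∀ i < P.k, (w.map fun d => P.tab i (d / 2)).sum = 1

theorem weight_congr {X : ℕ → K} {w' : List ℕ} (h : (w.map (· / 2)).Perm (w'.map (· / 2))) :
    weight X w = weight X w' := by
  have := (h.map X).prod_eq
  simpa [weight, Function.comp_def] using this

theorem exact_congr {w' : List ℕ} (h : (w.map (· / 2)).Perm (w'.map (· / 2))) :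
    Exact P w ↔ Exact P w' := by
  refine forall₂_congr fun i _ => ?_
  have := (h.map (P.tab i)).sum_eq
  simp only [List.map_map, Function.comp_def] at this
  rw [this]

open Classical in
/-- In characteristic two, walks with repeated vertices cancel. -/
theorem sum_walks_eq_sum_simple (hK : ∀ x : K, x + x = 0) {X : ℕ → K} {r : ℕ} {pre : List ℕ}
    (hmin : ∀ c, c.length < r → IsWalk P vis s v c → (v :: c.map P.dst).Nodup →
      ¬ Exact P (pre ++ c)) :
    ∑ w ∈ walks P vis s r v, (if Exact P (pre ++ w) then weight X w else 0) =
      ∑ w ∈ (walks P vis s r v).filter fun w => (v :: w.map P.dst).Nodup,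
        if Exact P (pre ++ w) then weight X w else 0 := by
  rw [← Finset.sum_filter_add_sum_filter_not (walks P vis s r v)
    fun w => (v :: w.map P.dst).Nodup, add_eq_left]
  have hperm : ∀ w ∈ walks P vis s r v, (if Exact P (pre ++ flip P v w) then
      weight X (flip P v w) else 0) = if Exact P (pre ++ w) then weight X w else 0 := by
    intro w hw
    obtain ⟨-, h2, -, -⟩ := flip_spec w v (mem_walks.1 hw).2
    have h3 : Exact P (pre ++ flip P v w) ↔ Exact P (pre ++ w) :=
      exact_congr (by simpa using h2.append_left _)
    simp only [h3, weight_congr h2]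
  -- Partners under the involution have the same edges, hence equal terms, which add up to zero in
  -- characteristic two. It remains to see that the term of a fixed walk with a repeated vertex
  -- vanishes.
  refine Finset.sum_involution (fun w _ => flip P v w) ?_ ?_ ?_ ?_
  · intro w hw
    rw [hperm w (Finset.mem_filter.1 hw).1]
    exact hK _
  · intro w hw hne hfix
    obtain ⟨h1, h2⟩ := Finset.mem_filter.1 hw
    obtain ⟨h3, h4⟩ := mem_walks.1 h1
    obtain ⟨c, g1, g2, -, g4, g5⟩ := exists_simple_of_flip_eq w v h4 hfix
    rcases g4 with rfl | g4
    · exact h2 g2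
    -- Deleting the palindromes changes the number of edges from a set by an even number without
    -- increasing it; from one it can only stay one. So a shorter simple walk would be exact too,
    -- against the minimality.
    · refine hmin c (by omega) g1 g2 fun i hi => ?_
      have hex : Exact P (pre ++ w) := by
        by_contra h
        exact hne (if_neg h)
      obtain ⟨q, hq⟩ := g5 (P.tab i)
      have h5 := hex i hi
      simp only [List.map_append, List.sum_append] at h5 ⊢
      omega
  · intro w hw
    obtain ⟨h1, h2⟩ := Finset.mem_filter.1 hw
    obtain ⟨h3, h4⟩ := mem_walks.1 h1
    obtain ⟨g1, g2, g3, -⟩ := flip_spec w v h4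
    refine Finset.mem_filter.2 ⟨mem_walks.2 ⟨?_, g1⟩, ?_⟩
    · rw [← h3]
      simpa using g3.length_eq
    · rwa [(g3.cons v).nodup_iff]
  · intro w hw
    exact (flip_spec w v (mem_walks.1 (Finset.mem_filter.1 hw).1).2).2.2.2

end EdgeSetCycle

/-! ### What the states and the rounds compute: exactly one edge from each set. -/

namespace EdgeSetCycle

variable {K : Type} [Field K] {P : Inst} {E : Env}

theorem testBit_sum_two_pow (c : ℕ → Prop) [DecidablePred c] (k i : ℕ) :
    (∑ i ∈ Finset.range k, if c i then 2 ^ i else 0).testBit i = decide (i < k ∧ c i) := by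
  have h : ∀ k, (∑ i ∈ Finset.range k, if c i then 2 ^ i else 0) < 2 ^ k := by
    intro k
    induction k with
    | zero => simp
    | succ k ih =>
      rw [Finset.sum_range_succ, pow_succ]
      split_ifs <;> omega
  induction k with
  | zero => simp
  | succ k ih =>
    have h1 : (∑ i ∈ Finset.range (k + 1), if c i then 2 ^ i else 0) =
        2 ^ k * (if c k then 1 else 0) + ∑ i ∈ Finset.range k, if c i then 2 ^ i else 0 := by
      rw [Finset.sum_range_succ, add_comm]
      split_ifs <;> simp
    rw [h1, Nat.testBit_two_pow_mul_add _ (h k), ih]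
    rcases lt_trichotomy i k with h2 | rfl | h2
    · simp [h2, h2.trans (Nat.lt_succ_self k)]
    · by_cases h3 : c i <;> simp [h3]
    · have h3 : ¬i < k := by omega
      have h4 : ∀ x < 2, Nat.testBit x (i - k) = false := fun x hx =>
        Nat.testBit_lt_two_pow (lt_of_lt_of_le hx (Nat.le_self_pow (by omega) 2))
      rw [if_neg h3, h4 _ (by split_ifs <;> omega)]
      simp
      omega

/-- The test allows a mask only inside the remaining bits, so each bit is removed at most once and
the bits add up without carries. -/
theorem trace_true_eq_some {ls : List ℕ} {j j' : ℕ} : trace true ls j = some j' ↔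
    ∀ i, (j.testBit i).toNat = (ls.map fun l => (l.testBit i).toNat).sum + (j'.testBit i).toNat := by
  induction ls generalizing j with
  | nil =>
    simp only [trace, Option.some.injEq, List.map_nil, List.sum_nil, zero_add]
    constructor
    · rintro rfl i
      rfl
    · intro h
      refine Nat.eq_of_testBit_eq fun i => ?_
      have := h i
      revert this
      cases j.testBit i <;> cases j'.testBit i <;> simp
  | cons l ls ih =>
    have ht : tst true j l ↔ ∀ i, l.testBit i = true → j.testBit i = true := by
      simp only [tst, if_true]
      constructor
      · intro h i hi
        rw [← h, Nat.testBit_and] at hi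
        simp_all
      · intro h
        refine Nat.eq_of_testBit_eq fun i => ?_
        rw [Nat.testBit_and]
        have := h i
        revert this
        cases j.testBit i <;> cases l.testBit i <;> simp
    rw [trace]
    split_ifs with h
    · rw [ih]
      refine forall_congr' fun i => ?_
      have := ht.1 h i
      simp only [nxt, if_true, Nat.testBit_xor, List.map_cons, List.sum_cons]
      revert this
      cases j.testBit i <;> cases l.testBit i <;> simp <;> omega
    · simp only [List.map_cons, List.sum_cons, false_iff]
      rw [ht] at h
      intro h'
      refine h fun i hi => ?_
      have := h' i
      rw [hi] at this
      revert this
      cases j.testBit i <;> simp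
      omega

theorem trace_false_eq_some {ls : List ℕ} {j j' : ℕ} :
    trace false ls j = some j' ↔ j = ls.sum + j' := by
  induction ls generalizing j with
  | nil => simp [trace]
  | cons l ls ih =>
    rw [trace]
    simp only [tst, nxt, Bool.false_eq_true, if_false, List.sum_cons]
    split_ifs with h
    · rw [ih]
      omega
    · simp only [false_iff]
      omega

/-- There are `k` summands, each at least one, so a total of `k` forces every product to be one. -/
theorem sum_weights_eq_iff {k : ℕ} {c a : ℕ → ℕ} (hc : ∀ i < k, 0 < c i) (ha : ∀ i < k, 0 < a i) :
    ∑ i ∈ Finset.range k, c i * a i = k ↔ ∀ i < k, c i = 1 ∧ a i = 1 := by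
  have h1 : ∀ i ∈ Finset.range k, 1 ≤ c i * a i := fun i hi =>
    Nat.mul_pos (hc i (Finset.mem_range.1 hi)) (ha i (Finset.mem_range.1 hi))
  have h2 := Finset.sum_eq_sum_iff_of_le h1
  simp only [Finset.sum_const, Finset.card_range, smul_eq_mul, mul_one, Finset.mem_range] at h2
  rw [eq_comm, h2]
  refine forall₂_congr fun i hi => ?_
  rw [eq_comm]
  exact ⟨fun h => ⟨Nat.eq_one_of_mul_eq_one_right h, Nat.eq_one_of_mul_eq_one_left h⟩,
    fun h => by rw [h.1, h.2]⟩

/-- Inclusion–exclusion modulo two. If some label is not used, its bit in `y` does not influence the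
weight, and toggling that bit pairs equal terms. If all labels are used, every summand of the weight
is at least one, so weight `k` requires each label to be used once and each to have weight one,
which happens only in the round `y = 2 ^ k - 1`. -/
theorem sum_rounds (hK : ∀ x : K, x + x = 0) (k : ℕ) (c : ℕ → ℕ) :
    (∑ y ∈ Finset.range (2 ^ k), if k = ∑ i ∈ Finset.range k, c i *
      (if y.testBit i then 1 else k + 1) then (1 : K) else 0) =
      if ∀ i < k, c i = 1 then 1 else 0 := by
  by_cases h0 : ∃ i < k, c i = 0
  · obtain ⟨i₀, hi₀, hc⟩ := h0
    rw [if_neg fun h => by have := h i₀ hi₀; omega]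
    have hbit : ∀ y i : ℕ, i ≠ i₀ → (y ^^^ 2 ^ i₀).testBit i = y.testBit i := by
      intro y i hi
      rw [Nat.testBit_xor, Nat.testBit_two_pow]
      simp [hi.symm]
    refine Finset.sum_involution (fun y _ => y ^^^ 2 ^ i₀) ?_ ?_ ?_ ?_
    · intro y _
      have : ∑ i ∈ Finset.range k, c i * (if (y ^^^ 2 ^ i₀).testBit i then 1 else k + 1) =
          ∑ i ∈ Finset.range k, c i * (if y.testBit i then 1 else k + 1) := by
        refine Finset.sum_congr rfl fun i _ => ?_
        by_cases hi : i = i₀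
        · rw [hi, hc, zero_mul, zero_mul]
        · rw [hbit y i hi]
      rw [this]
      exact hK _
    · intro y _ _ h
      have := congrArg (Nat.testBit · i₀) h
      simp [Nat.testBit_xor] at this
    · intro y hy
      exact Finset.mem_range.2 (Nat.xor_lt_two_pow (Finset.mem_range.1 hy)
        (Nat.pow_lt_pow_right (by omega) hi₀))
    · intro y _
      rw [Nat.xor_assoc, Nat.xor_self, Nat.xor_zero]
  · push Not at h0
    have h1 : ∀ y : ℕ, (k = ∑ i ∈ Finset.range k, c i * (if y.testBit i then 1 else k + 1)) ↔
        (∀ i < k, c i = 1) ∧ ∀ i < k, y.testBit i = true := by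
      intro y
      rw [eq_comm, sum_weights_eq_iff (fun i hi => Nat.pos_of_ne_zero (h0 i hi))
        (fun i _ => by split_ifs <;> omega), ← forall₂_and]
      refine forall₂_congr fun i hi => ?_
      refine and_congr_right fun _ => ?_
      cases y.testBit i <;> simp
      omega
    simp only [h1]
    split_ifs with h
    · rw [Finset.sum_eq_single (2 ^ k - 1)]
      · rw [if_pos]
        exact ⟨h, fun i hi => by rw [Nat.testBit_two_pow_sub_one]; simpa using hi⟩
      · intro y hy hne
        rw [if_neg]
        rintro ⟨-, h2⟩
        refine hne (Nat.eq_of_testBit_eq fun i => ?_)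
        rw [Nat.testBit_two_pow_sub_one]
        by_cases hi : i < k
        · simp [h2 i hi, hi]
        · rw [Nat.testBit_lt_two_pow (lt_of_lt_of_le (Finset.mem_range.1 hy)
            (Nat.pow_le_pow_right (by omega) (not_lt.1 hi)))]
          simp [hi]
      · intro h2
        simp at h2
    · simp [h]

/-- Here the two versions of the algorithm meet: with subsets as states a single round tests
exactness; with counters the test holds modulo two after summing over all rounds. -/
theorem sum_trace (hP : P.OK E) (hK : ∀ x : K, x + x = 0) {es : List ℕ} (hes : ∀ e ∈ es, e < P.m) :
    (∑ y ∈ Finset.range P.Y, if trace P.b (es.map (lamOf P (wtY P y))) (P.J - 1) = some 0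
      then (1 : K) else 0) = if ∀ i < P.k, (es.map (P.tab i)).sum = 1 then 1 else 0 := by
  cases hb : P.b with
  | true =>
    have hY : P.Y = 1 := by simp [Inst.Y, hb]
    have hJ : P.J = 2 ^ P.k := by simp [Inst.J, hb]
    rw [hY, Finset.sum_range_one, hJ]
    congr 1
    rw [trace_true_eq_some, eq_iff_iff]
    have h1 : ∀ i, ((2 ^ P.k - 1).testBit i).toNat = ((es.map (lamOf P (wtY P 0))).map
        fun l => (l.testBit i).toNat).sum + (Nat.testBit 0 i).toNat ↔
        (i < P.k → (es.map (P.tab i)).sum = 1) := by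
      intro i
      have h2 : ((es.map (lamOf P (wtY P 0))).map fun l => (l.testBit i).toNat).sum =
          if i < P.k then (es.map (P.tab i)).sum else 0 := by
        rw [List.map_map]
        have h3 : ∀ e ∈ es, ((fun l => (l.testBit i).toNat) ∘ lamOf P (wtY P 0)) e =
            if i < P.k then P.tab i e else 0 := by
          intro e he
          have h4 : lamOf P (wtY P 0) e =
              ∑ i ∈ Finset.range P.k, if P.tab i e ≠ 0 then 2 ^ i else 0 := by
            simp [lamOf, wtY, hb]
          rw [Function.comp_apply, h4, testBit_sum_two_pow]
          split_ifs with hi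
          · have := hP.tab_le i hi e (hes e he)
            interval_cases P.tab i e <;> simp [hi]
          · simp [hi]
        rw [List.map_congr_left h3]
        split_ifs
        · rfl
        · simp
      rw [h2, Nat.testBit_two_pow_sub_one]
      by_cases hi : i < P.k <;> simp [hi]
      omega
    simp only [h1]
  | false =>
    have hY : P.Y = 2 ^ P.k := by simp [Inst.Y, hb]
    have hJ : P.J = P.k + 1 := by simp [Inst.J, hb]
    have h1 : ∀ y, (es.map (lamOf P (wtY P y))).sum = ∑ i ∈ Finset.range P.k,
        (es.map (P.tab i)).sum * (if y.testBit i then 1 else P.k + 1) := by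
      intro y
      induction es with
      | nil => simp
      | cons e es ih =>
        rw [List.map_cons, List.sum_cons, ih fun e he => hes e (by simp [he]), lamOf,
          ← Finset.sum_add_distrib]
        refine Finset.sum_congr rfl fun i hi => ?_
        rw [List.map_cons, List.sum_cons, add_mul]
        congr 1
        have := hP.tab_le i (Finset.mem_range.1 hi) e (hes e (by simp))
        interval_cases P.tab i e <;> simp [wtY, hb]
    rw [hY, hJ, ← sum_rounds hK P.k]
    refine Finset.sum_congr rfl fun y _ => ?_
    simp only [trace_false_eq_some, h1, Nat.add_sub_cancel, add_zero]

theorem gval_eq (P : Inst) (lam vis : ℕ → ℕ) (X : ℕ → K) (s r v j : ℕ) :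
    gval P lam vis X s r v j = ∑ w ∈ walks P vis s r v,
      if trace P.b (w.map fun d => lam (d / 2)) j = some 0 then weight X w else 0 := by
  induction r generalizing v j with
  | zero =>
    simp only [gval, walks]
    by_cases h : v = s <;> simp [h, trace, weight]
  | succ r ih =>
    rw [gval, sum_walks_succ]
    refine Finset.sum_congr rfl fun d _ => ?_
    rw [relaxTerm]
    by_cases h : P.src d = v ∧ vis (P.dst d) = 0
    · rw [if_pos h]
      by_cases ht : tst P.b j (lam (d / 2))
      · rw [if_pos ⟨h.1, h.2, ht⟩, ih, Finset.mul_sum]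
        refine Finset.sum_congr rfl fun w _ => ?_
        simp only [List.map_cons, trace, ht, if_true, weight, List.prod_cons]
        split_ifs <;> simp
      · rw [if_neg (by tauto)]
        simp [trace, ht]
    · rw [if_neg h, if_neg (by tauto)]

-- The sum over rounds is exchanged with the sum over walks, and `sum_trace` is applied to the edges
-- of each walk, including those of the fixed prefix.
open Classical in
theorem totalVal_eq (hP : P.OK E) (hK : ∀ x : K, x + x = 0) (vis cand : ℕ → ℕ) (X : ℕ → K)
    {pre : List ℕ} (s r : ℕ) {d : ℕ} (hpre : ∀ d ∈ pre, d < 2 * P.m) (hd : d < 2 * P.m) :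
    totalVal P vis cand X (pre.map (· / 2)) s r d = if cand d ≠ 0 then
      ∑ w ∈ walks P vis s r (P.dst d), if Exact P (pre ++ d :: w) then weight X (d :: w) else 0
      else 0 := by
  by_cases hc : cand d = 0
  · rw [if_neg (by simpa using hc), totalVal_eq_zero hc]
  rw [if_pos hc, totalVal]
  have h1 : ∀ y, roundVal P vis cand X (pre.map (· / 2)) s y r d =
      ∑ w ∈ walks P vis s r (P.dst d), (if trace P.b (((pre ++ d :: w).map (· / 2)).map
        (lamOf P (wtY P y))) (P.J - 1) = some 0 then 1 else 0) * weight X (d :: w) := by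
    intro y
    simp only [roundVal, List.map_append, trace_append]
    cases trace P.b ((pre.map (· / 2)).map (lamOf P (wtY P y))) (P.J - 1) with
    | none => simp [hookVal]
    | some j =>
      simp only [hookVal, hookTerm, Option.bind_some, List.map_cons, trace]
      by_cases ht : tst P.b j (lamOf P (wtY P y) (d / 2))
      · rw [if_pos ⟨hc, ht⟩, gval_eq, Finset.mul_sum]
        refine Finset.sum_congr rfl fun w _ => ?_
        simp only [ht, if_true, weight, List.map_cons, List.prod_cons, List.map_map,
          Function.comp_def]
        split_ifs <;> simp
      · rw [if_neg (by tauto)]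
        simp [ht]
  simp only [h1]
  rw [Finset.sum_comm]
  refine Finset.sum_congr rfl fun w hw => ?_
  rw [← Finset.sum_mul, sum_trace hP hK]
  · have : (∀ i < P.k, (((pre ++ d :: w).map (· / 2)).map (P.tab i)).sum = 1) ↔
        Exact P (pre ++ d :: w) := by
      simp [Exact, Function.comp_def]
    simp only [this]
    split_ifs <;> simp
  · intro e he
    obtain ⟨d', hd', rfl⟩ := List.mem_map.1 he
    have : d' < 2 * P.m := by
      rcases List.mem_append.1 hd' with h | h
      · exact hpre d' h
      · rcases List.mem_cons.1 h with rfl | h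
        · exact hd
        · exact (mem_walks.1 hw).2.lt d' h
    omega

end EdgeSetCycle

/-! ### The values up to the minimum length, and self-reduction along the path. -/

namespace EdgeSetCycle

variable {K : Type} [Field K] {P : Inst} {E : Env} {s : ℕ}

/-- The list of darts `L` is a simple closed walk through `s` with exactly one edge from each set,
which starts with a candidate. -/
def Cyc (P : Inst) (s : ℕ) (L : List ℕ) : Prop :=
  IsWalk P (fun _ => 0) s s L ∧ (∃ d ∈ L.head?, firstCand P s d ≠ 0) ∧ (L.map P.dst).Nodup ∧
    Exact P L

theorem visOf_eq_zero {pe : ℕ → ℕ} {j v : ℕ} :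
    visOf P pe j v = 0 ↔ v ∉ ((List.range j).map pe).map P.dst := by
  simp [visOf]

/-- The first `j` darts `pe` form a simple walk from `s` to `u`. -/
structure PathTo (P : Inst) (pe : ℕ → ℕ) (s j u : ℕ) : Prop where
  walk : IsWalk P (fun _ => 0) u s ((List.range j).map pe)
  nodup : (((List.range j).map pe).map P.dst).Nodup
  cand : ∀ d, candOf P pe s j d ≠ 0 → P.src d = u ∧ visOf P pe j (P.dst d) = 0 ∧
    ∃ d' ∈ ((List.range j).map pe ++ [d]).head?, firstCand P s d' ≠ 0

theorem PathTo.zero (pe : ℕ → ℕ) (s : ℕ) : PathTo P pe s 0 s := by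
  refine ⟨rfl, List.nodup_nil, fun d hd => ⟨?_, by simp [visOf], d, by simp, by simpa [candOf] using hd⟩⟩
  by_contra h
  exact hd (by simp [candOf, firstCand, h])

theorem PathTo.succ {pe : ℕ → ℕ} {j u : ℕ} (h : PathTo P pe s j u) (hj : pe j < 2 * P.m)
    (hc : candOf P pe s j (pe j) ≠ 0) : PathTo P pe s (j + 1) (P.dst (pe j)) := by
  obtain ⟨h1, h2, d', h3, h4⟩ := h.cand _ hc
  have e : (List.range (j + 1)).map pe = (List.range j).map pe ++ [pe j] := by
    simp [List.range_succ]
  refine ⟨?_, ?_, fun d hd => ?_⟩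
  · rw [e, isWalk_append]
    exact ⟨u, h.walk, hj, h1, rfl, rfl⟩
  · rw [e, List.map_append, List.nodup_append]
    refine ⟨h.nodup, by simp, ?_⟩
    intro a ha b hb
    rw [visOf_eq_zero] at h2
    simp only [List.map_cons, List.map_nil, List.mem_singleton] at hb
    rw [hb]
    exact fun hab => h2 (hab ▸ ha)
  · have : P.src d = P.dst (pe j) ∧ visOf P pe (j + 1) (P.dst d) = 0 := by
      by_contra hcon
      exact hd (by simp only [candOf, Nat.succ_ne_zero, if_false, Nat.add_sub_cancel, if_neg hcon])
    refine ⟨this.1, this.2, d', ?_, h4⟩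
    rw [e, List.head?_append, h3]
    simp

/-- The completion avoids the heads already visited and is simple itself, so no head is repeated in
the concatenation. -/
theorem PathTo.cyc {pe : ℕ → ℕ} {j u d : ℕ} {w : List ℕ} (h : PathTo P pe s j u)
    (hd : d < 2 * P.m) (hc : candOf P pe s j d ≠ 0)
    (hw : IsWalk P (visOf P pe j) s (P.dst d) w) (hn : (P.dst d :: w.map P.dst).Nodup)
    (he : Exact P ((List.range j).map pe ++ d :: w)) :
    Cyc P s ((List.range j).map pe ++ d :: w) := by
  obtain ⟨h1, h2, d', h3, h4⟩ := h.cand _ hc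
  refine ⟨isWalk_append.2 ⟨u, h.walk, hd, h1, rfl, hw.mono fun _ _ => rfl⟩, ⟨d', ?_, h4⟩, ?_, he⟩
  · rw [List.append_cons, List.head?_append, h3]
    simp
  · rw [List.map_append, List.nodup_append]
    refine ⟨h.nodup, hn, ?_⟩
    intro a ha b hb hab
    rcases List.mem_cons.1 hb with rfl | hb
    · exact visOf_eq_zero.1 h2 (hab ▸ ha)
    · obtain ⟨d'', hd'', rfl⟩ := List.mem_map.1 hb
      exact visOf_eq_zero.1 (hw.vis_dst _ hd'') (hab ▸ ha)

-- A shorter exact simple completion would close the path to a cycle shorter than `r + 1`. So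
-- minimality supplies the hypothesis of `sum_walks_eq_sum_simple`, applied with the path followed
-- by `d` as prefix.
open Classical in
theorem stepVal_eq (hP : P.OK E) (hK : ∀ x : K, x + x = 0) {X : ℕ → K} {pe : ℕ → ℕ} {j u r d : ℕ}
    (h : PathTo P pe s j u) (hjr : j ≤ r) (hmin : ∀ L, Cyc P s L → r + 1 ≤ L.length)
    (hd : d < 2 * P.m) : stepVal P X pe s r j d = if candOf P pe s j d ≠ 0 then
      X (d / 2) * ∑ w ∈ (walks P (visOf P pe j) s (r - j) (P.dst d)).filter
        (fun w => (P.dst d :: w.map P.dst).Nodup),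
        if Exact P ((List.range j).map pe ++ d :: w) then weight X w else 0
      else 0 := by
  have e : ((List.range j).map fun i => pe i / 2) = ((List.range j).map pe).map (· / 2) := by
    simp [Function.comp_def]
  rw [stepVal, e, totalVal_eq hP hK _ _ _ _ _ h.walk.lt hd]
  split_ifs with hc
  · have h1 : ∀ w : List ℕ, (if Exact P ((List.range j).map pe ++ d :: w) then weight X (d :: w)
        else 0) = X (d / 2) * if Exact P (((List.range j).map pe ++ [d]) ++ w)
          then weight X w else 0 := by
      intro w
      rw [List.append_assoc, List.singleton_append]
      split_ifs <;> simp [weight]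
    simp only [h1]
    rw [← Finset.mul_sum, sum_walks_eq_sum_simple hK]
    · simp only [List.append_assoc, List.singleton_append]
    · intro c hcl hcw hcn hce
      rw [List.append_assoc, List.singleton_append] at hce
      have := hmin _ (h.cyc hd hc hcw hcn hce)
      simp only [List.length_append, List.length_map, List.length_range, List.length_cons] at this
      omega
  · rfl

/-- Splitting the simple completions by their first dart expresses the value of `pe j` as its field
element times the sum of the values of the next darts. Not returning to the head of `pe j` is first
a part of simplicity and then a mark of a visited vertex. -/
theorem exists_stepVal_ne_zero (hP : P.OK E) (hK : ∀ x : K, x + x = 0) {X : ℕ → K} {pe : ℕ → ℕ}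
    {j u r : ℕ} (h : PathTo P pe s j u) (hjr : j + 1 ≤ r)
    (hmin : ∀ L, Cyc P s L → r + 1 ≤ L.length) (hj : pe j < 2 * P.m)
    (hne : stepVal P X pe s r j (pe j) ≠ 0) : ∃ d < 2 * P.m, stepVal P X pe s r (j + 1) d ≠ 0 := by
  classical
  by_contra hcon
  push Not at hcon
  rw [stepVal_eq hP hK h (by omega) hmin hj] at hne
  have hc : candOf P pe s j (pe j) ≠ 0 := by
    intro hc
    simp [hc] at hne
  rw [if_pos hc, Finset.sum_filter, show r - j = r - (j + 1) + 1 by omega, sum_walks_succ] at hne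
  refine hne ?_
  rw [Finset.sum_eq_zero, mul_zero]
  intro d hd
  have hd := Finset.mem_range.1 hd
  have h0 := hcon d hd
  rw [stepVal_eq hP hK (h.succ hj hc) hjr hmin hd] at h0
  have hcd : candOf P pe s (j + 1) d ≠ 0 ↔ P.src d = P.dst (pe j) ∧ visOf P pe (j + 1) (P.dst d) = 0 := by
    simp [candOf]
  have hvis : ∀ v, visOf P pe (j + 1) v = 0 ↔ visOf P pe j v = 0 ∧ v ≠ P.dst (pe j) := by
    intro v
    simp only [visOf_eq_zero, List.range_succ, List.map_append, List.mem_append, not_or]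
    simp
  have e : (List.range (j + 1)).map pe = (List.range j).map pe ++ [pe j] := by
    simp [List.range_succ]
  split_ifs with hs
  · by_cases hv : P.dst d = P.dst (pe j)
    · refine Finset.sum_eq_zero fun w _ => if_neg fun hn => ?_
      simp [hv] at hn
    · rw [if_pos (hcd.2 ⟨hs.1, (hvis _).2 ⟨hs.2, hv⟩⟩), Finset.mul_sum] at h0
      rw [← Finset.sum_filter]
      refine (Finset.sum_congr ?_ fun w _ => ?_).trans h0
      · ext w
        simp only [Finset.mem_filter, mem_walks, List.map_cons]
        constructor
        · rintro ⟨⟨h1, h2⟩, h3⟩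
          have h4 := List.nodup_cons.1 h3
          refine ⟨⟨h1, h2.mono fun d' hd' => (hvis _).2 ⟨h2.vis_dst d' hd', fun h5 => ?_⟩⟩, h4.2⟩
          exact h4.1 (List.mem_cons_of_mem _ (h5 ▸ List.mem_map_of_mem hd'))
        · rintro ⟨⟨h1, h2⟩, h3⟩
          refine ⟨⟨h1, h2.mono fun d' hd' => ((hvis _).1 (h2.vis_dst d' hd')).1⟩,
            List.nodup_cons.2 ⟨fun h5 => ?_, h3⟩⟩
          rcases List.mem_cons.1 h5 with h5 | h5
          · exact hv h5.symm
          · obtain ⟨d', hd', h6⟩ := List.mem_map.1 h5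
            exact ((hvis _).1 (h2.vis_dst d' hd')).2 h6
      · rw [e, List.append_assoc, List.singleton_append]
        split_ifs <;> simp [weight]
  · rfl

open Classical in
/-- The simple closed walks of length `r` through `s` with exactly one edge from each set. -/
noncomputable def cycs (P : Inst) (s r : ℕ) : Finset (List ℕ) :=
  (walks P (fun _ => 0) s r s).filter (Cyc P s)

theorem mem_cycs {r : ℕ} {L : List ℕ} : L ∈ cycs P s r ↔ L.length = r ∧ Cyc P s L := by
  classical
  rw [cycs, Finset.mem_filter, mem_walks]
  exact ⟨fun h => ⟨h.1.1, h.2⟩, fun h => ⟨⟨h.1, h.2.1⟩, h.2⟩⟩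

theorem decVal_eq_sum_stepVal (X : ℕ → K) (pe : ℕ → ℕ) (r : ℕ) : decVal P X s r =
    ∑ d ∈ Finset.range (2 * P.m), stepVal P X pe s r 0 d := by
  have h1 : visOf P pe 0 = fun _ => 0 := by
    funext v
    simp [visOf]
  have h2 : candOf P pe s 0 = firstCand P s := by
    funext d
    simp [candOf]
  simp only [decVal, stepVal, h1, h2, List.range_zero, List.map_nil, Nat.sub_zero]

/-- The case of the empty path, summed over all first darts. Below the minimum length the right-hand
side is an empty sum. -/
theorem decVal_eq (hP : P.OK E) (hK : ∀ x : K, x + x = 0) (X : ℕ → K) {r : ℕ}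
    (hmin : ∀ L, Cyc P s L → r + 1 ≤ L.length) :
    decVal P X s r = ∑ L ∈ cycs P s (r + 1), weight X L := by
  classical
  rw [cycs, Finset.sum_filter, sum_walks_succ, decVal_eq_sum_stepVal X (fun _ => 0)]
  refine Finset.sum_congr rfl fun d hd => ?_
  have hd := Finset.mem_range.1 hd
  rw [stepVal_eq hP hK (PathTo.zero _ s) (Nat.zero_le r) hmin hd]
  have h1 : visOf P (fun _ => 0) 0 = fun _ => 0 := by
    funext v
    simp [visOf]
  have h2 : candOf P (fun _ => 0) s 0 = firstCand P s := by
    funext d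
    simp [candOf]
  simp only [h1, h2, List.range_zero, List.map_nil, Nat.sub_zero, List.nil_append, and_true]
  by_cases hc : firstCand P s d = 0
  · rw [if_neg (by simpa using hc)]
    split_ifs with hs
    · refine (Finset.sum_eq_zero fun w _ => if_neg ?_).symm
      rintro ⟨-, ⟨d', hd', hne⟩, -⟩
      simp at hd'
      exact hne (hd' ▸ hc)
    · rfl
  · have hs : P.src d = s := by
      by_contra h
      exact hc (by simp [firstCand, h])
    rw [if_pos hc, if_pos hs, Finset.mul_sum, Finset.sum_filter]
    refine Finset.sum_congr rfl fun w hw => ?_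
    have hw := (mem_walks.1 hw).2
    have : Cyc P s (d :: w) ↔ (P.dst d :: w.map P.dst).Nodup ∧ Exact P (d :: w) := by
      rw [Cyc]
      simp [IsWalk, hd, hs, hw, hc]
    by_cases hn : (P.dst d :: w.map P.dst).Nodup <;> by_cases he : Exact P (d :: w) <;>
      simp [this, hn, he, weight]

theorem exists_cyc (hP : P.OK E) (hK : ∀ x : K, x + x = 0) {X : ℕ → K} {r : ℕ}
    (hmin : ∀ L, Cyc P s L → r + 1 ≤ L.length) (hne : decVal P X s r ≠ 0) :
    ∃ L, Cyc P s L ∧ L.length = r + 1 := by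
  rw [decVal_eq hP hK X hmin] at hne
  obtain ⟨L, hL, -⟩ := Finset.exists_ne_zero_of_sum_ne_zero hne
  exact ⟨L, (mem_cycs.1 hL).2, (mem_cycs.1 hL).1⟩

/-- Nonzero values propagate along the chosen darts. -/
theorem cyc_of_good (hP : P.OK E) (hK : ∀ x : K, x + x = 0) {X : ℕ → K} {r : ℕ} {pe : ℕ → ℕ}
    (hmin : ∀ L, Cyc P s L → r + 1 ≤ L.length) (hne : decVal P X s r ≠ 0)
    (hg : ∀ j < r + 1, Good P X pe s r j) : Cyc P s ((List.range (r + 1)).map pe) := by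
  have key : ∀ j ≤ r, ∃ u, PathTo P pe s j u ∧ stepVal P X pe s r j (pe j) ≠ 0 := by
    intro j
    induction j with
    | zero =>
      intro _
      refine ⟨s, PathTo.zero pe s, (hg 0 (by omega)).2 ?_⟩
      rw [decVal_eq_sum_stepVal X pe] at hne
      obtain ⟨d, hd, h⟩ := Finset.exists_ne_zero_of_sum_ne_zero hne
      exact ⟨d, Finset.mem_range.1 hd, h⟩
    | succ j ih =>
      intro hj
      obtain ⟨u, h1, h2⟩ := ih (by omega)
      have hpe := (hg j (by omega)).1
      have hc : candOf P pe s j (pe j) ≠ 0 := fun hc => h2 (totalVal_eq_zero hc)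
      exact ⟨_, h1.succ hpe hc, (hg (j + 1) (by omega)).2
        (exists_stepVal_ne_zero hP hK h1 hj hmin hpe h2)⟩
  classical
  obtain ⟨u, h1, h2⟩ := key r le_rfl
  have hpe := (hg r (by omega)).1
  have hc : candOf P pe s r (pe r) ≠ 0 := fun hc => h2 (totalVal_eq_zero hc)
  rw [stepVal_eq hP hK h1 le_rfl hmin hpe, if_pos hc] at h2
  -- After the last dart the only possible completion is the empty one, so a nonzero value says that
  -- the path has closed and is exact.
  obtain ⟨w, hw, h3⟩ := Finset.exists_ne_zero_of_sum_ne_zero (right_ne_zero_of_mul h2)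
  obtain ⟨hw1, hw2⟩ := Finset.mem_filter.1 hw
  rw [Nat.sub_self] at hw1
  obtain ⟨hw3, hw4⟩ := mem_walks.1 hw1
  obtain rfl := List.length_eq_zero_iff.1 hw3
  have := h1.cyc hpe hc hw4 hw2 (by by_contra h; exact h3 (if_neg h))
  simpa [List.range_succ] using this

end EdgeSetCycle

/-! ### Independence of the trials. -/

namespace WordRAM

theorem one_sub_prob_le {w T : ℕ} {A B : (Fin T → BitVec w) → Prop} (h : ∀ ω, ¬ B ω → A ω) :
    1 - prob B ≤ prob A := by
  classical
  have h1 : (Fintype.card (Fin T → BitVec w) : ℝ) ≠ 0 := Nat.cast_ne_zero.2 Fintype.card_ne_zero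
  rw [prob, prob, Nat.card_eq_fintype_card, Nat.card_eq_fintype_card, Nat.card_eq_fintype_card,
    sub_le_iff_le_add, ← add_div, le_div_iff₀ (by positivity), one_mul, ← Nat.cast_add,
    Fintype.card_subtype, Fintype.card_subtype]
  refine Nat.cast_le.2 (le_trans ?_ (Finset.card_union_le _ _))
  rw [← Finset.card_univ]
  refine Finset.card_le_card fun ω _ => ?_
  by_cases hB : B ω
  · simp [hB]
  · simp [h ω hB]

/-- The random words split into independent uniformly random residues and a remainder. -/
theorem exists_equiv_draws (D m T' : ℕ) {q w : ℕ} (hq : q ≤ w) :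
    ∃ (Z : Type) (_ : Finite Z) (_ : Nonempty Z)
      (Φ : (Fin (D * m + T') → BitVec w) ≃ (Fin D → Fin m → Fin (2 ^ q)) × Z),
      ∀ ω (t : Fin D) (e : Fin m),
        ((Φ ω).1 t e : ℕ) = (extend ω (t * m + e)).toNat &&& (2 ^ q - 1) := by
  have hw : 2 ^ w = 2 ^ (w - q) * 2 ^ q := by rw [← pow_add, Nat.sub_add_cancel hq]
  -- Quotient and residue modulo `2 ^ q`; the residue is the part that the mask `2 ^ q - 1` keeps.
  let β : BitVec w ≃ Fin (2 ^ (w - q)) × Fin (2 ^ q) :=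
    (⟨fun x => ⟨x.toNat, x.isLt⟩, fun i => BitVec.ofFin i, fun _ => rfl, fun _ => rfl⟩ :
      BitVec w ≃ Fin (2 ^ w)).trans ((finCongr hw).trans finProdFinEquiv.symm)
  have hβ : ∀ x, ((β x).2 : ℕ) = x.toNat &&& (2 ^ q - 1) := fun x => by
    rw [Nat.and_two_pow_sub_one_eq_mod]
    rfl
  let Φ : (Fin (D * m + T') → BitVec w) ≃ (Fin D → Fin m → Fin (2 ^ q)) ×
      ((Fin D → Fin m → Fin (2 ^ (w - q))) × (Fin T' → BitVec w)) :=
    { toFun := fun ω => (fun t e => (β (ω (Fin.castAdd T' (finProdFinEquiv (t, e))))).2,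
        fun t e => (β (ω (Fin.castAdd T' (finProdFinEquiv (t, e))))).1, fun i => ω (Fin.natAdd _ i))
      invFun := fun x => Fin.append
        (fun i => β.symm (x.2.1 (finProdFinEquiv.symm i).1 (finProdFinEquiv.symm i).2,
          x.1 (finProdFinEquiv.symm i).1 (finProdFinEquiv.symm i).2)) x.2.2
      left_inv := fun ω => by
        funext i
        refine Fin.addCases (fun i => ?_) (fun i => ?_) i
        · simp only [Fin.append_left, Prod.mk.eta, Equiv.apply_symm_apply, Equiv.symm_apply_apply]
        · simp only [Fin.append_right]
      right_inv := fun x => by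
        simp only [Fin.append_left, Fin.append_right, Equiv.symm_apply_apply,
          Equiv.apply_symm_apply] }
  refine ⟨_, inferInstance, inferInstance, Φ, fun ω t e => ?_⟩
  have h1 : (t : ℕ) * m + e < D * m + T' := by
    have := (finProdFinEquiv (t, e)).isLt
    simp only [finProdFinEquiv_apply_val] at this
    rw [mul_comm]
    omega
  have h2 : Fin.castAdd T' (finProdFinEquiv (t, e)) = ⟨t * m + e, h1⟩ := by
    ext
    simp only [Fin.val_castAdd, finProdFinEquiv_apply_val]
    ring
  rw [show ((Φ ω).1 t e : ℕ) = ((β (ω (Fin.castAdd T' (finProdFinEquiv (t, e))))).2 : ℕ) from rfl,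
    hβ, h2, extend, dif_pos h1]

/-- The probability that each of `D` independent trials fails. -/
theorem prob_forall_le {D m T' q w : ℕ} (hq : q ≤ w) {B : (Fin m → Fin (2 ^ q)) → Prop}
    (hB : 2 * Nat.card {x // B x} ≤ (2 ^ q) ^ m) {A : (Fin (D * m + T') → BitVec w) → Prop}
    (hA : ∀ ω, A ω → ∀ t < D, ∀ x : Fin m → Fin (2 ^ q), (∀ e : Fin m, (x e : ℕ) =
      (extend ω (t * m + e)).toNat &&& (2 ^ q - 1)) → B x) :
    prob A ≤ (1 / 2) ^ D := by
  classical
  obtain ⟨Z, _, _, Φ, hΦ⟩ := exists_equiv_draws D m T' hq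
  have h1 : Nat.card {ω // A ω} ≤ Nat.card {x // B x} ^ D * Nat.card Z := by
    have h2 : Nat.card ((Fin D → {x // B x}) × Z) = Nat.card {x // B x} ^ D * Nat.card Z := by
      rw [Nat.card_prod, Nat.card_fun, Nat.card_fin]
    rw [← h2]
    -- An outcome on which all trials fail is determined by `D` failing assignments and the
    -- remaining random bits.
    refine Nat.card_le_card_of_injective (fun ω => ⟨fun t => ⟨(Φ ω.1).1 t,
      hA ω.1 ω.2 t t.isLt _ fun e => hΦ ω.1 t e⟩, (Φ ω.1).2⟩) ?_
    intro ω ω' h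
    simp only [Prod.mk.injEq, funext_iff, Subtype.mk.injEq] at h
    exact Subtype.ext (Φ.injective (Prod.ext (funext fun t => funext fun e => h.1 t e) h.2))
  have h3 : Nat.card (Fin (D * m + T') → BitVec w) = ((2 ^ q) ^ m) ^ D * Nat.card Z := by
    rw [Nat.card_congr Φ, Nat.card_prod, Nat.card_fun, Nat.card_fun, Nat.card_fin, Nat.card_fin,
      Nat.card_fin]
  have hZ : 0 < Nat.card Z := Nat.card_pos
  rw [prob, h3, div_le_iff₀ (by positivity)]
  calc (Nat.card {ω // A ω} : ℝ) ≤ (Nat.card {x // B x} : ℝ) ^ D * Nat.card Z := by exact_mod_cast h1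
    _ ≤ (1 / 2 * ((2 ^ q) ^ m : ℕ)) ^ D * Nat.card Z := by
      gcongr
      have : (2 * Nat.card {x // B x} : ℝ) ≤ ((2 ^ q) ^ m : ℕ) := by exact_mod_cast hB
      linarith
    _ = _ := by
      push_cast
      rw [mul_pow]
      ring

end WordRAM

/-! ### Distinct monomials and the bound of Schwartz–Zippel. -/

namespace EdgeSetCycle

variable {K : Type} [Field K] {P : Inst} {E : Env} {s : ℕ} {vis : ℕ → ℕ}

theorem eq_or_eq_xor_one {d d' : ℕ} (h : d / 2 = d' / 2) : d = d' ∨ d = d' ^^^ 1 := by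
  rcases Nat.even_or_odd d' with hd | hd
  · rw [Nat.xor_one_of_even hd]
    obtain ⟨c, rfl⟩ := hd
    omega
  · rw [Nat.xor_one_of_odd hd]
    obtain ⟨c, rfl⟩ := hd
    omega

/-- A simple walk is determined by its end and its edges. -/
theorem IsWalk.eq_of_perm {v : ℕ} {w w' : List ℕ} (hw : IsWalk P vis s v w)
    (hw' : IsWalk P vis s v w') (hn : (v :: w.map P.dst).Nodup) (hn' : (v :: w'.map P.dst).Nodup)
    (hp : (w.map (· / 2)).Perm (w'.map (· / 2))) : w = w' := by
  induction w generalizing v w' with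
  | nil =>
    have := hp.length_eq
    simp only [List.map_nil, List.length_nil, List.length_map] at this
    exact (List.length_eq_zero_iff.1 this.symm).symm
  | cons d w ih =>
    rcases w' with _ | ⟨d', w'⟩
    · simp at hp
    obtain ⟨h1, h2, h3, h4⟩ := hw
    obtain ⟨g1, g2, g3, g4⟩ := hw'
    have hd : P.dst d ≠ v := fun h => by simp [h] at hn
    have : d / 2 ∈ (d' :: w').map (· / 2) := hp.subset (by simp)
    obtain ⟨d'', hd'', he⟩ := List.mem_map.1 this
    have hv : P.src d'' = v ∨ P.dst d'' = v := by
      rcases eq_or_eq_xor_one he with rfl | rfl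
      · exact Or.inl h2
      · exact Or.inr (by rw [P.dst_xor_one, h2])
    -- The edge at hand contains `v`, and a simple walk never returns to its start, so this edge can
    -- only be the first one.
    have hv' : d'' = d' := by
      by_contra hne
      have hmem : d'' ∈ w' := by simpa [hne] using hd''
      rcases hv with hv | hv
      · have h5 : P.src d'' ∈ w'.map P.src ++ [s] :=
          List.mem_append_left _ (List.mem_map_of_mem hmem)
        rw [g4.map_src, hv] at h5
        exact (List.nodup_cons.1 hn').1 h5
      · exact (List.nodup_cons.1 hn').1 (List.mem_cons_of_mem _
          (List.mem_map.2 ⟨_, hmem, hv⟩))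
    subst hv'
    have hdd : d'' = d := by
      rcases eq_or_eq_xor_one he with h | h
      · exact h
      · rw [h] at g2
        exact absurd g2 hd
    subst hdd
    rw [ih h4 g4 (List.nodup_cons.1 hn).2 (List.nodup_cons.1 hn').2 (by simpa using hp)]

/-- The cycle contains just one edge of the first set, and this edge is its first one, traversed
from the smaller to the larger endpoint. So the first dart is determined by the edges, and the
remaining simple walk by `IsWalk.eq_of_perm`. Without the orientation, a cycle and its reversal
would have the same monomial and cancel. -/
theorem Cyc.eq_of_perm (hP : P.OK E) {L L' : List ℕ} (hL : Cyc P s L) (hL' : Cyc P s L')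
    (hp : (L.map (· / 2)).Perm (L'.map (· / 2))) : L = L' := by
  obtain ⟨h1, ⟨d, hd, hc⟩, h2, h3⟩ := hL
  obtain ⟨g1, ⟨d', hd', hc'⟩, g2, -⟩ := hL'
  rcases L with _ | ⟨e, w⟩
  · simp at hd
  rcases L' with _ | ⟨e', w'⟩
  · simp at hd'
  simp only [List.head?_cons, Option.mem_def, Option.some.injEq] at hd hd'
  subst hd hd'
  have hcand : ∀ {d}, firstCand P s d ≠ 0 → P.src d = s ∧ s < P.dst d ∧ P.tab 0 (d / 2) = 1 := by
    intro d h
    by_contra hcon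
    exact h (if_neg hcon)
  obtain ⟨a1, a2, a3⟩ := hcand hc
  obtain ⟨b1, b2, b3⟩ := hcand hc'
  have he : e' / 2 = e / 2 := by
    have h4 : e' / 2 ∈ (e :: w).map (· / 2) := hp.symm.subset (by simp)
    obtain ⟨d, hd, hde⟩ := List.mem_map.1 h4
    rcases List.mem_cons.1 hd with rfl | hd
    · exact hde.symm
    · have h5 := h3 0 hP.k0
      have h6 : P.tab 0 (d / 2) ≤ (w.map fun d => P.tab 0 (d / 2)).sum :=
        List.single_le_sum (by simp) _ (List.mem_map_of_mem hd)
      simp only [List.map_cons, List.sum_cons] at h5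
      rw [hde] at h6
      omega
  have hee : e' = e := by
    rcases eq_or_eq_xor_one he with h | h
    · exact h
    · rw [h, P.src_xor_one] at b1
      omega
  subst hee
  rw [h1.2.2.2.eq_of_perm g1.2.2.2 h2 g2 (by simpa using hp)]

theorem Cyc.length_le (hP : P.OK E) {L : List ℕ} (hL : Cyc P s L) : L.length ≤ P.n := by
  have h1 : (L.map P.dst).toFinset ⊆ Finset.range P.n := by
    intro v hv
    obtain ⟨d, hd, rfl⟩ := List.mem_map.1 (List.mem_toFinset.1 hv)
    exact Finset.mem_range.2 (hP.dst_lt (hL.1.lt d hd))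
  have h2 := Finset.card_le_card h1
  rwa [List.toFinset_card_of_nodup hL.2.2.1, List.length_map, Finset.card_range] at h2

/-- The edges of a list of darts, with multiplicities. -/
noncomputable def edgeCount (m : ℕ) (L : List ℕ) : Fin m →₀ ℕ :=
  Finsupp.equivFunOnFinite.symm fun e => (L.map (· / 2)).count (e : ℕ)

theorem sum_edgeCount {m : ℕ} {L : List ℕ} (hL : ∀ d ∈ L, d < 2 * m) :
    ∑ e : Fin m, edgeCount m L e = L.length := by
  have : L.length = ∑ e ∈ Finset.range m, (L.map (· / 2)).count e := by
    have h1 : Multiset.card (↑(L.map (· / 2)) : Multiset ℕ) = _ :=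
      (Multiset.sum_count_eq_card (s := Finset.range m) fun a ha => by
        obtain ⟨d, hd, rfl⟩ := List.mem_map.1 (Multiset.mem_coe.1 ha)
        have := hL d hd
        exact Finset.mem_range.2 (by omega)).symm
    simpa using h1
  rw [this, Finset.sum_range]
  rfl

theorem eval_monomial_edgeCount {m : ℕ} {L : List ℕ} (hL : ∀ d ∈ L, d < 2 * m) (X : ℕ → K) :
    MvPolynomial.eval (fun e : Fin m => X e) (MvPolynomial.monomial (edgeCount m L) 1) =
      weight X L := by
  rw [MvPolynomial.eval_monomial, one_mul, Finsupp.prod_fintype _ _ (by simp)]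
  have h1 : weight X L = ((L.map (· / 2)).map X).prod := by simp [weight, Function.comp_def]
  rw [h1, Finset.prod_list_map_count]
  rw [Finset.prod_subset (s₂ := Finset.range m)]
  · rw [Finset.prod_range]
    rfl
  · intro a ha
    obtain ⟨d, hd, rfl⟩ := List.mem_map.1 (List.mem_toFinset.1 ha)
    have := hL d hd
    exact Finset.mem_range.2 (by omega)
  · intro a _ ha
    rw [List.count_eq_zero_of_not_mem fun h => ha (List.mem_toFinset.2 h), pow_zero]

/-- The generating polynomial of the simple closed walks. -/
noncomputable def cycPoly (K : Type) [Field K] (P : Inst) (s r : ℕ) : MvPolynomial (Fin P.m) K :=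
  ∑ L ∈ cycs P s r, MvPolynomial.monomial (edgeCount P.m L) 1

/-- Different cycles have different monomials by `Cyc.eq_of_perm`, so the coefficient of the
monomial of `L` is one. -/
theorem cycPoly_ne_zero (hP : P.OK E) {r : ℕ} {L : List ℕ} (hL : L ∈ cycs P s r) :
    cycPoly K P s r ≠ 0 := by
  intro h
  have h1 := congrArg (MvPolynomial.coeff (edgeCount P.m L)) h
  rw [cycPoly, MvPolynomial.coeff_sum, Finset.sum_eq_single_of_mem L hL] at h1
  · simp at h1
  · intro L' hL' hne
    rw [MvPolynomial.coeff_monomial, if_neg]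
    intro he
    refine hne ((mem_cycs.1 hL').2.eq_of_perm hP (mem_cycs.1 hL).2 ?_)
    rw [List.perm_iff_count]
    intro a
    by_cases ha : a < P.m
    · exact DFunLike.congr_fun he (⟨a, ha⟩ : Fin P.m)
    · have h0 : ∀ L'' ∈ cycs P s r, (L''.map (· / 2)).count a = 0 := by
        intro L'' hL''
        refine List.count_eq_zero_of_not_mem fun hmem => ?_
        obtain ⟨d, hd, rfl⟩ := List.mem_map.1 hmem
        have := (mem_cycs.1 hL'').2.1.lt d hd
        omega
      rw [h0 _ hL, h0 _ hL']

theorem totalDegree_cycPoly_le (r : ℕ) : (cycPoly K P s r).totalDegree ≤ r := by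
  refine MvPolynomial.totalDegree_finsetSum_le fun L hL => ?_
  obtain ⟨h1, h2⟩ := mem_cycs.1 hL
  refine (MvPolynomial.totalDegree_monomial_le _ _).trans ?_
  rw [Finsupp.sum_fintype _ _ (by simp)]
  exact (sum_edgeCount h2.1.lt).trans_le h1.le

theorem FieldRep.add_self {N : ℕ} {φ : ℕ → K} (hφ : FieldRep N φ) (hN : 1 < N) (x : K) :
    x + x = 0 := by
  have h := hφ.xor 1 hN 1 hN
  rw [Nat.xor_self, hφ.zero, hφ.one] at h
  rw [← two_mul, ← one_add_one_eq_two, ← h, zero_mul]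

/-- A trial fails with probability at most one half. -/
theorem card_decVal_eq_zero_le (hP : P.OK E) (hK : ∀ x : K, x + x = 0) {φ : ℕ → K}
    (hφ : FieldRep P.N φ) {r : ℕ} (hmin : ∀ L, Cyc P s L → r + 1 ≤ L.length) {L : List ℕ}
    (hL : Cyc P s L) (hr : L.length = r + 1) :
    2 * Nat.card {x : Fin P.m → Fin P.N // decVal P
      (fun e => if h : e < P.m then φ (x ⟨e, h⟩) else 0) s r = 0} ≤ P.N ^ P.m := by
  classical
  have hN0 : 0 < P.N := P.N_pos
  have hp := cycPoly_ne_zero (K := K) hP (mem_cycs.2 ⟨hr, hL⟩)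
  set S : Finset K := (Finset.range P.N).image φ with hS
  have hinj : ∀ a < P.N, ∀ b < P.N, φ a = φ b → a = b := by
    intro a ha b hb h
    have h0 : a ^^^ b = 0 := hφ.inj _ (Nat.xor_lt_two_pow ha hb) (by rw [hφ.xor a ha b hb, h, hK])
    calc a = (a ^^^ b) ^^^ b := by rw [Nat.xor_assoc, Nat.xor_self, Nat.xor_zero]
      _ = b := by rw [h0, Nat.zero_xor]
  have hcard : S.card = P.N := by
    rw [hS, Finset.card_image_of_injOn, Finset.card_range]
    intro a ha b hb h
    exact hinj a (by simpa using ha) b (by simpa using hb) h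
  have hsz := MvPolynomial.schwartz_zippel_totalDegree hp S
  have hev : ∀ x : Fin P.m → Fin P.N, MvPolynomial.eval (fun e => φ (x e)) (cycPoly K P s (r + 1)) =
      decVal P (fun e => if h : e < P.m then φ (x ⟨e, h⟩) else 0) s r := by
    intro x
    rw [decVal_eq hP hK _ hmin, cycPoly, map_sum]
    refine Finset.sum_congr rfl fun L' hL' => ?_
    rw [← eval_monomial_edgeCount (mem_cycs.1 hL').2.1.lt]
    simp
  have hle : Nat.card {x : Fin P.m → Fin P.N // decVal P
      (fun e => if h : e < P.m then φ (x ⟨e, h⟩) else 0) s r = 0} ≤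
      (Finset.card {f ∈ Fintype.piFinset fun _ : Fin P.m => S |
        MvPolynomial.eval f (cycPoly K P s (r + 1)) = 0}) := by
    rw [Nat.card_eq_fintype_card, Fintype.card_subtype]
    refine Finset.card_le_card_of_injOn (fun x e => φ (x e)) ?_ ?_
    · intro x hx
      simp only [Finset.coe_filter, Finset.mem_univ, true_and, Set.mem_ofPred_eq] at hx
      simp only [Finset.coe_filter, Fintype.mem_piFinset, Set.mem_ofPred_eq, hev, hx, and_true]
      exact fun e => Finset.mem_image_of_mem _ (Finset.mem_range.2 (x e).isLt)
    · intro x _ y _ h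
      funext e
      exact Fin.ext (hinj _ (x e).isLt _ (y e).isLt (congrFun h e))
  rw [hcard] at hsz
  -- The degree is at most the length of a simple cycle, hence at most `n`, and `2 * n ≤ N`.
  have h2 : ((cycPoly K P s (r + 1)).totalDegree : ℚ≥0) / P.N ≤ 1 / 2 := by
    rw [div_le_div_iff₀ (by exact_mod_cast hN0) (by norm_num)]
    have h3 := totalDegree_cycPoly_le (K := K) (P := P) (s := s) (r + 1)
    have h4 := hL.length_le hP
    have h5 := hP.N_ge
    have : (cycPoly K P s (r + 1)).totalDegree * 2 ≤ 1 * P.N := by omega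
    exact_mod_cast this
  have h6 := hsz.trans h2
  rw [div_le_div_iff₀ (by exact_mod_cast (Nat.pow_pos hN0)) (by norm_num), one_mul] at h6
  have h7 : (Finset.card {f ∈ Fintype.piFinset fun _ : Fin P.m => S |
        MvPolynomial.eval f (cycPoly K P s (r + 1)) = 0}) * 2 ≤ P.N ^ P.m := by exact_mod_cast h6
  omega

end EdgeSetCycle

/-! ### Translation between lists of darts and cycles of the graph. -/

namespace EdgeSetCycle

variable {P : Inst} {E : Env} {n k : ℕ} {G : SimpleGraph (Fin n)} {S : Fin k → Set (Sym2 (Fin n))}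
  {a : ℕ → Fin n} {vis : ℕ → ℕ}

/-- The edge of a dart, if `a d` is the tail of the dart `d`. -/
def edgeOf (a : ℕ → Fin n) (d : ℕ) : Sym2 (Fin n) := s(a d, a (d ^^^ 1))

open Classical in
/-- The numerical data describe the graph `G` with the edge sets `S`. -/
structure Models (P : Inst) (G : SimpleGraph (Fin n)) (S : Fin k → Set (Sym2 (Fin n)))
    (a : ℕ → Fin n) : Prop where
  k_eq : P.k = k
  src : ∀ d < 2 * P.m, P.src d = a d
  adj : ∀ d < 2 * P.m, G.Adj (a d) (a (d ^^^ 1))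
  inj : ∀ d < 2 * P.m, ∀ d' < 2 * P.m, edgeOf a d = edgeOf a d' → d / 2 = d' / 2
  surj : ∀ u v, G.Adj u v → ∃ d < 2 * P.m, a d = u ∧ a (d ^^^ 1) = v
  tab : ∀ i : Fin k, ∀ d < 2 * P.m, P.tab i (d / 2) = if edgeOf a d ∈ S i then 1 else 0

theorem Models.dst (hM : Models P G S a) {d : ℕ} (hd : d < 2 * P.m) : P.dst d = a (d ^^^ 1) :=
  hM.src _ (Inst.xor_one_lt hd)

theorem Models.exists_walk (hM : Models P G S a) {L : List ℕ} {u v : Fin n}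
    (h : IsWalk P vis u v L) : ∃ c : G.Walk v u, c.edges = L.map (edgeOf a) ∧
      c.support.map Fin.val = (v : ℕ) :: L.map P.dst ∧ ∀ j (hj : j < L.length), c.getVert j = P.src L[j] := by
  induction L generalizing v with
  | nil =>
    obtain rfl : v = u := Fin.ext h
    exact ⟨.nil, by simp⟩
  | cons d L ih =>
    obtain ⟨h1, h2, -, h3⟩ := h
    have hs := hM.src d h1
    rw [hM.dst h1] at h3
    obtain ⟨c, hc1, hc2, hc3⟩ := ih h3
    obtain rfl : a d = v := Fin.ext (hs ▸ h2)
    refine ⟨.cons (hM.adj d h1) c, by simp [hc1, edgeOf], by simp [hc2, hM.dst h1], ?_⟩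
    rintro (_ | j) hj
    · simp [hs]
    · simpa using hc3 j (by simpa using hj)

theorem Models.exists_darts (hM : Models P G S a) {u v : Fin n} (c : G.Walk v u) :
    ∃ L : List ℕ, IsWalk P (fun _ => 0) u v L ∧ c.edges = L.map (edgeOf a) ∧
      c.support.map Fin.val = (v : ℕ) :: L.map P.dst := by
  induction c with
  | nil => exact ⟨[], rfl, rfl, rfl⟩
  | @cons v v' u h c ih =>
    obtain ⟨L, h1, h2, h3⟩ := ih
    obtain ⟨d, hd, rfl, rfl⟩ := hM.surj _ _ h
    refine ⟨d :: L, ⟨hd, hM.src d hd, rfl, ?_⟩, by simp [h2, edgeOf], by simp [h3, hM.dst hd]⟩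
    rwa [hM.dst hd]

open Classical in
theorem sum_ite_eq_one_iff {α : Type*} {l : List α} (hl : l.Nodup) (p : α → Prop) :
    (l.map fun x => if p x then 1 else 0).sum = 1 ↔ ∃! x, x ∈ l ∧ p x := by
  have h1 : ∀ l : List α, (l.map fun x => if p x then 1 else 0).sum = (l.filter p).length := by
    intro l
    induction l with
    | nil => rfl
    | cons x l ih => by_cases hx : p x <;> simp [hx, ih, add_comm]
  rw [h1, List.length_eq_one_iff]
  constructor
  · rintro ⟨x, hx⟩
    have h2 : ∀ y, y ∈ l ∧ p y ↔ y = x := fun y => by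
      have : y ∈ l.filter p ↔ y ∈ [x] := by rw [hx]
      simpa using this
    exact ⟨x, (h2 x).2 rfl, fun y hy => (h2 y).1 hy⟩
  · rintro ⟨x, hx, hu⟩
    refine ⟨x, List.perm_singleton.1 ((List.perm_ext_iff_of_nodup (hl.filter _) (by simp)).2 fun y => ?_)⟩
    simp only [List.mem_filter, decide_eq_true_eq, List.mem_singleton]
    exact ⟨fun hy => hu y hy, fun hy => hy ▸ hx⟩

theorem Models.exact_iff (hM : Models P G S a) {L : List ℕ} (hL : ∀ d ∈ L, d < 2 * P.m)
    (hn : (L.map (edgeOf a)).Nodup) :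
    Exact P L ↔ ∀ i, ∃! e, e ∈ L.map (edgeOf a) ∧ e ∈ S i := by
  classical
  have h1 : ∀ i : Fin k, (L.map fun d => P.tab i (d / 2)).sum =
      ((L.map (edgeOf a)).map fun e => if e ∈ S i then 1 else 0).sum := by
    intro i
    rw [List.map_map]
    exact congrArg List.sum (List.map_congr_left fun d hd => hM.tab i d (hL d hd))
  rw [Exact, hM.k_eq]
  constructor
  · intro h i
    rw [← sum_ite_eq_one_iff hn, ← h1]
    exact h i i.isLt
  · intro h i hi
    exact (h1 ⟨i, hi⟩).trans ((sum_ite_eq_one_iff hn _).2 (h _))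

/-- A simple closed walk with exactly one edge from each set is a solution. -/
theorem Models.exists_solution (hM : Models P G S a) (hP : P.OK E) {s : ℕ} {d : ℕ} {w : List ℕ}
    (hw : IsWalk P vis s s (d :: w)) (hn : ((d :: w).map P.dst).Nodup) (he : Exact P (d :: w)) :
    ∃ (v : Fin n) (c : G.Walk v v), IsSolution S c ∧ c.length = w.length + 1 ∧
      ∀ j (hj : j < (d :: w).length), c.getVert j = P.src (d :: w)[j] := by
  obtain ⟨h1, h2, -, h3⟩ := id hw
  have hs := hM.src d h1
  have hL := hw.lt
  rw [h2] at hs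
  subst hs
  obtain ⟨c, hc1, hc2, hc3⟩ := hM.exists_walk hw
  refine ⟨a d, c, ?_, by rw [← SimpleGraph.Walk.length_edges, hc1]; simp, hc3⟩
  have hcyc : c.IsCycle := by
    rcases c with _ | ⟨hadj, p⟩
    · simp at hc1
    simp only [SimpleGraph.Walk.edges_cons, SimpleGraph.Walk.support_cons, List.map_cons,
      List.cons.injEq, true_and] at hc1 hc2
    rw [SimpleGraph.Walk.cons_isCycle_iff]
    refine ⟨.mk' (List.Nodup.of_map Fin.val (hc2 ▸ hn)), fun hmem => ?_⟩
    rw [hc1.1, hc1.2] at hmem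
    obtain ⟨d', hd', hdd⟩ := List.mem_map.1 hmem
    have hd2 := hL d' (List.mem_cons_of_mem _ hd')
    have hn' := List.nodup_cons.1 hn
    -- The first edge must not recur. In the same direction it would repeat a head; in the opposite
    -- direction it either repeats a vertex or is the immediate way back.
    rcases eq_or_eq_xor_one (hM.inj _ hd2 _ h1 hdd) with rfl | rfl
    · exact hn'.1 (List.mem_map_of_mem hd')
    · rcases w with _ | ⟨d'', w⟩
      · simp at hd'
      obtain ⟨g1, g2, g3, g4⟩ := h3
      rcases List.mem_cons.1 hd' with rfl | hd'
      · rw [P.dst_xor_one, h2] at g4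
        rcases w with _ | ⟨e, w⟩
        -- Going along an edge and straight back repeats no head. It is excluded only by exactness:
        -- the edge would be counted twice, so the count of the first set would be even.
        · have := he 0 hP.k0
          simp [xor_one_div_two] at this
          omega
        · refine (List.nodup_cons.1 hn'.2).1 ?_
          rw [P.dst_xor_one, h2]
          have := g4.endsAt (by simp)
          rw [← this]
          exact List.mem_map_of_mem (List.getLast_mem _)
      · refine hn'.1 ?_
        have h5 : P.src (d ^^^ 1) ∈ w.map P.src ++ [(a d : ℕ)] :=
          List.mem_append_left _ (List.mem_map_of_mem hd')
        rw [g4.map_src] at h5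
        exact h5
  refine ⟨hcyc, ?_⟩
  rw [hc1]
  exact (hM.exact_iff hL (hc1 ▸ hcyc.edges_nodup)).1 he

/-- Rotation moves a dart to the front, and reversal is used first if the cycle traverses the edge
in the other direction. -/
theorem IsSolution.exists_cons {v : Fin n} {c : G.Walk v v} (hc : IsSolution S c) {x y : Fin n}
    (hxy : s(x, y) ∈ c.edges) : ∃ (h : G.Adj x y) (p : G.Walk y x),
      IsSolution S (.cons h p) ∧ p.length + 1 = c.length := by
  have key : ∀ {v : Fin n} {c : G.Walk v v}, IsSolution S c → (∃ d ∈ c.darts, d.toProd = (x, y)) →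
      ∃ (h : G.Adj x y) (p : G.Walk y x), IsSolution S (.cons h p) ∧ p.length + 1 = c.length := by
    rintro v c hc ⟨d, hd, hdxy⟩
    have hx : x ∈ c.support := by
      have := c.dart_fst_mem_support_of_mem_darts hd
      rwa [hdxy] at this
    have hc' : IsSolution S (c.rotate x hx) := by
      refine ⟨hc.1.rotate hx, fun i => ?_⟩
      simpa only [(c.rotate_edges x hx).mem_iff] using hc.2 i
    have hd' : d ∈ (c.rotate x hx).darts := (c.rotate_darts x hx).mem_iff.2 hd
    have hl : (c.rotate x hx).length = c.length := by
      rw [← SimpleGraph.Walk.length_edges, ← SimpleGraph.Walk.length_edges]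
      exact (c.rotate_edges x hx).perm.length_eq
    generalize c.rotate x hx = c' at hc' hd' hl
    rcases c' with _ | ⟨h, p⟩
    · simp at hd'
    rw [SimpleGraph.Walk.darts_cons, List.mem_cons] at hd'
    rcases hd' with rfl | hd'
    · simp only [Prod.mk.injEq, true_and] at hdxy
      subst hdxy
      exact ⟨h, p, hc', by simpa using hl⟩
    -- The rest of the cycle is a path ending at `x`, so none of its darts can start there.
    · exfalso
      have hp := (SimpleGraph.Walk.cons_isCycle_iff p h).1 hc'.1
      have h1 := hp.1.support_nodup
      rw [← p.map_fst_darts_append, List.nodup_append] at h1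
      refine h1.2.2 d.fst (List.mem_map_of_mem hd') x (by simp) ?_
      rw [hdxy]
  obtain ⟨d, hd, hde⟩ := List.mem_map.1 hxy
  rcases Sym2.eq_iff.1 (show s(d.fst, d.snd) = s(x, y) from hde) with h | h
  · exact key hc ⟨d, hd, Prod.ext h.1 h.2⟩
  · have hr : IsSolution S c.reverse := by
      refine ⟨hc.1.reverse, fun i => ?_⟩
      simpa only [SimpleGraph.Walk.edges_reverse, List.mem_reverse] using hc.2 i
    obtain ⟨h1, p, h2, h3⟩ := key hr ⟨d.symm, by simpa using hd, Prod.ext h.2 h.1⟩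
    exact ⟨h1, p, h2, by simpa using h3⟩

/-- The cycle is rotated, and reversed if necessary, so as to begin with its edge from the first set
at the smaller endpoint. -/
theorem Models.exists_cyc (hM : Models P G S a) (hP : P.OK E) {v : Fin n} {c : G.Walk v v}
    (hc : IsSolution S c) : ∃ s < P.n, ∃ L, Cyc P s L ∧ L.length = c.length := by
  classical
  have hk : 0 < k := hM.k_eq ▸ hP.k0
  obtain ⟨e, ⟨he, heS⟩, -⟩ := hc.2 ⟨0, hk⟩
  have key : ∃ x y : Fin n, x < y ∧ e = s(x, y) := by
    induction e using Sym2.ind with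
    | _ x y =>
      have hne : x ≠ y := (c.adj_of_mem_edges he).ne
      rcases lt_or_gt_of_ne hne with h | h
      · exact ⟨x, y, h, rfl⟩
      · exact ⟨y, x, h, Sym2.eq_swap⟩
  obtain ⟨x, y, hxy, rfl⟩ := key
  obtain ⟨h, p, hp, hl⟩ := hc.exists_cons he
  obtain ⟨w, h1, h2, h3⟩ := hM.exists_darts p
  obtain ⟨d, hd, rfl, rfl⟩ := hM.surj _ _ h
  have hlt := h1.lt
  have hw : IsWalk P (fun _ => 0) (a d) (a d) (d :: w) :=
    ⟨hd, hM.src d hd, rfl, by rwa [hM.dst hd]⟩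
  have hed : (SimpleGraph.Walk.cons h p).edges = (d :: w).map (edgeOf a) := by
    simp [h2, edgeOf]
  refine ⟨a d, hM.src d hd ▸ hP.src_lt d hd, d :: w, ⟨hw, ⟨d, by simp, ?_⟩, ?_, ?_⟩, ?_⟩
  · have : P.tab 0 (d / 2) = 1 := by
      rw [hM.tab ⟨0, hk⟩ d hd, if_pos]
      exact heS
    rw [firstCand, if_pos ⟨hM.src d hd, by rw [hM.dst hd]; exact hxy, this⟩]
    exact one_ne_zero
  · rw [List.map_cons, hM.dst hd, ← h3]
    exact ((SimpleGraph.Walk.cons_isCycle_iff p h).1 hp.1).1.support_nodup.map Fin.val_injective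
  · rw [hM.exact_iff hw.lt (hed ▸ hp.1.edges_nodup), ← hed]
    exact hp.2
  · rw [← hl, ← SimpleGraph.Walk.length_edges, h2]
    simp

theorem isWalk_range {pe : ℕ → ℕ} {u v l : ℕ} : IsWalk P (fun _ => 0) u v ((List.range l).map pe) ↔
    (∀ i < l, pe i < 2 * P.m ∧ P.src (pe i) = if i = 0 then v else P.dst (pe (i - 1))) ∧
      u = if l = 0 then v else P.dst (pe (l - 1)) := by
  induction l generalizing u with
  | zero => simp [IsWalk, eq_comm]
  | succ l ih =>
    rw [List.range_succ, List.map_append, isWalk_append]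
    simp only [ih, List.map_cons, List.map_nil, IsWalk, true_and, Nat.lt_succ_iff_lt_or_eq,
      Nat.succ_ne_zero, if_false, Nat.add_sub_cancel]
    constructor
    · rintro ⟨u', ⟨h1, rfl⟩, h2, h3, h4⟩
      refine ⟨?_, h4.symm⟩
      rintro i (hi | rfl)
      · exact h1 i hi
      · exact ⟨h2, h3⟩
    · rintro ⟨h1, h2⟩
      exact ⟨_, ⟨fun i hi => h1 i (Or.inl hi), rfl⟩, (h1 l (Or.inr rfl)).1, (h1 l (Or.inr rfl)).2, h2.symm⟩

theorem valid_iff {pe : ℕ → ℕ} {l : ℕ} (hpe : ∀ i < l + 1, pe i < 2 * P.m) : Valid P pe (l + 1) ↔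
    IsWalk P (fun _ => 0) (P.src (pe 0)) (P.src (pe 0)) ((List.range (l + 1)).map pe) ∧
      (((List.range (l + 1)).map pe).map P.dst).Nodup ∧ Exact P ((List.range (l + 1)).map pe) := by
  have hsum : ∀ f : ℕ → ℕ, ((List.range (l + 1)).map f).sum = ∑ i ∈ Finset.range (l + 1), f i :=
    fun _ => rfl
  have hnd : (((List.range (l + 1)).map pe).map P.dst).Nodup ↔
      ∀ i < l + 1, ∀ i' < i, P.dst (pe i') ≠ P.dst (pe i) := by
    rw [List.map_map]
    constructor
    · intro h i hi i' hi' he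
      have := List.inj_on_of_nodup_map h (List.mem_range.2 (hi'.trans hi)) (List.mem_range.2 hi) he
      omega
    · intro h
      refine List.Nodup.map_on ?_ List.nodup_range
      intro i hi j hj he
      rw [List.mem_range] at hi hj
      rcases lt_trichotomy i j with h1 | h1 | h1
      · exact absurd he (h j hj i h1)
      · exact h1
      · exact absurd he.symm (h i hi j h1)
  rw [hnd, isWalk_range, Exact]
  simp only [List.map_map, Function.comp_def, hsum, Nat.succ_ne_zero, if_false, Nat.add_sub_cancel]
  constructor
  · intro h
    have h0 := h.chain 0 (by omega)
    rw [if_pos rfl, Nat.add_sub_cancel] at h0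
    refine ⟨⟨fun i hi => ⟨hpe i hi, ?_⟩, h0⟩, h.inj, h.count⟩
    have := h.chain i hi
    split_ifs with h1
    · rw [h1]
    · rwa [if_neg h1] at this
  · rintro ⟨⟨h1, h2⟩, h3, h4⟩
    refine ⟨fun i hi => ?_, h3, h4⟩
    have := (h1 i hi).2
    split_ifs with h5
    · rw [h5, h2, Nat.add_sub_cancel]
    · rwa [if_neg h5] at this

/-- The number of active starting vertices is at most the number of vertices of the first set. -/
theorem Models.actCard_le (hM : Models P G S a) (hk : 0 < k) :
    actCard P ≤ (vertexSet (S ⟨0, hk⟩)).ncard := by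
  classical
  rw [actCard, ← Set.ncard_coe_finset,
    ← Set.ncard_image_of_injective (vertexSet (S ⟨0, hk⟩)) Fin.val_injective]
  refine Set.ncard_le_ncard ?_ (Set.toFinite _)
  intro s hs
  obtain ⟨-, d, hd, hc⟩ := Finset.mem_filter.1 (Finset.mem_coe.1 hs)
  have h1 : P.src d = s ∧ s < P.dst d ∧ P.tab 0 (d / 2) = 1 := by
    by_contra hcon
    exact hc (if_neg hcon)
  refine ⟨a d, ⟨edgeOf a d, ?_, by simp [edgeOf]⟩, by rw [← hM.src d hd, h1.1]⟩
  have := hM.tab ⟨0, hk⟩ d hd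
  rw [h1.2.2] at this
  by_contra hcon
  simp [hcon] at this

end EdgeSetCycle

/-! ### Runs beyond the halting time. -/

namespace WordRAM

/-- A halted configuration is a fixed point of `step` and touches nothing, so the actual halting
time may be replaced by a bound common to all random words. -/
theorem run_of_runs {w s d t T : ℕ} {p : Prog} {I tape : ℕ → BitVec w} {M : ℕ → BitVec w}
    (h : Runs I tape s [p] (fun _ => 0) 0 M d t) (ht : t ≤ T) :
    (run p I tape T).code = [] ∧ (run p I tape T).mem = M ∧
      ∀ j < T, ∀ x ∈ touched (run p I tape j), x < s := by
  have h1 : ∀ j, t ≤ j → run p I tape j = ⟨[], M, d⟩ := by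
    intro j hj
    rw [run, ← Nat.sub_add_cancel hj, Function.iterate_add_apply]
    have := (h []).1
    rw [List.append_nil] at this
    rw [this]
    exact Function.iterate_fixed rfl _
  rw [h1 T ht]
  refine ⟨rfl, rfl, fun j _ x hx => ?_⟩
  rcases lt_or_ge j t with hjt | hjt
  · exact (h []).2 j hjt x hx
  · rw [h1 j hjt] at hx
    simp [touched] at hx

end WordRAM

/-! ### Soundness and optimality of the output. -/

namespace EdgeSetCycle

variable {K : Type} [Field K] {P : Inst} {E : Env} {φ : ℕ → K} {σ : St} {n k D : ℕ}
  {G : SimpleGraph (Fin n)} {S : Fin k → Set (Sym2 (Fin n))} {a : ℕ → Fin n} {M : ℕ → BitVec E.w}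

theorem Models.outputsCycle (hM : Models P G S a) (hP : P.OK E) (hR : Repr E σ M) {pe : ℕ → ℕ}
    {r : ℕ} (hr : r < P.n) (hpe : ∀ i < r + 1, pe i < 2 * P.m) (hv : Valid P pe (r + 1))
    (h0 : σ.r 0 = r + 1) (h1 : σ.r 1 = 76 + 13 * E.L) (ho : ∀ i < r + 1, σ.o i = P.src (pe i)) :
    ∃ (v : Fin n) (c : G.Walk v v), IsSolution S c ∧ c.length = r + 1 ∧ OutputsCycle M c := by
  obtain ⟨hw, hn, he⟩ := (valid_iff hpe).1 hv
  have hL : (List.range (r + 1)).map pe = pe 0 :: (List.range r).map fun i => pe (i + 1) := by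
    simp [List.range_succ_eq_map, Function.comp_def]
  have hget : ∀ j (hj : j < (pe 0 :: (List.range r).map fun i => pe (i + 1)).length),
      (pe 0 :: (List.range r).map fun i => pe (i + 1))[j] = pe j := by
    rintro (_ | j) hj <;> simp
  rw [hL] at hw hn he
  obtain ⟨v, c, hc, hcl, hcj⟩ := hM.exists_solution hP hw hn he
  rw [List.length_map, List.length_range] at hcl
  refine ⟨v, c, hc, hcl, ?_, fun j hj => ?_⟩
  · rw [hR.reg 0 (by decide), h0, hcl]
  · rw [hcl] at hj
    have h2 := hR.out j (by rw [hP.Lo_eq]; omega)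
    rw [hR.reg 1 (by decide), h1, hcj j (by simpa using hj), hget, ← ho j hj, ← h2]

/-- Soundness rests on the final verification alone, not on the values found in the trials. -/
theorem Result.isSound (hM : Models P G S a) (hP : P.OK E) (hR : Repr E σ M)
    (h : Result φ P E D σ) : IsSound G S M := by
  cases h with
  | none h0 h => exact Or.inl (by rw [OutputsNone, hR.reg 0 (by decide), h0])
  | some pe hs hr hne hmin hpe hout =>
    rcases hout with ⟨hv, h0, h1, ho⟩ | ⟨-, h0⟩
    · obtain ⟨v, c, hc, -, ho⟩ := hM.outputsCycle hP hR hr (fun i hi => (hpe i hi).1) hv h0 h1 ho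
      exact Or.inr ⟨v, c, hc, ho⟩
    · exact Or.inl (by rw [OutputsNone, hR.reg 0 (by decide), h0])

/-- If some trial detects a shortest cycle, then the output is optimal. -/
theorem Result.isOptimal (hM : Models P G S a) (hP : P.OK E) (hR : Repr E σ M)
    (hK : ∀ x : K, x + x = 0) (h : Result φ P E D σ)
    (hgood : ∀ s < P.n, ∀ r L, Cyc P s L → L.length = r + 1 →
      (∀ s' L', Cyc P s' L' → r + 1 ≤ L'.length) → ∃ s < P.n, ∃ t < D,
        decVal P (fun e => φ (draw P E t e)) s r ≠ 0) : IsOptimal G S M := by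
  by_cases hex : ∃ s L, Cyc P s L
  · classical
    obtain ⟨s₀, L₀, h₀⟩ := hex
    have hex' : ∃ l s L, Cyc P s L ∧ L.length = l := ⟨_, s₀, L₀, h₀, rfl⟩
    -- A cycle whose length is least over all starting vertices.
    obtain ⟨s₁, L₁, hc₁, hl₁⟩ := Nat.find_spec hex'
    have hmin₁ : ∀ s' L', Cyc P s' L' → L₁.length ≤ L'.length := fun s' L' h' =>
      hl₁ ▸ Nat.find_min' hex' ⟨s', L', h', rfl⟩
    have hpos : L₁ ≠ [] := by
      obtain ⟨d, hd, -⟩ := hc₁.2.1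
      rintro rfl
      simp at hd
    obtain ⟨r₁, hr₁⟩ := Nat.exists_eq_succ_of_ne_zero (List.length_pos_of_ne_nil hpos).ne'
    have hs₁ : s₁ < P.n := by
      rcases L₁ with _ | ⟨d, w⟩
      · exact absurd rfl hpos
      · exact hc₁.1.2.1 ▸ hP.src_lt d hc₁.1.1
    have hr₁n := hc₁.length_le hP
    rw [hr₁] at hmin₁ hr₁n
    obtain ⟨s₂, hs₂, t₂, ht₂, hne₂⟩ := hgood s₁ hs₁ r₁ L₁ hc₁ hr₁ hmin₁
    cases h with
    | none h0 h => exact absurd (h t₂ ht₂ s₂ hs₂ r₁ hr₁n) hne₂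
    | @some s r t pe hs hr hne hmin hpe hout =>
      have hle := hmin t₂ ht₂ s₂ hs₂ r₁ hr₁n hne₂
      -- The detected length is at most the least one, so cancellation applies to it. Its nonzero
      -- value then exhibits a cycle of that length, and the two lengths agree, although the
      -- starting vertices may differ.
      have hmin' : ∀ L, Cyc P s L → r + 1 ≤ L.length := fun L hL =>
        (Nat.succ_le_succ hle).trans (hmin₁ s L hL)
      obtain ⟨L, hL, hLr⟩ := exists_cyc hP hK hmin' hne
      have hrr : r = r₁ := le_antisymm hle (by have := hmin₁ s L hL; omega)
      have hpe' : ∀ i < r + 1, pe i < 2 * P.m := fun i hi => (hpe i hi).1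
      have hcyc := cyc_of_good hP hK hmin' hne hpe
      have hv : Valid P pe (r + 1) := by
        rw [valid_iff hpe']
        have h0 : P.src (pe 0) = s := by
          have := hcyc.1
          rw [List.range_succ_eq_map] at this
          exact this.2.1
        rw [h0]
        exact ⟨hcyc.1, hcyc.2.2.1, hcyc.2.2.2⟩
      rcases hout with ⟨-, h0, h1, ho⟩ | ⟨hv', -⟩
      · obtain ⟨v, c, hc, hcl, ho⟩ := hM.outputsCycle hP hR hr hpe' hv h0 h1 ho
        refine Or.inl ⟨v, c, ⟨hc, fun u c' hc' => ?_⟩, ho⟩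
        obtain ⟨s', -, L', hL', hl'⟩ := hM.exists_cyc hP hc'
        rw [hcl, ← hl', hrr]
        exact hmin₁ s' L' hL'
      · exact absurd hv hv'
  · right
    constructor
    · rintro ⟨v, c, hc⟩
      obtain ⟨s, -, L, hL, -⟩ := hM.exists_cyc hP hc
      exact hex ⟨s, L, hL⟩
    · cases h with
      | none h0 h => rw [OutputsNone, hR.reg 0 (by decide), h0]
      | @some s r t pe hs hr hne =>
        -- Without any cycle the minimality hypothesis is vacuous for every length, so no value can
        -- be nonzero.
        obtain ⟨L, hL, -⟩ := EdgeSetCycle.exists_cyc hP hK (fun L hL => absurd ⟨s, L, hL⟩ hex) hne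
        exact absurd ⟨s, L, hL⟩ hex

theorem exists_least_passes {q : ℕ} (hq : 1 < q) :
    ∃ f < 2 ^ q, Passes (2 ^ q) f ∧ ∀ f' < f, ¬ Passes (2 ^ q) f' := by
  classical
  have h := exists_passes hq
  obtain ⟨h1, h2⟩ := Nat.find_spec h
  exact ⟨_, h1, h2, fun f' hf' hp => Nat.find_min h hf' ⟨hf'.trans h1, hp⟩⟩

/-! ### Encoding of a graph with edge sets as an instance. -/

section

variable {w m : ℕ} {e : Fin m → Fin n × Fin n}

theorem IsEdgeList.le_choose (h : IsEdgeList G e) : m ≤ n.choose 2 := by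
  classical
  have h1 := G.card_edgeFinset_le_card_choose_two
  rw [Fintype.card_fin] at h1
  refine le_trans ?_ h1
  have h2 : Finset.univ.image (fun j => s((e j).1, (e j).2)) ⊆ G.edgeFinset := by
    intro x hx
    rw [SimpleGraph.mem_edgeFinset, ← h.2]
    obtain ⟨j, -, rfl⟩ := Finset.mem_image.1 hx
    exact ⟨j, rfl⟩
  have h3 := Finset.card_le_card h2
  rwa [Finset.card_image_of_injective _ h.1, Finset.card_univ, Fintype.card_fin] at h3

/-- From `n ≤ m ≤ n.choose 2`: graphs on one or two vertices have too few edges. -/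
theorem IsEdgeList.three_le (h : IsEdgeList G e) (hn : 0 < n) (hnm : n ≤ m) : 3 ≤ n := by
  have h1 := h.le_choose
  by_contra hcon
  have : n = 1 ∨ n = 2 := by omega
  rcases this with rfl | rfl <;> simp at h1 <;> omega

theorem IsEdgeList.le_mul_self (h : IsEdgeList G e) : m ≤ n * n :=
  h.le_choose.trans ((Nat.choose_le_pow n 2).trans_eq (sq n))

/-- The tails of the darts. -/
def tailOf (e : Fin m → Fin n × Fin n) (hn : 0 < n) (d : ℕ) : Fin n :=
  if h : d / 2 < m then (if d % 2 = 0 then (e ⟨d / 2, h⟩).1 else (e ⟨d / 2, h⟩).2) else ⟨0, hn⟩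

open Classical in
/-- The numerical data of a graph with edge sets. -/
noncomputable def toInst (e : Fin m → Fin n × Fin n) (S : Fin k → Set (Sym2 (Fin n))) (hn : 0 < n)
    (b : Bool) : Inst where
  n := n
  m := m
  k := k
  q := Nat.clog 2 (2 * n)
  b := b
  src d := tailOf e hn d
  tab i j := if h : i < k ∧ j < m then
    if s((e ⟨j, h.2⟩).1, (e ⟨j, h.2⟩).2) ∈ S ⟨i, h.1⟩ then 1 else 0 else 0

theorem exists_dart {d : ℕ} (hd : d < 2 * m) : ∃ j : Fin m, (d = 2 * j ∧ d ^^^ 1 = 2 * j + 1) ∨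
    (d = 2 * j + 1 ∧ d ^^^ 1 = 2 * j) := by
  refine ⟨⟨d / 2, by omega⟩, ?_⟩
  rcases Nat.even_or_odd d with h | h
  · rw [Nat.xor_one_of_even h]
    obtain ⟨c, rfl⟩ := h
    left
    simp only
    omega
  · rw [Nat.xor_one_of_odd h]
    obtain ⟨c, rfl⟩ := h
    right
    simp only
    omega

theorem tailOf_two_mul (hn : 0 < n) (j : Fin m) : tailOf e hn (2 * j) = (e j).1 := by
  have h : 2 * (j : ℕ) / 2 = j := by omega
  simp [tailOf, h]

theorem tailOf_two_mul_add_one (hn : 0 < n) (j : Fin m) : tailOf e hn (2 * j + 1) = (e j).2 := by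
  have h : (2 * (j : ℕ) + 1) / 2 = j := by omega
  have h' : ¬ (2 * (j : ℕ) + 1) % 2 = 0 := by omega
  simp only [tailOf, h, j.isLt, dif_pos, if_neg h']

theorem edgeOf_tailOf (hn : 0 < n) {d : ℕ} (hd : d < 2 * m) : edgeOf (tailOf e hn) d =
    s((e ⟨d / 2, by omega⟩).1, (e ⟨d / 2, by omega⟩).2) := by
  obtain ⟨j, ⟨h1, h2⟩ | ⟨h1, h2⟩⟩ := exists_dart hd
  · have h3 : (⟨d / 2, by omega⟩ : Fin m) = j := Fin.ext (by simp only; omega)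
    rw [edgeOf, h2, h3, h1, tailOf_two_mul, tailOf_two_mul_add_one]
  · have h3 : (⟨d / 2, by omega⟩ : Fin m) = j := Fin.ext (by simp only; omega)
    rw [edgeOf, h2, h3, h1, tailOf_two_mul, tailOf_two_mul_add_one, Sym2.eq_swap]

theorem models_toInst (he : IsEdgeList G e) (hn : 0 < n) (b : Bool) :
    Models (toInst e S hn b) G S (tailOf e hn) := by
  classical
  have hadj : ∀ d < 2 * m, edgeOf (tailOf e hn) d ∈ G.edgeSet := by
    intro d hd
    rw [edgeOf_tailOf hn hd, ← he.2]
    exact ⟨_, rfl⟩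
  refine ⟨rfl, fun d _ => rfl, hadj, ?_, ?_, ?_⟩
  · intro d hd d' hd' h
    have hd : d < 2 * m := hd
    have hd' : d' < 2 * m := hd'
    rw [edgeOf_tailOf hn hd, edgeOf_tailOf hn hd'] at h
    exact congrArg Fin.val (he.1 h)
  · intro u v huv
    have : s(u, v) ∈ Set.range fun j => s((e j).1, (e j).2) := by
      rw [he.2]
      exact huv
    obtain ⟨j, hj⟩ := this
    have hj2 := j.isLt
    have h1 : (2 * (j : ℕ)) ^^^ 1 = 2 * j + 1 := Nat.xor_one_of_even (even_two_mul _)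
    rcases Sym2.eq_iff.1 hj with ⟨h, h'⟩ | ⟨h, h'⟩
    · refine ⟨2 * j, by change _ < 2 * m; omega, ?_, ?_⟩
      · rw [tailOf_two_mul, h]
      · rw [h1, tailOf_two_mul_add_one, h']
    · refine ⟨2 * j + 1, by change _ < 2 * m; omega, ?_, ?_⟩
      · rw [tailOf_two_mul_add_one, h']
      · rw [← h1, xor_one_xor_one, tailOf_two_mul, h]
  · intro i d hd
    have hd : d < 2 * m := hd
    have h : (i : ℕ) < k ∧ d / 2 < m := ⟨i.isLt, by omega⟩
    simp only [toInst, dif_pos h, edgeOf_tailOf hn hd]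

/-- The execution environment of an instance. -/
def toEnv (I tape : ℕ → BitVec w) (P : Inst) (hw : 0 < w)
    (h : 76 + 13 * (P.n * P.J + 8 * P.n + 2 * P.m) + P.n ≤ 2 ^ w) : Env where
  w := w
  I := I
  tape := tape
  L := P.n * P.J + 8 * P.n + 2 * P.m
  Lo := P.n
  w_pos := hw
  fits := h

theorem ok_toInst {I tape : ℕ → BitVec w} (hI : IsInput e S I) (hn : 0 < n) (b : Bool) (hn3 : 3 ≤ n)
    (hnm : n ≤ m) (hk : 0 < k) (hw : 0 < w)
    (h : 76 + 13 * (n * (toInst e S hn b).J + 8 * n + 2 * m) + n ≤ 2 ^ w)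
    (hin : 3 + 2 * m + k * m < 2 ^ w) (hk2 : (k + 1) * (k + 1) < 2 ^ w) :
    (toInst e S hn b).OK (toEnv I tape (toInst e S hn b) hw h) := by
  classical
  have hkm : m ≤ k * m := Nat.le_mul_of_pos_left _ hk
  have hkk : k ≤ (k + 1) * (k + 1) := by nlinarith
  have hv : ∀ x : ℕ, x < 2 ^ w → (BitVec.ofNat w x).toNat = x := fun x hx => by
    rw [BitVec.toNat_ofNat, Nat.mod_eq_of_lt hx]
  have hlt : ∀ x : Fin n, (x : ℕ) < 2 ^ w := fun x => x.isLt.trans (by omega)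
  refine ⟨hn3, hnm, hk, ?_, ?_, ?_, ?_, ?_, fun d _ => (tailOf e hn d).isLt, ?_, rfl, rfl, hin, hk2, ?_, ?_⟩
  · change (I 0).toNat = n
    rw [hI.n_eq, hv _ (by omega)]
  · change (I 1).toNat = m
    rw [hI.m_eq, hv _ (by omega)]
  · change (I 2).toNat = k
    rw [hI.k_eq, hv _ (by omega)]
  · intro d hd
    change (I (3 + d)).toNat = (tailOf e hn d : ℕ)
    obtain ⟨j, ⟨h1, -⟩ | ⟨h1, -⟩⟩ := exists_dart (m := m) hd
    · rw [h1, hI.fst_eq, tailOf_two_mul, hv _ (hlt _)]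
    · rw [h1, show 3 + (2 * (j : ℕ) + 1) = 4 + 2 * j by omega, hI.snd_eq, tailOf_two_mul_add_one,
        hv _ (hlt _)]
  · intro i hi j hj
    change (I (3 + 2 * m + i * m + j)).toNat = _
    rw [hI.set_eq ⟨i, hi⟩ ⟨j, hj⟩, hv]
    · have h' : i < k ∧ j < m := ⟨hi, hj⟩
      simp only [toInst, dif_pos h']
    · split_ifs <;> omega
  · intro i hi j hj
    simp only [toInst]
    split_ifs <;> omega
  · exact Nat.le_pow_clog (by omega) _
  · have h1 : 2 ^ (Nat.clog 2 (2 * n) - 1) < 2 * n := Nat.pow_pred_clog_lt_self (by omega) (by omega)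
    have h2 : 0 < Nat.clog 2 (2 * n) := Nat.clog_pos (by omega) (by omega)
    change 2 ^ Nat.clog 2 (2 * n) < 4 * n
    have h3 := pow_succ 2 (Nat.clog 2 (2 * n) - 1)
    rw [Nat.sub_add_cancel h2] at h3
    omega

end

end EdgeSetCycle

/-! ### The two algorithms and the main theorem. -/

namespace EdgeSetCycle

/-- The number `x` is a common scale, `2 ^ k * n` or `k * n`. All quantities that must fit into a
word are bounded by a multiple of `x ^ 2`, and `x ≥ 3` lets the sixth power absorb the constants. -/
theorem algP_finds {w n m k : ℕ} (b : Bool) (R : ℕ) (hk : 0 < k) {G : SimpleGraph (Fin n)}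
    {e : Fin m → Fin n × Fin n} {S : Fin k → Set (Sym2 (Fin n))} {I : ℕ → BitVec w} (hn : 0 < n)
    (hnm : n ≤ m) (he : IsEdgeList G e) (hI : IsInput e S I) {x J Y : ℕ} (hkx : k * n ≤ x)
    (hJ : J = if b then 2 ^ k else k + 1) (hY : Y = if b then 1 else 2 ^ k) (hJx : n * J ≤ 2 * x)
    (hx : x ^ 6 ≤ 2 ^ w) {time space δ : ℝ}
    (ht : (((R + 1) * (300000 * (max 1 (vertexSet (S ⟨0, hk⟩)).ncard *
      (Y * (m * J * (n * n))))) : ℕ) : ℝ) ≤ time)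
    (hs : ((76 + 13 * (n * J + 8 * n + 2 * m) + n : ℕ) : ℝ) ≤ space)
    (hδ : (1 / 2) ^ (R * n) ≤ δ) :
    MonteCarloFinds (algP b R).code I G S time space δ := by
  have hn3 := he.three_le hn hnm
  have hmn := he.le_mul_self
  have hnx : n ≤ x := (Nat.le_mul_of_pos_left n hk).trans hkx
  have hkx' : k ≤ x := (Nat.le_mul_of_pos_right k hn).trans hkx
  have hmx : m ≤ x * x := hmn.trans (Nat.mul_le_mul hnx hnx)
  have hkm : k * m ≤ x * x := by
    calc k * m ≤ k * (n * n) := Nat.mul_le_mul_left _ hmn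
      _ = (k * n) * n := (mul_assoc _ _ _).symm
      _ ≤ x * x := Nat.mul_le_mul hkx hnx
  have hx9 : 3 * x ≤ x * x := Nat.mul_le_mul_right _ (hn3.trans hnx)
  have hx6 : 81 * (x * x) ≤ 2 ^ w := by
    refine le_trans ?_ hx
    calc 81 * (x * x) = 3 ^ 4 * (x * x) := by norm_num
      _ ≤ x ^ 4 * (x * x) := Nat.mul_le_mul_right _ (Nat.pow_le_pow_left (hn3.trans hnx) 4)
      _ = x ^ 6 := by ring
  set P := toInst e S hn b with hPdef
  have hPJ : P.J = J := hJ.symm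
  have hPY : P.Y = Y := hY.symm
  have hw : 0 < w := by
    rcases Nat.eq_zero_or_pos w with rfl | h
    · simp at hx6
      nlinarith
    · exact h
  have hfit : 76 + 13 * (n * P.J + 8 * n + 2 * m) + n ≤ 2 ^ w := by
    rw [hPJ]
    omega
  have hin : 3 + 2 * m + k * m < 2 ^ w := by omega
  have hk2 : (k + 1) * (k + 1) < 2 ^ w := by nlinarith
  have hP : ∀ tape, P.OK (toEnv I tape P hw hfit) := fun tape =>
    ok_toInst hI hn b hn3 hnm hk hw hfit hin hk2
  have hM : Models P G S (tailOf e hn) := models_toInst he hn b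
  have hNge : 2 * n ≤ P.N := (hP I).N_ge
  have hNlt : P.N < 4 * n := (hP I).N_lt
  have hq : 1 < P.q := by
    by_contra hcon
    have : P.N ≤ 2 ^ 1 := Nat.pow_le_pow_right (by omega) (not_lt.1 hcon)
    omega
  obtain ⟨f, hf, hp, hmin⟩ := exists_least_passes hq
  obtain ⟨K, _, φ, g, hg⟩ := exists_fieldPow (by omega) hf hp
  have hK : ∀ y : K, y + y = 0 := fun y => hg.rep.add_self (Nat.one_lt_two_pow (by omega)) y
  set B := (R + 1) * (300000 * (max 1 (vertexSet (S ⟨0, hk⟩)).ncard * (Y * (m * J * (n * n)))))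
  have hJ0 : 0 < J := hPJ ▸ P.J_pos
  have hY0 : 0 < Y := hPY ▸ P.Y_pos
  -- The time bound exceeds the number of words drawn in the trials, so a random tape of that length
  -- splits into the draws and a rest `T'`.
  have hDB : R * n * m ≤ B := by
    have h1 : n * m ≤ Y * (m * J * (n * n)) := by
      calc n * m ≤ (n * m) * (Y * J * n) := Nat.le_mul_of_pos_right _ (by positivity)
        _ = _ := by ring
    have h2 : Y * (m * J * (n * n)) ≤ 300000 * (max 1 (vertexSet (S ⟨0, hk⟩)).ncard *
        (Y * (m * J * (n * n)))) := by
      rw [← mul_assoc 300000]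
      exact Nat.le_mul_of_pos_left _ (by positivity)
    calc R * n * m = R * (n * m) := mul_assoc _ _ _
      _ ≤ B := Nat.mul_le_mul (Nat.le_succ R) (h1.trans h2)
  obtain ⟨T', hT'⟩ := Nat.exists_eq_add_of_le hDB
  have main : ∀ ω : Fin (R * n * m + T') → BitVec w, ∃ (σ : St) (M : ℕ → BitVec w),
      Repr (toEnv I (extend ω) P hw hfit) σ M ∧
      Result φ P (toEnv I (extend ω) P hw hfit) (R * P.n) σ ∧
      (run (algP b R).code I (extend ω) (R * n * m + T')).code = [] ∧
      (run (algP b R).code I (extend ω) (R * n * m + T')).mem = M ∧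
      ∀ j < R * n * m + T', ∀ y ∈ touched (run (algP b R).code I (extend ω) j),
        y < 76 + 13 * (n * J + 8 * n + 2 * m) + n := by
    intro ω
    obtain ⟨σ', t', hE, ht', hres⟩ := algP_spec (σ := ⟨fun _ => 0, fun _ _ => 0, fun _ => 0, 0⟩) R
      (hP (extend ω)) hf hp hmin hg (fun _ => rfl) (fun _ _ => rfl) rfl
    have hrepr : Repr (toEnv I (extend ω) P hw hfit)
        ⟨fun _ => 0, fun _ _ => 0, fun _ => 0, 0⟩ fun _ => 0 :=
      ⟨fun _ _ => by simp, fun _ _ _ _ => by simp, fun _ _ => by simp⟩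
    obtain ⟨M', hruns, hrepr'⟩ := hE.runs (algP_wf _ _) _ hrepr
    have hle : t' ≤ R * n * m + T' := by
      rw [← hT']
      refine ht'.trans ?_
      have := hM.actCard_le hk
      rw [hPY, hPJ]
      exact Nat.mul_le_mul_left _ (Nat.mul_le_mul_left _
        (Nat.mul_le_mul_right _ (max_le_max le_rfl this)))
    obtain ⟨h1, h2, h3⟩ := run_of_runs hruns hle
    refine ⟨σ', M', hrepr', hres, h1, h2, fun j hj y hy => (h3 j hj y hy).trans_eq ?_⟩
    change 76 + 13 * (n * P.J + 8 * n + 2 * m) + n = _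
    rw [hPJ]
  refine ⟨R * n * m + T', 76 + 13 * (n * J + 8 * n + 2 * m) + n, hT' ▸ ht, hs, fun ω => ?_, ?_⟩
  · obtain ⟨σ, M, hR, hres, h1, h2, h3⟩ := main ω
    refine ⟨h1, h3, ?_⟩
    rw [h2]
    exact hres.isSound hM (hP _) hR
  · have hopt : ∀ ω : Fin (R * n * m + T') → BitVec w,
        (∀ s < P.n, ∀ r L, Cyc P s L → L.length = r + 1 →
          (∀ s' L', Cyc P s' L' → r + 1 ≤ L'.length) → ∃ s < P.n, ∃ t < R * P.n,
            decVal P (fun e' => φ (draw P (toEnv I (extend ω) P hw hfit) t e')) s r ≠ 0) →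
        IsOptimal G S (run (algP b R).code I (extend ω) (R * n * m + T')).mem := by
      intro ω hω
      obtain ⟨σ, M, hR, hres, h1, h2, h3⟩ := main ω
      rw [h2]
      exact hres.isOptimal hM (hP _) hR hK hω
    have hqw : P.q ≤ w := by
      by_contra hcon
      have : 2 ^ w ≤ P.N := Nat.pow_le_pow_right (by omega) (not_le.1 hcon).le
      omega
    -- If there is a shortest cycle, it suffices that some trial detects it at the fixed start `s`;
    -- otherwise the output is optimal for all random words.
    by_cases hex : ∃ s < P.n, ∃ r L, Cyc P s L ∧ L.length = r + 1 ∧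
        ∀ s' L', Cyc P s' L' → r + 1 ≤ L'.length
    · obtain ⟨s, hs, r, L, hL, hr, hminL⟩ := hex
      refine le_trans (sub_le_sub_left ?_ 1) (one_sub_prob_le (B := fun ω => ∀ t < R * n,
        decVal P (fun e' => φ (draw P (toEnv I (extend ω) P hw hfit) t e')) s r = 0) ?_)
      · refine le_trans (prob_forall_le hqw (B := fun y => decVal P
          (fun e' => if h : e' < P.m then φ (y ⟨e', h⟩) else 0) s r = 0)
          (card_decVal_eq_zero_le (hP I) hK hg.rep (hminL s) hL hr) ?_) hδ
        intro ω hω t ht y hy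
        rw [← hω t ht]
        refine decVal_congr (hP I) fun e' he' => ?_
        rw [dif_pos he', hy ⟨e', he'⟩]
        rfl
      · intro ω hω
        push Not at hω
        obtain ⟨t, ht, hne⟩ := hω
        refine hopt ω fun s' hs' r' L' hL' hr' hmin' => ⟨s, hs, t, ht, ?_⟩
        have h1 := hminL s' L' hL'
        have h2 := hmin' s L hL
        have : r' = r := by omega
        rwa [this]
    · have h1 : (1 : ℝ) - prob (fun _ : Fin (R * n * m + T') → BitVec w => False) ≤ _ :=
        one_sub_prob_le fun ω _ => hopt ω fun s hs r L hL hr hmin' =>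
          absurd ⟨s, hs, r, L, hL, hr, hmin'⟩ hex
      refine le_trans (sub_le_sub_left ?_ 1) h1
      rw [prob]
      simp only [Nat.card_of_isEmpty, Nat.cast_zero, zero_div]
      exact le_trans (by positivity) hδ

theorem pow_le_two_pow_of_logb {c x w : ℕ} (hx : 0 < x) (h : c * Real.logb 2 x ≤ w) :
    x ^ c ≤ 2 ^ w := by
  rw [← Real.logb_pow, Real.logb_le_iff_le_rpow (by norm_num) (by positivity),
    Real.rpow_natCast] at h
  exact_mod_cast h

/-- Uses `n ≤ 2 ^ n`: this is why `⌈W⌉ * n` trials suffice. -/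
theorem half_pow_le {n : ℕ} {W : ℝ} (hn : 0 < n) :
    (1 / 2 : ℝ) ^ (⌈W⌉₊ * n) ≤ 1 / (n : ℝ) ^ W := by
  have h1 : (n : ℝ) ^ W ≤ 2 ^ (⌈W⌉₊ * n) := by
    calc (n : ℝ) ^ W ≤ (n : ℝ) ^ (⌈W⌉₊ : ℝ) :=
          Real.rpow_le_rpow_of_exponent_le (by exact_mod_cast hn) (Nat.le_ceil W)
      _ = (n : ℝ) ^ ⌈W⌉₊ := Real.rpow_natCast _ _
      _ ≤ (2 ^ n) ^ ⌈W⌉₊ := by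
        gcongr
        exact_mod_cast Nat.lt_two_pow_self.le
      _ = _ := by rw [← pow_mul, mul_comm]
  rw [div_pow, one_pow]
  exact one_div_le_one_div_of_le (Real.rpow_pos_of_pos (by exact_mod_cast hn) W) h1

/-- Since `2 * m / n ≥ 2`. The logarithm in the time bound is mere slack here, as multiplication in
the field by tables takes constant time. -/
theorem one_le_logb {n m : ℕ} (hn : 0 < n) (hnm : n ≤ m) : 1 ≤ Real.logb 2 (2 * m / n) := by
  have hn' : (0 : ℝ) < n := by exact_mod_cast hn
  have hm' : (0 : ℝ) < m := by exact_mod_cast hn.trans_le hnm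
  have hnm' : (n : ℝ) ≤ m := by exact_mod_cast hnm
  rw [Real.le_logb_iff_rpow_le (by norm_num) (by positivity), Real.rpow_one, le_div_iff₀ hn']
  linarith

theorem time_le {n m Z : ℕ} {W : ℝ} (hW : 1 ≤ W) (hn : 0 < n) (hnm : n ≤ m) :
    (((⌈W⌉₊ + 1) * (300000 * Z) : ℕ) : ℝ) ≤ 900000 * (Z * (Real.logb 2 (2 * m / n) * W)) := by
  have h1 : ((⌈W⌉₊ : ℕ) : ℝ) + 1 ≤ 3 * W := by
    have := Nat.ceil_lt_add_one (show 0 ≤ W by linarith)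
    linarith
  have h2 := one_le_logb hn hnm
  push_cast
  calc ((⌈W⌉₊ : ℕ) + 1 : ℝ) * (300000 * Z) ≤ 3 * W * (300000 * Z) := by gcongr
    _ = 900000 * (Z * (1 * W)) := by ring
    _ ≤ _ := by gcongr

end EdgeSetCycle

theorem mainTheorem1 :
    ∃ C c : ℕ, ∀ W : ℝ, 1 ≤ W →
      -- time `O(2^k m n^2 log(2m/n) |V(S_1)| W)` and space `O(2^k n + m)`
      (∃ P : WordRAM.Prog,
        ∀ (w n m k : ℕ) (hk : 0 < k) (G : SimpleGraph (Fin n)) (e : Fin m → Fin n × Fin n)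
          (S : Fin k → Set (Sym2 (Fin n))) (I : ℕ → BitVec w),
          0 < n → n ≤ m → EdgeSetCycle.IsEdgeList G e → (∀ i, S i ⊆ G.edgeSet) →
          EdgeSetCycle.IsInput e S I →
          c * (k + Real.logb 2 n) ≤ w →
          EdgeSetCycle.MonteCarloFinds P I G S
            (C * (2 ^ k * m * n ^ 2 * Real.logb 2 (2 * m / n) *
              max 1 (EdgeSetCycle.vertexSet (S ⟨0, hk⟩)).ncard * W))
            (C * (2 ^ k * n + m))
            (1 / (n : ℝ) ^ W)) ∧
      -- an additional factor `k` in the time, and space `O(k n + m)`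
      (∃ P : WordRAM.Prog,
        ∀ (w n m k : ℕ) (hk : 0 < k) (G : SimpleGraph (Fin n)) (e : Fin m → Fin n × Fin n)
          (S : Fin k → Set (Sym2 (Fin n))) (I : ℕ → BitVec w),
          0 < n → n ≤ m → EdgeSetCycle.IsEdgeList G e → (∀ i, S i ⊆ G.edgeSet) →
          EdgeSetCycle.IsInput e S I →
          c * Real.logb 2 (n * k) ≤ w →
          EdgeSetCycle.MonteCarloFinds P I G S
            (C * (k * (2 ^ k * m * n ^ 2 * Real.logb 2 (2 * m / n) *
              max 1 (EdgeSetCycle.vertexSet (S ⟨0, hk⟩)).ncard * W)))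
            (C * (k * n + m))
            (1 / (n : ℝ) ^ W)) := by
  open EdgeSetCycle in
  -- The exponent 6 is the one required by `algP_finds`. The constant is `2 * 900000`, where 900000
  -- is from `time_le` and the factor 2 from `k + 1 ≤ 2 * k` in the second part.
  refine ⟨1800000, 6, fun W hW => ⟨⟨(algP true ⌈W⌉₊).code, ?_⟩, ⟨(algP false ⌈W⌉₊).code, ?_⟩⟩⟩
  · intro w n m k hk G e S I hn hnm he hS hI hw
    have hlog := one_le_logb hn hnm
    have hW0 : 0 ≤ W := by linarith
    have hx : (2 ^ k * n) ^ 6 ≤ 2 ^ w := by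
      refine pow_le_two_pow_of_logb (by positivity) ?_
      rw [Nat.cast_mul, Nat.cast_pow, Real.logb_mul (by positivity) (by positivity), Real.logb_pow]
      simpa using hw
    refine algP_finds true _ hk hn hnm he hI (x := 2 ^ k * n)
      (Nat.mul_le_mul_right n Nat.lt_two_pow_self.le) rfl rfl (by simp; ring_nf; omega) hx
      ((time_le hW hn hnm).trans ?_) ?_ (half_pow_le hn)
    · simp only [if_true, one_mul]
      push_cast
      calc _ = 900000 * (2 ^ k * m * n ^ 2 * Real.logb 2 (2 * m / n) *
            max 1 ((vertexSet (S ⟨0, hk⟩)).ncard : ℝ) * W) := by ring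
        _ ≤ _ := by gcongr; norm_num
    · have : 76 + 13 * (n * 2 ^ k + 8 * n + 2 * m) + n ≤ 1800000 * (2 ^ k * n + m) := by
        rw [mul_comm n]
        omega
      exact_mod_cast this
  · intro w n m k hk G e S I hn hnm he hS hI hw
    have hlog := one_le_logb hn hnm
    have hW0 : 0 ≤ W := by linarith
    have hx : (k * n) ^ 6 ≤ 2 ^ w := by
      refine pow_le_two_pow_of_logb (by positivity) ?_
      rw [Nat.cast_mul, mul_comm (k : ℝ)]
      exact_mod_cast hw
    have hkn : n ≤ k * n := Nat.le_mul_of_pos_left _ hk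
    refine algP_finds false _ hk hn hnm he hI (x := k * n) le_rfl rfl rfl
      (by simp only [Bool.false_eq_true, if_false]; rw [mul_add, mul_comm n]; omega) hx
      ((time_le hW hn hnm).trans ?_) ?_ (half_pow_le hn)
    · simp only [Bool.false_eq_true, if_false]
      push_cast
      have hk1 : (k : ℝ) + 1 ≤ 2 * k := by
        have : (1 : ℝ) ≤ k := by exact_mod_cast hk
        linarith
      calc _ = 900000 * (((k : ℝ) + 1) * (2 ^ k * m * n ^ 2 * Real.logb 2 (2 * m / n) *
            max 1 ((vertexSet (S ⟨0, hk⟩)).ncard : ℝ) * W)) := by ring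
        _ ≤ 900000 * ((2 * k) * (2 ^ k * m * n ^ 2 * Real.logb 2 (2 * m / n) *
            max 1 ((vertexSet (S ⟨0, hk⟩)).ncard : ℝ) * W)) := by gcongr
        _ = _ := by ring
    · have : 76 + 13 * (n * (k + 1) + 8 * n + 2 * m) + n ≤ 1800000 * (k * n + m) := by
        rw [mul_add n, mul_comm n]
        omega
      exact_mod_cast this
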